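/- Let $V\in C^\infty(\mathbb R)$, $V\ge 0$, satisfy $V(r)/|r|\to\infty$ as $|r|\to\infty$, $\sup_r|V''(r)|\le C_2<\infty$ and $V'(r)^2\le C_1(1+V(r))$ for all $r$. Let $\beta:[0,1]\to(0,\infty)$ be smooth, $\beta_i=\beta(i/n)$, let $\gamma>0$, and let the tension $\bar\tau:[0,\infty)\to\mathbb R$ be of class $C^1$. For $n\ge1$ write points of $\mathbb R^{2n}$ as $(r_1,\dots,r_n,p_1,\dots,p_n)$, set $p_0=0$, and let $\nu_n$ be the inhomogeneous Gibbs probability measure $$d\nu_n=\prod_{i=1}^n Z_{\beta_i}^{-1}e^{-\beta_i(p_i^2/2+V(r_i))}\,dr_i\,dp_i .$$ Put $$A^\tau=\sum_{i=1}^n(p_i-p_{i-1})\partial_{r_i}+\sum_{i=1}^{n-1}(V'(r_{i+1})-V'(r_i))\partial_{p_i}+(\tau-V'(r_n))\partial_{p_n},\qquad S=\sum_{i=1}^n(\beta_i^{-1}\partial_{p_i}^2-p_i\partial_{p_i}).$$ Let $\mathcal L_n^{\tau,*}$ be the adjoint in $L^2(\nu_n)$ of the generator $n^2A^\tau+n^2\gamma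 S$ of the diffusively rescaled chain, that is $$\mathcal L_n^{\tau,*}=-n^2A^\tau-n^2\sum_{i=1}^{n-1}(\beta_{i+1}-\beta_i)p_iV'(r_{i+1})+n^2\beta(1)p_n\tau+n^2\gamma S .$$ A solution of the forward equation is a family $(f_t)_{t\ge0}$ of probability densities with respect to $\nu_n$ with the following properties: for $t>0$, $f_t$ is $C^\infty$ on $\mathbb R^{2n}$ with all space derivatives jointly continuous in $(t,x)$, $\partial_tf_t=\mathcal L_n^{\bar\tau(t),*}f_t$ pointwise, and $f_t\to f_0$ in $L^1(\nu_n)$ as $t\downarrow0$. With $\partial_{q_i}=\partial_{r_i}-\partial_{r_{i+1}}$ for $i<n$, let $H_n(t)=\int f_t\log f_t\,d\nu_n$ and $$\mathcal D^p_n(f)=\sum_{i=1}^n\beta_i^{-1}\!\int\frac{(\partial_{p_i}f)^2}{f}d\nu_n,\quad \mathcal D^r_n(f)=\sum_{i=1}^{n-1}\beta_i^{-1}\!\int\frac{(\partial_{q_i}f)^2}{f}d\nu_n,\quad I_n(f)=\sum_{i=1}^{n-1}\beta_i^{-1}\!\int\frac{(\partial_{p_i}f+\partial_{q_i}f)^2}{f}d\nu_n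 .$$ Fix $T>0$ and $C_0$. In (b) and (c), where $I_n(f_0)$ appears, assume moreover that $f_0$ is $C^1$ and that $f_t$ and $\nabla f_t$ are jointly continuous in $(t,x)$ up to $t=0$. (a) There is a constant $C$ such that for all $n\ge1$ and all solutions with $H_n(0)\le C_0n$, $$H_n(t)\le Cn,\qquad \int_0^t\mathcal D^p_n(f_s)\,ds\le\frac Cn\qquad\text{for all }t\in[0,T].$$ (b) For every $K_0$ there is a constant $C$ such that for all $n\ge1$ and all solutions with $H_n(0)\le C_0n$ and $I_n(f_0)\le K_0n$, $$\int_0^t\mathcal D^r_n(f_s)\,ds\le\frac Cn,\qquad \int_0^tI_n(f_s)\,ds\le\frac Cn\qquad\text{for all }t\in[0,T].$$ (c) Let $(K_n)$ grow less than exponentially, i.e. $K_ne^{-\varepsilon n}\to0$ for every $\varepsilon>0$, and let $\delta>0$. There is a constant $C$ such that for all $n\ge1$ and all solutions with $H_n(0)\le C_0n$ and $I_n(f_0)\le K_n$, $$\int_\delta^t\mathcal D^r_n(f_s)\,ds\le\frac Cn,\qquad \int_\delta^tI_n(f_s)\,ds\le\frac Cn\qquad\text{for all }t\in[\delta,T].$$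 -/

import Mathlib

open MeasureTheory Set Filter Topology
open scoped ENNReal ContDiff

noncomputable section

namespace OscChain

/-- Phase space `(r, p) ∈ ℝⁿ × ℝⁿ`. The particle with label `i ∈ {1, …, n}` has
index `i - 1` in `Fin n`. -/
abbrev Phase (n : ℕ) : Type := (Fin n → ℝ) × (Fin n → ℝ)

/-- Assumptions on the anharmonic potential. -/
structure IsPotential (V : ℝ → ℝ) : Prop where
  smooth : ContDiff ℝ ∞ V
  nonneg : ∀ r, 0 ≤ V r
  superlinear : Tendsto (fun r => V r / |r|) (cocompact ℝ) atTop
  bounded_second : ∃ C₂ > 0, ∀ r, |deriv (deriv V) r| ≤ C₂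
  deriv_sq_le : ∃ C₁ > 0, ∀ r, deriv V r ^ 2 ≤ C₁ * (1 + V r)

/-- A smooth strictly positive profile of inverse temperatures on `[0,1]`. -/
structure IsProfile (β : ℝ → ℝ) : Prop where
  smooth : ContDiffOn ℝ ∞ β (Icc 0 1)
  pos : ∀ x ∈ Icc (0 : ℝ) 1, 0 < β x

/-- `β_i = β(i/n)` for the particle `i = k + 1` of index `k : Fin n`. -/
def betaAt (β : ℝ → ℝ) (n : ℕ) (k : Fin n) : ℝ := β (((k : ℕ) + 1 : ℝ) / n)

/-- The discrete gradient `n (β((i+1)/n) - β(i/n))` for `i = k + 1`. -/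
def gradBeta (β : ℝ → ℝ) (n : ℕ) (k : Fin n) : ℝ :=
  n * (β (((k : ℕ) + 2 : ℝ) / n) - β (((k : ℕ) + 1 : ℝ) / n))

/-- Indices of the particles `1, …, n - 1`, all but the last. -/
def bulk (n : ℕ) : Finset (Fin n) := Finset.univ.filter fun k => (k : ℕ) + 1 < n

/-- The energy of one particle. -/
def energy (V : ℝ → ℝ) (r p : ℝ) : ℝ := p ^ 2 / 2 + V r

/-- The one-particle partition function at inverse temperature `b`. -/
def partitionFn (V : ℝ → ℝ) (b : ℝ) : ℝ :=
  ∫ z : ℝ × ℝ, Real.exp (-b * energy V z.1 z.2)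

/-- The inhomogeneous Gibbs measure `∏ᵢ exp (-βᵢ 𝓔ᵢ) / Z_{βᵢ} drᵢ dpᵢ`. -/
def gibbs (V β : ℝ → ℝ) (n : ℕ) : Measure (Phase n) :=
  (volume : Measure (Phase n)).withDensity fun x =>
    ENNReal.ofReal (∏ k, Real.exp (-betaAt β n k * energy V (x.1 k) (x.2 k)) /
      partitionFn V (betaAt β n k))

/-- `∂_{r_i} f`. -/
def dr {n : ℕ} (k : Fin n) (f : Phase n → ℝ) (x : Phase n) : ℝ :=
  fderiv ℝ f x (Pi.single k 1, 0)

/-- `∂_{p_i} f`. -/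
def dp {n : ℕ} (k : Fin n) (f : Phase n → ℝ) (x : Phase n) : ℝ :=
  fderiv ℝ f x (0, Pi.single k 1)

/-- `∂_{q_i} f = ∂_{r_i} f - ∂_{r_{i+1}} f` for `i < n`, and `∂_{q_n} f = ∂_{r_n} f`. -/
def dq {n : ℕ} (k : Fin n) (f : Phase n → ℝ) (x : Phase n) : ℝ :=
  dr k f x - if h : (k : ℕ) + 1 < n then dr ⟨k + 1, h⟩ f x else 0

/-- `p_{i-1}`, with `p_0 = 0`. -/
def pPrev {n : ℕ} (p : Fin n → ℝ) (k : Fin n) : ℝ :=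
  if (k : ℕ) = 0 then 0 else p ⟨(k : ℕ) - 1, lt_of_le_of_lt (Nat.sub_le _ _) k.isLt⟩

/-- The force acting on particle `i` from the right: `V'(r_{i+1})` for `i < n`, and the
tension `τ` for `i = n`. -/
def forceRight {n : ℕ} (V : ℝ → ℝ) (τ : ℝ) (r : Fin n → ℝ) (k : Fin n) : ℝ :=
  if h : (k : ℕ) + 1 < n then deriv V (r ⟨k + 1, h⟩) else τ

/-- The Liouville operator with tension `τ`. -/
def liouville (V : ℝ → ℝ) {n : ℕ} (τ : ℝ) (f : Phase n → ℝ) (x : Phase n) : ℝ :=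
  ∑ k, (x.2 k - pPrev x.2 k) * dr k f x +
    ∑ k, (forceRight V τ x.1 k - deriv V (x.1 k)) * dp k f x

/-- The generator of the Langevin thermostats. -/
def thermostat (β : ℝ → ℝ) {n : ℕ} (f : Phase n → ℝ) (x : Phase n) : ℝ :=
  ∑ k, ((betaAt β n k)⁻¹ * dp k (dp k f) x - x.2 k * dp k f x)

/-- The multiplication part `-n ∑_{i<n} ∇ₙβ(i/n) p_i V'(r_{i+1}) + n² β(1) p_n τ` of the
adjoint of the generator. -/
def sourceTerm (V β : ℝ → ℝ) {n : ℕ} (τ : ℝ) (x : Phase n) : ℝ :=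
  ∑ k : Fin n, if h : (k : ℕ) + 1 < n then
      -(n : ℝ) * gradBeta β n k * x.2 k * deriv V (x.1 ⟨k + 1, h⟩)
    else (n : ℝ) ^ 2 * β 1 * x.2 k * τ

/-- The adjoint, with respect to the measure `gibbs V β n`, of the generator
`n² A^τ + n² γ S` of the chain. -/
def forwardOp (V β : ℝ → ℝ) (γ : ℝ) {n : ℕ} (τ : ℝ) (f : Phase n → ℝ) (x : Phase n) : ℝ :=
  -(n : ℝ) ^ 2 * liouville V τ f x + sourceTerm V β τ x * f x +
    (n : ℝ) ^ 2 * γ * thermostat β f x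

/-- `f` is a classical solution on `(0, ∞)` of the forward equation `∂ₜ f = 𝓛* f` with tension
`τ(t)`, made of probability densities with respect to the Gibbs measure, smooth in the phase space
variable for positive times, which attains its initial value `f 0` in `L¹`. -/
structure IsForwardSolution (V β : ℝ → ℝ) (γ : ℝ) (τ : ℝ → ℝ) (n : ℕ)
    (f : ℝ → Phase n → ℝ) : Prop where
  nonneg : ∀ t, 0 ≤ t → ∀ x, 0 ≤ f t x
  measurable_zero : Measurable (f 0)
  mass : ∀ t, 0 ≤ t → ∫⁻ x, ENNReal.ofReal (f t x) ∂(gibbs V β n) = 1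
  initial : Tendsto (fun t => ∫⁻ x, ENNReal.ofReal |f t x - f 0 x| ∂(gibbs V β n))
    (𝓝[>] 0) (𝓝 0)
  contDiff : ∀ t, 0 < t → ContDiff ℝ ∞ (f t)
  continuousOn_iteratedFDeriv : ∀ m : ℕ,
    ContinuousOn (fun z : ℝ × Phase n => iteratedFDeriv ℝ m (f z.1) z.2) (Ioi 0 ×ˢ univ)
  forward : ∀ t, 0 < t → ∀ x,
    HasDerivAt (fun s => f s x) (forwardOp V β γ (τ t) (f t) x) t

/-- `f` is of class `C¹` in the phase space variable up to time `0`. -/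
structure IsC1UpToZero {n : ℕ} (f : ℝ → Phase n → ℝ) : Prop where
  contDiff_zero : ContDiff ℝ 1 (f 0)
  continuousOn : ContinuousOn (fun z : ℝ × Phase n => f z.1 z.2) (Ici 0 ×ˢ univ)
  continuousOn_fderiv :
    ContinuousOn (fun z : ℝ × Phase n => fderiv ℝ (f z.1) z.2) (Ici 0 ×ˢ univ)

/-- The relative entropy `∫ f log f dν` is well defined, finite and at most `a`. -/
def EntropyLE (V β : ℝ → ℝ) {n : ℕ} (f : Phase n → ℝ) (a : ℝ) : Prop :=
  Integrable (fun x => f x * Real.log (f x)) (gibbs V β n) ∧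
    ∫ x, f x * Real.log (f x) ∂(gibbs V β n) ≤ a

/-- The velocity Fisher information `∫ ∑_{i≤n} βᵢ⁻¹ (∂_{p_i} f)² / f dν`. The quotient is
read as `0` where `f = 0`; there the gradient of a nonnegative `C¹` function vanishes. -/
def fisherP (V β : ℝ → ℝ) {n : ℕ} (f : Phase n → ℝ) : ℝ≥0∞ :=
  ∫⁻ x, ENNReal.ofReal ((∑ k, (betaAt β n k)⁻¹ * dp k f x ^ 2) / f x) ∂(gibbs V β n)

/-- The position Fisher information `∫ ∑_{i<n} βᵢ⁻¹ (∂_{q_i} f)² / f dν`. -/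
def fisherR (V β : ℝ → ℝ) {n : ℕ} (f : Phase n → ℝ) : ℝ≥0∞ :=
  ∫⁻ x, ENNReal.ofReal ((∑ k ∈ bulk n, (betaAt β n k)⁻¹ * dq k f x ^ 2) / f x)
    ∂(gibbs V β n)

/-- The hypocoercive Fisher information `∫ ∑_{i<n} βᵢ⁻¹ (∂_{p_i} f + ∂_{q_i} f)² / f dν`. -/
def fisherI (V β : ℝ → ℝ) {n : ℕ} (f : Phase n → ℝ) : ℝ≥0∞ :=
  ∫⁻ x, ENNReal.ofReal
    ((∑ k ∈ bulk n, (betaAt β n k)⁻¹ * (dp k f x + dq k f x) ^ 2) / f x) ∂(gibbs V β n)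

/-- `K` grows less than exponentially. -/
def Subexponential (K : ℕ → ℝ) : Prop :=
  ∀ ε > 0, Tendsto (fun n : ℕ => K n * Real.exp (-ε * n)) atTop (𝓝 0)

end OscChain

end

open OscChain

/-! ### Constants uniform in the size of the chain -/

noncomputable section

namespace OscChain

/-! Entropy. Along the forward equation the symmetric part `thermostat` dissipates `n² γ` times the
velocity Fisher information, and the transport part only acts through `sourceTerm`, which is `n²`
times the Liouville derivative of the Gibbs exponent. This source has two pieces. The bulk piece is
linear in each velocity with a coefficient of order `n`. Gaussian integration by parts in the
velocity turns it into a derivative of `f`, and half of the dissipation absorbs it; the powers of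
`n` cancel, leaving a sum of squared forces, hence at most a constant times `n + E`. The boundary
piece `n² β(1) τ p_n` would cost order `n²` if treated in this way. But `n² p_n` is exactly the
speed of the total length, so subtracting `β(1) τ(t) ∫ len f` from the entropy (`entBalance`)
removes it and leaves a term with `τ'`. Since `V` is superlinear, the length is at most `κ E + K n`
with `κ` as small as needed, and the entropy inequality `integral_energy_le_entropy` controls the
energy by the entropy plus a multiple of `n`. A Gronwall argument then closes in
`ChainBounds.exists_entropy_bound`.

Nothing is assumed about the decay of `f` or its derivatives at infinity, so every computation is
made against compactly supported functions of the energy (`ChainBounds.evolution`) and with `ent N`,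
a convex function with bounded slope in place of `s log s - s`. The truncation errors are dominated
by `(1 + E) f`, whose integrability is first propagated without uniformity by `exists_energy_bound`.
Fatou's lemma then removes the truncations.

Bond Fisher information. Commuting `∂_{p_i} + ∂_{q_i}` with the transport produces a relaxation at
rate of order `n²`. Instead of differentiating the equation, the proof compares `f` with its
translate by `η` in the direction `bondDir i`, through the convex function `sqDiff`. Letting `η`
grow like `exp (n² u)` makes the moving translation cancel the `∂_{q_i}` part of the commutator
(`forwardOp_shift`). Only velocity derivatives at neighbouring particles and differences of the
source remain. Young's inequality bounds them by `n²` times the functional plus `η²` times a source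
consisting of `n²` times local velocity Fisher information and a local energy (`sqDiff_rate_le`).
The functional starts at size `η(0)²`, may grow by `exp (n² t)`, and measures `η(t)² = η(0)² exp (2
n² t)` times the Fisher information. The net effect is exponential decay at rate `n²`
(`bondFisher_le`, and `fisherI_le` after summation over the bonds).

The functional is localized by an energy cutoff at scale `1/δ`, which shrinks in time so as to be
almost a supersolution. The shift is of order `δ`, the errors are of order `δ³`, the signal is of
order `δ²`, and on the support of the cutoff the Gibbs density changes by at most a factor two under
the shift. Integrating in time, the convolution with `exp (-n² ·)` gains `n⁻²`, and the entropy
estimate gives the order `1/n` (`exists_fisher_bound`). Initial Fisher information enters multiplied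
by `exp (-n² s)`, which for `s = δ` beats any subexponential growth. -/

/-- The quantitative bounds on the potential and on the temperature profile. -/
structure ChainBounds (V β : ℝ → ℝ) (b B G C : ℝ) : Prop where
  pot : IsPotential V
  b_pos : 0 < b
  b_le : ∀ (n : ℕ) (k : Fin n), b ≤ betaAt β n k
  le_B : ∀ (n : ℕ) (k : Fin n), betaAt β n k ≤ B
  G_nonneg : 0 ≤ G
  grad_le : ∀ (n : ℕ) (k : Fin n), (k : ℕ) + 1 < n → |gradBeta β n k| ≤ G
  one_le_C : 1 ≤ C
  smooth : ContDiff ℝ ∞ V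
  nonneg : ∀ r, 0 ≤ V r
  second_le : ∀ r, |deriv (deriv V) r| ≤ C
  deriv_sq_le : ∀ r, deriv V r ^ 2 ≤ C * (1 + V r)

theorem betaAt_mem (n : ℕ) (k : Fin n) : (((k : ℕ) + 1 : ℝ) / n) ∈ Icc (0 : ℝ) 1 := by
  have hk : ((k : ℕ) + 1 : ℝ) ≤ n := by exact_mod_cast k.isLt
  have hn : (0 : ℝ) < n := by
    have := k.pos
    exact_mod_cast this
  constructor
  · positivity
  · rw [div_le_one hn]; exact hk

/-- Compactness of `[0,1]` bounds the profile from both sides and bounds its derivative, so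
increments over a step `1/n` are of order `1/n`. One constant `C ≥ 1` serves for both conditions on
the potential. -/
theorem exists_chainBounds {V β : ℝ → ℝ} (hV : IsPotential V) (hβ : IsProfile β) :
    ∃ b B G C, ChainBounds V β b B G C := by
  obtain ⟨C₂, hC₂, h2⟩ := hV.bounded_second
  obtain ⟨C₁, hC₁, h1⟩ := hV.deriv_sq_le
  have hcont : ContinuousOn β (Icc 0 1) := hβ.smooth.continuousOn
  obtain ⟨x, hx, hmin⟩ := isCompact_Icc.exists_isMinOn (nonempty_Icc.2 zero_le_one) hcont
  obtain ⟨y, hy, hmax⟩ := isCompact_Icc.exists_isMaxOn (nonempty_Icc.2 zero_le_one) hcont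
  have hd : ContinuousOn (derivWithin β (Icc 0 1)) (Icc 0 1) :=
    hβ.smooth.continuousOn_derivWithin (uniqueDiffOn_Icc zero_lt_one) (by simp)
  obtain ⟨G, hG⟩ := isCompact_Icc.exists_bound_of_continuousOn hd
  have hG0 : 0 ≤ G := (norm_nonneg _).trans (hG 0 (by simp))
  have hlip : ∀ u ∈ Icc (0 : ℝ) 1, ∀ v ∈ Icc (0 : ℝ) 1, ‖β v - β u‖ ≤ G * ‖v - u‖ := by
    intro u hu v hv
    exact (convex_Icc (0 : ℝ) 1).norm_image_sub_le_of_norm_derivWithin_le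
      (hβ.smooth.differentiableOn (by simp)) hG hu hv
  refine ⟨β x, β y, G, max 1 (max C₁ C₂), hV, hβ.pos x hx, fun n k => hmin (betaAt_mem n k),
    fun n k => hmax (betaAt_mem n k), hG0, ?_, le_max_left _ _, hV.smooth, hV.nonneg,
    fun r => (h2 r).trans ((le_max_right _ _).trans (le_max_right _ _)), fun r => ?_⟩
  · intro n k hk
    have hn : (0 : ℝ) < n := by
      have := k.pos
      exact_mod_cast this
    have := hlip _ (betaAt_mem n k) _ (betaAt_mem n ⟨k + 1, hk⟩)
    simp only [Nat.cast_add, Nat.cast_one, Real.norm_eq_abs] at this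
    have e : (((k : ℕ) + 1 + 1 : ℝ) / n) - ((k : ℕ) + 1 : ℝ) / n = 1 / n := by
      field_simp; ring
    rw [e, abs_of_pos (by positivity : (0 : ℝ) < 1 / n)] at this
    unfold gradBeta
    rw [abs_mul, abs_of_pos hn]
    have e2 : ((k : ℕ) + 2 : ℝ) = (k : ℕ) + 1 + 1 := by ring
    rw [e2]
    calc (n : ℝ) * _ ≤ n * (G * (1 / n)) := by gcongr
      _ = G := by field_simp
  · refine (h1 r).trans ?_
    have := hV.nonneg r
    gcongr
    exact (le_max_left _ _).trans (le_max_right _ _)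

/-! ### Growth of the potential and one-particle integrals -/

section Potential
variable {V β : ℝ → ℝ} {b B G C : ℝ}

namespace ChainBounds

theorem B_pos (h : ChainBounds V β b B G C) : 0 < B :=
  h.b_pos.trans_le ((h.b_le 1 0).trans (h.le_B 1 0))

theorem betaAt_pos (h : ChainBounds V β b B G C) {n : ℕ} (k : Fin n) : 0 < betaAt β n k :=
  h.b_pos.trans_le (h.b_le n k)

theorem C_pos (h : ChainBounds V β b B G C) : 0 < C := zero_lt_one.trans_le h.one_le_C

theorem inv_le (h : ChainBounds V β b B G C) {n : ℕ} (k : Fin n) :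
    (betaAt β n k)⁻¹ ≤ b⁻¹ := inv_anti₀ h.b_pos (h.b_le n k)

theorem beta_inv_nonneg (h : ChainBounds V β b B G C) {n : ℕ} (k : Fin n) :
    0 ≤ (betaAt β n k)⁻¹ := (inv_pos.2 (h.betaAt_pos k)).le

theorem differentiable (h : ChainBounds V β b B G C) : Differentiable ℝ V :=
  h.smooth.differentiable (by simp)

theorem contDiff_deriv (h : ChainBounds V β b B G C) : ContDiff ℝ ∞ (deriv V) :=
  ((contDiff_infty_iff_deriv).1 h.smooth).2

theorem deriv_lip (h : ChainBounds V β b B G C) (r s : ℝ) :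
    |deriv V s - deriv V r| ≤ C * |s - r| := by
  have := (convex_univ (𝕜 := ℝ) (E := ℝ)).norm_image_sub_le_of_norm_deriv_le (f := deriv V) (C := C)
    (fun x _ => (h.contDiff_deriv.differentiable (by simp)) x) (fun x _ => h.second_le x)
    (mem_univ r) (mem_univ s)
  simpa using this

/-- The mean value inequality on the segment, where the derivative is at most `|V'(r)| + C |s|`; the
optimal factor one half is not needed. -/
theorem taylor (h : ChainBounds V β b B G C) (r s : ℝ) :
    |V (r + s) - V r| ≤ |deriv V r| * |s| + C * s ^ 2 := by
  have := (convex_segment (𝕜 := ℝ) r (r + s)).norm_image_sub_le_of_norm_deriv_le (f := V)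
    (C := |deriv V r| + C * |s|) (fun x _ => h.differentiable x) (fun x hx => ?_)
    (left_mem_segment ℝ _ _) (right_mem_segment ℝ _ _)
  · simp only [Real.norm_eq_abs, add_sub_cancel_left] at this
    calc _ ≤ _ := this
      _ = _ := by rw [add_mul, mul_assoc C, abs_mul_abs_self]; ring
  · have h1 := h.deriv_lip r x
    have h2 : |x - r| ≤ |s| := by
      obtain ⟨θ, hθ, rfl⟩ := (segment_eq_image' ℝ r (r + s)) ▸ hx
      simp only [add_sub_cancel_left, smul_eq_mul, abs_mul, abs_of_nonneg hθ.1]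
      exact mul_le_of_le_one_left (abs_nonneg _) hθ.2
    have h3 : |deriv V x| ≤ |deriv V r| + |deriv V x - deriv V r| := by
      have := abs_add_le (deriv V r) (deriv V x - deriv V r)
      simpa using this
    have h4 : C * |x - r| ≤ C * |s| := by gcongr; exact h.C_pos.le
    rw [Real.norm_eq_abs]; linarith

end ChainBounds

/-- This is where superlinearity enters. The freedom to take `κ` small later lets the length
correction of the entropy be absorbed by the entropy inequality. -/
theorem IsPotential.abs_le (hV : IsPotential V) {κ : ℝ} (hκ : 0 < κ) :
    ∃ K, 0 ≤ K ∧ ∀ r, |r| ≤ κ * V r + K := by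
  have h1 := hV.superlinear.eventually_ge_atTop κ⁻¹
  rw [← Metric.cobounded_eq_cocompact] at h1
  rw [(Metric.hasBasis_cobounded_compl_closedBall (0 : ℝ)).eventually_iff] at h1
  obtain ⟨R, -, hR⟩ := h1
  refine ⟨max R 0, le_max_right _ _, fun r => ?_⟩
  by_cases hr : |r| ≤ max R 0
  · have := mul_nonneg hκ.le (hV.nonneg r); linarith
  · push Not at hr
    have hr0 : 0 < |r| := (le_max_right _ _).trans_lt hr
    have hm : r ∈ (Metric.closedBall (0 : ℝ) R)ᶜ := by
      simp only [mem_compl_iff, Metric.mem_closedBall, dist_zero_right, Real.norm_eq_abs, not_le]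
      exact (le_max_left _ _).trans_lt hr
    have := hR hm
    rw [le_div_iff₀ hr0, inv_mul_le_iff₀ hκ] at this
    have := le_max_right R 0
    linarith

/-- Comparison with `2 / (1 + r²)`, from `exp y ≥ 1 + y + y²/2` for nonnegative `y`. -/
theorem integrable_exp_neg_abs : Integrable fun r : ℝ => Real.exp (-|r|) := by
  refine (integrable_inv_one_add_sq.const_mul 2).mono'
    (by fun_prop : Continuous fun r : ℝ => Real.exp (-|r|)).aestronglyMeasurable
    (Eventually.of_forall fun r => ?_)
  rw [Real.norm_eq_abs, abs_of_pos (Real.exp_pos _), Real.exp_neg]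
  have h1 := Real.quadratic_le_exp_of_nonneg (abs_nonneg r)
  rw [sq_abs] at h1
  have h2 : 0 < 1 + r ^ 2 := by positivity
  rw [inv_le_comm₀ (Real.exp_pos _) (by positivity), mul_inv, inv_inv]
  linarith [abs_nonneg r]

theorem IsPotential.integrable_exp (hV : IsPotential V) {c : ℝ} (hc : 0 < c) :
    Integrable fun r => Real.exp (-c * V r) := by
  obtain ⟨K, -, hK⟩ := hV.abs_le hc
  have h1 : Integrable fun r : ℝ => Real.exp K * Real.exp (-|r|) :=
    (integrable_exp_neg_abs).const_mul _
  refine h1.mono' ?_ (Eventually.of_forall fun r => ?_)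
  · have : Continuous V := hV.smooth.continuous
    exact (by fun_prop : Continuous fun r => Real.exp (-c * V r)).aestronglyMeasurable
  · rw [Real.norm_eq_abs, abs_of_pos (Real.exp_pos _), ← Real.exp_add]
    gcongr
    have := hK r; linarith

theorem IsPotential.integrable_exp_energy (hV : IsPotential V) {c : ℝ} (hc : 0 < c) :
    Integrable fun z : ℝ × ℝ => Real.exp (-c * energy V z.1 z.2) := by
  have h1 := (hV.integrable_exp hc).mul_prod (integrable_exp_neg_mul_sq (half_pos hc))
  refine h1.congr (Eventually.of_forall fun z => ?_)
  simp only [energy]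
  rw [← Real.exp_add]; congr 1; ring

theorem IsPotential.partitionFn_pos (hV : IsPotential V) {c : ℝ} (hc : 0 < c) :
    0 < partitionFn V c := by
  unfold partitionFn
  exact integral_exp_pos (hV.integrable_exp_energy hc)

theorem IsPotential.partitionFn_anti (hV : IsPotential V) {c d : ℝ} (hc : 0 < c) (hcd : c ≤ d) :
    partitionFn V d ≤ partitionFn V c := by
  refine integral_mono (hV.integrable_exp_energy (hc.trans_le hcd)) (hV.integrable_exp_energy hc)
    fun z => ?_
  have : 0 ≤ energy V z.1 z.2 := add_nonneg (by positivity) (hV.nonneg _)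
  dsimp only
  gcongr

end Potential

/-! ### Derivatives on phase space and the Liouville operator -/

section Calculus
variable {n : ℕ} {V β : ℝ → ℝ} {b B G C : ℝ}

/-- The direction of `∂_{r_k}`. -/
def er (k : Fin n) : Phase n := (Pi.single k 1, 0)

/-- The direction of `∂_{p_k}`. -/
def ep (k : Fin n) : Phase n := (0, Pi.single k 1)

theorem dr_eq (k : Fin n) (f : Phase n → ℝ) (x : Phase n) : dr k f x = fderiv ℝ f x (er k) := rfl

theorem dp_eq (k : Fin n) (f : Phase n → ℝ) (x : Phase n) : dp k f x = fderiv ℝ f x (ep k) := rfl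

/-- A weighted sum of the energies of the particles. -/
def wEnergy (V : ℝ → ℝ) (w : Fin n → ℝ) (x : Phase n) : ℝ := ∑ k, w k * energy V (x.1 k) (x.2 k)

/-- The total energy of the chain. -/
def totalEnergy (V : ℝ → ℝ) (x : Phase n) : ℝ := ∑ k, energy V (x.1 k) (x.2 k)

theorem totalEnergy_eq_wEnergy (x : Phase n) :
    totalEnergy V x = wEnergy V (fun _ => 1) x := by simp [totalEnergy, wEnergy]

/-- The Lebesgue density of the Gibbs measure. -/
def density (V β : ℝ → ℝ) (x : Phase n) : ℝ :=
  ∏ k, Real.exp (-betaAt β n k * energy V (x.1 k) (x.2 k)) / partitionFn V (betaAt β n k)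

theorem density_eq (x : Phase n) : density V β x =
    (∏ k, (partitionFn V (betaAt β n k))⁻¹) * Real.exp (-wEnergy V (betaAt β n) x) := by
  rw [density, wEnergy, ← Finset.sum_neg_distrib, Real.exp_sum, ← Finset.prod_mul_distrib]
  refine Finset.prod_congr rfl fun k _ => ?_
  rw [neg_mul, div_eq_inv_mul]

/-- The generator `n² A^τ + n² γ S` of the chain. -/
def gen (V β : ℝ → ℝ) (γ τ : ℝ) (f : Phase n → ℝ) (x : Phase n) : ℝ :=
  (n : ℝ) ^ 2 * liouville V τ f x + (n : ℝ) ^ 2 * γ * thermostat β f x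

theorem ChainBounds.contDiff_wEnergy (h : ChainBounds V β b B G C) (w : Fin n → ℝ) :
    ContDiff ℝ ∞ (wEnergy V w) := by
  have := h.smooth
  unfold wEnergy energy
  fun_prop

theorem ChainBounds.contDiff_totalEnergy (h : ChainBounds V β b B G C) :
    ContDiff ℝ ∞ (totalEnergy V : Phase n → ℝ) := by
  have := h.smooth
  unfold totalEnergy energy
  fun_prop

theorem ChainBounds.contDiff_density (h : ChainBounds V β b B G C) :
    ContDiff ℝ ∞ (density V β : Phase n → ℝ) := by
  rw [funext (density_eq (V := V) (β := β))]
  exact contDiff_const.mul (h.contDiff_wEnergy _).neg.exp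

theorem hasFDerivAt_wEnergy (hV : Differentiable ℝ V) (w : Fin n → ℝ) (x : Phase n) :
    HasFDerivAt (wEnergy V w) (∑ k, w k •
      (x.2 k • (ContinuousLinearMap.proj (R := ℝ) (φ := fun _ : Fin n => ℝ) k).comp
          (ContinuousLinearMap.snd ℝ (Fin n → ℝ) (Fin n → ℝ)) +
        deriv V (x.1 k) • (ContinuousLinearMap.proj (R := ℝ) (φ := fun _ : Fin n => ℝ) k).comp
          (ContinuousLinearMap.fst ℝ (Fin n → ℝ) (Fin n → ℝ)))) x := by
  unfold wEnergy
  refine HasFDerivAt.fun_sum fun k _ => ?_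
  refine HasFDerivAt.const_mul ?_ _
  unfold energy
  refine HasFDerivAt.add ?_ ?_
  · have h1 : HasDerivAt (fun p : ℝ => p ^ 2 / 2) (x.2 k) (x.2 k) := by
      exact ((hasDerivAt_pow 2 (x.2 k)).div_const 2).congr_deriv (by simp)
    exact h1.comp_hasFDerivAt x (ContinuousLinearMap.hasFDerivAt (x := x)
      ((ContinuousLinearMap.proj (R := ℝ) (φ := fun _ : Fin n => ℝ) k).comp
          (ContinuousLinearMap.snd ℝ (Fin n → ℝ) (Fin n → ℝ))))
  · exact (hV (x.1 k)).hasDerivAt.comp_hasFDerivAt x (ContinuousLinearMap.hasFDerivAt (x := x)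
      ((ContinuousLinearMap.proj (R := ℝ) (φ := fun _ : Fin n => ℝ) k).comp
          (ContinuousLinearMap.fst ℝ (Fin n → ℝ) (Fin n → ℝ))))

theorem dr_wEnergy (hV : Differentiable ℝ V) (w : Fin n → ℝ) (k : Fin n) (x : Phase n) :
    dr k (wEnergy V w) x = w k * deriv V (x.1 k) := by
  rw [dr, (hasFDerivAt_wEnergy hV w x).fderiv]
  simp [Pi.single_apply, Finset.sum_ite_eq']

theorem dp_wEnergy (hV : Differentiable ℝ V) (w : Fin n → ℝ) (k : Fin n) (x : Phase n) :
    dp k (wEnergy V w) x = w k * x.2 k := by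
  rw [dp, (hasFDerivAt_wEnergy hV w x).fderiv]
  simp [Pi.single_apply, Finset.sum_ite_eq']

section Rules
variable {u v : Phase n → ℝ} {x : Phase n} (k : Fin n)

theorem dr_mul (hu : DifferentiableAt ℝ u x) (hv : DifferentiableAt ℝ v x) :
    dr k (fun y => u y * v y) x = u x * dr k v x + v x * dr k u x := by
  simp [dr, fderiv_fun_mul hu hv]

theorem dp_mul (hu : DifferentiableAt ℝ u x) (hv : DifferentiableAt ℝ v x) :
    dp k (fun y => u y * v y) x = u x * dp k v x + v x * dp k u x := by
  simp [dp, fderiv_fun_mul hu hv]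

theorem dp_sub (hu : DifferentiableAt ℝ u x) (hv : DifferentiableAt ℝ v x) :
    dp k (fun y => u y - v y) x = dp k u x - dp k v x := by
  simp [dp, fderiv_fun_sub hu hv]

theorem dr_comp {φ : ℝ → ℝ} {φ' : ℝ} (hφ : HasDerivAt φ φ' (u x)) (hu : DifferentiableAt ℝ u x) :
    dr k (fun y => φ (u y)) x = φ' * dr k u x := by
  simp [dr, (show fderiv ℝ (fun y => φ (u y)) x = _ from
      (hφ.comp_hasFDerivAt x hu.hasFDerivAt).fderiv)]

theorem dp_comp {φ : ℝ → ℝ} {φ' : ℝ} (hφ : HasDerivAt φ φ' (u x)) (hu : DifferentiableAt ℝ u x) :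
    dp k (fun y => φ (u y)) x = φ' * dp k u x := by
  simp [dp, (show fderiv ℝ (fun y => φ (u y)) x = _ from
      (hφ.comp_hasFDerivAt x hu.hasFDerivAt).fderiv)]

end Rules

theorem contDiff_dp {u : Phase n → ℝ} (k : Fin n) (hu : ContDiff ℝ 2 u) :
    ContDiff ℝ 1 (dp k u) :=
  (hu.fderiv_right (m := 1) (by norm_num)).clm_apply contDiff_const

theorem liouville_mul (τ : ℝ) {u v : Phase n → ℝ} {x : Phase n} (hu : DifferentiableAt ℝ u x)
    (hv : DifferentiableAt ℝ v x) :
    liouville V τ (fun y => u y * v y) x = u x * liouville V τ v x + v x * liouville V τ u x := by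
  have e : ∀ c d d' : ℝ, c * (u x * d + v x * d') = u x * (c * d) + v x * (c * d') :=
    fun c d d' => by ring
  simp only [liouville, dr_mul _ hu hv, dp_mul _ hu hv, e, Finset.sum_add_distrib, ← Finset.mul_sum]
  ring

theorem liouville_comp (τ : ℝ) {u : Phase n → ℝ} {x : Phase n} {φ : ℝ → ℝ} {φ' : ℝ}
    (hφ : HasDerivAt φ φ' (u x)) (hu : DifferentiableAt ℝ u x) :
    liouville V τ (fun y => φ (u y)) x = φ' * liouville V τ u x := by
  simp only [liouville, dr_comp _ hφ hu, dp_comp _ hφ hu, mul_add, Finset.mul_sum]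
  congr 1 <;> exact Finset.sum_congr rfl fun k _ => by ring

/-- Summation by parts along the chain; the convention `p_0 = 0` leaves no term at the left end. -/
theorem sum_pPrev_mul (p a : Fin n → ℝ) :
    ∑ k, pPrev p k * a k = ∑ k : Fin n, if h : (k : ℕ) + 1 < n then p k * a ⟨k + 1, h⟩ else 0 := by
  cases n with
  | zero => simp
  | succ m =>
    rw [Fin.sum_univ_succ, Fin.sum_univ_castSucc]
    simp [pPrev]
    rfl

/-- `p_n` as a sum over the last particle. -/
def pLast (p : Fin n → ℝ) : ℝ := ∑ k : Fin n, if (k : ℕ) + 1 < n then 0 else p k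

/-- The energy current through the bond between `k` and `k + 1` is carried by `p_k V'(r_{k+1})`. It
leaves one particle and enters the next, so only differences of neighbouring weights survive,
together with the work of the tension on the last particle. -/
theorem liouville_wEnergy (hV : Differentiable ℝ V) (w : Fin n → ℝ) (τ : ℝ) (x : Phase n) :
    liouville V τ (wEnergy V w) x = ∑ k : Fin n, if h : (k : ℕ) + 1 < n then
      (w k - w ⟨k + 1, h⟩) * x.2 k * deriv V (x.1 ⟨k + 1, h⟩) else τ * w k * x.2 k := by
  simp only [liouville, dr_wEnergy hV, dp_wEnergy hV, sub_mul, Finset.sum_sub_distrib]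
  rw [sum_pPrev_mul x.2 fun k => w k * deriv V (x.1 k)]
  have : ∀ k : Fin n, x.2 k * (w k * deriv V (x.1 k)) = deriv V (x.1 k) * (w k * x.2 k) :=
    fun k => by ring
  simp only [this]
  rw [sub_add_sub_comm, add_comm, add_sub_add_right_eq_sub, ← Finset.sum_sub_distrib]
  refine Finset.sum_congr rfl fun k _ => ?_
  unfold forceRight
  split_ifs <;> ring

theorem liouville_totalEnergy (hV : Differentiable ℝ V) (τ : ℝ) (x : Phase n) :
    liouville V τ (totalEnergy V) x = τ * pLast x.2 := by
  rw [funext (totalEnergy_eq_wEnergy (V := V)), liouville_wEnergy hV, pLast, Finset.mul_sum]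
  refine Finset.sum_congr rfl fun k _ => ?_
  split_ifs <;> simp

theorem betaAt_last (k : Fin n) (hk : ¬ (k : ℕ) + 1 < n) : betaAt β n k = β 1 := by
  have : (k : ℕ) + 1 = n := by omega
  have h2 : ((k : ℕ) + 1 : ℝ) = n := by exact_mod_cast this
  have h3 : (n : ℝ) ≠ 0 := by rw [← h2]; positivity
  rw [betaAt, h2, div_self h3]

/-- This identity explains the multiplication part of the adjoint: it compensates the failure of the
Gibbs density to be invariant under the transport. -/
theorem sourceTerm_eq (hV : Differentiable ℝ V) (τ : ℝ) (x : Phase n) :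
    sourceTerm V β τ x = (n : ℝ) ^ 2 * liouville V τ (wEnergy V (betaAt β n)) x := by
  rw [liouville_wEnergy hV, sourceTerm, Finset.mul_sum]
  refine Finset.sum_congr rfl fun k _ => ?_
  split_ifs with hk
  · simp only [gradBeta, betaAt, Nat.cast_add, Nat.cast_one]
    rw [show ((k : ℕ) + 1 + 1 : ℝ) = (k : ℕ) + 2 by ring]
    ring
  · rw [betaAt_last k hk]; ring

theorem ChainBounds.liouville_density (h : ChainBounds V β b B G C) (τ : ℝ) (x : Phase n) :
    (n : ℝ) ^ 2 * liouville V τ (density V β) x = -sourceTerm V β τ x * density V β x := by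
  have h1 : (density V β : Phase n → ℝ) = fun y => (fun s =>
      (∏ k, (partitionFn V (betaAt β n k))⁻¹) * Real.exp (-s)) (wEnergy V (betaAt β n) y) :=
    funext density_eq
  have h2 : HasDerivAt (fun s : ℝ =>
      (∏ k : Fin n, (partitionFn V (betaAt β n k))⁻¹) * Real.exp (-s))
      (-density V β x) (wEnergy V (betaAt β n) x) := by
    have := ((hasDerivAt_neg (wEnergy V (betaAt β n) x)).exp).const_mul
      (∏ k : Fin n, (partitionFn V (betaAt β n k))⁻¹)
    exact this.congr_deriv (by rw [density_eq]; ring)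
  rw [h1, liouville_comp τ h2 ((h.contDiff_wEnergy _).differentiable (by simp) x), ← h1,
    sourceTerm_eq h.differentiable]
  ring

theorem ChainBounds.dp_density (h : ChainBounds V β b B G C) (k : Fin n) (x : Phase n) :
    dp k (density V β) x = -betaAt β n k * x.2 k * density V β x := by
  have h1 : (density V β : Phase n → ℝ) = fun y => (fun s =>
      (∏ k, (partitionFn V (betaAt β n k))⁻¹) * Real.exp (-s)) (wEnergy V (betaAt β n) y) :=
    funext density_eq
  have h2 : HasDerivAt (fun s : ℝ =>
      (∏ k : Fin n, (partitionFn V (betaAt β n k))⁻¹) * Real.exp (-s))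
      (-density V β x) (wEnergy V (betaAt β n) x) := by
    have := ((hasDerivAt_neg (wEnergy V (betaAt β n) x)).exp).const_mul
      (∏ k : Fin n, (partitionFn V (betaAt β n k))⁻¹)
    exact this.congr_deriv (by rw [density_eq]; ring)
  rw [h1, dp_comp k h2 ((h.contDiff_wEnergy _).differentiable (by simp) x), ← h1,
    dp_wEnergy h.differentiable]
  ring

end Calculus

/-! ### The Gibbs measure, exponential moments and compact energy sublevels -/

section Gibbs
variable {n : ℕ} {V β : ℝ → ℝ} {b B G C : ℝ}

/-- The coordinates are regrouped particle by particle, after which the exponential is a product and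
Fubini applies. -/
theorem integrable_exp_wEnergy (hV : IsPotential V) {w : Fin n → ℝ} (hw : ∀ k, 0 < w k) :
    Integrable (fun x : Phase n => Real.exp (-wEnergy V w x)) ∧
      ∫ x : Phase n, Real.exp (-wEnergy V w x) = ∏ k, partitionFn V (w k) := by
  have mp := volume_measurePreserving_arrowProdEquivProdArrow ℝ ℝ (Fin n)
  have e : ∀ z : Fin n → ℝ × ℝ,
      Real.exp (-wEnergy V w (MeasurableEquiv.arrowProdEquivProdArrow ℝ ℝ (Fin n) z)) =
        ∏ k, Real.exp (-w k * energy V (z k).1 (z k).2) := fun z => by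
    simp only [wEnergy, ← Finset.sum_neg_distrib, Real.exp_sum, neg_mul]
    rfl
  constructor
  · rw [← mp.integrable_comp_emb (MeasurableEquiv.measurableEmbedding _)]
    refine Integrable.congr (Integrable.fintype_prod
      (f := fun k (z : ℝ × ℝ) => Real.exp (-w k * energy V z.1 z.2))
      fun k => hV.integrable_exp_energy (hw k)) (Eventually.of_forall fun z => (e z).symm)
  · rw [← mp.integral_comp (MeasurableEquiv.measurableEmbedding _)]
    simp only [e]
    exact integral_fintype_prod_volume_eq_prod
      (fun k (z : ℝ × ℝ) => Real.exp (-w k * energy V z.1 z.2))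

theorem ChainBounds.prod_partitionFn_pos (h : ChainBounds V β b B G C) (n : ℕ) :
    0 < ∏ k : Fin n, partitionFn V (betaAt β n k) :=
  Finset.prod_pos fun k _ => h.pot.partitionFn_pos (h.betaAt_pos k)

theorem ChainBounds.density_pos (h : ChainBounds V β b B G C) (x : Phase n) :
    0 < density V β x :=
  Finset.prod_pos fun k _ => div_pos (Real.exp_pos _) (h.pot.partitionFn_pos (h.betaAt_pos k))

theorem ChainBounds.continuous_density (h : ChainBounds V β b B G C) :
    Continuous (density V β : Phase n → ℝ) := h.contDiff_density.continuous

theorem ChainBounds.continuous_totalEnergy (h : ChainBounds V β b B G C) :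
    Continuous (totalEnergy V : Phase n → ℝ) := h.contDiff_totalEnergy.continuous

theorem ChainBounds.totalEnergy_nonneg (h : ChainBounds V β b B G C) (x : Phase n) :
    0 ≤ totalEnergy V x :=
  Finset.sum_nonneg fun k _ => add_nonneg (by positivity) (h.nonneg _)

theorem gibbs_eq : gibbs V β n =
    (volume : Measure (Phase n)).withDensity fun x => ENNReal.ofReal (density V β x) := rfl

theorem ChainBounds.integral_gibbs (h : ChainBounds V β b B G C) (g : Phase n → ℝ) :
    ∫ x, g x ∂(gibbs V β n) = ∫ x, density V β x * g x := by
  rw [gibbs_eq, integral_withDensity_eq_integral_toReal_smul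
    h.continuous_density.measurable.ennreal_ofReal (by simp)]
  simp [ENNReal.toReal_ofReal (h.density_pos _).le]

theorem ChainBounds.integrable_gibbs (h : ChainBounds V β b B G C) (g : Phase n → ℝ) :
    Integrable g (gibbs V β n) ↔ Integrable fun x => density V β x * g x := by
  rw [gibbs_eq, integrable_withDensity_iff_integrable_smul'
    h.continuous_density.measurable.ennreal_ofReal (by simp)]
  simp only [ENNReal.toReal_ofReal (h.density_pos _).le, smul_eq_mul]

theorem ChainBounds.lintegral_gibbs (h : ChainBounds V β b B G C) (g : Phase n → ℝ≥0∞) :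
    ∫⁻ x, g x ∂(gibbs V β n) = ∫⁻ x, ENNReal.ofReal (density V β x) * g x := by
  rw [gibbs_eq, lintegral_withDensity_eq_lintegral_mul_non_measurable _
    h.continuous_density.measurable.ennreal_ofReal (by simp)]
  rfl

theorem ChainBounds.isProbabilityMeasure (h : ChainBounds V β b B G C) :
    IsProbabilityMeasure (gibbs V β n) := by
  constructor
  obtain ⟨h1, h2⟩ := integrable_exp_wEnergy h.pot (w := betaAt β n) h.betaAt_pos
  have h3 : Integrable (density V β : Phase n → ℝ) := by
    rw [funext (density_eq (V := V) (β := β))]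
    exact h1.const_mul _
  rw [← setLIntegral_one, setLIntegral_univ, h.lintegral_gibbs]
  simp only [mul_one]
  rw [← ofReal_integral_eq_lintegral_ofReal h3 (Eventually.of_forall fun x => (h.density_pos x).le)]
  rw [funext (density_eq (V := V) (β := β)), integral_const_mul, h2, Finset.prod_inv_distrib,
    inv_mul_cancel₀ (h.prod_partitionFn_pos n).ne', ENNReal.ofReal_one]

instance : (volume : Measure (Phase n)).IsAddHaarMeasure :=
  Measure.prod.instIsAddHaarMeasure _ _

theorem ChainBounds.integrable_gibbs_of_compact (h : ChainBounds V β b B G C) {g : Phase n → ℝ}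
    (hg : Continuous g) (hc : HasCompactSupport g) : Integrable g (gibbs V β n) := by
  have := h.isProbabilityMeasure (n := n)
  exact hg.integrable_of_hasCompactSupport hc

/-- The exponential moment of the energy is at most exponential in the number of particles. -/
theorem ChainBounds.exists_exp_moment (h : ChainBounds V β b B G C) : ∃ K, 0 ≤ K ∧ ∀ n : ℕ,
    Integrable (fun x : Phase n => Real.exp (b / 2 * totalEnergy V x)) (gibbs V β n) ∧
      ∫ x : Phase n, Real.exp (b / 2 * totalEnergy V x) ∂(gibbs V β n) ≤ Real.exp (K * n) := by
  have hb2 := half_pos h.b_pos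
  have hZ : partitionFn V B ≤ partitionFn V (b / 2) :=
    h.pot.partitionFn_anti hb2 ((half_le_self h.b_pos.le).trans ((h.b_le 1 0).trans (h.le_B 1 0)))
  have hZB := h.pot.partitionFn_pos h.B_pos
  -- Tilting by `b/2` leaves every inverse temperature at least `b/2`. Each factor is therefore at
  -- most the ratio of the partition functions at `b/2` and at `B`, and `K` is its logarithm.
  refine ⟨Real.log (partitionFn V (b / 2) / partitionFn V B),
    Real.log_nonneg (by rwa [one_le_div hZB]), fun n => ?_⟩
  have hw : ∀ k : Fin n, 0 < betaAt β n k - b / 2 := fun k => by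
    have := h.b_le n k; have := h.b_pos; linarith
  obtain ⟨h1, h2⟩ := integrable_exp_wEnergy h.pot hw
  have e : ∀ x : Phase n, density V β x * Real.exp (b / 2 * totalEnergy V x) =
      (∏ k, (partitionFn V (betaAt β n k))⁻¹) *
        Real.exp (-wEnergy V (fun k => betaAt β n k - b / 2) x) := fun x => by
    rw [density_eq, mul_assoc, ← Real.exp_add]
    congr 2
    simp only [wEnergy, totalEnergy, Finset.mul_sum, sub_mul, Finset.sum_sub_distrib]
    ring
  constructor
  · rw [h.integrable_gibbs]
    simp only [e]
    exact h1.const_mul _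
  · rw [h.integral_gibbs]
    simp only [e]
    rw [integral_const_mul, h2, ← Finset.prod_mul_distrib, mul_comm, Real.exp_nat_mul,
      Real.exp_log (div_pos (h.pot.partitionFn_pos hb2) hZB)]
    calc _ ≤ ∏ _k : Fin n, partitionFn V (b / 2) / partitionFn V B := by
          refine Finset.prod_le_prod (fun k _ => ?_) fun k _ => ?_
          · exact mul_nonneg (inv_nonneg.2 (h.pot.partitionFn_pos (h.betaAt_pos k)).le)
              (h.pot.partitionFn_pos (hw k)).le
          · rw [← div_eq_inv_mul]
            refine div_le_div₀ (h.pot.partitionFn_pos hb2).le ?_ hZB ?_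
            · exact h.pot.partitionFn_anti hb2 (by have := h.b_le n k; linarith)
            · exact h.pot.partitionFn_anti (h.betaAt_pos k) (h.le_B n k)
      _ = _ := by simp [div_pow]

/-- Properness of the energy makes every cutoff that is a compactly supported function of the energy
compactly supported on phase space. -/
theorem ChainBounds.isCompact_sublevel (h : ChainBounds V β b B G C) (R : ℝ) :
    IsCompact {x : Phase n | totalEnergy V x ≤ R} := by
  refine Metric.isCompact_of_isClosed_isBounded
    (isClosed_le h.continuous_totalEnergy continuous_const) ?_
  obtain ⟨K, hK0, hK⟩ := h.pot.abs_le one_pos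
  refine (Metric.isBounded_closedBall (x := (0 : Phase n)) (r := max 0 (1 + R + K))).subset
    fun x hx => ?_
  have hx' : totalEnergy V x ≤ R := hx
  have h1 : ∀ k, energy V (x.1 k) (x.2 k) ≤ R := fun k =>
    (Finset.single_le_sum (f := fun k => energy V (x.1 k) (x.2 k))
      (fun k _ => add_nonneg (by positivity) (h.nonneg _)) (Finset.mem_univ k)).trans hx'
  rw [mem_closedBall_zero_iff, Prod.norm_def, max_le_iff,
    pi_norm_le_iff_of_nonneg (le_max_left _ _), pi_norm_le_iff_of_nonneg (le_max_left _ _)]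
  refine ⟨fun k => le_max_of_le_right ?_, fun k => le_max_of_le_right ?_⟩
  · have h2 := hK (x.1 k)
    have h3 := h1 k
    unfold energy at h3
    rw [Real.norm_eq_abs]
    nlinarith [sq_nonneg (x.2 k)]
  · have h3 := h1 k
    unfold energy at h3
    have h4 := h.nonneg (x.1 k)
    rw [Real.norm_eq_abs]
    have : |x.2 k| ≤ 1 + x.2 k ^ 2 / 2 := by
      rw [← sq_abs]; nlinarith [sq_nonneg (|x.2 k| - 1)]
    linarith

end Gibbs

/-! ### Integration by parts and adjointness -/

section IntegrationByParts
variable {n : ℕ} {V β : ℝ → ℝ} {b B G C : ℝ}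

theorem fderiv_eq_zero_of_invariant {c : Phase n → ℝ} {w : Phase n}
    (hc : ∀ (x : Phase n) (s : ℝ), c (x + s • w) = c x) (hd : Differentiable ℝ c) (x : Phase n) :
    fderiv ℝ c x w = 0 := by
  rw [← (hd x).lineDeriv_eq_fderiv, lineDeriv]
  simp [hc]

theorem integral_mul_fderiv_eq_neg {c u : Phase n → ℝ} (hc : ContDiff ℝ 1 c) (hu : ContDiff ℝ 1 u)
    (hs : HasCompactSupport u) (w : Phase n) :
    ∫ x, c x * fderiv ℝ u x w = -∫ x, fderiv ℝ c x w * u x := by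
  have hcd := hc.continuous_fderiv (by simp)
  have hud := hu.continuous_fderiv (by simp)
  have hs' : HasCompactSupport fun x => fderiv ℝ u x w := hs.fderiv_apply ℝ w
  refine integral_mul_fderiv_eq_neg_fderiv_mul_of_integrable ?_ ?_ ?_
    (fun x _ => hc.differentiable (by simp) x) (fun x _ => hu.differentiable (by simp) x)
  · exact ((hcd.clm_apply continuous_const).mul hu.continuous).integrable_of_hasCompactSupport
      hs.mul_left
  · exact (hc.continuous.mul (hud.clm_apply continuous_const)).integrable_of_hasCompactSupport
      hs'.mul_left
  · exact (hc.continuous.mul hu.continuous).integrable_of_hasCompactSupport hs.mul_left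

theorem integral_fderiv_eq_zero {u : Phase n → ℝ} (hu : ContDiff ℝ 1 u)
    (hs : HasCompactSupport u) (w : Phase n) : ∫ x, fderiv ℝ u x w = 0 := by
  simpa using integral_mul_fderiv_eq_neg (c := fun _ => 1) contDiff_const hu hs w

theorem integral_mul_fderiv_of_invariant {c u : Phase n → ℝ} (hc : ContDiff ℝ 1 c)
    (hu : ContDiff ℝ 1 u) (hs : HasCompactSupport u) {w : Phase n}
    (hw : ∀ (x : Phase n) (s : ℝ), c (x + s • w) = c x) : ∫ x, c x * fderiv ℝ u x w = 0 := by
  rw [integral_mul_fderiv_eq_neg hc hu hs]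
  simp [fderiv_eq_zero_of_invariant hw (hc.differentiable (by simp))]

theorem contDiff_pPrev (k : Fin n) : ContDiff ℝ ∞ fun x : Phase n => pPrev x.2 k := by
  unfold pPrev; split_ifs <;> fun_prop

theorem ChainBounds.contDiff_forceRight (h : ChainBounds V β b B G C) (τ : ℝ) (k : Fin n) :
    ContDiff ℝ ∞ fun x : Phase n => forceRight V τ x.1 k := by
  have := h.contDiff_deriv
  unfold forceRight; split_ifs <;> fun_prop

/-- The Liouville field is divergence free: the velocity coefficient of `∂_{r_k}` does not involve
positions, and the force coefficient of `∂_{p_k}` does not involve velocities. -/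
theorem ChainBounds.integral_liouville (h : ChainBounds V β b B G C) (τ : ℝ) {u : Phase n → ℝ}
    (hu : ContDiff ℝ 1 u) (hs : HasCompactSupport u) :
    Integrable (liouville V τ u) ∧ ∫ x, liouville V τ u x = 0 := by
  have hud := hu.continuous_fderiv (by simp)
  have hc1 : ∀ k : Fin n, ContDiff ℝ 1 fun x : Phase n => x.2 k - pPrev x.2 k := fun k =>
    ContDiff.sub (by fun_prop) ((contDiff_pPrev k).of_le (by simp))
  have hc2 : ∀ k : Fin n, ContDiff ℝ 1 fun x : Phase n => forceRight V τ x.1 k - deriv V (x.1 k) :=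
    fun k => ((h.contDiff_forceRight τ k).of_le (by simp)).sub
      ((h.contDiff_deriv.of_le (by simp)).comp (by fun_prop : ContDiff ℝ 1 fun x : Phase n => x.1 k))
  have hi1 : ∀ k : Fin n, Integrable fun x : Phase n => (x.2 k - pPrev x.2 k) * dr k u x :=
    fun k => ((hc1 k).continuous.mul
      (hud.clm_apply continuous_const)).integrable_of_hasCompactSupport
        (hs.fderiv_apply ℝ _).mul_left
  have hi2 : ∀ k : Fin n, Integrable fun x : Phase n =>
      (forceRight V τ x.1 k - deriv V (x.1 k)) * dp k u x :=
    fun k => ((hc2 k).continuous.mul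
      (hud.clm_apply continuous_const)).integrable_of_hasCompactSupport
        (hs.fderiv_apply ℝ _).mul_left
  have hi1' := integrable_finsetSum Finset.univ fun k _ => hi1 k
  have hi2' := integrable_finsetSum Finset.univ fun k _ => hi2 k
  refine ⟨hi1'.add hi2', ?_⟩
  unfold liouville
  rw [integral_add hi1' hi2', integral_finsetSum _ fun k _ => hi1 k,
    integral_finsetSum _ fun k _ => hi2 k]
  rw [Finset.sum_eq_zero fun k _ => ?_, Finset.sum_eq_zero fun k _ => ?_, add_zero]
  · exact integral_mul_fderiv_of_invariant (hc2 k) hu hs (w := ep k) fun x s => by simp [ep]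
  · exact integral_mul_fderiv_of_invariant (hc1 k) hu hs (w := er k) fun x s => by simp [er]

/-- The forward operator is the adjoint of the generator. -/
theorem ChainBounds.integral_mul_forwardOp (h : ChainBounds V β b B G C) (γ τ : ℝ)
    {W g : Phase n → ℝ} (hW : ContDiff ℝ 2 W) (hs : HasCompactSupport W) (hg : ContDiff ℝ 2 g) :
    Integrable (fun x => W x * forwardOp V β γ τ g x - gen V β γ τ W x * g x) (gibbs V β n) ∧
      ∫ x, (W x * forwardOp V β γ τ g x - gen V β γ τ W x * g x) ∂(gibbs V β n) = 0 := by
  have hD := h.contDiff_density (n := n)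
  have hWd : ∀ x, DifferentiableAt ℝ W x := fun x => hW.differentiable (by simp) x
  have hgd : ∀ x, DifferentiableAt ℝ g x := fun x => hg.differentiable (by simp) x
  have hDd : ∀ x, DifferentiableAt ℝ (density V β : Phase n → ℝ) x :=
    fun x => hD.differentiable (by simp) x
  have hW2 : ∀ k, ContDiff ℝ 1 (dp k W) := fun k => contDiff_dp k hW
  have hg2 : ∀ k, ContDiff ℝ 1 (dp k g) := fun k => contDiff_dp k hg
  have hWd2 : ∀ k x, DifferentiableAt ℝ (dp k W) x := fun k x => (hW2 k).differentiable (by simp) x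
  have hgd2 : ∀ k x, DifferentiableAt ℝ (dp k g) x := fun k x => (hg2 k).differentiable (by simp) x
  have hW1 : ContDiff ℝ 1 W := hW.of_le (by norm_num)
  have hg1 : ContDiff ℝ 1 g := hg.of_le (by norm_num)
  have hD1 : ContDiff ℝ 1 (density V β : Phase n → ℝ) := hD.of_le (by simp)
  -- The Wronskian current of `W` and `g`. Its weighted divergence is the defect of symmetry of the
  -- thermostat, so the thermostat is symmetric for the Gibbs measure.
  set Y : Fin n → Phase n → ℝ := fun k x =>
    density V β x * (W x * dp k g x - g x * dp k W x) with hY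
  have hYc : ∀ k, ContDiff ℝ 1 (Y k) := fun k =>
    hD1.mul ((hW1.mul (hg2 k)).sub (hg1.mul (hW2 k)))
  have hYs : ∀ k, HasCompactSupport (Y k) := fun k =>
    HasCompactSupport.mul_left (hs.mul_right.sub (hs.fderiv_apply ℝ (ep k)).mul_left)
  have hY' : ∀ k x, dp k (Y k) x = density V β x * (W x * (dp k (dp k g) x -
      betaAt β n k * x.2 k * dp k g x) - g x * (dp k (dp k W) x -
      betaAt β n k * x.2 k * dp k W x)) := fun k x => by
    have d1 := (hWd x).fun_mul (hgd2 k x)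
    have d2 := (hgd x).fun_mul (hWd2 k x)
    rw [hY, dp_mul k (hDd x) (d1.fun_sub d2), dp_sub k d1 d2, dp_mul k (hWd x) (hgd2 k x),
      dp_mul k (hgd x) (hWd2 k x), h.dp_density]
    ring
  -- Pointwise, the defect of adjointness is a transport term plus divergences of compactly
  -- supported fields, and each of these integrates to zero.
  have key : ∀ x, density V β x * (W x * forwardOp V β γ τ g x - gen V β γ τ W x * g x) =
      -(n : ℝ) ^ 2 * liouville V τ (fun y => density V β y * (W y * g y)) x +
        (n : ℝ) ^ 2 * γ * ∑ k, (betaAt β n k)⁻¹ * dp k (Y k) x := fun x => by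
    rw [liouville_mul τ (hDd x) ((hWd x).fun_mul (hgd x)), liouville_mul τ (hWd x) (hgd x)]
    have e1 := h.liouville_density (n := n) τ x
    have e2 : ∑ k, (betaAt β n k)⁻¹ * dp k (Y k) x =
        density V β x * (W x * thermostat β g x - g x * thermostat β W x) := by
      simp only [thermostat, Finset.mul_sum, ← Finset.sum_sub_distrib]
      refine Finset.sum_congr rfl fun k _ => ?_
      rw [hY']
      have := (h.betaAt_pos k).ne'
      field_simp
    rw [e2, forwardOp, gen]
    linear_combination (W x * g x) * e1
  rw [h.integral_gibbs, h.integrable_gibbs]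
  simp only [key]
  obtain ⟨i1, i2⟩ := h.integral_liouville τ (hD1.mul (hW1.mul hg1))
    (HasCompactSupport.mul_left hs.mul_right : HasCompactSupport fun y => density V β y * (W y * g y))
  have i3 : ∀ k, Integrable fun x => (betaAt β n k)⁻¹ * dp k (Y k) x := fun k =>
    ((((hYc k).continuous_fderiv (by simp)).clm_apply
      continuous_const).integrable_of_hasCompactSupport ((hYs k).fderiv_apply ℝ _)).const_mul _
  have i4 := (integrable_finsetSum Finset.univ fun k _ => i3 k).const_mul ((n : ℝ) ^ 2 * γ)
  refine ⟨(i1.const_mul _).add i4, ?_⟩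
  rw [integral_add (i1.const_mul _) i4, integral_const_mul, i2, integral_const_mul, integral_finsetSum _ fun k _ => i3 k]
  rw [Finset.sum_eq_zero fun k _ => ?_]
  · simp
  · rw [integral_const_mul]
    have := integral_fderiv_eq_zero (hYc k) (hYs k) (ep k)
    simp only [dp_eq, this, mul_zero]

/-- Gaussian integration by parts in the velocity of one particle. -/
theorem ChainBounds.integral_velocity_mul (h : ChainBounds V β b B G C) (k : Fin n)
    {c u : Phase n → ℝ} (hc : ContDiff ℝ 1 c) (hu : ContDiff ℝ 1 u) (hs : HasCompactSupport u)
    (hck : ∀ (x : Phase n) (s : ℝ), c (x + s • ep k) = c x) :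
    ∫ x, c x * x.2 k * u x ∂(gibbs V β n) =
      ∫ x, (betaAt β n k)⁻¹ * c x * dp k u x ∂(gibbs V β n) := by
  rw [h.integral_gibbs, h.integral_gibbs]
  have hD1 : ContDiff ℝ 1 (density V β : Phase n → ℝ) := h.contDiff_density.of_le (by simp)
  have hDu : ∀ x, dp k (fun y => density V β y * u y) x =
      density V β x * dp k u x - betaAt β n k * x.2 k * density V β x * u x := fun x => by
    rw [dp_mul k (hD1.differentiable (by simp) x) (hu.differentiable (by simp) x), h.dp_density]
    ring
  -- The derivative falls on the product of the density and `u`. The density contributes `-β_k p_k`,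
  -- which produces the velocity factor.
  have h0 := integral_mul_fderiv_of_invariant hc (hD1.mul hu) hs.mul_left hck
  simp only [← dp_eq, hDu] at h0
  have hcont := hc.continuous
  have hDc := hD1.continuous
  have huc := hu.continuous
  have i1 : Integrable fun x => density V β x * ((betaAt β n k)⁻¹ * c x * dp k u x) := by
    refine Continuous.integrable_of_hasCompactSupport ?_
      (HasCompactSupport.mul_left (HasCompactSupport.mul_left (hs.fderiv_apply ℝ (ep k))))
    exact hDc.mul ((continuous_const.mul hcont).mul
      ((hu.continuous_fderiv (by simp)).clm_apply continuous_const))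
  have i2 : Integrable fun x => density V β x * (c x * x.2 k * u x) := by
    refine Continuous.integrable_of_hasCompactSupport ?_
      (HasCompactSupport.mul_left (HasCompactSupport.mul_left hs))
    fun_prop
  have hβ := (h.betaAt_pos k).ne'
  have e : ∀ x, c x * (density V β x * dp k u x - betaAt β n k * x.2 k * density V β x * u x) =
      betaAt β n k * (density V β x * ((betaAt β n k)⁻¹ * c x * dp k u x)) -
        betaAt β n k * (density V β x * (c x * x.2 k * u x)) := fun x => by
    field_simp
  simp only [e] at h0
  rw [integral_sub (i1.const_mul _) (i2.const_mul _), integral_const_mul, integral_const_mul,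
    sub_eq_zero] at h0
  exact (mul_left_cancel₀ hβ h0).symm

end IntegrationByParts

/-! ### Weak evolution against compactly supported weights -/

section Evolution
variable {n : ℕ} {V β : ℝ → ℝ} {b B G C : ℝ}

theorem continuous_slice {F : ℝ → Phase n → ℝ} {S : Set ℝ}
    (hF : ContinuousOn (fun z : ℝ × Phase n => F z.1 z.2) (S ×ˢ univ)) {u : ℝ} (hu : u ∈ S) :
    Continuous (F u) := by
  rw [← continuousOn_univ]
  exact hF.comp (f := fun x : Phase n => (u, x)) (by fun_prop) fun x _ => ⟨hu, mem_univ _⟩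

theorem ChainBounds.integrable_prod_of_compact (h : ChainBounds V β b B G C)
    {F : ℝ → Phase n → ℝ} {K : Set (Phase n)} (hK : IsCompact K) {s t : ℝ}
    (hF : ContinuousOn (fun z : ℝ × Phase n => F z.1 z.2) (Icc s t ×ˢ univ))
    (hFK : ∀ u ∈ Icc s t, ∀ x ∉ K, F u x = 0) :
    Integrable (Function.uncurry F) ((volume.restrict (Ioc s t)).prod (gibbs V β n)) := by
  have := h.isProbabilityMeasure (n := n)
  have h1 : IntegrableOn (Function.uncurry F) (Icc s t ×ˢ K) (volume.prod (gibbs V β n)) :=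
    (hF.mono (prod_mono le_rfl (subset_univ _))).integrableOn_compact (isCompact_Icc.prod hK)
  have h2 : IntegrableOn (Function.uncurry F) (Icc s t ×ˢ univ) (volume.prod (gibbs V β n)) := by
    refine h1.of_forall_sdiff_eq_zero (measurableSet_Icc.prod MeasurableSet.univ) ?_
    rintro ⟨u, x⟩ ⟨hu, hx⟩
    exact hFK u hu.1 x fun hxK => hx ⟨hu.1, hxK⟩
  have h3 := h2.mono_set (prod_mono (Ioc_subset_Icc_self (a := s) (b := t)) (subset_univ univ))
  rwa [IntegrableOn, ← Measure.prod_restrict, Measure.restrict_univ] at h3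

/-- The fundamental theorem of calculus at every point, followed by Fubini. Only the time derivative
has to be supported in the compact set. -/
theorem ChainBounds.integral_sub_eq_of_hasDerivAt (h : ChainBounds V β b B G C)
    {Q Q' : ℝ → Phase n → ℝ} {K : Set (Phase n)} (hK : IsCompact K) {s t : ℝ} (hst : s ≤ t)
    (hQ : ∀ u ∈ Icc s t, ∀ x, HasDerivAt (fun u => Q u x) (Q' u x) u)
    (hQ' : ContinuousOn (fun z : ℝ × Phase n => Q' z.1 z.2) (Icc s t ×ˢ univ))
    (hQK : ∀ u ∈ Icc s t, ∀ x ∉ K, Q' u x = 0) (hs : Integrable (Q s) (gibbs V β n))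
    (ht : Integrable (Q t) (gibbs V β n)) :
    ∫ x, Q t x ∂(gibbs V β n) - ∫ x, Q s x ∂(gibbs V β n) =
      ∫ u in s..t, ∫ x, Q' u x ∂(gibbs V β n) := by
  have := h.isProbabilityMeasure (n := n)
  rw [intervalIntegral_integral_swap, ← integral_sub ht hs]
  · refine integral_congr_ae (Eventually.of_forall fun x => ?_)
    dsimp only
    rw [intervalIntegral.integral_eq_sub_of_hasDerivAt]
    · intro u hu
      rw [uIcc_of_le hst] at hu
      exact hQ u hu x
    · refine ContinuousOn.intervalIntegrable ?_
      rw [uIcc_of_le hst]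
      exact hQ'.comp (f := fun u : ℝ => (u, x)) (by fun_prop) fun u hu => ⟨hu, mem_univ _⟩
  · rw [uIoc_of_le hst]
    exact h.integrable_prod_of_compact hK hQ' hQK

/-- The weak form of the evolution of `∫ W G dν` for a compactly supported weight `W`. -/
theorem ChainBounds.evolution (h : ChainBounds V β b B G C) (γ : ℝ) (τ : ℝ → ℝ)
    {W W' g g' : ℝ → Phase n → ℝ} {K : Set (Phase n)} (hK : IsCompact K) {s t : ℝ} (hst : s ≤ t)
    (hW2 : ∀ u ∈ Icc s t, ContDiff ℝ 2 (W u))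
    (hWK : ∀ u ∈ Icc s t, ∀ x ∉ K, W u x = 0) (hWK' : ∀ u ∈ Icc s t, ∀ x ∉ K, W' u x = 0)
    (hW : ∀ u ∈ Icc s t, ∀ x, HasDerivAt (fun u => W u x) (W' u x) u)
    (hWc : ContinuousOn (fun z : ℝ × Phase n => W z.1 z.2) (Icc s t ×ˢ univ))
    (hWc' : ContinuousOn (fun z : ℝ × Phase n => W' z.1 z.2) (Icc s t ×ˢ univ))
    (hg2 : ∀ u ∈ Icc s t, ContDiff ℝ 2 (g u))
    (hg : ∀ u ∈ Icc s t, ∀ x, HasDerivAt (fun u => g u x) (g' u x) u)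
    (hgc : ContinuousOn (fun z : ℝ × Phase n => g z.1 z.2) (Icc s t ×ˢ univ))
    (hgc' : ContinuousOn (fun z : ℝ × Phase n => g' z.1 z.2) (Icc s t ×ˢ univ)) :
    ∫ x, W t x * g t x ∂(gibbs V β n) - ∫ x, W s x * g s x ∂(gibbs V β n) =
      ∫ u in s..t, ∫ x, ((W' u x + gen V β γ (τ u) (W u) x) * g u x +
        W u x * (g' u x - forwardOp V β γ (τ u) (g u) x)) ∂(gibbs V β n) := by
  have := h.isProbabilityMeasure (n := n)
  have hcs : ∀ u ∈ Icc s t, HasCompactSupport (W u) := fun u hu =>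
    HasCompactSupport.intro hK fun x hx => hWK u hu x hx
  have hint : ∀ u ∈ Icc s t, Integrable (fun x => W u x * g u x) (gibbs V β n) := fun u hu =>
    h.integrable_gibbs_of_compact ((continuous_slice hWc hu).mul (continuous_slice hgc hu))
      (hcs u hu).mul_right
  rw [h.integral_sub_eq_of_hasDerivAt (Q := fun u x => W u x * g u x)
    (Q' := fun u x => W' u x * g u x + W u x * g' u x) hK hst
    (fun u hu x => (hW u hu x).mul (hg u hu x)) ((hWc'.mul hgc).add (hWc.mul hgc'))
    (fun u hu x hx => by simp [hWK u hu x hx, hWK' u hu x hx]) (hint s ⟨le_rfl, hst⟩)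
    (hint t ⟨hst, le_rfl⟩)]
  refine intervalIntegral.integral_congr fun u hu => ?_
  rw [uIcc_of_le hst] at hu
  obtain ⟨i1, i2⟩ := h.integral_mul_forwardOp γ (τ u) (hW2 u hu) (hcs u hu) (hg2 u hu)
  have i3 : Integrable (fun x => W' u x * g u x + W u x * g' u x) (gibbs V β n) := by
    refine h.integrable_gibbs_of_compact ?_ ?_
    · exact ((continuous_slice hWc' hu).mul (continuous_slice hgc hu)).add
        ((continuous_slice hWc hu).mul (continuous_slice hgc' hu))
    · exact HasCompactSupport.intro hK fun x hx => by simp [hWK u hu x hx, hWK' u hu x hx]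
  -- The adjointness defect has zero integral and may be subtracted. The function `g` need not solve
  -- the equation; its own defect stays visible, and for nonlinear functions of a solution that
  -- defect is the production term.
  have e : ∀ x, (W' u x + gen V β γ (τ u) (W u) x) * g u x +
      W u x * (g' u x - forwardOp V β γ (τ u) (g u) x) = (W' u x * g u x + W u x * g' u x) -
        (W u x * forwardOp V β γ (τ u) (g u) x - gen V β γ (τ u) (W u) x * g u x) :=
    fun x => by ring
  simp only [e]
  rw [integral_sub i3 i1, i2, sub_zero]

end Evolution

/-! ### Regularity of solutions and differentiation along moving points -/

section Regularity
variable {n : ℕ} {V β : ℝ → ℝ} {b B G C : ℝ} {γ : ℝ} {τ : ℝ → ℝ} {f : ℝ → Phase n → ℝ}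

namespace IsForwardSolution

theorem continuousOn_apply (hf : IsForwardSolution V β γ τ n f) (m : ℕ) (w : Fin m → Phase n) :
    ContinuousOn (fun z : ℝ × Phase n => iteratedFDeriv ℝ m (f z.1) z.2 w) (Ioi 0 ×ˢ univ) :=
  (ContinuousMultilinearMap.apply ℝ (fun _ : Fin m => Phase n) ℝ w).continuous.comp_continuousOn
    (hf.continuousOn_iteratedFDeriv m)

theorem continuousOn (hf : IsForwardSolution V β γ τ n f) :
    ContinuousOn (fun z : ℝ × Phase n => f z.1 z.2) (Ioi 0 ×ˢ univ) := by
  simpa using hf.continuousOn_apply 0 0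

theorem continuousOn_fderiv_apply (hf : IsForwardSolution V β γ τ n f) (w : Phase n) :
    ContinuousOn (fun z : ℝ × Phase n => fderiv ℝ (f z.1) z.2 w) (Ioi 0 ×ˢ univ) := by
  simpa using hf.continuousOn_apply 1 fun _ => w

theorem continuousOn_fderiv (hf : IsForwardSolution V β γ τ n f) :
    ContinuousOn (fun z : ℝ × Phase n => fderiv ℝ (f z.1) z.2) (Ioi 0 ×ˢ univ) :=
  continuousOn_clm_apply.2 hf.continuousOn_fderiv_apply

theorem continuousOn_dp (hf : IsForwardSolution V β γ τ n f) (k : Fin n) :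
    ContinuousOn (fun z : ℝ × Phase n => dp k (f z.1) z.2) (Ioi 0 ×ˢ univ) :=
  hf.continuousOn_fderiv_apply _

theorem continuousOn_dr (hf : IsForwardSolution V β γ τ n f) (k : Fin n) :
    ContinuousOn (fun z : ℝ × Phase n => dr k (f z.1) z.2) (Ioi 0 ×ˢ univ) :=
  hf.continuousOn_fderiv_apply _

theorem continuousOn_dp_dp (hf : IsForwardSolution V β γ τ n f) (k : Fin n) :
    ContinuousOn (fun z : ℝ × Phase n => dp k (dp k (f z.1)) z.2) (Ioi 0 ×ˢ univ) := by
  refine (hf.continuousOn_apply 2 fun _ => ep k).congr ?_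
  rintro ⟨u, x⟩ ⟨hu, -⟩
  have hd : DifferentiableAt ℝ (fderiv ℝ (f u)) x :=
    ((hf.contDiff u hu).fderiv_right (m := 1) (by norm_cast)).differentiable (by simp) x
  simp only [iteratedFDeriv_two_apply]
  have : dp k (f u) = fun y => fderiv ℝ (f u) y (ep k) := rfl
  rw [dp_eq, this, fderiv_clm_apply hd (differentiableAt_const _)]
  simp

theorem continuousOn_forwardOp (hf : IsForwardSolution V β γ τ n f) (h : ChainBounds V β b B G C)
    (hτ : ContinuousOn τ (Ioi 0)) :
    ContinuousOn (fun z : ℝ × Phase n => forwardOp V β γ (τ z.1) (f z.1) z.2) (Ioi 0 ×ˢ univ) := by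
  have hV' := h.contDiff_deriv.continuous
  have hτ' : ContinuousOn (fun z : ℝ × Phase n => τ z.1) (Ioi 0 ×ˢ univ) :=
    hτ.comp continuousOn_fst fun z hz => hz.1
  have h0 := hf.continuousOn
  have h1 := hf.continuousOn_dp
  have h2 := hf.continuousOn_dr
  have h3 := hf.continuousOn_dp_dp
  have hp : ∀ k : Fin n, Continuous fun z : ℝ × Phase n => pPrev z.2.2 k := fun k =>
    (contDiff_pPrev k).continuous.comp continuous_snd
  have hr : ∀ k : Fin n, ContinuousOn (fun z : ℝ × Phase n => forceRight V (τ z.1) z.2.1 k)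
      (Ioi 0 ×ˢ univ) := fun k => by
    unfold forceRight; split_ifs
    · fun_prop
    · exact hτ'
  have hs : ContinuousOn (fun z : ℝ × Phase n => sourceTerm V β (τ z.1) z.2)
      (Ioi 0 ×ˢ univ) := by
    unfold sourceTerm
    refine continuousOn_finsetSum _ fun k _ => ?_
    split_ifs
    · fun_prop
    · exact ContinuousOn.mul (by fun_prop) hτ'
  unfold forwardOp liouville thermostat
  refine ContinuousOn.add (ContinuousOn.add (continuousOn_const.mul (ContinuousOn.add ?_ ?_))
    (hs.mul h0)) (continuousOn_const.mul ?_)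
  · exact continuousOn_finsetSum _ fun k _ => ContinuousOn.mul
      (by have := hp k; fun_prop) (h2 k)
  · exact continuousOn_finsetSum _ fun k _ => ContinuousOn.mul
      ((hr k).sub (by fun_prop)) (h1 k)
  · exact continuousOn_finsetSum _ fun k _ => ((continuousOn_const.mul (h3 k)).sub
      (ContinuousOn.mul (by fun_prop) (h1 k)))

/-- Joint continuity of the time derivative and of the space gradient gives strict differentiability
in time and space together. The chain rule then applies to a point whose displacement itself depends
on time. -/
theorem hasDerivAt_shift (hf : IsForwardSolution V β γ τ n f) (h : ChainBounds V β b B G C)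
    (hτ : ContinuousOn τ (Ioi 0)) {t : ℝ} (ht : 0 < t) (x w : Phase n) {η : ℝ → ℝ} {η' : ℝ}
    (hη : HasDerivAt η η' t) :
    HasDerivAt (fun s => f s (x + η s • w))
      (forwardOp V β γ (τ t) (f t) (x + η t • w) + η' * fderiv ℝ (f t) (x + η t • w) w) t := by
  set y : Phase n := x + η t • w
  have hnhds : (Ioi (0 : ℝ) ×ˢ univ : Set (ℝ × Phase n)) ∈ 𝓝 (t, y) :=
    (isOpen_Ioi.prod isOpen_univ).mem_nhds ⟨ht, mem_univ _⟩
  have hstrict := hasStrictFDerivAt_uncurry_coprod (𝕜 := ℝ) (u := (t, y)) (f := f)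
    (f₁ := fun s z => ContinuousLinearMap.toSpanSingleton ℝ (forwardOp V β γ (τ s) (f s) z))
    (f₂ := fun s z => fderiv ℝ (f s) z)
    (by
      filter_upwards [hnhds] with v hv
      exact (hf.forward v.1 hv.1 v.2).hasFDerivAt)
    (by
      filter_upwards [hnhds] with v hv
      exact ((hf.contDiff v.1 hv.1).differentiable (by simp) v.2).hasFDerivAt)
    (by
      refine ContinuousAt.comp (f := fun z : ℝ × Phase n => forwardOp V β γ (τ z.1) (f z.1) z.2)
        (g := fun a : ℝ => ContinuousLinearMap.toSpanSingleton ℝ a) ?_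
        ((hf.continuousOn_forwardOp h hτ).continuousAt hnhds)
      exact (ContinuousLinearMap.toSpanSingletonCLE (𝕜 := ℝ) (E := ℝ)).continuous.continuousAt)
    (hf.continuousOn_fderiv.continuousAt hnhds)
  have hcurve : HasDerivAt (fun s => (s, x + η s • w)) ((1 : ℝ), η' • w) t :=
    (hasDerivAt_id t).prodMk ((hη.smul_const w).const_add x)
  have := hstrict.hasFDerivAt.comp_hasDerivAt t hcurve
  refine this.congr_deriv ?_
  simp [Function.HasUncurry.uncurry, y]

/-- A zero of a nonnegative function is a minimum. This makes the convention for the Fisher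
quotients on the zero set harmless. -/
theorem fderiv_eq_zero_of_eq_zero (hf : IsForwardSolution V β γ τ n f) {t : ℝ} (ht : 0 < t)
    {x : Phase n} (hx : f t x = 0) : fderiv ℝ (f t) x = 0 :=
  IsLocalMin.fderiv_eq_zero (Eventually.of_forall fun y => hx ▸ hf.nonneg t ht.le y)

end IsForwardSolution

end Regularity

/-! ### Second-order chain rules and the generator applied to the energy -/

section ChainRule
variable {n : ℕ} {V β : ℝ → ℝ} {b B G C : ℝ} {γ τ : ℝ}

theorem dp_dp_comp {u : Phase n → ℝ} (hu : ContDiff ℝ 2 u) {φ φ' : ℝ → ℝ} {φ'' : ℝ} {x : Phase n}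
    (h1 : ∀ y, HasDerivAt φ (φ' (u y)) (u y)) (h2 : HasDerivAt φ' φ'' (u x)) (k : Fin n) :
    dp k (dp k fun y => φ (u y)) x = φ' (u x) * dp k (dp k u) x + φ'' * dp k u x ^ 2 := by
  have hd : ∀ y, DifferentiableAt ℝ u y := fun y => hu.differentiable (by simp) y
  have e : (dp k fun y => φ (u y)) = fun y => φ' (u y) * dp k u y :=
    funext fun y => dp_comp k (h1 y) (hd y)
  rw [e, dp_mul (u := fun y => φ' (u y)) k (h2.differentiableAt.comp x (hd x))
    ((contDiff_dp k hu).differentiable (by simp) x), dp_comp k h2 (hd x)]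
  ring

theorem thermostat_comp {u : Phase n → ℝ} (hu : ContDiff ℝ 2 u) {φ φ' : ℝ → ℝ} {φ'' : ℝ}
    {x : Phase n} (h1 : ∀ y, HasDerivAt φ (φ' (u y)) (u y)) (h2 : HasDerivAt φ' φ'' (u x)) :
    thermostat β (fun y => φ (u y)) x = φ' (u x) * thermostat β u x +
      φ'' * ∑ k, (betaAt β n k)⁻¹ * dp k u x ^ 2 := by
  have hd : ∀ y, DifferentiableAt ℝ u y := fun y => hu.differentiable (by simp) y
  simp only [thermostat, dp_dp_comp hu h1 h2, dp_comp _ (h1 x) (hd x), Finset.mul_sum]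
  rw [← Finset.sum_add_distrib]
  exact Finset.sum_congr rfl fun k _ => by ring

/-- The transport obeys the chain rule exactly, so it drops out. The zero-order source leaves the
Legendre expression of `φ` and the noise leaves `φ''` times the squared velocity gradient. -/
theorem forwardOp_comp {u : Phase n → ℝ} (hu : ContDiff ℝ 2 u) {φ φ' : ℝ → ℝ} {φ'' : ℝ}
    {x : Phase n} (h1 : ∀ y, HasDerivAt φ (φ' (u y)) (u y)) (h2 : HasDerivAt φ' φ'' (u x)) :
    φ' (u x) * forwardOp V β γ τ u x - forwardOp V β γ τ (fun y => φ (u y)) x =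
      sourceTerm V β τ x * (φ' (u x) * u x - φ (u x)) -
        (n : ℝ) ^ 2 * γ * (φ'' * ∑ k, (betaAt β n k)⁻¹ * dp k u x ^ 2) := by
  rw [forwardOp, forwardOp, thermostat_comp hu h1 h2,
    liouville_comp τ (h1 x) (hu.differentiable (by simp) x)]
  ring

theorem gen_comp {u : Phase n → ℝ} (hu : ContDiff ℝ 2 u) {φ φ' : ℝ → ℝ} {φ'' : ℝ}
    {x : Phase n} (h1 : ∀ y, HasDerivAt φ (φ' (u y)) (u y)) (h2 : HasDerivAt φ' φ'' (u x)) :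
    gen V β γ τ (fun y => φ (u y)) x = φ' (u x) * gen V β γ τ u x +
        (n : ℝ) ^ 2 * γ * (φ'' * ∑ k, (betaAt β n k)⁻¹ * dp k u x ^ 2) := by
  rw [gen, gen, thermostat_comp hu h1 h2,
    liouville_comp τ (h1 x) (hu.differentiable (by simp) x)]
  ring

theorem dp_totalEnergy (hV : Differentiable ℝ V) (k : Fin n) (x : Phase n) :
    dp k (totalEnergy V) x = x.2 k := by
  rw [funext (totalEnergy_eq_wEnergy (V := V)), dp_wEnergy hV, one_mul]

theorem dp_coord (k : Fin n) (x : Phase n) : dp k (fun y => y.2 k) x = 1 := by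
  have : HasFDerivAt (fun y : Phase n => y.2 k)
    ((ContinuousLinearMap.proj (R := ℝ) (φ := fun _ : Fin n => ℝ) k).comp
      (ContinuousLinearMap.snd ℝ (Fin n → ℝ) (Fin n → ℝ))) x :=
    ContinuousLinearMap.hasFDerivAt (x := x)
      ((ContinuousLinearMap.proj (R := ℝ) (φ := fun _ : Fin n => ℝ) k).comp
        (ContinuousLinearMap.snd ℝ (Fin n → ℝ) (Fin n → ℝ)))
  rw [dp, this.fderiv]; simp

theorem gen_totalEnergy (hV : Differentiable ℝ V) (x : Phase n) :
    gen V β γ τ (totalEnergy V) x = (n : ℝ) ^ 2 * (τ * pLast x.2) +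
      (n : ℝ) ^ 2 * γ * ∑ k, ((betaAt β n k)⁻¹ - x.2 k ^ 2) := by
  rw [gen, liouville_totalEnergy hV, thermostat]
  congr 2
  refine Finset.sum_congr rfl fun k _ => ?_
  rw [show dp k (totalEnergy V) = fun y : Phase n => y.2 k from funext (dp_totalEnergy hV k),
    dp_coord]
  ring

theorem pLast_sq_le (p : Fin n → ℝ) : pLast p ^ 2 ≤ ∑ k, p k ^ 2 := by
  cases n with
  | zero => simp [pLast]
  | succ m =>
    rw [Fin.sum_univ_castSucc, pLast, Fin.sum_univ_castSucc]
    have : 0 ≤ ∑ i : Fin m, p i.castSucc ^ 2 := Finset.sum_nonneg fun _ _ => sq_nonneg _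
    simpa using this

namespace ChainBounds

theorem sum_sq_le (h : ChainBounds V β b B G C) (x : Phase n) :
    ∑ k, x.2 k ^ 2 ≤ 2 * totalEnergy V x := by
  rw [totalEnergy, Finset.mul_sum]
  refine Finset.sum_le_sum fun k _ => ?_
  have := h.nonneg (x.1 k)
  unfold energy; linarith

theorem sum_inv_sq_le (h : ChainBounds V β b B G C) (x : Phase n) :
    ∑ k, (betaAt β n k)⁻¹ * x.2 k ^ 2 ≤ 2 * b⁻¹ * totalEnergy V x := by
  calc _ ≤ ∑ k, b⁻¹ * x.2 k ^ 2 := by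
        exact Finset.sum_le_sum fun k _ => mul_le_mul_of_nonneg_right (h.inv_le k) (sq_nonneg _)
    _ = b⁻¹ * ∑ k, x.2 k ^ 2 := by rw [Finset.mul_sum]
    _ ≤ b⁻¹ * (2 * totalEnergy V x) := by
        have := h.b_pos
        gcongr
        exact h.sum_sq_le x
    _ = _ := by ring

theorem sum_inv_nonneg (h : ChainBounds V β b B G C) (a : Fin n → ℝ) :
    0 ≤ ∑ k, (betaAt β n k)⁻¹ * a k ^ 2 :=
  Finset.sum_nonneg fun k _ => mul_nonneg (h.beta_inv_nonneg k) (sq_nonneg _)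

theorem sum_inv_le (h : ChainBounds V β b B G C) (n : ℕ) :
    ∑ k : Fin n, (betaAt β n k)⁻¹ ≤ n * b⁻¹ := by
  refine (Finset.sum_le_sum fun k _ => h.inv_le k).trans (le_of_eq ?_)
  simp

/-- The friction `-γ Σ p_k²` absorbs the work `τ p_n` by Young's inequality. The upper bound does
not involve the energy, unlike the two-sided bound below. -/
theorem gen_totalEnergy_le (h : ChainBounds V β b B G C) (hγ : 0 < γ) {τm : ℝ} (hτ : |τ| ≤ τm)
    (x : Phase n) :
    gen V β γ τ (totalEnergy V) x ≤ (n : ℝ) ^ 2 * (τm ^ 2 / (4 * γ) + γ * (n * b⁻¹)) := by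
  rw [gen_totalEnergy h.differentiable, Finset.sum_sub_distrib]
  have h1 := pLast_sq_le x.2
  have h2 := h.sum_inv_le n
  have h3 : τ ^ 2 ≤ τm ^ 2 := sq_le_sq.2 (hτ.trans (le_abs_self _))
  have h4 : τ * pLast x.2 ≤ τm ^ 2 / (4 * γ) + γ * ∑ k, x.2 k ^ 2 := by
    have e1 : τ * pLast x.2 ≤ τ ^ 2 / (4 * γ) + γ * pLast x.2 ^ 2 := by
      have : 0 ≤ (τ - 2 * γ * pLast x.2) ^ 2 / (4 * γ) := by positivity
      have e : (τ - 2 * γ * pLast x.2) ^ 2 / (4 * γ) =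
        τ ^ 2 / (4 * γ) + γ * pLast x.2 ^ 2 - τ * pLast x.2 := by field_simp; ring
      linarith
    have e2 : τ ^ 2 / (4 * γ) ≤ τm ^ 2 / (4 * γ) := by gcongr
    have e3 : γ * pLast x.2 ^ 2 ≤ γ * ∑ k, x.2 k ^ 2 := by gcongr
    linarith
  have h5 : γ * ∑ k : Fin n, (betaAt β n k)⁻¹ ≤ γ * (n * b⁻¹) := by gcongr
  have hn : (0 : ℝ) ≤ (n : ℝ) ^ 2 := by positivity
  nlinarith

theorem abs_gen_totalEnergy_le (h : ChainBounds V β b B G C) (hγ : 0 < γ) {τm : ℝ}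
    (hτ : |τ| ≤ τm) (x : Phase n) :
    |gen V β γ τ (totalEnergy V) x| ≤
      (n : ℝ) ^ 2 * (2 * τm + 2 * γ + γ * (n * b⁻¹)) * (1 + totalEnergy V x) := by
  rw [gen_totalEnergy h.differentiable, Finset.sum_sub_distrib]
  have h1 := pLast_sq_le x.2
  have h2 := h.sum_inv_le n
  have h0 : 0 ≤ ∑ k : Fin n, (betaAt β n k)⁻¹ := Finset.sum_nonneg fun k _ => h.beta_inv_nonneg k
  have hE := h.totalEnergy_nonneg x
  have h3 := h.sum_sq_le x
  have h3' : 0 ≤ ∑ k, x.2 k ^ 2 := Finset.sum_nonneg fun _ _ => sq_nonneg _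
  have h4 : |pLast x.2| ≤ 2 * (1 + totalEnergy V x) := by
    refine abs_le_of_sq_le_sq ?_ (by positivity)
    nlinarith
  have hτm := (abs_nonneg _).trans hτ
  have h5 : |τ * pLast x.2| ≤ τm * (2 * (1 + totalEnergy V x)) := by
    rw [abs_mul]; gcongr
  have h6 : |∑ k : Fin n, (betaAt β n k)⁻¹ - ∑ k, x.2 k ^ 2| ≤
      n * b⁻¹ * (1 + totalEnergy V x) + 2 * (1 + totalEnergy V x) := by
    have hnb : 0 ≤ (n : ℝ) * b⁻¹ := h0.trans h2
    rw [abs_le]; constructor <;> nlinarith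
  calc _ ≤ |(n : ℝ) ^ 2 * (τ * pLast x.2)| + |(n : ℝ) ^ 2 * γ *
        (∑ k : Fin n, (betaAt β n k)⁻¹ - ∑ k, x.2 k ^ 2)| := abs_add_le _ _
    _ = (n : ℝ) ^ 2 * |τ * pLast x.2| + (n : ℝ) ^ 2 * γ *
        |∑ k : Fin n, (betaAt β n k)⁻¹ - ∑ k, x.2 k ^ 2| := by
      rw [abs_mul, abs_mul ((n : ℝ) ^ 2 * γ), abs_of_nonneg (by positivity : (0:ℝ) ≤ (n : ℝ) ^ 2),
        abs_of_nonneg (by positivity : (0:ℝ) ≤ (n : ℝ) ^ 2 * γ)]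
    _ ≤ (n : ℝ) ^ 2 * (τm * (2 * (1 + totalEnergy V x))) + (n : ℝ) ^ 2 * γ *
        (n * b⁻¹ * (1 + totalEnergy V x) + 2 * (1 + totalEnergy V x)) := by gcongr
    _ = _ := by ring

end ChainBounds

end ChainRule

/-! ### Energy cutoff -/

section Cutoff
variable {n : ℕ} {V β : ℝ → ℝ} {b B G C : ℝ} {γ τ : ℝ}

theorem hasDerivAt_max_pow (m : ℕ) (s : ℝ) :
    HasDerivAt (fun s : ℝ => max s 0 ^ (m + 2)) ((m + 2) * max s 0 ^ (m + 1)) s := by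
  have key : ∀ y : ℝ, y ≠ 0 →
      HasDerivAt (fun s : ℝ => max s 0 ^ (m + 2)) ((m + 2) * max y 0 ^ (m + 1)) y := by
    intro y hy
    rcases lt_or_gt_of_ne hy with h | h
    · have e : (fun s : ℝ => max s 0 ^ (m + 2)) =ᶠ[𝓝 y] fun _ => 0 := by
        filter_upwards [gt_mem_nhds h] with z hz
        rw [max_eq_right hz.le]; simp
      refine ((hasDerivAt_const y (0 : ℝ)).congr_of_eventuallyEq e).congr_deriv ?_
      rw [max_eq_right h.le]; simp
    · have e : (fun s : ℝ => max s 0 ^ (m + 2)) =ᶠ[𝓝 y] fun s => s ^ (m + 2) := by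
        filter_upwards [lt_mem_nhds h] with z hz
        rw [max_eq_left hz.le]
      refine ((hasDerivAt_pow (m + 2) y).congr_of_eventuallyEq e).congr_deriv ?_
      rw [max_eq_left h.le]; push_cast; rfl
  rcases eq_or_ne s 0 with rfl | hs
  -- At the kink the derivative is the limit of the derivatives nearby, since the function and the
  -- candidate derivative are continuous.
  · exact hasDerivAt_of_hasDerivAt_of_ne (g := fun y => (m + 2) * max y 0 ^ (m + 1))
      key (by fun_prop) (by fun_prop)
  · exact key s hs

theorem hasDerivAt_max_cube (s : ℝ) :
    HasDerivAt (fun s : ℝ => max s 0 ^ 3) (3 * max s 0 ^ 2) s :=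
  (hasDerivAt_max_pow 1 s).congr_deriv (by norm_num)

theorem hasDerivAt_max_sq (s : ℝ) :
    HasDerivAt (fun s : ℝ => 3 * max s 0 ^ 2) (6 * max s 0) s :=
  ((hasDerivAt_max_pow 0 s).const_mul 3).congr_deriv (by norm_num; ring)

theorem contDiff_max_cube : ContDiff ℝ 2 fun s : ℝ => max s 0 ^ 3 := by
  have h1 : deriv (fun s : ℝ => max s 0 ^ 3) = fun s => 3 * max s 0 ^ 2 :=
    funext fun s => (hasDerivAt_max_cube s).deriv
  have h2 : deriv (fun s : ℝ => 3 * max s 0 ^ 2) = fun s => 6 * max s 0 :=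
    funext fun s => (hasDerivAt_max_sq s).deriv
  rw [show (2 : WithTop ℕ∞) = 1 + 1 by norm_num, contDiff_succ_iff_deriv]
  refine ⟨fun s => (hasDerivAt_max_cube s).differentiableAt, by simp, ?_⟩
  rw [h1, show (1 : WithTop ℕ∞) = 0 + 1 by norm_num, contDiff_succ_iff_deriv]
  refine ⟨fun s => (hasDerivAt_max_sq s).differentiableAt, by simp, ?_⟩
  rw [h2, contDiff_zero]
  fun_prop

/-- The cutoff `(1 - a E)₊³` of the energy. -/
def cutoff (V : ℝ → ℝ) (a : ℝ) (x : Phase n) : ℝ := max (1 - a * totalEnergy V x) 0 ^ 3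

theorem cutoff_nonneg (a : ℝ) (x : Phase n) : 0 ≤ cutoff V a x := by
  unfold cutoff; positivity

namespace ChainBounds

theorem cutoff_le_one (h : ChainBounds V β b B G C) {a : ℝ} (ha : 0 ≤ a) (x : Phase n) :
    cutoff V a x ≤ 1 := by
  have := mul_nonneg ha (h.totalEnergy_nonneg x)
  exact pow_le_one₀ (le_max_right _ _) (max_le (by linarith) zero_le_one)

/-- Bernoulli's inequality. The factor `3 a` is also the exact first-order rate as `a → 0`, which
lets `(1 - cutoff) / (3 a)` recover the energy without loss. -/
theorem one_sub_cutoff_le (h : ChainBounds V β b B G C) {a : ℝ} (ha : 0 ≤ a) (x : Phase n) :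
    1 - cutoff V a x ≤ 3 * a * totalEnergy V x := by
  have := mul_nonneg ha (h.totalEnergy_nonneg x)
  unfold cutoff
  rcases le_total (1 - a * totalEnergy V x) 0 with h0 | h0
  · rw [max_eq_right h0]; linarith
  · rw [max_eq_left h0]
    set y := a * totalEnergy V x
    nlinarith [mul_nonneg this h0]

theorem contDiff_cutoff (h : ChainBounds V β b B G C) (a : ℝ) :
    ContDiff ℝ 2 (cutoff V a : Phase n → ℝ) :=
  contDiff_max_cube.comp (contDiff_const.sub (contDiff_const.mul
    (h.contDiff_totalEnergy.of_le (by norm_cast))))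

theorem cutoff_eq_zero {a : ℝ} (ha : 0 < a) {x : Phase n}
    (hx : x ∉ {x : Phase n | totalEnergy V x ≤ 1 / a}) : cutoff V a x = 0 := by
  have : 1 / a < totalEnergy V x := not_le.1 hx
  rw [div_lt_iff₀ ha] at this
  rw [cutoff, max_eq_right (by linarith)]; simp

theorem gen_cutoff (h : ChainBounds V β b B G C) (a : ℝ) (x : Phase n) :
    gen V β γ τ (cutoff V a) x =
      -(3 * a * max (1 - a * totalEnergy V x) 0 ^ 2) * gen V β γ τ (totalEnergy V) x +
      (n : ℝ) ^ 2 * γ * (6 * a ^ 2 * max (1 - a * totalEnergy V x) 0 *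
        ∑ k, (betaAt β n k)⁻¹ * x.2 k ^ 2) := by
  have d0 : ∀ s : ℝ, HasDerivAt (fun s => 1 - a * s) (-a) s := fun s =>
    (((hasDerivAt_id s).const_mul a).const_sub 1).congr_deriv (by simp)
  have d1 : ∀ s : ℝ, HasDerivAt (fun s => max (1 - a * s) 0 ^ 3)
      (3 * max (1 - a * s) 0 ^ 2 * (-a)) s := fun s =>
    (hasDerivAt_max_cube (1 - a * s)).comp (h := fun s => 1 - a * s) s (d0 s)
  have d2 : ∀ s : ℝ, HasDerivAt (fun s => 3 * max (1 - a * s) 0 ^ 2 * (-a))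
      (6 * max (1 - a * s) 0 * (-a) * (-a)) s := fun s =>
    ((hasDerivAt_max_sq (1 - a * s)).comp (h := fun s => 1 - a * s) s (d0 s)).mul_const _
  have := gen_comp (V := V) (β := β) (γ := γ) (τ := τ) (x := x)
    ((h.contDiff_totalEnergy (n := n)).of_le (by norm_cast)) (fun y => d1 (totalEnergy V y))
    (d2 (totalEnergy V x))
  simp only [dp_totalEnergy h.differentiable] at this
  unfold cutoff
  rw [this]; ring

/-- The cutoff is a convex function of the energy, so the second-order term has the favourable sign,
and the first-order term needs only the one-sided bound on the generator of the energy. Mass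
therefore leaves a sublevel at a rate at most proportional to `a`. -/
theorem neg_le_gen_cutoff (h : ChainBounds V β b B G C) (hγ : 0 < γ) {τm : ℝ} (hτ : |τ| ≤ τm)
    {a : ℝ} (ha : 0 ≤ a) (x : Phase n) :
    -(3 * a * ((n : ℝ) ^ 2 * (τm ^ 2 / (4 * γ) + γ * (n * b⁻¹)))) ≤ gen V β γ τ (cutoff V a) x := by
  rw [h.gen_cutoff]
  have h1 := h.gen_totalEnergy_le hγ hτ x
  set K := (n : ℝ) ^ 2 * (τm ^ 2 / (4 * γ) + γ * (n * b⁻¹))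
  have hb := h.b_pos
  have hK : 0 ≤ K := by positivity
  set m := max (1 - a * totalEnergy V x) 0
  have hm0 : 0 ≤ m := le_max_right _ _
  have hm1 : m ≤ 1 := max_le (by have := mul_nonneg ha (h.totalEnergy_nonneg x); linarith)
    zero_le_one
  have hm2 : m ^ 2 ≤ 1 := pow_le_one₀ hm0 hm1
  have h2 : 0 ≤ (n : ℝ) ^ 2 * γ * (6 * a ^ 2 * m * ∑ k, (betaAt β n k)⁻¹ * x.2 k ^ 2) := by
    have := h.sum_inv_nonneg x.2
    positivity
  have h3 : 3 * a * m ^ 2 * gen V β γ τ (totalEnergy V) x ≤ 3 * a * m ^ 2 * K := by gcongr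
  have h4 : 3 * a * m ^ 2 * K ≤ 3 * a * 1 * K := by gcongr
  linarith

/-- The constant in `|L W| ≤ K a (1 + E)` for the cutoff `W = (1 - a E)₊³`. -/
def cutoffConst (b γ τm : ℝ) (n : ℕ) : ℝ :=
  3 * ((n : ℝ) ^ 2 * (2 * τm + 2 * γ + γ * (n * b⁻¹))) + 12 * ((n : ℝ) ^ 2 * γ * b⁻¹)

theorem abs_gen_cutoff_le (h : ChainBounds V β b B G C) (hγ : 0 < γ) {τm : ℝ} (hτ : |τ| ≤ τm)
    {a : ℝ} (ha : 0 ≤ a) (ha1 : a ≤ 1) (x : Phase n) :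
    |gen V β γ τ (cutoff V a) x| ≤ cutoffConst b γ τm n * a * (1 + totalEnergy V x) := by
  rw [h.gen_cutoff]
  have h1 := h.abs_gen_totalEnergy_le hγ hτ x
  set K := (n : ℝ) ^ 2 * (2 * τm + 2 * γ + γ * (n * b⁻¹)) with hKdef
  have hb := h.b_pos
  have hτm := (abs_nonneg _).trans hτ
  have hK : 0 ≤ K := by positivity
  have hE := h.totalEnergy_nonneg x
  set m := max (1 - a * totalEnergy V x) 0
  have hm0 : 0 ≤ m := le_max_right _ _
  have hm1 : m ≤ 1 := max_le (by have := mul_nonneg ha hE; linarith) zero_le_one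
  have hm2 : m ^ 2 ≤ 1 := pow_le_one₀ hm0 hm1
  have hS0 := h.sum_inv_nonneg x.2
  have hS := h.sum_inv_sq_le x
  refine (abs_add_le _ _).trans ?_
  rw [abs_mul, abs_neg, abs_of_nonneg (by positivity : 0 ≤ 3 * a * m ^ 2),
    abs_of_nonneg (by positivity :
      0 ≤ (n : ℝ) ^ 2 * γ * (6 * a ^ 2 * m * ∑ k, (betaAt β n k)⁻¹ * x.2 k ^ 2))]
  calc _ ≤ 3 * a * 1 * (K * (1 + totalEnergy V x)) +
        (n : ℝ) ^ 2 * γ * (6 * (a * 1) * 1 * (2 * b⁻¹ * (1 + totalEnergy V x))) := by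
        rw [sq a]
        have : 2 * b⁻¹ * totalEnergy V x ≤ 2 * b⁻¹ * (1 + totalEnergy V x) := by
          gcongr; linarith
        have := hS.trans this
        gcongr
    _ = _ := by rw [cutoffConst, ← hKdef]; ring

end ChainBounds

end Cutoff

/-! ### Propagation of finite energy and the entropy inequality -/

section Energy
variable {n : ℕ} {V β : ℝ → ℝ} {b B G C : ℝ} {γ : ℝ} {τ : ℝ → ℝ} {f : ℝ → Phase n → ℝ}

namespace IsForwardSolution

theorem aestronglyMeasurable (hf : IsForwardSolution V β γ τ n f) {t : ℝ} (ht : 0 ≤ t)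
    (μ : Measure (Phase n)) : AEStronglyMeasurable (f t) μ := by
  rcases ht.eq_or_lt with rfl | ht
  · exact hf.measurable_zero.aestronglyMeasurable
  · exact (hf.contDiff t ht).continuous.aestronglyMeasurable

theorem integrable (hf : IsForwardSolution V β γ τ n f) {t : ℝ} (ht : 0 ≤ t) :
    Integrable (f t) (gibbs V β n) := by
  refine ⟨hf.aestronglyMeasurable ht _, ?_⟩
  rw [hasFiniteIntegral_iff_ofReal (Eventually.of_forall (hf.nonneg t ht)), hf.mass t ht]
  exact ENNReal.one_lt_top

theorem integral_eq_one (hf : IsForwardSolution V β γ τ n f) {t : ℝ} (ht : 0 ≤ t) :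
    ∫ x, f t x ∂(gibbs V β n) = 1 := by
  rw [integral_eq_lintegral_of_nonneg_ae (Eventually.of_forall (hf.nonneg t ht))
    (hf.aestronglyMeasurable ht _), hf.mass t ht, ENNReal.toReal_one]

/-- The initial value is attained only in `L¹`, which suffices for bounded weights and Lipschitz
nonlinearities. This is one reason for truncating the entropy to bounded slope. -/
theorem tendsto_integral_mul (hf : IsForwardSolution V β γ τ n f) {W : Phase n → ℝ} {M L : ℝ}
    (hW : ∀ x, |W x| ≤ M) {φ : ℝ → ℝ} (hφ : ∀ a, 0 ≤ a → ∀ c, 0 ≤ c → |φ a - φ c| ≤ L * |a - c|)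
    (hi : ∀ s, 0 ≤ s → Integrable (fun x => W x * φ (f s x)) (gibbs V β n)) :
    Tendsto (fun s => ∫ x, W x * φ (f s x) ∂(gibbs V β n)) (𝓝[>] 0)
      (𝓝 (∫ x, W x * φ (f 0 x) ∂(gibbs V β n))) := by
  have h1 : Tendsto (fun s => M * L * (∫⁻ x, ENNReal.ofReal |f s x - f 0 x| ∂(gibbs V β n)).toReal)
      (𝓝[>] 0) (𝓝 0) := by
    have := ((ENNReal.tendsto_toReal ENNReal.zero_ne_top).comp hf.initial).const_mul (M * L)
    simpa using this
  rw [tendsto_iff_norm_sub_tendsto_zero]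
  refine squeeze_zero' (Eventually.of_forall fun _ => norm_nonneg _) ?_ h1
  filter_upwards [self_mem_nhdsWithin] with s hs
  have hs0 : (0 : ℝ) ≤ s := (mem_Ioi.1 hs).le
  have hd : Integrable (fun x => |f s x - f 0 x|) (gibbs V β n) :=
    ((hf.integrable hs0).sub (hf.integrable le_rfl)).abs
  rw [← integral_sub (hi s hs0) (hi 0 le_rfl), ← integral_eq_lintegral_of_nonneg_ae
    (Eventually.of_forall fun _ => abs_nonneg _) hd.aestronglyMeasurable, ← integral_const_mul]
  refine norm_integral_le_of_norm_le (hd.const_mul _) (Eventually.of_forall fun x => ?_)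
  rw [← mul_sub, Real.norm_eq_abs, abs_mul, mul_assoc]
  have hM := (abs_nonneg _).trans (hW x)
  exact mul_le_mul (hW x) (hφ _ (hf.nonneg s hs0 x) _ (hf.nonneg 0 le_rfl x)) (abs_nonneg _) hM

end IsForwardSolution

/-- Legendre duality between `a log a - a` and the exponential. -/
theorem mul_le_mul_log_add_exp {a : ℝ} (ha : 0 ≤ a) (y : ℝ) :
    a * y ≤ a * Real.log a - a + Real.exp y := by
  rcases ha.eq_or_lt with rfl | ha
  · simpa using (Real.exp_pos y).le
  · have h1 := Real.add_one_le_exp (y - Real.log a)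
    rw [Real.exp_sub, Real.exp_log ha, le_div_iff₀ ha] at h1
    linarith

/-- The entropy inequality for the energy. -/
theorem integral_energy_le_entropy (h : ChainBounds V β b B G C) {K : ℝ}
    (hK : Integrable (fun x : Phase n => Real.exp (b / 2 * totalEnergy V x)) (gibbs V β n) ∧
      ∫ x : Phase n, Real.exp (b / 2 * totalEnergy V x) ∂(gibbs V β n) ≤ Real.exp (K * n))
    {g : Phase n → ℝ} (hg : Integrable g (gibbs V β n)) (hg0 : ∀ x, 0 ≤ g x)
    (hg1 : ∫ x, g x ∂(gibbs V β n) = 1)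
    (hlog : Integrable (fun x => g x * Real.log (g x)) (gibbs V β n)) :
    Integrable (fun x => totalEnergy V x * g x) (gibbs V β n) ∧
      b / 2 * ∫ x, totalEnergy V x * g x ∂(gibbs V β n) ≤
        ∫ x, g x * Real.log (g x) ∂(gibbs V β n) + K * n := by
  have hb := half_pos h.b_pos
  -- The duality is applied with exponent `(b/2) E - K n`, so that the exponential moment
  -- contributes at most `1`, which the mass of `g` cancels.
  have e : ∀ x : Phase n, Real.exp (b / 2 * totalEnergy V x - K * n) =
      Real.exp (-(K * n)) * Real.exp (b / 2 * totalEnergy V x) := fun x => by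
    rw [← Real.exp_add]; congr 1; ring
  have hpt : ∀ x, b / 2 * (totalEnergy V x * g x) ≤ g x * Real.log (g x) - g x +
      Real.exp (-(K * n)) * Real.exp (b / 2 * totalEnergy V x) + K * n * g x := fun x => by
    have := mul_le_mul_log_add_exp (hg0 x) (b / 2 * totalEnergy V x - K * n)
    rw [e] at this; linarith
  have hint : Integrable (fun x => g x * Real.log (g x) - g x +
      Real.exp (-(K * n)) * Real.exp (b / 2 * totalEnergy V x) + K * n * g x) (gibbs V β n) :=
    ((hlog.sub hg).add (hK.1.const_mul _)).add (hg.const_mul _)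
  have hi : Integrable (fun x => b / 2 * (totalEnergy V x * g x)) (gibbs V β n) := by
    refine hint.mono' ((h.continuous_totalEnergy.aestronglyMeasurable.mul
      hg.aestronglyMeasurable).const_mul _) (Eventually.of_forall fun x => ?_)
    rw [Real.norm_eq_abs, abs_of_nonneg (mul_nonneg hb.le
      (mul_nonneg (h.totalEnergy_nonneg x) (hg0 x)))]
    exact hpt x
  refine ⟨(integrable_const_mul_iff (IsUnit.mk0 _ hb.ne') _).1 hi, ?_⟩
  rw [← integral_const_mul]
  refine (integral_mono hi hint hpt).trans ?_
  have i1 : Integrable (fun x => g x * Real.log (g x) - g x) (gibbs V β n) := hlog.sub hg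
  have i2 : Integrable (fun x => g x * Real.log (g x) - g x +
      Real.exp (-(K * n)) * Real.exp (b / 2 * totalEnergy V x)) (gibbs V β n) :=
    i1.add (hK.1.const_mul _)
  rw [integral_add i2 (hg.const_mul _), integral_add i1 (hK.1.const_mul _), integral_sub hlog hg, integral_const_mul,
    integral_const_mul, hg1]
  have : Real.exp (-(K * n)) * ∫ x : Phase n, Real.exp (b / 2 * totalEnergy V x) ∂(gibbs V β n) ≤
      1 := by
    calc _ ≤ Real.exp (-(K * n)) * Real.exp (K * n) := by gcongr; exact hK.2
      _ = 1 := by rw [← Real.exp_add]; simp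
  linarith

theorem ChainBounds.integrable_cutoff_mul (h : ChainBounds V β b B G C) {a : ℝ} (ha : 0 ≤ a)
    {g : Phase n → ℝ} (hg : Integrable g (gibbs V β n)) :
    Integrable (fun x => cutoff V a x * g x) (gibbs V β n) := by
  refine hg.bdd_mul (c := 1) (h.contDiff_cutoff a).continuous.aestronglyMeasurable
    (Eventually.of_forall fun x => ?_)
  rw [Real.norm_eq_abs, abs_of_nonneg (cutoff_nonneg a x)]
  exact h.cutoff_le_one ha x

/-- Energy stays integrable along a solution. -/
theorem IsForwardSolution.exists_energy_bound (hf : IsForwardSolution V β γ τ n f)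
    (h : ChainBounds V β b B G C) (hγ : 0 < γ) (hτc : ContinuousOn τ (Ioi 0)) {τm T : ℝ}
    (hτ : ∀ t ∈ Icc 0 T, |τ t| ≤ τm)
    (h0 : Integrable (fun x => totalEnergy V x * f 0 x) (gibbs V β n)) :
    ∃ M, 0 ≤ M ∧ ∀ t ∈ Icc 0 T, Integrable (fun x => totalEnergy V x * f t x) (gibbs V β n) ∧
      ∫ x, totalEnergy V x * f t x ∂(gibbs V β n) ≤ M := by
  have hprob := h.isProbabilityMeasure (n := n)
  set K := (n : ℝ) ^ 2 * (τm ^ 2 / (4 * γ) + γ * (n * b⁻¹)) with hKdef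
  have hb := h.b_pos
  have hK0 : 0 ≤ K := by positivity
  set M0 := ∫ x, totalEnergy V x * f 0 x ∂(gibbs V β n)
  have hM0 : 0 ≤ M0 :=
    integral_nonneg fun x => mul_nonneg (h.totalEnergy_nonneg x) (hf.nonneg 0 le_rfl x)
  -- the mass in a sublevel set decreases slowly
  have step1 : ∀ a, 0 < a → ∀ t ∈ Icc 0 T,
      ∫ x, cutoff V a x * f 0 x ∂(gibbs V β n) - 3 * a * K * t ≤
        ∫ x, cutoff V a x * f t x ∂(gibbs V β n) := by
    intro a ha t ht
    rcases ht.1.eq_or_lt with rfl | ht0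
    · simp
    have hs : ∀ s ∈ Ioo 0 t, ∫ x, cutoff V a x * f s x ∂(gibbs V β n) - 3 * a * K * t ≤
        ∫ x, cutoff V a x * f t x ∂(gibbs V β n) := by
      intro s hs
      have hsub : Icc s t ×ˢ (univ : Set (Phase n)) ⊆ Ioi 0 ×ˢ univ :=
        prod_mono (fun u hu => hs.1.trans_le hu.1) le_rfl
      have hpos : ∀ u ∈ Icc s t, 0 < u := fun u hu => hs.1.trans_le hu.1
      have hcutc : ContinuousOn (fun z : ℝ × Phase n => cutoff V a z.2) (Icc s t ×ˢ univ) :=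
        ((h.contDiff_cutoff a).continuous.comp continuous_snd).continuousOn
      have ev := h.evolution γ τ (W := fun _ => cutoff V a) (W' := fun _ _ => 0) (g := f)
        (g' := fun u x => forwardOp V β γ (τ u) (f u) x) (h.isCompact_sublevel (1 / a)) hs.2.le
        (fun u _ => h.contDiff_cutoff a) (fun u _ x hx => ChainBounds.cutoff_eq_zero ha hx)
        (fun u _ x _ => rfl) (fun u _ x => hasDerivAt_const _ _) hcutc continuousOn_const
        (fun u hu => (hf.contDiff u (hpos u hu)).of_le (by norm_cast))
        (fun u hu x => hf.forward u (hpos u hu) x) (hf.continuousOn.mono hsub)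
        ((hf.continuousOn_forwardOp h hτc).mono hsub)
      have hlow : ∀ u ∈ Ioc s t, -(3 * a * K) ≤ ∫ x, ((0 + gen V β γ (τ u) (cutoff V a) x) * f u x +
          cutoff V a x * (forwardOp V β γ (τ u) (f u) x - forwardOp V β γ (τ u) (f u) x))
            ∂(gibbs V β n) := by
        intro u hu
        have hu0 : 0 < u := hs.1.trans hu.1
        simp only [sub_self, mul_zero, add_zero, zero_add]
        -- No integrability has to be proved here: a non-integrable integrand has integral zero by
        -- convention, which is above the negative lower bound.
        by_cases hi : Integrable (fun x => gen V β γ (τ u) (cutoff V a) x * f u x) (gibbs V β n)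
        · have : -(3 * a * K) = ∫ x, -(3 * a * K) * f u x ∂(gibbs V β n) := by
            rw [integral_const_mul, hf.integral_eq_one hu0.le, mul_one]
          rw [this]
          refine integral_mono ((hf.integrable hu0.le).const_mul _) hi fun x => ?_
          exact mul_le_mul_of_nonneg_right (h.neg_le_gen_cutoff hγ
            (hτ u ⟨hu0.le, hu.2.trans ht.2⟩) ha.le x) (hf.nonneg u hu0.le x)
        · rw [integral_undef hi]
          have : 0 ≤ 3 * a * K := by positivity
          linarith
      have hge : -(3 * a * K) * (t - s) ≤ ∫ u in s..t, ∫ x,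
          ((0 + gen V β γ (τ u) (cutoff V a) x) * f u x +
          cutoff V a x * (forwardOp V β γ (τ u) (f u) x - forwardOp V β γ (τ u) (f u) x))
            ∂(gibbs V β n) := by
        by_cases hii : IntervalIntegrable (fun u => ∫ x,
          ((0 + gen V β γ (τ u) (cutoff V a) x) * f u x +
          cutoff V a x * (forwardOp V β γ (τ u) (f u) x - forwardOp V β γ (τ u) (f u) x))
            ∂(gibbs V β n)) volume s t
        · have : -(3 * a * K) * (t - s) = ∫ u in s..t, -(3 * a * K) := by
            rw [intervalIntegral.integral_const, smul_eq_mul]; ring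
          rw [this]
          refine intervalIntegral.integral_mono_on_of_le_Ioo hs.2.le (by simp) hii fun u hu => ?_
          exact hlow u ⟨hu.1, hu.2.le⟩
        · rw [intervalIntegral.integral_undef hii]
          have : 0 ≤ 3 * a * K * (t - s) := mul_nonneg (by positivity) (sub_nonneg.2 hs.2.le)
          linarith
      have : 0 ≤ 3 * a * K * s := mul_nonneg (by positivity) hs.1.le
      linarith
    -- The balance holds between positive times; the limit `s → 0` is taken through `L¹`
    -- convergence.
    have hlim := hf.tendsto_integral_mul (W := cutoff V a) (φ := fun s => s) (M := 1) (L := 1)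
      (fun x => by
        rw [abs_of_nonneg (cutoff_nonneg a x)]; exact h.cutoff_le_one ha.le x)
      (fun _ _ _ _ => by simp) (fun s hs => h.integrable_cutoff_mul ha.le (hf.integrable hs))
    refine le_of_tendsto (hlim.sub_const _) ?_
    filter_upwards [Ioo_mem_nhdsGT ht0] with s hs' using hs s hs'
  refine ⟨M0 + K * |T|, by positivity, fun t ht => ?_⟩
  -- The lost mass divided by `3 a` is bounded uniformly in `a`, and Fatou's lemma as `a → 0` turns
  -- it into the energy.
  have step2 : ∀ a, 0 < a →
      ∫⁻ x, ENNReal.ofReal ((1 - cutoff V a x) / (3 * a) * f t x) ∂(gibbs V β n) ≤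
        ENNReal.ofReal (M0 + K * |T|) := by
    intro a ha
    have hi : ∀ s, 0 ≤ s → Integrable (fun x => (1 - cutoff V a x) * f s x) (gibbs V β n) := by
      intro s hs
      simp only [sub_mul, one_mul]
      exact (hf.integrable hs).sub (h.integrable_cutoff_mul ha.le (hf.integrable hs))
    have hv : ∀ s, 0 ≤ s → ∫ x, (1 - cutoff V a x) * f s x ∂(gibbs V β n) =
        1 - ∫ x, cutoff V a x * f s x ∂(gibbs V β n) := by
      intro s hs
      simp only [sub_mul, one_mul]
      rw [integral_sub (hf.integrable hs) (h.integrable_cutoff_mul ha.le (hf.integrable hs)),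
        hf.integral_eq_one hs]
    have hi' : Integrable (fun x => (1 - cutoff V a x) / (3 * a) * f t x) (gibbs V β n) := by
      refine ((hi t ht.1).const_mul (3 * a)⁻¹).congr (Eventually.of_forall fun x => ?_)
      simp only [div_eq_inv_mul, mul_assoc]
    rw [← ofReal_integral_eq_lintegral_ofReal hi' (Eventually.of_forall fun x => ?_)]
    · refine ENNReal.ofReal_le_ofReal ?_
      have e : ∫ x, (1 - cutoff V a x) / (3 * a) * f t x ∂(gibbs V β n) =
          (3 * a)⁻¹ * ∫ x, (1 - cutoff V a x) * f t x ∂(gibbs V β n) := by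
        rw [← integral_const_mul]
        simp only [div_eq_inv_mul, mul_assoc]
      rw [e, hv t ht.1]
      have h1 := step1 a ha t ht
      have h2 : ∫ x, (1 - cutoff V a x) * f 0 x ∂(gibbs V β n) ≤ 3 * a * M0 := by
        rw [← integral_const_mul]
        refine integral_mono (hi 0 le_rfl) (h0.const_mul _) fun x => ?_
        have := mul_le_mul_of_nonneg_right (h.one_sub_cutoff_le ha.le x) (hf.nonneg 0 le_rfl x)
        dsimp only; linarith
      rw [hv 0 le_rfl] at h2
      rw [inv_mul_le_iff₀ (by positivity)]
      have h3 : 3 * a * K * t ≤ 3 * a * K * |T| := by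
        have : t ≤ |T| := ht.2.trans (le_abs_self T)
        gcongr
      linarith
    · have := h.cutoff_le_one ha.le x
      exact mul_nonneg (div_nonneg (by linarith) (by positivity)) (hf.nonneg t ht.1 x)
  have hcont := h.continuous_totalEnergy (n := n)
  have hpt : ∀ x : Phase n, Tendsto (fun m : ℕ => (1 - cutoff V (1 / ((m : ℝ) + 1)) x) /
      (3 * (1 / ((m : ℝ) + 1)))) atTop (𝓝 (totalEnergy V x)) := by
    intro x
    have hd : HasDerivAt (fun a : ℝ => max (1 - a * totalEnergy V x) 0 ^ 3)
        (-(3 * totalEnergy V x)) 0 := by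
      have d0 : HasDerivAt (fun a : ℝ => 1 - a * totalEnergy V x) (-totalEnergy V x) 0 :=
        (((hasDerivAt_id (0 : ℝ)).mul_const (totalEnergy V x)).const_sub 1).congr_deriv (by simp)
      exact ((hasDerivAt_max_cube _).comp (h := fun a : ℝ => 1 - a * totalEnergy V x) 0
        d0).congr_deriv (by simp)
    have ht := hd.tendsto_slope_zero
    have hto : Tendsto (fun m : ℕ => (1 / ((m : ℝ) + 1))) atTop (𝓝[≠] 0) := by
      rw [tendsto_nhdsWithin_iff]
      exact ⟨tendsto_one_div_add_atTop_nhds_zero_nat,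
        Eventually.of_forall fun m => (by positivity : (0 : ℝ) < 1 / ((m : ℝ) + 1)).ne'⟩
    have := (ht.comp hto).const_mul (-(1 / 3))
    refine (this.congr fun m => ?_).trans (by rw [show -(1 / 3) * -(3 * totalEnergy V x) =
      totalEnergy V x by ring])
    simp only [Function.comp, zero_add, zero_mul, sub_zero, smul_eq_mul, cutoff]
    have : ((m : ℝ) + 1) ≠ 0 := by positivity
    simp only [max_eq_left zero_le_one, one_pow]
    field_simp
    ring
  have step3 : ∫⁻ x, ENNReal.ofReal (totalEnergy V x * f t x) ∂(gibbs V β n) ≤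
      ENNReal.ofReal (M0 + K * |T|) := by
    have hmeas : ∀ m : ℕ, AEMeasurable (fun x => ENNReal.ofReal
        ((1 - cutoff V (1 / ((m : ℝ) + 1)) x) / (3 * (1 / ((m : ℝ) + 1))) * f t x))
        (gibbs V β n) := fun m => by
      have h1 : Continuous fun x : Phase n =>
        (1 - cutoff V (1 / ((m : ℝ) + 1)) x) / (3 * (1 / ((m : ℝ) + 1))) :=
        (continuous_const.sub (h.contDiff_cutoff _).continuous).div_const _
      exact (h1.aestronglyMeasurable.mul
        (hf.aestronglyMeasurable ht.1 _)).aemeasurable.ennreal_ofReal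
    refine le_trans ?_ (liminf_le_of_le (by isBoundedDefault)
      (u := fun m : ℕ => ∫⁻ x, ENNReal.ofReal
        ((1 - cutoff V (1 / ((m : ℝ) + 1)) x) / (3 * (1 / ((m : ℝ) + 1))) * f t x) ∂(gibbs V β n))
      (f := atTop) fun c hc => ?_)
    · refine le_trans (lintegral_mono fun x => ?_) (lintegral_liminf_le' hmeas)
      refine le_of_eq (Tendsto.liminf_eq ?_).symm
      exact (ENNReal.continuous_ofReal.tendsto _).comp ((hpt x).mul_const _)
    · obtain ⟨m, hm⟩ := hc.exists
      exact hm.trans (step2 _ (by positivity))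
  have hnn : ∀ x, 0 ≤ totalEnergy V x * f t x := fun x =>
    mul_nonneg (h.totalEnergy_nonneg x) (hf.nonneg t ht.1 x)
  have hi : Integrable (fun x => totalEnergy V x * f t x) (gibbs V β n) := by
    refine ⟨hcont.aestronglyMeasurable.mul (hf.aestronglyMeasurable ht.1 _), ?_⟩
    rw [hasFiniteIntegral_iff_ofReal (Eventually.of_forall hnn)]
    exact step3.trans_lt ENNReal.ofReal_lt_top
  refine ⟨hi, ?_⟩
  rw [← ofReal_integral_eq_lintegral_ofReal hi (Eventually.of_forall hnn)] at step3
  exact (ENNReal.ofReal_le_ofReal_iff (by positivity)).1 step3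

end Energy

/-! ### The truncated entropy function -/

section Entropy

/-- A convex function with bounded slope which approximates `s log s - s` as `N → ∞`. -/
def ent (N s : ℝ) : ℝ :=
  (s + N⁻¹) * Real.log (s + N⁻¹) - N⁻¹ * Real.log N⁻¹ - (N + s) * Real.log (1 + s / N)

/-- The derivative of `ent N`. -/
def entSlope (N s : ℝ) : ℝ := Real.log (s + N⁻¹) - Real.log (1 + s / N)

/-- The second derivative of `ent N`. -/
def entCurv (N s : ℝ) : ℝ := (s + N⁻¹)⁻¹ - (s + N)⁻¹

/-- The Legendre expression `s φ'(s) - φ(s)` for `φ = ent N`. -/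
def entDual (N s : ℝ) : ℝ := N * Real.log (1 + s / N) - N⁻¹ * Real.log (1 + N * s)

variable {N s : ℝ}

theorem log_one_add_div (hN : 1 ≤ N) (hs : 0 ≤ s) : 0 < 1 + s / N := by
  have : 0 < N := by linarith
  positivity

theorem hasDerivAt_ent (hN : 1 ≤ N) (hs : 0 ≤ s) : HasDerivAt (ent N) (entSlope N s) s := by
  have hN0 : 0 < N := by linarith
  have h1 : HasDerivAt (fun s : ℝ => s + N⁻¹) 1 s := (hasDerivAt_id s).add_const _
  have h2 : HasDerivAt (fun s : ℝ => 1 + s / N) (1 / N) s :=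
    ((hasDerivAt_id s).div_const N).const_add 1
  have h3 : HasDerivAt (fun s : ℝ => N + s) 1 s := (hasDerivAt_id s).const_add N
  have p1 : s + N⁻¹ ≠ 0 := by positivity
  have p2 : 1 + s / N ≠ 0 := by positivity
  have p3 : N + s ≠ 0 := by positivity
  refine (((h1.mul (h1.log p1)).sub_const _).sub (h3.mul (h2.log p2))).congr_deriv ?_
  rw [entSlope]
  have e : (N + s) * (1 / N / (1 + s / N)) = 1 := by field_simp
  have e' : (s + N⁻¹) * (1 / (s + N⁻¹)) = 1 := by field_simp
  rw [e, e']; ring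

theorem hasDerivAt_entSlope (hN : 1 ≤ N) (hs : 0 ≤ s) :
    HasDerivAt (entSlope N) (entCurv N s) s := by
  have hN0 : 0 < N := by linarith
  have h1 : HasDerivAt (fun s : ℝ => s + N⁻¹) 1 s := (hasDerivAt_id s).add_const _
  have h2 : HasDerivAt (fun s : ℝ => 1 + s / N) (1 / N) s :=
    ((hasDerivAt_id s).div_const N).const_add 1
  have p1 : s + N⁻¹ ≠ 0 := by positivity
  have p2 : 1 + s / N ≠ 0 := by positivity
  have p3 : s + N ≠ 0 := by positivity
  refine ((h1.log p1).sub (h2.log p2)).congr_deriv ?_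
  rw [entCurv]
  field_simp
  ring

theorem entCurv_nonneg (hN : 1 ≤ N) (hs : 0 ≤ s) : 0 ≤ entCurv N s := by
  have hN0 : 0 < N := by linarith
  rw [entCurv, sub_nonneg]
  have : N⁻¹ ≤ N := (inv_le_one_of_one_le₀ hN).trans hN
  exact inv_anti₀ (by positivity) (by linarith)

/-- The curvature never exceeds `1/s`, that of `s log s`. This lets Young's inequality return a
multiple of `f` itself. -/
theorem entCurv_mul_sq_le (hN : 1 ≤ N) (hs : 0 ≤ s) : entCurv N s * s ^ 2 ≤ s := by
  have hN0 : 0 < N := by linarith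
  rcases hs.eq_or_lt with rfl | hs0
  · simp
  have h1 : entCurv N s ≤ s⁻¹ := by
    have e1 : (s + N⁻¹)⁻¹ ≤ s⁻¹ := inv_anti₀ hs0 (by have : 0 < N⁻¹ := by positivity
                                                     linarith)
    have e2 : 0 ≤ (s + N)⁻¹ := by positivity
    rw [entCurv]; linarith
  calc _ ≤ s⁻¹ * s ^ 2 := by gcongr
    _ = s := by field_simp

theorem ent_eq (hN : 1 ≤ N) (hs : 0 ≤ s) : entSlope N s * s - ent N s = entDual N s := by
  have hN0 : 0 < N := by linarith
  have e : Real.log (1 + N * s) = Real.log (s + N⁻¹) - Real.log N⁻¹ := by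
    rw [← Real.log_div (by positivity) (by positivity)]
    congr 1; field_simp; ring
  rw [entSlope, ent, entDual, e]
  ring

theorem hasDerivAt_entDual (hN : 1 ≤ N) (hs : 0 ≤ s) :
    HasDerivAt (entDual N) (entCurv N s * s) s := by
  have hN0 : 0 < N := by linarith
  have h2 : HasDerivAt (fun s : ℝ => 1 + s / N) (1 / N) s :=
    ((hasDerivAt_id s).div_const N).const_add 1
  have h3 : HasDerivAt (fun s : ℝ => 1 + N * s) N s :=
    (((hasDerivAt_id s).const_mul N).const_add 1).congr_deriv (by simp)
  have p1 : s + N⁻¹ ≠ 0 := by positivity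
  have p2 : 1 + s / N ≠ 0 := by positivity
  have p3 : 1 + N * s ≠ 0 := by positivity
  have p4 : s + N ≠ 0 := by positivity
  refine (((h2.log p2).const_mul N).sub ((h3.log p3).const_mul N⁻¹)).congr_deriv ?_
  rw [entCurv]
  field_simp
  ring

/-- For `s log s - s` the Legendre expression is exactly `s`. Truncation lowers it, and the deficit
`s - entDual N s` is the error left when the boundary source is compared with the speed of the
length. -/
theorem entDual_le (hN : 1 ≤ N) (hs : 0 ≤ s) : entDual N s ≤ s := by
  have hN0 : 0 < N := by linarith
  have h1 : N * Real.log (1 + s / N) ≤ N * (s / N) := by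
    have := Real.log_le_sub_one_of_pos (log_one_add_div hN hs)
    gcongr; linarith
  have h2 : 0 ≤ N⁻¹ * Real.log (1 + N * s) :=
    mul_nonneg (by positivity) (Real.log_nonneg (by nlinarith))
  rw [mul_div_cancel₀ _ hN0.ne'] at h1
  rw [entDual]; linarith

theorem continuousOn_ent (hN : 1 ≤ N) : ContinuousOn (ent N) (Ici 0) := fun _ hs =>
  (hasDerivAt_ent hN hs).continuousAt.continuousWithinAt

theorem continuousOn_entCurv (hN : 1 ≤ N) : ContinuousOn (entCurv N) (Ici 0) := by
  have hN0 : 0 < N := by linarith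
  unfold entCurv
  refine ContinuousOn.sub (ContinuousOn.inv₀ (by fun_prop) ?_) (ContinuousOn.inv₀ (by fun_prop) ?_)
  all_goals
    intro s hs
    have : (0 : ℝ) ≤ s := hs
    positivity

theorem continuousOn_entDual (hN : 1 ≤ N) : ContinuousOn (entDual N) (Ici 0) := fun _ hs =>
  (hasDerivAt_entDual hN hs).continuousAt.continuousWithinAt

theorem continuousOn_entSlope (hN : 1 ≤ N) : ContinuousOn (entSlope N) (Ici 0) := fun _ hs =>
  (hasDerivAt_entSlope hN hs).continuousAt.continuousWithinAt

theorem entDual_nonneg (hN : 1 ≤ N) (hs : 0 ≤ s) : 0 ≤ entDual N s := by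
  have hmono : MonotoneOn (entDual N) (Ici 0) := by
    refine monotoneOn_of_deriv_nonneg (convex_Ici 0) (continuousOn_entDual hN) ?_ ?_
    · intro s hs
      rw [interior_Ici] at hs
      exact (hasDerivAt_entDual hN (mem_Ioi.1 hs).le).differentiableAt.differentiableWithinAt
    · intro s hs
      rw [interior_Ici] at hs
      have hs0 := (mem_Ioi.1 hs).le
      rw [(hasDerivAt_entDual hN hs0).deriv]
      exact mul_nonneg (entCurv_nonneg hN hs0) hs0
  have := hmono (mem_Ici.2 le_rfl) (mem_Ici.2 hs) hs
  simpa [entDual] using this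

theorem ent_zero : ent N 0 = 0 := by simp [ent]

/-- The quotient of the two arguments of the logarithm lies between `1/N` and `N`, so the slope is
at most `log N` in absolute value. -/
theorem abs_entSlope_le (hN : 1 ≤ N) (hs : 0 ≤ s) : |entSlope N s| ≤ N := by
  have hN0 : 0 < N := by linarith
  have hNi : 0 < N⁻¹ := by positivity
  have hNi1 : N⁻¹ ≤ 1 := inv_le_one_of_one_le₀ hN
  have hlog : Real.log N ≤ N := (Real.log_le_sub_one_of_pos hN0).trans (by linarith)
  have p2 := log_one_add_div hN hs
  have p1 : 0 < s + N⁻¹ := by positivity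
  have e1 : s + N⁻¹ ≤ N * (1 + s / N) := by rw [mul_add, mul_div_cancel₀ _ hN0.ne']; linarith
  have e2 : 1 + s / N ≤ N * (s + N⁻¹) := by
    rw [mul_add, mul_inv_cancel₀ hN0.ne', div_eq_mul_inv]; nlinarith
  have h1 := Real.log_le_log p1 e1
  have h2 := Real.log_le_log p2 e2
  rw [Real.log_mul hN0.ne' p2.ne'] at h1
  rw [Real.log_mul hN0.ne' p1.ne'] at h2
  rw [entSlope, abs_le]
  constructor <;> linarith

theorem abs_ent_sub_le (hN : 1 ≤ N) {a c : ℝ} (ha : 0 ≤ a) (hc : 0 ≤ c) :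
    |ent N a - ent N c| ≤ N * |a - c| := by
  have := (convex_Ici (0 : ℝ)).norm_image_sub_le_of_norm_hasDerivWithin_le (f := ent N)
    (f' := entSlope N) (C := N) (fun x hx => (hasDerivAt_ent hN hx).hasDerivWithinAt)
    (fun x hx => abs_entSlope_le hN hx) (mem_Ici.2 hc) (mem_Ici.2 ha)
  simpa using this

theorem abs_ent_le (hN : 1 ≤ N) (hs : 0 ≤ s) : |ent N s| ≤ N * s := by
  have := abs_ent_sub_le hN hs le_rfl
  rwa [ent_zero, sub_zero, sub_zero, abs_of_nonneg hs] at this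

/-- Convexity with zero slope at `1` puts the minimum there, where the value is minus the Legendre
expression. The lower bound `-1` is that of `s log s - s`. -/
theorem neg_one_le_ent (hN : 1 ≤ N) (hs : 0 ≤ s) : -1 ≤ ent N s := by
  have hN0 : 0 < N := by linarith
  have hconv : ConvexOn ℝ (Ici 0) (ent N) := by
    refine convexOn_of_deriv2_nonneg (convex_Ici 0) (continuousOn_ent hN) ?_ ?_ ?_
    · intro s hs
      rw [interior_Ici] at hs
      exact (hasDerivAt_ent hN (mem_Ioi.1 hs).le).differentiableAt.differentiableWithinAt
    · rw [interior_Ici]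
      refine DifferentiableOn.congr (f := entSlope N) (fun s hs => ?_) fun s hs => ?_
      · exact (hasDerivAt_entSlope hN (mem_Ioi.1 hs).le).differentiableAt.differentiableWithinAt
      · exact (hasDerivAt_ent hN (mem_Ioi.1 hs).le).deriv
    · intro s hs
      rw [interior_Ici] at hs
      have e : deriv (ent N) =ᶠ[𝓝 s] entSlope N := by
        filter_upwards [Ioi_mem_nhds hs] with z hz
        exact (hasDerivAt_ent hN (mem_Ioi.1 hz).le).deriv
      simp only [Function.iterate_succ, Function.iterate_zero, Function.comp, id]
      rw [e.deriv_eq, (hasDerivAt_entSlope hN (mem_Ioi.1 hs).le).deriv]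
      exact entCurv_nonneg hN (mem_Ioi.1 hs).le
  have h1 : HasDerivAt (ent N) 0 1 := by
    have := hasDerivAt_ent hN zero_le_one
    rwa [show entSlope N 1 = 0 by simp [entSlope]] at this
  have hmin := hconv.isMinOn_of_rightDeriv_eq_zero (x := 1)
    (by rw [interior_Ici]; exact mem_Ioi.2 one_pos)
    (h1.hasDerivWithinAt.derivWithin (uniqueDiffWithinAt_Ioi 1))
  have h2 : ent N 1 ≤ ent N s := hmin (mem_Ici.2 hs)
  have h3 := ent_eq hN zero_le_one
  rw [show entSlope N 1 = 0 by simp [entSlope]] at h3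
  have h4 := entDual_le hN zero_le_one
  linarith

/-- Dropping the nonnegative Legendre expression leaves `s` times the slope, and the shift by `N⁻¹`
inside the logarithm costs at most `N⁻¹`. This compares the initial truncated entropy with the true
one. -/
theorem ent_le (hN : 1 ≤ N) (hs : 0 ≤ s) : ent N s ≤ s * Real.log s + N⁻¹ := by
  have hN0 : 0 < N := by linarith
  have h1 := ent_eq hN hs
  have h2 := entDual_nonneg hN hs
  have hNi : 0 < N⁻¹ := by positivity
  have h3 : entSlope N s * s ≤ s * Real.log s + N⁻¹ := by
    rcases hs.eq_or_lt with rfl | hs0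
    · simpa using hNi.le
    have e1 : Real.log (s + N⁻¹) ≤ Real.log s + N⁻¹ / s := by
      have := Real.log_le_sub_one_of_pos (x := (s + N⁻¹) / s) (by positivity)
      rw [Real.log_div (by positivity) hs0.ne', add_div, div_self hs0.ne'] at this
      linarith
    have e2 : 0 ≤ Real.log (1 + s / N) := Real.log_nonneg (by
      have : 0 ≤ s / N := by positivity
      linarith)
    have e3 : entSlope N s ≤ Real.log s + N⁻¹ / s := by rw [entSlope]; linarith
    calc _ ≤ (Real.log s + N⁻¹ / s) * s := by gcongr
      _ = _ := by field_simp
  linarith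

theorem tendsto_mul_log_one_add_div (s : ℝ) :
    Tendsto (fun N : ℝ => N * Real.log (1 + s / N)) atTop (𝓝 s) :=
  Real.tendsto_mul_log_one_add_div_atTop s

theorem tendsto_entDual (hs : 0 ≤ s) : Tendsto (fun N => entDual N s) atTop (𝓝 s) := by
  have h1 := tendsto_mul_log_one_add_div s
  -- The logarithm is bounded by a multiple of the square root, which is beaten by `N⁻¹`.
  have h2 : Tendsto (fun N : ℝ => N⁻¹ * Real.log (1 + N * s)) atTop (𝓝 0) := by
    have h3 : Tendsto (fun N : ℝ => (1 + N * s) ^ (1 / 2 : ℝ) * N⁻¹ * 2) atTop (𝓝 0) := by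
      have h4 : Tendsto (fun N : ℝ => (1 + s) ^ (1 / 2 : ℝ) * 2 * N ^ (-(1 / 2) : ℝ)) atTop
          (𝓝 ((1 + s) ^ (1 / 2 : ℝ) * 2 * 0)) :=
        (tendsto_rpow_neg_atTop (by norm_num)).const_mul _
      rw [mul_zero] at h4
      refine squeeze_zero' ?_ ?_ h4
      · filter_upwards [eventually_ge_atTop 1] with N hN
        positivity
      · filter_upwards [eventually_ge_atTop 1] with N hN
        have hN0 : 0 < N := by linarith
        have : (1 + N * s) ^ (1 / 2 : ℝ) ≤ (N * (1 + s)) ^ (1 / 2 : ℝ) := by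
          gcongr; nlinarith
        rw [Real.mul_rpow hN0.le (by positivity)] at this
        calc _ ≤ N ^ (1 / 2 : ℝ) * (1 + s) ^ (1 / 2 : ℝ) * N⁻¹ * 2 := by gcongr
          _ = (1 + s) ^ (1 / 2 : ℝ) * 2 * (N ^ (1 / 2 : ℝ) * N ^ (-1 : ℝ)) := by
            rw [Real.rpow_neg_one]; ring
          _ = _ := by rw [← Real.rpow_add hN0]; norm_num
    refine squeeze_zero' ?_ ?_ h3
    · filter_upwards [eventually_ge_atTop 1] with N hN
      exact mul_nonneg (by positivity) (Real.log_nonneg (by nlinarith))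
    · filter_upwards [eventually_ge_atTop 1] with N hN
      have hN0 : 0 < N := by linarith
      have := Real.log_le_rpow_div (x := 1 + N * s) (by positivity) (ε := 1 / 2) (by norm_num)
      calc N⁻¹ * Real.log (1 + N * s) ≤ N⁻¹ * ((1 + N * s) ^ (1 / 2 : ℝ) / (1 / 2)) := by gcongr
        _ = _ := by ring
  simpa [entDual] using h1.sub h2

theorem tendsto_ent (hs : 0 ≤ s) : Tendsto (fun N => ent N s) atTop (𝓝 (s * Real.log s - s)) := by
  have h1 := tendsto_entDual hs
  have h2 : Tendsto (fun N : ℝ => entSlope N s * s) atTop (𝓝 (s * Real.log s)) := by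
    rcases hs.eq_or_lt with rfl | hs0
    · simp
    have e1 : Tendsto (fun N : ℝ => Real.log (s + N⁻¹)) atTop (𝓝 (Real.log s)) := by
      have : Tendsto (fun N : ℝ => s + N⁻¹) atTop (𝓝 (s + 0)) :=
        tendsto_inv_atTop_zero.const_add s
      rw [add_zero] at this
      exact this.log hs0.ne'
    have e2 : Tendsto (fun N : ℝ => Real.log (1 + s / N)) atTop (𝓝 (Real.log 1)) := by
      have : Tendsto (fun N : ℝ => 1 + s / N) atTop (𝓝 (1 + 0)) :=
        (tendsto_const_nhds.div_atTop tendsto_id).const_add 1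
      rw [add_zero] at this
      exact this.log one_ne_zero
    have := (e1.sub e2).mul_const s
    simpa [entSlope, mul_comm] using this
  refine (h2.sub h1).congr' ?_
  filter_upwards [eventually_ge_atTop 1] with N hN
  have := ent_eq hN hs
  linarith

theorem tendsto_entCurv (hs : 0 < s) : Tendsto (fun N => entCurv N s) atTop (𝓝 s⁻¹) := by
  have e1 : Tendsto (fun N : ℝ => (s + N⁻¹)⁻¹) atTop (𝓝 (s + 0)⁻¹) :=
    (tendsto_inv_atTop_zero.const_add s).inv₀ (by simpa using hs.ne')
  have e2 : Tendsto (fun N : ℝ => (s + N)⁻¹) atTop (𝓝 0) :=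
    tendsto_inv_atTop_zero.comp (tendsto_atTop_add_const_left _ _ tendsto_id)
  simpa [entCurv] using e1.sub e2

end Entropy

/-! ### Pointwise estimates for the entropy production -/

section Production
variable {n : ℕ} {V β : ℝ → ℝ} {b B G C : ℝ} {γ : ℝ}

/-- The coefficient of `p_k` in the bulk part of the source term. -/
def bulkCoeff (V β : ℝ → ℝ) (k : Fin n) (x : Phase n) : ℝ :=
  if h : (k : ℕ) + 1 < n then -(n : ℝ) * gradBeta β n k * deriv V (x.1 ⟨k + 1, h⟩) else 0

/-- The two pieces are treated differently: the sum has coefficients of order `n` and is integrated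
by parts, while the boundary term of order `n²` is compensated by the motion of the length. -/
theorem sourceTerm_split (τ : ℝ) (x : Phase n) : sourceTerm V β τ x =
    ∑ k, bulkCoeff V β k x * x.2 k + (n : ℝ) ^ 2 * β 1 * τ * pLast x.2 := by
  rw [sourceTerm, pLast, Finset.mul_sum, ← Finset.sum_add_distrib]
  refine Finset.sum_congr rfl fun k _ => ?_
  unfold bulkCoeff
  split_ifs <;> ring

/-- The square of the force between particle `k` and its right neighbour. -/
def nextForceSq (V : ℝ → ℝ) (k : Fin n) (x : Phase n) : ℝ :=
  if h : (k : ℕ) + 1 < n then deriv V (x.1 ⟨k + 1, h⟩) ^ 2 else 0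

theorem nextForceSq_nonneg (k : Fin n) (x : Phase n) : 0 ≤ nextForceSq V k x := by
  unfold nextForceSq; split_ifs <;> positivity

theorem sum_next_le {a : Fin n → ℝ} (ha : ∀ k, 0 ≤ a k) :
    ∑ k : Fin n, (if h : (k : ℕ) + 1 < n then a ⟨k + 1, h⟩ else 0) ≤ ∑ k, a k := by
  have := sum_pPrev_mul (fun _ : Fin n => (1 : ℝ)) a
  simp only [one_mul] at this
  rw [← this]
  refine Finset.sum_le_sum fun k _ => ?_
  unfold pPrev
  split_ifs <;> simp [ha k]

namespace ChainBounds

theorem sum_deriv_sq_le (h : ChainBounds V β b B G C) (x : Phase n) :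
    ∑ k, deriv V (x.1 k) ^ 2 ≤ C * (n + totalEnergy V x) := by
  calc _ ≤ ∑ k, C * (1 + energy V (x.1 k) (x.2 k)) := by
        refine Finset.sum_le_sum fun k _ => (h.deriv_sq_le _).trans ?_
        have := h.C_pos
        have h2 : V (x.1 k) ≤ energy V (x.1 k) (x.2 k) := by
          unfold energy; have := sq_nonneg (x.2 k); linarith
        gcongr
    _ = _ := by rw [← Finset.mul_sum, Finset.sum_add_distrib, totalEnergy]; simp

theorem sum_nextForceSq_le (h : ChainBounds V β b B G C) (x : Phase n) :
    ∑ k, nextForceSq V k x ≤ C * (n + totalEnergy V x) :=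
  (sum_next_le (a := fun k => deriv V (x.1 k) ^ 2) fun _ => sq_nonneg _).trans
    (h.sum_deriv_sq_le x)

theorem bulkCoeff_sq_le (h : ChainBounds V β b B G C) (k : Fin n) (x : Phase n) :
    bulkCoeff V β k x ^ 2 ≤ (n : ℝ) ^ 2 * G ^ 2 * nextForceSq V k x := by
  unfold bulkCoeff nextForceSq
  split_ifs with hk
  · have h1 : gradBeta β n k ^ 2 ≤ G ^ 2 := by
      rw [← sq_abs]; exact pow_le_pow_left₀ (abs_nonneg _) (h.grad_le n k hk) 2
    calc _ = (n : ℝ) ^ 2 * gradBeta β n k ^ 2 * deriv V (x.1 ⟨k + 1, hk⟩) ^ 2 := by ring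
      _ ≤ _ := by gcongr
  · simp

theorem contDiff_bulkCoeff (h : ChainBounds V β b B G C) (k : Fin n) :
    ContDiff ℝ 1 (bulkCoeff V β k) := by
  have : ContDiff ℝ 1 (deriv V) := h.contDiff_deriv.of_le (by norm_cast)
  unfold bulkCoeff
  split_ifs with hk
  · exact contDiff_const.mul (this.comp (by fun_prop : ContDiff ℝ 1 fun x : Phase n =>
      x.1 ⟨k + 1, hk⟩))
  · exact contDiff_const

theorem beta_one_pos (h : ChainBounds V β b B G C) : 0 < β 1 := by
  have := h.betaAt_pos (0 : Fin 1)
  rwa [betaAt_last (0 : Fin 1) (by simp)] at this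

theorem beta_one_le (h : ChainBounds V β b B G C) : β 1 ≤ B := by
  have := h.le_B 1 0
  rwa [betaAt_last (0 : Fin 1) (by simp)] at this

theorem dp_cutoff (h : ChainBounds V β b B G C) (a : ℝ) (k : Fin n) (x : Phase n) :
    dp k (cutoff V a) x = -(3 * a * max (1 - a * totalEnergy V x) 0 ^ 2) * x.2 k := by
  have d1 : HasDerivAt (fun s => max (1 - a * s) 0 ^ 3)
      (3 * max (1 - a * totalEnergy V x) 0 ^ 2 * (-a)) (totalEnergy V x) :=
    (hasDerivAt_max_cube (1 - a * totalEnergy V x)).comp (h := fun s => 1 - a * s) _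
      ((((hasDerivAt_id _).const_mul a).const_sub 1).congr_deriv (by simp))
  have := dp_comp k d1 (h.contDiff_totalEnergy.differentiable (by simp) x)
  rw [show cutoff V a = fun y : Phase n => max (1 - a * totalEnergy V y) 0 ^ 3 from rfl, this,
    dp_totalEnergy h.differentiable]
  ring

theorem gen_cutoff_eq_zero (h : ChainBounds V β b B G C) {τ a : ℝ} (ha : 0 < a) {x : Phase n}
    (hx : x ∉ {x : Phase n | totalEnergy V x ≤ 1 / a}) : gen V β γ τ (cutoff V a) x = 0 := by
  have : 1 / a < totalEnergy V x := not_le.1 hx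
  rw [div_lt_iff₀ ha] at this
  rw [h.gen_cutoff, max_eq_right (by linarith)]; simp

theorem continuous_gen_cutoff (h : ChainBounds V β b B G C) (a : ℝ) :
    Continuous fun z : ℝ × Phase n => gen V β γ z.1 (cutoff V a) z.2 := by
  have hE : Continuous fun z : ℝ × Phase n => totalEnergy V z.2 :=
    h.continuous_totalEnergy.comp continuous_snd
  have hp : Continuous fun z : ℝ × Phase n => pLast z.2.2 := by
    unfold pLast
    refine continuous_finsetSum _ fun k _ => ?_
    split_ifs <;> fun_prop
  simp only [h.gen_cutoff, gen_totalEnergy h.differentiable]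
  fun_prop

/-- On the support `a E ≤ 1`, which makes the bound uniform in the state and in `a`; the other entry
of the minimum tends to zero with `a`. Together they allow dominated convergence. -/
theorem abs_gen_cutoff_le_const (h : ChainBounds V β b B G C) (hγ : 0 < γ) {τ τm : ℝ}
    (hτ : |τ| ≤ τm) {a : ℝ} (ha : 0 < a) (ha1 : a ≤ 1) (x : Phase n) :
    |gen V β γ τ (cutoff V a) x| ≤
      min (2 * cutoffConst b γ τm n) (cutoffConst b γ τm n * a * (1 + totalEnergy V x)) := by
  have hτm := (abs_nonneg _).trans hτ
  have hb := h.b_pos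
  have hK : 0 ≤ cutoffConst b γ τm n := by unfold cutoffConst; positivity
  have h1 := h.abs_gen_cutoff_le hγ hτ ha.le ha1 x
  refine le_min ?_ h1
  by_cases hx : x ∈ {x : Phase n | totalEnergy V x ≤ 1 / a}
  · have hx' : totalEnergy V x ≤ 1 / a := hx
    rw [le_div_iff₀ ha] at hx'
    calc _ ≤ _ := h1
      _ = cutoffConst b γ τm n * (a + totalEnergy V x * a) := by ring
      _ ≤ cutoffConst b γ τm n * 2 := by gcongr; linarith
      _ = _ := by ring
  · rw [h.gen_cutoff_eq_zero ha hx]; simpa using hK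

end ChainBounds

/-- The total length of the chain. -/
def len (x : Phase n) : ℝ := ∑ k, x.1 k

theorem dp_len (k : Fin n) (x : Phase n) : dp k len x = 0 := by
  refine fderiv_eq_zero_of_invariant (fun x s => ?_) (by unfold len; fun_prop) x
  simp [len]

theorem dr_len (k : Fin n) (x : Phase n) : dr k len x = 1 := by
  have : HasFDerivAt (len : Phase n → ℝ) (∑ k,
    (ContinuousLinearMap.proj (R := ℝ) (φ := fun _ : Fin n => ℝ) k).comp
      (ContinuousLinearMap.fst ℝ (Fin n → ℝ) (Fin n → ℝ))) x := by
    unfold len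
    exact HasFDerivAt.fun_sum fun k _ => ContinuousLinearMap.hasFDerivAt (x := x)
      ((ContinuousLinearMap.proj (R := ℝ) (φ := fun _ : Fin n => ℝ) k).comp
        (ContinuousLinearMap.fst ℝ (Fin n → ℝ) (Fin n → ℝ)))
  rw [dr, this.fderiv]; simp [Pi.single_apply]

theorem pLast_eq (p : Fin n → ℝ) : pLast p = ∑ k, (p k - pPrev p k) := by
  have := sum_pPrev_mul p fun _ => 1
  simp only [mul_one, dite_eq_ite] at this
  rw [Finset.sum_sub_distrib, this, ← Finset.sum_sub_distrib, pLast]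
  refine Finset.sum_congr rfl fun k _ => ?_
  split_ifs <;> simp

/-- The length telescopes to the speed `n² p_n` and carries no noise, so no cross term with `W`
appears. This is the function whose motion produces the boundary source. -/
theorem gen_len_mul (τ : ℝ) {W : Phase n → ℝ} (hW : ContDiff ℝ 2 W) (x : Phase n) :
    gen V β γ τ (fun y => len y * W y) x =
      len x * gen V β γ τ W x + (n : ℝ) ^ 2 * pLast x.2 * W x := by
  have hl : ∀ y, DifferentiableAt ℝ (len : Phase n → ℝ) y := by unfold len; fun_prop
  have hd : ∀ y, DifferentiableAt ℝ W y := fun y => hW.differentiable (by simp) y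
  have e1 : ∀ k, (dp k fun y => len y * W y) = fun y => len y * dp k W y := fun k =>
    funext fun y => by rw [dp_mul k (hl y) (hd y), dp_len]; ring
  have e2 : ∀ k, dp k (dp k fun y => len y * W y) x = len x * dp k (dp k W) x := fun k => by
    rw [e1, dp_mul k (hl x) ((contDiff_dp k hW).differentiable (by simp) x), dp_len]; ring
  rw [gen, gen, liouville_mul τ (hl x) (hd x)]
  have e3 : thermostat β (fun y => len y * W y) x = len x * thermostat β W x := by
    have : ∀ k, dp k (fun y => len y * W y) x = len x * dp k W x := fun k => by rw [e1]
    simp only [thermostat, e2, this, Finset.mul_sum]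
    exact Finset.sum_congr rfl fun k _ => by ring
  have e4 : liouville V τ (len : Phase n → ℝ) x = pLast x.2 := by
    simp [liouville, dp_len, dr_len, pLast_eq]
  rw [e3, e4]; ring

theorem gen_const_mul (τ c : ℝ) {W : Phase n → ℝ} (hW : ContDiff ℝ 2 W) (x : Phase n) :
    gen V β γ τ (fun y => c * W y) x = c * gen V β γ τ W x := by
  have := gen_comp (V := V) (β := β) (γ := γ) (τ := τ) (x := x) hW (φ := fun s => c * s)
    (φ' := fun _ => c) (φ'' := 0)
    (fun y => ((hasDerivAt_id _).const_mul c).congr_deriv (by simp)) (hasDerivAt_const _ _)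
  rw [this]; simp

theorem abs_len_le {κ K : ℝ} (hκ : 0 ≤ κ)
    (hK : ∀ r, |r| ≤ κ * V r + K) (x : Phase n) : |len x| ≤ κ * totalEnergy V x + n * K := by
  calc |len x| ≤ ∑ k, |x.1 k| := Finset.abs_sum_le_sum_abs _ _
    _ ≤ ∑ k, (κ * energy V (x.1 k) (x.2 k) + K) := by
      refine Finset.sum_le_sum fun k _ => (hK _).trans ?_
      have h2 : V (x.1 k) ≤ energy V (x.1 k) (x.2 k) := by
        unfold energy; have := sq_nonneg (x.2 k); linarith
      gcongr
    _ = _ := by rw [Finset.sum_add_distrib, ← Finset.mul_sum, totalEnergy]; simp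

/-- The error made by the truncations in the entropy balance. -/
def truncErr (V : ℝ → ℝ) (B b γ τm N a : ℝ) (F : Phase n → ℝ) (x : Phase n) : ℝ :=
  (n : ℝ) ^ 2 * B * τm * |pLast x.2| * (F x - entDual N (F x)) +
    B * τm * |len x| * min (2 * ChainBounds.cutoffConst b γ τm n)
      (ChainBounds.cutoffConst b γ τm n * a * (1 + totalEnergy V x)) * F x

/-- The constant in front of the truncation error of the cutoff. -/
def cutoffErrConst (b G C γ τm : ℝ) (n : ℕ) : ℝ :=
  ChainBounds.cutoffConst b γ τm n + b⁻¹ * n * G * 3 * (C * (n + 1) + 2)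

/-- The coefficient of the energy in the entropy balance. -/
def growthConst (b B G C γ τ₁ K₁ : ℝ) : ℝ := b⁻¹ * (G ^ 2 * C) / (2 * γ) + B * τ₁ * (1 + K₁)

/-- The integrand of the entropy balance. -/
def entRate (V β : ℝ → ℝ) (γ τ N a : ℝ) (F : Phase n → ℝ) (x : Phase n) : ℝ :=
  gen V β γ τ (cutoff V a) x * ent N (F x) + cutoff V a x *
    (sourceTerm V β τ x * entDual N (F x) -
      (n : ℝ) ^ 2 * γ * (entCurv N (F x) * ∑ k, (betaAt β n k)⁻¹ * dp k F x ^ 2))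

/-- The integrand of the balance of the length. -/
def lenRate (V β : ℝ → ℝ) (γ τ τ' a : ℝ) (F : Phase n → ℝ) (x : Phase n) : ℝ :=
  (τ' * (len x * cutoff V a x) + τ * (len x * gen V β γ τ (cutoff V a) x +
    (n : ℝ) ^ 2 * pLast x.2 * cutoff V a x)) * F x

/-- The truncated velocity Fisher information. -/
def fisherCut (V β : ℝ → ℝ) (N a : ℝ) (F : Phase n → ℝ) (x : Phase n) : ℝ :=
  cutoff V a x * (entCurv N (F x) * ∑ k, (betaAt β n k)⁻¹ * dp k F x ^ 2)

/-- The upper bound for the entropy balance. -/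
def rateBound (V : ℝ → ℝ) (b B G C γ τm τ₁ K₁ N a : ℝ) (F : Phase n → ℝ) (x : Phase n) : ℝ :=
  (cutoffErrConst b G C γ τm n * a * N * (1 + totalEnergy V x) +
    growthConst b B G C γ τ₁ K₁ * (n + totalEnergy V x)) * F x + truncErr V B b γ τm N a F x

end Production

section Production
variable {n : ℕ} {V β : ℝ → ℝ} {b B G C : ℝ} {γ : ℝ}

theorem continuous_pLast : Continuous fun x : Phase n => pLast x.2 := by
  unfold pLast
  refine continuous_finsetSum _ fun k _ => ?_
  split_ifs <;> fun_prop

theorem continuous_len : Continuous (len : Phase n → ℝ) := by unfold len; fun_prop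

/-- Young's inequality against half of the dissipation. The squared coefficient has size `n² G²`
times a squared force and the dissipation carries `n² γ`, so `n` cancels; then `f² φ'' ≤ f` and the
squared forces sum to at most `C (n + E)`. -/
theorem ChainBounds.sum_bulkCoeff_curv_le (h : ChainBounds V β b B G C) (hn : 1 ≤ n) (hγ : 0 < γ)
    {N a : ℝ} (hN : 1 ≤ N) (ha : 0 < a) {F : Phase n → ℝ} (x : Phase n)
    (hF0 : 0 ≤ F x) :
    ∑ k, (betaAt β n k)⁻¹ * bulkCoeff V β k x * (cutoff V a x * (entCurv N (F x) * F x * dp k F x)) -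
      (n : ℝ) ^ 2 * γ / 2 * (cutoff V a x * (entCurv N (F x) * ∑ k, (betaAt β n k)⁻¹ * dp k F x ^ 2)) ≤
      b⁻¹ * (G ^ 2 * C) / (2 * γ) * (n + totalEnergy V x) * F x := by
  have hW0 := cutoff_nonneg (V := V) a x
  have hW1 := h.cutoff_le_one ha.le x
  have hcurv := entCurv_nonneg hN hF0
  have hcurv2 := entCurv_mul_sq_le hN hF0
  have hb := h.b_pos
  have hn0 : (1 : ℝ) ≤ n := by exact_mod_cast hn
  set E := totalEnergy V x
  set W := cutoff V a x
  set κ := entCurv N (F x)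
  rw [Finset.mul_sum, Finset.mul_sum, Finset.mul_sum, ← Finset.sum_sub_distrib]
  calc _ ≤ ∑ k, b⁻¹ * G ^ 2 / (2 * γ) * F x * nextForceSq V k x := by
        refine Finset.sum_le_sum fun k _ => ?_
        have hc := h.bulkCoeff_sq_le k x
        have hv := nextForceSq_nonneg (V := V) k x
        set c := bulkCoeff V β k x
        set d := dp k F x
        have hβk := h.beta_inv_nonneg k
        -- Completion of the square in `d`; the remainder no longer contains `n`.
        have y1 : c * (F x * d) - (n : ℝ) ^ 2 * γ / 2 * d ^ 2 ≤
            F x ^ 2 * (G ^ 2 * nextForceSq V k x) / (2 * γ) := by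
          have e : F x ^ 2 * c ^ 2 / (2 * ((n : ℝ) ^ 2 * γ)) - (c * (F x * d) -
              (n : ℝ) ^ 2 * γ / 2 * d ^ 2) =
              (F x * c - (n : ℝ) ^ 2 * γ * d) ^ 2 / (2 * ((n : ℝ) ^ 2 * γ)) := by
            field_simp; ring
          have e2 : 0 ≤ (F x * c - (n : ℝ) ^ 2 * γ * d) ^ 2 / (2 * ((n : ℝ) ^ 2 * γ)) := by
            positivity
          have e3 : F x ^ 2 * c ^ 2 / (2 * ((n : ℝ) ^ 2 * γ)) ≤
              F x ^ 2 * ((n : ℝ) ^ 2 * G ^ 2 * nextForceSq V k x) / (2 * ((n : ℝ) ^ 2 * γ)) := by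
            gcongr
          have e4 : F x ^ 2 * ((n : ℝ) ^ 2 * G ^ 2 * nextForceSq V k x) /
              (2 * ((n : ℝ) ^ 2 * γ)) = F x ^ 2 * (G ^ 2 * nextForceSq V k x) / (2 * γ) := by
            field_simp
          linarith
        calc _ = (betaAt β n k)⁻¹ * (W * κ * (c * (F x * d) - (n : ℝ) ^ 2 * γ / 2 * d ^ 2)) := by
              ring
          _ ≤ (betaAt β n k)⁻¹ * (W * κ * (F x ^ 2 * (G ^ 2 * nextForceSq V k x) / (2 * γ))) := by
              gcongr
          _ = (betaAt β n k)⁻¹ * (W * (κ * F x ^ 2) * (G ^ 2 * nextForceSq V k x / (2 * γ))) := by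
              ring
          _ ≤ b⁻¹ * (1 * F x * (G ^ 2 * nextForceSq V k x / (2 * γ))) := by
              gcongr
              exact h.b_le n k
          _ = _ := by ring
    _ = b⁻¹ * G ^ 2 / (2 * γ) * F x * ∑ k, nextForceSq V k x := by rw [Finset.mul_sum]
    _ ≤ b⁻¹ * G ^ 2 / (2 * γ) * F x * (C * (n + E)) := by
        gcongr
        exact h.sum_nextForceSq_le x
    _ = _ := by ring

/-- When the integrated derivative falls on the cutoff it brings a factor `a`. The constant may
depend badly on `n`, because `a` tends to zero at fixed `n`. -/
theorem ChainBounds.sum_bulkCoeff_cutoff_le (h : ChainBounds V β b B G C) (hn : 1 ≤ n)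
    {N a : ℝ} (hN : 1 ≤ N) (ha : 0 < a) {F : Phase n → ℝ} (x : Phase n)
    (hF0 : 0 ≤ F x) :
    ∑ k, (betaAt β n k)⁻¹ * bulkCoeff V β k x * (entDual N (F x) * dp k (cutoff V a) x) ≤
      b⁻¹ * n * G * 3 * (C * (n + 1) + 2) * a * (1 + totalEnergy V x) * F x := by
  have hE := h.totalEnergy_nonneg x
  have hq0 := entDual_nonneg hN hF0
  have hq1 := entDual_le hN hF0
  have hb := h.b_pos
  have hG := h.G_nonneg
  have hC := h.C_pos
  have hn0 : (1 : ℝ) ≤ n := by exact_mod_cast hn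
  set E := totalEnergy V x
  set q := entDual N (F x)
  have hm0 : 0 ≤ max (1 - a * E) 0 := le_max_right _ _
  have hm1 : max (1 - a * E) 0 ^ 2 ≤ 1 := pow_le_one₀ hm0
    (max_le (by have := mul_nonneg ha.le hE; linarith) zero_le_one)
  calc _ ≤ ∑ k, b⁻¹ * (3 * a) * F x * (n * G * (nextForceSq V k x + x.2 k ^ 2)) := by
        refine Finset.sum_le_sum fun k _ => ?_
        rw [h.dp_cutoff]
        have hc := h.bulkCoeff_sq_le k x
        have hv := nextForceSq_nonneg (V := V) k x
        set c := bulkCoeff V β k x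
        set v := nextForceSq V k x
        have hβk := h.beta_inv_nonneg k
        have y1 : |c * x.2 k| ≤ n * G * (v + x.2 k ^ 2) := by
          refine abs_le_of_sq_le_sq ?_ (by positivity)
          calc (c * x.2 k) ^ 2 = c ^ 2 * x.2 k ^ 2 := by ring
            _ ≤ ((n : ℝ) ^ 2 * G ^ 2 * v) * x.2 k ^ 2 := by gcongr
            _ = (n * G) ^ 2 * (v * x.2 k ^ 2) := by ring
            _ ≤ (n * G) ^ 2 * (v + x.2 k ^ 2) ^ 2 := by
                gcongr
                nlinarith [sq_nonneg (x.2 k), sq_nonneg (v), sq_nonneg (x.2 k ^ 2)]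
            _ = _ := by ring
        calc _ = (betaAt β n k)⁻¹ * (3 * a * max (1 - a * E) 0 ^ 2) * q * (-(c * x.2 k)) := by
              ring
          _ ≤ (betaAt β n k)⁻¹ * (3 * a * max (1 - a * E) 0 ^ 2) * q *
              (n * G * (v + x.2 k ^ 2)) := by
              have := (neg_le_abs _).trans y1
              gcongr
          _ ≤ b⁻¹ * (3 * a * 1) * F x * (n * G * (v + x.2 k ^ 2)) := by
              gcongr
              exact h.b_le n k
          _ = _ := by ring
    _ = b⁻¹ * (3 * a) * F x * (n * G * (∑ k, nextForceSq V k x + ∑ k, x.2 k ^ 2)) := by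
        rw [← Finset.mul_sum, ← Finset.mul_sum, Finset.sum_add_distrib]
    _ ≤ b⁻¹ * (3 * a) * F x * (n * G * ((C * (n + 1) + 2) * (1 + E))) := by
        gcongr
        have e1 := h.sum_nextForceSq_le x
        have e2 := h.sum_sq_le x
        have e3 : C * (n + E) ≤ C * (n + 1) * (1 + E) := by
          rw [mul_assoc]; gcongr; nlinarith
        calc _ ≤ C * (n + 1) * (1 + E) + 2 * E := by linarith
          _ ≤ _ := by nlinarith
    _ = _ := by ring

/-- The pointwise estimate behind the entropy balance. -/
theorem ChainBounds.entropy_pointwise (h : ChainBounds V β b B G C) (hn : 1 ≤ n) (hγ : 0 < γ)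
    {τ τ' τm τ₁ K₁ N a : ℝ} (hτ : |τ| ≤ τm) (hτ' : |τ'| ≤ τ₁) (hK0 : 0 ≤ K₁)
    (hK : ∀ r, |r| ≤ V r + K₁) (hN : 1 ≤ N) (ha : 0 < a) (ha1 : a ≤ 1) {F : Phase n → ℝ}
    (x : Phase n) (hF0 : 0 ≤ F x) :
    gen V β γ τ (cutoff V a) x * ent N (F x) +
      (n : ℝ) ^ 2 * β 1 * τ * pLast x.2 * cutoff V a x * (entDual N (F x) - F x) -
      β 1 * ((τ' * (len x * cutoff V a x) + τ * (len x * gen V β γ τ (cutoff V a) x)) * F x) -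
      (n : ℝ) ^ 2 * γ / 2 * fisherCut V β N a F x +
      ∑ k, (betaAt β n k)⁻¹ * bulkCoeff V β k x *
        (cutoff V a x * (entCurv N (F x) * F x * dp k F x) +
          entDual N (F x) * dp k (cutoff V a) x) ≤
    rateBound V b B G C γ τm τ₁ K₁ N a F x := by
  have hE := h.totalEnergy_nonneg x
  have hW0 := cutoff_nonneg (V := V) a x
  have hW1 := h.cutoff_le_one ha.le x
  have hgen := h.abs_gen_cutoff_le hγ hτ ha.le ha1 x
  have hgen2 := h.abs_gen_cutoff_le_const hγ hτ ha ha1 x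
  have hq0 := entDual_nonneg hN hF0
  have hq1 := entDual_le hN hF0
  have hent := abs_ent_le hN hF0
  have hcurv := entCurv_nonneg hN hF0
  have hcurv2 := entCurv_mul_sq_le hN hF0
  have hβ0 := h.beta_one_pos
  have hβ1 := h.beta_one_le
  have hB := h.B_pos
  have hb := h.b_pos
  have hG := h.G_nonneg
  have hC := h.C_pos
  have hτm := (abs_nonneg _).trans hτ
  have hτ₁ := (abs_nonneg _).trans hτ'
  have hn0 : (1 : ℝ) ≤ n := by exact_mod_cast hn
  set E := totalEnergy V x
  set W := cutoff V a x
  set q := entDual N (F x)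
  set κ := entCurv N (F x)
  have hlen := abs_len_le (κ := 1) (K := K₁) zero_le_one (by simpa using hK) x
  rw [one_mul] at hlen
  have T1 : gen V β γ τ (cutoff V a) x * ent N (F x) ≤
      cutoffConst b γ τm n * a * (1 + E) * (N * F x) := by
    refine (le_abs_self _).trans ?_
    rw [abs_mul]
    exact mul_le_mul hgen hent (abs_nonneg _) ((abs_nonneg _).trans hgen)
  -- What remains of the boundary source after the length correction: the source multiplies `entDual
  -- N (F x)`, the length multiplies `F x`.
  have T2 : (n : ℝ) ^ 2 * β 1 * τ * pLast x.2 * W * (q - F x) ≤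
      (n : ℝ) ^ 2 * B * τm * |pLast x.2| * (F x - q) := by
    refine (le_abs_self _).trans ?_
    rw [abs_mul, abs_mul, abs_mul, abs_mul, abs_mul, abs_of_nonneg (by positivity : (0:ℝ) ≤ (n:ℝ)^2),
      abs_of_pos hβ0, abs_of_nonneg hW0, abs_sub_comm, abs_of_nonneg (sub_nonneg.2 hq1)]
    have : 0 ≤ F x - q := sub_nonneg.2 hq1
    calc _ ≤ (n : ℝ) ^ 2 * B * τm * |pLast x.2| * 1 * (F x - q) := by gcongr
      _ = _ := by ring
  have T3 : -(β 1 * (τ' * (len x * W) * F x)) ≤ B * τ₁ * (1 + K₁) * (n + E) * F x := by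
    refine (le_abs_self _).trans ?_
    rw [abs_neg, abs_mul, abs_mul, abs_mul, abs_mul, abs_of_pos hβ0, abs_of_nonneg hW0,
      abs_of_nonneg hF0]
    calc _ ≤ B * (τ₁ * ((E + n * K₁) * 1) * F x) := by gcongr
      _ ≤ B * (τ₁ * (((1 + K₁) * (n + E)) * 1) * F x) := by
        gcongr
        nlinarith
      _ = _ := by ring
  have T4 : -(β 1 * (τ * (len x * gen V β γ τ (cutoff V a) x) * F x)) ≤
      B * τm * |len x| * min (2 * cutoffConst b γ τm n) (cutoffConst b γ τm n * a * (1 + E)) *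
        F x := by
    refine (le_abs_self _).trans ?_
    rw [abs_neg, abs_mul, abs_mul, abs_mul, abs_mul, abs_of_pos hβ0, abs_of_nonneg hF0]
    calc _ ≤ B * (τm * (|len x| * min (2 * cutoffConst b γ τm n)
          (cutoffConst b γ τm n * a * (1 + E))) * F x) := by gcongr
      _ = _ := by ring
  have T5 := h.sum_bulkCoeff_curv_le hn hγ hN ha x hF0
  have T6 := h.sum_bulkCoeff_cutoff_le hn hN ha x hF0
  -- The factor `N ≥ 1` is inserted only to give this error the same form as the one from the
  -- generator of the cutoff.
  have T6' : b⁻¹ * n * G * 3 * (C * (n + 1) + 2) * a * (1 + E) * F x ≤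
      b⁻¹ * n * G * 3 * (C * (n + 1) + 2) * a * (1 + E) * F x * N :=
    le_mul_of_one_le_right (by positivity) hN
  simp only [mul_add, Finset.sum_add_distrib, fisherCut, rateBound, truncErr, growthConst,
    cutoffErrConst]
  simp only [mul_add] at T1 T2 T3 T4 T5 T6 T6'
  linarith

end Production

/-! ### The entropy balance at a fixed time -/

section Balance
variable {n : ℕ} {V β : ℝ → ℝ} {b B G C : ℝ} {γ : ℝ} {τ : ℝ → ℝ} {f : ℝ → Phase n → ℝ}

theorem ChainBounds.continuous_sourceTerm (h : ChainBounds V β b B G C) :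
    Continuous fun z : ℝ × Phase n => sourceTerm V β z.1 z.2 := by
  have h1 : ∀ k : Fin n, Continuous fun z : ℝ × Phase n => bulkCoeff V β k z.2 := fun k =>
    (h.contDiff_bulkCoeff k).continuous.comp continuous_snd
  have h2 : Continuous fun z : ℝ × Phase n => pLast z.2.2 :=
    continuous_pLast.comp continuous_snd
  simp only [sourceTerm_split]
  fun_prop

/-- The constant in the bound of `truncErr` by the energy. -/
def truncConst (B b γ τm K₁ : ℝ) (n : ℕ) : ℝ :=
  2 * (n : ℝ) ^ 2 * B * τm + B * τm * (1 + n * K₁) * (2 * ChainBounds.cutoffConst b γ τm n)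

theorem ChainBounds.abs_pLast_le (h : ChainBounds V β b B G C) (x : Phase n) :
    |pLast x.2| ≤ 2 * (1 + totalEnergy V x) := by
  have h1 := pLast_sq_le x.2
  have h3 := h.sum_sq_le x
  have hE := h.totalEnergy_nonneg x
  refine abs_le_of_sq_le_sq ?_ (by positivity)
  nlinarith

theorem ChainBounds.cutoffConst_nonneg (h : ChainBounds V β b B G C) (hγ : 0 < γ) {τm : ℝ}
    (hτm : 0 ≤ τm) : 0 ≤ cutoffConst b γ τm n := by
  have hb := h.b_pos
  unfold cutoffConst; positivity

theorem ChainBounds.truncErr_nonneg (h : ChainBounds V β b B G C) (hγ : 0 < γ) {τm N a : ℝ}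
    (hτm : 0 ≤ τm) (hN : 1 ≤ N) (ha : 0 ≤ a) {F : Phase n → ℝ} (x : Phase n) (hF0 : 0 ≤ F x) :
    0 ≤ truncErr V B b γ τm N a F x := by
  have hq1 := sub_nonneg.2 (entDual_le hN hF0)
  have hE := h.totalEnergy_nonneg x
  have hB := h.B_pos
  have hc := h.cutoffConst_nonneg (n := n) hγ hτm
  unfold truncErr
  positivity

theorem ChainBounds.truncErr_le (h : ChainBounds V β b B G C) (hγ : 0 < γ) {τm K₁ N a : ℝ}
    (hτm : 0 ≤ τm) (hK0 : 0 ≤ K₁) (hK : ∀ r, |r| ≤ V r + K₁) (hN : 1 ≤ N)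
    {F : Phase n → ℝ} (x : Phase n) (hF0 : 0 ≤ F x) :
    truncErr V B b γ τm N a F x ≤ truncConst B b γ τm K₁ n * ((1 + totalEnergy V x) * F x) := by
  have hq1 := entDual_nonneg hN hF0
  have hE := h.totalEnergy_nonneg x
  have hB := h.B_pos
  have hc := h.cutoffConst_nonneg (n := n) hγ hτm
  have hp := h.abs_pLast_le x
  have hlen := abs_len_le (κ := 1) (K := K₁) zero_le_one (by simpa using hK) x
  rw [one_mul] at hlen
  have hlen' : |len x| ≤ (1 + n * K₁) * (1 + totalEnergy V x) := by
    have : 0 ≤ n * K₁ := by positivity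
    nlinarith
  have h1 : (n : ℝ) ^ 2 * B * τm * |pLast x.2| * (F x - entDual N (F x)) ≤
      (n : ℝ) ^ 2 * B * τm * (2 * (1 + totalEnergy V x)) * F x := by
    calc _ ≤ (n : ℝ) ^ 2 * B * τm * |pLast x.2| * F x := by gcongr; linarith
      _ ≤ _ := by gcongr
  have h2 : B * τm * |len x| * min (2 * cutoffConst b γ τm n)
      (cutoffConst b γ τm n * a * (1 + totalEnergy V x)) * F x ≤
      B * τm * ((1 + n * K₁) * (1 + totalEnergy V x)) * (2 * cutoffConst b γ τm n) * F x := by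
    calc _ ≤ B * τm * |len x| * (2 * cutoffConst b γ τm n) * F x := by
          gcongr; exact min_le_left _ _
      _ ≤ _ := by gcongr
  rw [truncErr, truncConst]
  linarith

/-- For nonnegative integrands, a bound of the space integrals uniform on the bounded time interval
gives joint integrability by Tonelli. -/
theorem integrable_prod_of_integral_le (h : ChainBounds V β b B G C) {P : ℝ → Phase n → ℝ}
    {t M : ℝ} (hP : ContinuousOn (fun z : ℝ × Phase n => P z.1 z.2) (Ioi 0 ×ˢ univ))
    (hP0 : ∀ u ∈ Ioc 0 t, ∀ x, 0 ≤ P u x)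
    (hPi : ∀ u ∈ Ioc 0 t, Integrable (P u) (gibbs V β n) ∧ ∫ x, P u x ∂(gibbs V β n) ≤ M) :
    Integrable (Function.uncurry P) ((volume.restrict (Ioc 0 t)).prod (gibbs V β n)) := by
  have hprob := h.isProbabilityMeasure (n := n)
  have hsub : Ioc 0 t ×ˢ (univ : Set (Phase n)) ⊆ Ioi 0 ×ˢ univ :=
    prod_mono Ioc_subset_Ioi_self le_rfl
  have hm : AEStronglyMeasurable (Function.uncurry P)
      ((volume.restrict (Ioc 0 t)).prod (gibbs V β n)) := by
    rw [show (volume.restrict (Ioc 0 t)).prod (gibbs V β n) =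
      ((volume : Measure ℝ).prod (gibbs V β n)).restrict (Ioc 0 t ×ˢ univ) by
        rw [← Measure.prod_restrict, Measure.restrict_univ]]
    exact (hP.mono hsub).aestronglyMeasurable (measurableSet_Ioc.prod MeasurableSet.univ)
  rw [integrable_prod_iff hm]
  have hae : ∀ᵐ u ∂(volume.restrict (Ioc 0 t)), u ∈ Ioc 0 t := ae_restrict_mem measurableSet_Ioc
  constructor
  · filter_upwards [hae] with u hu using (hPi u hu).1
  · have hm2 := hm.norm.integral_prod_right'
    refine (integrable_const (M : ℝ)).mono' hm2 ?_
    filter_upwards [hae] with u hu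
    rw [Real.norm_eq_abs, abs_of_nonneg (integral_nonneg fun x => norm_nonneg _)]
    have e : ∀ x, ‖Function.uncurry P (u, x)‖ = P u x := fun x => by
      rw [Real.norm_eq_abs]; exact abs_of_nonneg (hP0 u hu x)
    simp only [e]
    exact (hPi u hu).2

namespace IsForwardSolution

theorem continuousOn_comp (hf : IsForwardSolution V β γ τ n f) {φ : ℝ → ℝ}
    (hφ : ContinuousOn φ (Ici 0)) :
    ContinuousOn (fun z : ℝ × Phase n => φ (f z.1 z.2)) (Ioi 0 ×ˢ univ) :=
  hφ.comp hf.continuousOn fun z hz => hf.nonneg z.1 (mem_Ioi.1 hz.1).le z.2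

theorem continuousOn_entRate (hf : IsForwardSolution V β γ τ n f) (h : ChainBounds V β b B G C)
    (hτc : ContinuousOn τ (Ioi 0)) {N : ℝ} (hN : 1 ≤ N) (a : ℝ) :
    ContinuousOn (fun z : ℝ × Phase n => entRate V β γ (τ z.1) N a (f z.1) z.2)
      (Ioi 0 ×ˢ univ) := by
  have hτ' : ContinuousOn (fun z : ℝ × Phase n => (τ z.1, z.2)) (Ioi 0 ×ˢ univ) :=
    (hτc.comp continuousOn_fst fun z hz => hz.1).prodMk continuousOn_snd
  have h1 := (h.continuous_gen_cutoff (γ := γ) (n := n) a).comp_continuousOn hτ'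
  have h2 := (h.continuous_sourceTerm (n := n)).comp_continuousOn hτ'
  have h3 : ContinuousOn (fun z : ℝ × Phase n => cutoff V a z.2) (Ioi 0 ×ˢ univ) :=
    ((h.contDiff_cutoff a).continuous.comp continuous_snd).continuousOn
  have h4 : ContinuousOn (fun z : ℝ × Phase n =>
      ∑ k, (betaAt β n k)⁻¹ * dp k (f z.1) z.2 ^ 2) (Ioi 0 ×ˢ univ) :=
    continuousOn_finsetSum _ fun k _ => continuousOn_const.mul ((hf.continuousOn_dp k).pow 2)
  exact (h1.mul (hf.continuousOn_comp (continuousOn_ent hN))).add (h3.mul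
    ((h2.mul (hf.continuousOn_comp (continuousOn_entDual hN))).sub
    (continuousOn_const.mul ((hf.continuousOn_comp (continuousOn_entCurv hN)).mul h4))))

theorem continuousOn_fisherCut (hf : IsForwardSolution V β γ τ n f) (h : ChainBounds V β b B G C)
    {N : ℝ} (hN : 1 ≤ N) (a : ℝ) :
    ContinuousOn (fun z : ℝ × Phase n => fisherCut V β N a (f z.1) z.2)
      (Ioi 0 ×ˢ univ) := by
  have h3 : ContinuousOn (fun z : ℝ × Phase n => cutoff V a z.2) (Ioi 0 ×ˢ univ) :=
    ((h.contDiff_cutoff a).continuous.comp continuous_snd).continuousOn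
  have h4 : ContinuousOn (fun z : ℝ × Phase n =>
      ∑ k, (betaAt β n k)⁻¹ * dp k (f z.1) z.2 ^ 2) (Ioi 0 ×ˢ univ) :=
    continuousOn_finsetSum _ fun k _ => continuousOn_const.mul ((hf.continuousOn_dp k).pow 2)
  exact h3.mul ((hf.continuousOn_comp (continuousOn_entCurv hN)).mul h4)

theorem continuousOn_lenRate (hf : IsForwardSolution V β γ τ n f) (h : ChainBounds V β b B G C)
    (hτc : ContinuousOn τ (Ioi 0)) {τ' : ℝ → ℝ} (hτc' : ContinuousOn τ' (Ioi 0)) (a : ℝ) :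
    ContinuousOn (fun z : ℝ × Phase n => lenRate V β γ (τ z.1) (τ' z.1) a (f z.1) z.2)
      (Ioi 0 ×ˢ univ) := by
  have hτ0 : ContinuousOn (fun z : ℝ × Phase n => τ z.1) (Ioi 0 ×ˢ univ) :=
    hτc.comp continuousOn_fst fun z hz => hz.1
  have hτ0' : ContinuousOn (fun z : ℝ × Phase n => τ' z.1) (Ioi 0 ×ˢ univ) :=
    hτc'.comp continuousOn_fst fun z hz => hz.1
  have h1 := (h.continuous_gen_cutoff (γ := γ) (n := n) a).comp_continuousOn
    (hτ0.prodMk continuousOn_snd)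
  have h3 : ContinuousOn (fun z : ℝ × Phase n => cutoff V a z.2) (Ioi 0 ×ˢ univ) :=
    ((h.contDiff_cutoff a).continuous.comp continuous_snd).continuousOn
  have h5 : ContinuousOn (fun z : ℝ × Phase n => len z.2) (Ioi 0 ×ˢ univ) :=
    (continuous_len.comp continuous_snd).continuousOn
  have h6 : ContinuousOn (fun z : ℝ × Phase n => pLast z.2.2) (Ioi 0 ×ˢ univ) :=
    (continuous_pLast.comp continuous_snd).continuousOn
  exact ((hτ0'.mul (h5.mul h3)).add (hτ0.mul ((h5.mul h1).add
    ((continuousOn_const.mul h6).mul h3)))).mul hf.continuousOn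

theorem continuousOn_truncErr (hf : IsForwardSolution V β γ τ n f) (h : ChainBounds V β b B G C)
    {N : ℝ} (hN : 1 ≤ N) (τm a : ℝ) :
    ContinuousOn (fun z : ℝ × Phase n => truncErr V B b γ τm N a (f z.1) z.2)
      (Ioi 0 ×ˢ univ) := by
  have h0 := hf.continuousOn
  have h1 := hf.continuousOn_comp (continuousOn_entDual hN)
  have h2 : ContinuousOn (fun z : ℝ × Phase n => totalEnergy V z.2) (Ioi 0 ×ˢ univ) :=
    (h.continuous_totalEnergy.comp continuous_snd).continuousOn
  have h5 : ContinuousOn (fun z : ℝ × Phase n => len z.2) (Ioi 0 ×ˢ univ) :=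
    (continuous_len.comp continuous_snd).continuousOn
  have h6 : ContinuousOn (fun z : ℝ × Phase n => pLast z.2.2) (Ioi 0 ×ˢ univ) :=
    (continuous_pLast.comp continuous_snd).continuousOn
  unfold truncErr
  fun_prop

/-- The entropy balance at a fixed time. -/
theorem entropy_production (hf : IsForwardSolution V β γ τ n f) (h : ChainBounds V β b B G C)
    (hn : 1 ≤ n) (hγ : 0 < γ) (hτc : ContinuousOn τ (Ioi 0)) {τ' : ℝ → ℝ}
    (hτc' : ContinuousOn τ' (Ioi 0)) {τm τ₁ K₁ N a u : ℝ} (hu : 0 < u)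
    (hτ : |τ u| ≤ τm) (hτ' : |τ' u| ≤ τ₁) (hK0 : 0 ≤ K₁)
    (hK : ∀ r, |r| ≤ V r + K₁) (hN : 1 ≤ N) (ha : 0 < a) (ha1 : a ≤ 1)
    (hi : Integrable (rateBound V b B G C γ τm τ₁ K₁ N a (f u)) (gibbs V β n)) :
    ∫ x, entRate V β γ (τ u) N a (f u) x ∂(gibbs V β n) -
      β 1 * ∫ x, lenRate V β γ (τ u) (τ' u) a (f u) x ∂(gibbs V β n) +
      (n : ℝ) ^ 2 * γ / 2 * ∫ x, fisherCut V β N a (f u) x ∂(gibbs V β n) ≤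
    ∫ x, rateBound V b B G C γ τm τ₁ K₁ N a (f u) x ∂(gibbs V β n) := by
  set F := f u with hF
  have hF0 := hf.nonneg u hu.le
  have hF2 : ContDiff ℝ 2 F := (hf.contDiff u hu).of_le (by norm_cast)
  have hF1 : ContDiff ℝ 1 F := (hf.contDiff u hu).of_le (by norm_cast)
  have hWsupp : ∀ x ∉ {x : Phase n | totalEnergy V x ≤ 1 / a}, cutoff V a x = 0 :=
    fun x hx => ChainBounds.cutoff_eq_zero ha hx
  have hcpt := h.isCompact_sublevel (n := n) (1 / a)
  have hWc : HasCompactSupport (cutoff V a : Phase n → ℝ) :=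
    HasCompactSupport.intro hcpt hWsupp
  have hW1 : ContDiff ℝ 1 (cutoff V a : Phase n → ℝ) := (h.contDiff_cutoff a).of_le (by norm_num)
  have c1 := continuous_slice (F := fun v => entRate V β γ (τ v) N a (f v))
    (hf.continuousOn_entRate h hτc hN a) hu
  have c2 := continuous_slice (F := fun v => lenRate V β γ (τ v) (τ' v) a (f v))
    (hf.continuousOn_lenRate h hτc hτc' a) hu
  have c3 := continuous_slice (F := fun v => fisherCut V β N a (f v))
    (hf.continuousOn_fisherCut h hN a) hu
  have i1 : Integrable (entRate V β γ (τ u) N a F) (gibbs V β n) :=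
    h.integrable_gibbs_of_compact c1 (HasCompactSupport.intro hcpt fun x hx => by
      rw [entRate, hWsupp x hx, h.gen_cutoff_eq_zero ha hx]; ring)
  have i2 : Integrable (lenRate V β γ (τ u) (τ' u) a F) (gibbs V β n) :=
    h.integrable_gibbs_of_compact c2 (HasCompactSupport.intro hcpt fun x hx => by
      rw [lenRate, hWsupp x hx, h.gen_cutoff_eq_zero ha hx]; ring)
  have i3 : Integrable (fisherCut V β N a F) (gibbs V β n) :=
    h.integrable_gibbs_of_compact c3 (HasCompactSupport.intro hcpt fun x hx => by
      rw [fisherCut, hWsupp x hx]; ring)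
  -- integration by parts in the velocities
  have hqd : ∀ x, HasDerivAt (entDual N) (entCurv N (F x) * F x) (F x) := fun x =>
    hasDerivAt_entDual hN (hF0 x)
  have hq1 : ContDiff ℝ 1 fun x => entDual N (F x) := by
    have hN0 : 0 < N := by linarith
    have p1 : ∀ x, 1 + F x / N ≠ 0 := fun x => by have := hF0 x; positivity
    have p2 : ∀ x, 1 + N * F x ≠ 0 := fun x => by have := hF0 x; positivity
    unfold entDual
    exact (contDiff_const.mul ((contDiff_const.add (hF1.div_const N)).log p1)).sub
      (contDiff_const.mul ((contDiff_const.add (contDiff_const.mul hF1)).log p2))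
  have hU1 : ContDiff ℝ 1 fun x => cutoff V a x * entDual N (F x) := hW1.mul hq1
  have hUc : HasCompactSupport fun x => cutoff V a x * entDual N (F x) := hWc.mul_right
  have hdU : ∀ k x, dp k (fun x => cutoff V a x * entDual N (F x)) x =
      cutoff V a x * (entCurv N (F x) * F x * dp k F x) + entDual N (F x) * dp k (cutoff V a) x := by
    intro k x
    rw [dp_mul (u := cutoff V a) (v := fun x => entDual N (F x)) k
      (hW1.differentiable (by simp) x) (hq1.differentiable (by simp) x),
      dp_comp k (hqd x) (hF1.differentiable (by simp) x)]
  have i4 : ∀ k, Integrable (fun x => bulkCoeff V β k x * x.2 k *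
      (cutoff V a x * entDual N (F x))) (gibbs V β n) := fun k => by
    have := (h.contDiff_bulkCoeff (n := n) k).continuous
    have := hU1.continuous
    exact h.integrable_gibbs_of_compact (by fun_prop) hUc.mul_left
  have i5 : ∀ k, Integrable (fun x => (betaAt β n k)⁻¹ * bulkCoeff V β k x *
      dp k (fun x => cutoff V a x * entDual N (F x)) x) (gibbs V β n) := fun k => by
    have h1 := (h.contDiff_bulkCoeff (n := n) k).continuous
    have h2 : Continuous (dp k fun x => cutoff V a x * entDual N (F x)) :=
      (hU1.continuous_fderiv (by simp)).clm_apply continuous_const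
    exact h.integrable_gibbs_of_compact ((continuous_const.mul h1).mul h2)
      (hUc.fderiv_apply ℝ (ep k)).mul_left
  have hibp : ∫ x, ∑ k, bulkCoeff V β k x * x.2 k * (cutoff V a x * entDual N (F x))
      ∂(gibbs V β n) = ∫ x, ∑ k, (betaAt β n k)⁻¹ * bulkCoeff V β k x *
      dp k (fun x => cutoff V a x * entDual N (F x)) x ∂(gibbs V β n) := by
    rw [integral_finsetSum _ fun k _ => i4 k, integral_finsetSum _ fun k _ => i5 k]
    refine Finset.sum_congr rfl fun k _ => ?_
    refine h.integral_velocity_mul k (h.contDiff_bulkCoeff k) hU1 hUc fun x s => ?_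
    simp [bulkCoeff, ep]
  have i4' := integrable_finsetSum Finset.univ fun k _ => i4 k
  have i5' := integrable_finsetSum Finset.univ fun k _ => i5 k
  have i6 : Integrable (fun x => entRate V β γ (τ u) N a F x -
      β 1 * lenRate V β γ (τ u) (τ' u) a F x +
      (n : ℝ) ^ 2 * γ / 2 * fisherCut V β N a F x) (gibbs V β n) :=
    (i1.sub (i2.const_mul _)).add (i3.const_mul _)
  -- The bulk source is exchanged for its integrated form under the integral sign. The total is
  -- unchanged, and only the new integrand has a pointwise bound.
  have e1 : ∫ x, entRate V β γ (τ u) N a F x ∂(gibbs V β n) -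
      β 1 * ∫ x, lenRate V β γ (τ u) (τ' u) a F x ∂(gibbs V β n) +
      (n : ℝ) ^ 2 * γ / 2 * ∫ x, fisherCut V β N a F x ∂(gibbs V β n) =
      ∫ x, ((entRate V β γ (τ u) N a F x - β 1 * lenRate V β γ (τ u) (τ' u) a F x +
      (n : ℝ) ^ 2 * γ / 2 * fisherCut V β N a F x) -
      ∑ k, bulkCoeff V β k x * x.2 k * (cutoff V a x * entDual N (F x)) +
      ∑ k, (betaAt β n k)⁻¹ * bulkCoeff V β k x *
      dp k (fun x => cutoff V a x * entDual N (F x)) x) ∂(gibbs V β n) := by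
    have i7 : Integrable (fun x => entRate V β γ (τ u) N a F x -
      β 1 * lenRate V β γ (τ u) (τ' u) a F x) (gibbs V β n) := i1.sub (i2.const_mul _)
    have i8 : Integrable (fun x => (entRate V β γ (τ u) N a F x -
      β 1 * lenRate V β γ (τ u) (τ' u) a F x +
      (n : ℝ) ^ 2 * γ / 2 * fisherCut V β N a F x) -
      ∑ k, bulkCoeff V β k x * x.2 k * (cutoff V a x * entDual N (F x))) (gibbs V β n) :=
      i6.sub i4'
    rw [integral_add i8 i5', integral_sub i6 i4', integral_add i7 (i3.const_mul _),
      integral_sub i1 (i2.const_mul _), integral_const_mul, integral_const_mul, hibp]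
    ring
  rw [e1]
  refine integral_mono ((i6.sub i4').add i5') hi fun x => ?_
  have := h.entropy_pointwise hn hγ hτ hτ' hK0 hK hN ha ha1 (F := F) x (hF0 x)
  refine le_trans (le_of_eq ?_) this
  dsimp only
  simp only [hdU]
  have e2 : ∑ k, bulkCoeff V β k x * x.2 k * (cutoff V a x * entDual N (F x)) =
      (∑ k, bulkCoeff V β k x * x.2 k) * (cutoff V a x * entDual N (F x)) := by
    rw [Finset.sum_mul]
  rw [e2, entRate, lenRate, sourceTerm_split, fisherCut]
  ring

end IsForwardSolution

end Balance

/-! ### The truncated entropy balance integrated in time -/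

/-- Bounds on the tension `τ` and its derivative `τ'` on a time interval. -/
structure TensionBounds (τ τ' : ℝ → ℝ) (T τm τ₁ : ℝ) : Prop where
  hasDerivAt : ∀ u, 0 < u → HasDerivAt τ (τ' u) u
  continuousOn_deriv : ContinuousOn τ' (Ioi 0)
  tendsto_zero : Tendsto τ (𝓝[>] 0) (𝓝 (τ 0))
  abs_le : ∀ u ∈ Icc 0 T, |τ u| ≤ τm
  abs_deriv_le : ∀ u ∈ Icc 0 T, |τ' u| ≤ τ₁

theorem exists_tensionBounds {τ : ℝ → ℝ} (hτ : ContDiffOn ℝ 1 τ (Ici 0)) (T : ℝ) :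
    ∃ τ' τm τ₁, TensionBounds τ τ' T τm τ₁ := by
  have hc : ContinuousOn (derivWithin τ (Ici 0)) (Ici 0) :=
    hτ.continuousOn_derivWithin (uniqueDiffOn_Ici 0) le_rfl
  obtain ⟨τm, h1⟩ := (isCompact_Icc (a := (0 : ℝ)) (b := T)).exists_bound_of_continuousOn
    (hτ.continuousOn.mono Icc_subset_Ici_self)
  obtain ⟨τ₁, h2⟩ := (isCompact_Icc (a := (0 : ℝ)) (b := T)).exists_bound_of_continuousOn
    (hc.mono Icc_subset_Ici_self)
  refine ⟨derivWithin τ (Ici 0), τm, τ₁, ⟨fun u hu => ?_, hc.mono Ioi_subset_Ici_self, ?_, h1, h2⟩⟩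
  · exact ((hτ.differentiableOn (by simp) u (mem_Ici.2 hu.le)).hasDerivWithinAt).hasDerivAt
      (Ici_mem_nhds hu)
  · exact (hτ.continuousOn 0 (mem_Ici.2 le_rfl)).mono_left (nhdsWithin_mono _ Ioi_subset_Ici_self)

section
variable {τ τ' : ℝ → ℝ} {T τm τ₁ : ℝ}

theorem TensionBounds.continuousOn (hτ : TensionBounds τ τ' T τm τ₁) : ContinuousOn τ (Ioi 0) :=
  fun u hu => (hτ.hasDerivAt u hu).continuousAt.continuousWithinAt

variable {n : ℕ} {V β : ℝ → ℝ} {b B G C : ℝ} {γ : ℝ} {f : ℝ → Phase n → ℝ}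

theorem contDiff_len : ContDiff ℝ 2 (len : Phase n → ℝ) := by
  unfold len
  exact ContDiff.sum fun k _ => by fun_prop

theorem contDiff_ent_comp {N : ℝ} (hN : 1 ≤ N) {F : Phase n → ℝ} (hF0 : ∀ x, 0 ≤ F x)
    {m : WithTop ℕ∞} (hF : ContDiff ℝ m F) : ContDiff ℝ m fun x => ent N (F x) := by
  have hN0 : 0 < N := by linarith
  have p1 : ∀ x, 1 + F x / N ≠ 0 := fun x => by have := hF0 x; positivity
  have p2 : ∀ x, F x + N⁻¹ ≠ 0 := fun x => by have := hF0 x; positivity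
  have h1 : ContDiff ℝ m fun x => F x + N⁻¹ := hF.add contDiff_const
  have h2 : ContDiff ℝ m fun x => N + F x := contDiff_const.add hF
  have h3 : ContDiff ℝ m fun x => 1 + F x / N := contDiff_const.add (hF.div_const N)
  unfold ent
  exact ((h1.mul (h1.log p2)).sub contDiff_const).sub (h2.mul (h3.log p1))

/-- The truncated entropy corrected by the work of the tension. -/
def entBalance (V β τ : ℝ → ℝ) (N a : ℝ) (f : ℝ → Phase n → ℝ) (u : ℝ) : ℝ :=
  ∫ x, cutoff V a x * ent N (f u x) ∂(gibbs V β n) -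
    β 1 * (τ u * ∫ x, len x * cutoff V a x * f u x ∂(gibbs V β n))

namespace IsForwardSolution

theorem integral_cutoff_ent_sub (hf : IsForwardSolution V β γ τ n f) (h : ChainBounds V β b B G C)
    (hτc : ContinuousOn τ (Ioi 0)) {N a s t : ℝ} (hN : 1 ≤ N) (ha : 0 < a) (hs : 0 < s)
    (hst : s ≤ t) :
    ∫ x, cutoff V a x * ent N (f t x) ∂(gibbs V β n) -
      ∫ x, cutoff V a x * ent N (f s x) ∂(gibbs V β n) =
    ∫ u in s..t, ∫ x, entRate V β γ (τ u) N a (f u) x ∂(gibbs V β n) := by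
  have hsub : Icc s t ×ˢ (univ : Set (Phase n)) ⊆ Ioi 0 ×ˢ univ :=
    prod_mono (fun u hu => hs.trans_le hu.1) le_rfl
  have hpos : ∀ u ∈ Icc s t, 0 < u := fun u hu => hs.trans_le hu.1
  have hF2 : ∀ u ∈ Icc s t, ContDiff ℝ 2 (f u) := fun u hu =>
    (hf.contDiff u (hpos u hu)).of_le (by norm_cast)
  have h0 : ∀ u ∈ Icc s t, ∀ x, 0 ≤ f u x := fun u hu => hf.nonneg u (hpos u hu).le
  have hcut : ContDiff ℝ 2 (cutoff V a : Phase n → ℝ) := h.contDiff_cutoff a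
  rw [h.evolution γ τ (W := fun _ => cutoff V a) (W' := fun _ _ => 0)
    (g := fun u x => ent N (f u x))
    (g' := fun u x => entSlope N (f u x) * forwardOp V β γ (τ u) (f u) x)
    (h.isCompact_sublevel (1 / a)) hst (fun _ _ => hcut)
    (fun _ _ x hx => ChainBounds.cutoff_eq_zero ha hx) (fun _ _ _ _ => rfl)
    (fun u _ x => hasDerivAt_const u _) (hcut.continuous.comp continuous_snd).continuousOn
    continuousOn_const (fun u hu => contDiff_ent_comp hN (h0 u hu) (hF2 u hu))
    (fun u hu x => HasDerivAt.comp (h₂ := ent N) (h := fun u => f u x) u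
      (hasDerivAt_ent hN (h0 u hu x)) (hf.forward u (hpos u hu) x))
    ((hf.continuousOn_comp (continuousOn_ent hN)).mono hsub)
    (((hf.continuousOn_comp (continuousOn_entSlope hN)).mul
      (hf.continuousOn_forwardOp h hτc)).mono hsub)]
  refine intervalIntegral.integral_congr fun u hu => ?_
  rw [uIcc_of_le hst] at hu
  refine integral_congr_ae (Eventually.of_forall fun x => ?_)
  dsimp only
  rw [forwardOp_comp (hF2 u hu) (fun y => hasDerivAt_ent hN (h0 u hu y))
    (hasDerivAt_entSlope hN (h0 u hu x)), ent_eq hN (h0 u hu x), entRate]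
  ring

/-- The tension is put into the weight, so that differentiating it yields the `τ'` term; the rest is
the transport of the length. -/
theorem integral_len_sub (hf : IsForwardSolution V β γ τ n f) (h : ChainBounds V β b B G C)
    (hτ : TensionBounds τ τ' T τm τ₁) {a s t : ℝ} (ha : 0 < a) (hs : 0 < s)
    (hst : s ≤ t) :
    τ t * ∫ x, len x * cutoff V a x * f t x ∂(gibbs V β n) -
      τ s * ∫ x, len x * cutoff V a x * f s x ∂(gibbs V β n) =
    ∫ u in s..t, ∫ x, lenRate V β γ (τ u) (τ' u) a (f u) x ∂(gibbs V β n) := by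
  have hsub : Icc s t ×ˢ (univ : Set (Phase n)) ⊆ Ioi 0 ×ˢ univ :=
    prod_mono (fun u hu => hs.trans_le hu.1) le_rfl
  have hpos : ∀ u ∈ Icc s t, 0 < u := fun u hu => hs.trans_le hu.1
  have hF2 : ∀ u ∈ Icc s t, ContDiff ℝ 2 (f u) := fun u hu =>
    (hf.contDiff u (hpos u hu)).of_le (by norm_cast)
  have hcut : ContDiff ℝ 2 (cutoff V a : Phase n → ℝ) := h.contDiff_cutoff a
  have hlc : ContDiff ℝ 2 (fun x : Phase n => len x * cutoff V a x) := contDiff_len.mul hcut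
  have e : ∀ u, τ u * ∫ x, len x * cutoff V a x * f u x ∂(gibbs V β n) =
      ∫ x, τ u * (len x * cutoff V a x) * f u x ∂(gibbs V β n) := fun u => by
    rw [← integral_const_mul]; simp only [mul_assoc]
  have hτc : ContinuousOn (fun z : ℝ × Phase n => τ z.1) (Icc s t ×ˢ univ) :=
    hτ.continuousOn.comp continuousOn_fst fun z hz => hpos z.1 hz.1
  have hτc' : ContinuousOn (fun z : ℝ × Phase n => τ' z.1) (Icc s t ×ˢ univ) :=
    hτ.continuousOn_deriv.comp continuousOn_fst fun z hz => hpos z.1 hz.1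
  have hl : ContinuousOn (fun z : ℝ × Phase n => len z.2 * cutoff V a z.2) (Icc s t ×ˢ univ) :=
    (hlc.continuous.comp continuous_snd).continuousOn
  rw [e, e, h.evolution γ τ (W := fun u x => τ u * (len x * cutoff V a x))
    (W' := fun u x => τ' u * (len x * cutoff V a x)) (g := f)
    (g' := fun u x => forwardOp V β γ (τ u) (f u) x)
    (h.isCompact_sublevel (1 / a)) hst (fun _ _ => contDiff_const.mul hlc)
    (fun _ _ x hx => by rw [ChainBounds.cutoff_eq_zero ha hx]; ring)
    (fun _ _ x hx => by rw [ChainBounds.cutoff_eq_zero ha hx]; ring)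
    (fun u hu x => (hτ.hasDerivAt u (hpos u hu)).mul_const _) (hτc.mul hl) (hτc'.mul hl)
    hF2 (fun u hu x => hf.forward u (hpos u hu) x) (hf.continuousOn.mono hsub)
    ((hf.continuousOn_forwardOp h hτ.continuousOn).mono hsub)]
  refine intervalIntegral.integral_congr fun u hu => ?_
  refine integral_congr_ae (Eventually.of_forall fun x => ?_)
  dsimp only
  rw [gen_const_mul (τ u) (τ u) hlc, gen_len_mul (τ u) hcut, lenRate]
  ring

/-- With `N` and `a` fixed the truncated entropy is a Lipschitz function of `f` and the localized
length is bounded, so `L¹` convergence at time zero is enough. -/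
theorem tendsto_entBalance (hf : IsForwardSolution V β γ τ n f) (h : ChainBounds V β b B G C)
    (hτ : TensionBounds τ τ' T τm τ₁) {N a : ℝ} (hN : 1 ≤ N) (ha : 0 < a) :
    Tendsto (entBalance V β τ N a f) (𝓝[>] 0) (𝓝 (entBalance V β τ N a f 0)) := by
  have hcut : ContDiff ℝ 2 (cutoff V a : Phase n → ℝ) := h.contDiff_cutoff a
  have hlc : Continuous (fun x : Phase n => len x * cutoff V a x) :=
    (contDiff_len.mul hcut).continuous
  have hsupp : HasCompactSupport (fun x : Phase n => len x * cutoff V a x) :=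
    HasCompactSupport.intro (h.isCompact_sublevel (1 / a)) fun x hx => by
      rw [ChainBounds.cutoff_eq_zero ha hx]; ring
  obtain ⟨M, hM⟩ := hlc.bounded_above_of_compact_support hsupp
  have h1 := hf.tendsto_integral_mul (W := cutoff V a) (M := 1) (L := N) (φ := ent N)
    (fun x => by rw [abs_of_nonneg (cutoff_nonneg a x)]; exact h.cutoff_le_one ha.le x)
    (fun a ha c hc => abs_ent_sub_le hN ha hc) (fun s hs => by
      refine h.integrable_cutoff_mul ha.le (((hf.integrable hs).const_mul N).mono' ?_ ?_)
      · have := hf.aestronglyMeasurable hs (gibbs V β n)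
        have hm : Measurable (ent N) := by unfold ent; fun_prop
        exact (hm.comp_aemeasurable this.aemeasurable).aestronglyMeasurable
      · exact Eventually.of_forall fun x => abs_ent_le hN (hf.nonneg s hs x))
  have h2 := hf.tendsto_integral_mul (W := fun x => len x * cutoff V a x) (M := M) (L := 1)
    (φ := id) (fun x => hM x) (fun a _ c _ => by simp)
    (fun s hs => (hf.integrable hs).bdd_mul hlc.aestronglyMeasurable (Eventually.of_forall hM))
  exact h1.sub ((hτ.tendsto_zero.mul h2).const_mul (β 1))

end IsForwardSolution
end

/-- A solution with controlled tension and energy on the time interval `[0, T]`. -/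
structure ControlledSolution (V β : ℝ → ℝ) (b B G C γ : ℝ) (τ τ' : ℝ → ℝ) (T τm τ₁ K₁ M : ℝ)
    (n : ℕ) (f : ℝ → Phase n → ℝ) : Prop where
  bounds : ChainBounds V β b B G C
  sol : IsForwardSolution V β γ τ n f
  one_le : 1 ≤ n
  gamma_pos : 0 < γ
  time_pos : 0 < T
  tension : TensionBounds τ τ' T τm τ₁
  K₁_nonneg : 0 ≤ K₁
  pot_bound : ∀ r, |r| ≤ V r + K₁
  M_nonneg : 0 ≤ M
  energy : ∀ t ∈ Icc 0 T, Integrable (fun x => totalEnergy V x * f t x) (gibbs V β n) ∧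
    ∫ x, totalEnergy V x * f t x ∂(gibbs V β n) ≤ M

section
variable {n : ℕ} {V β τ τ' : ℝ → ℝ} {b B G C γ T τm τ₁ K₁ M : ℝ} {f : ℝ → Phase n → ℝ}

namespace ControlledSolution

theorem tension_nonneg (c : ControlledSolution V β b B G C γ τ τ' T τm τ₁ K₁ M n f) : 0 ≤ τm :=
  (abs_nonneg _).trans (c.tension.abs_le 0 ⟨le_rfl, c.time_pos.le⟩)

theorem tension_deriv_nonneg (c : ControlledSolution V β b B G C γ τ τ' T τm τ₁ K₁ M n f) :
    0 ≤ τ₁ :=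
  (abs_nonneg _).trans (c.tension.abs_deriv_le 0 ⟨le_rfl, c.time_pos.le⟩)

theorem growthConst_nonneg (c : ControlledSolution V β b B G C γ τ τ' T τm τ₁ K₁ M n f) :
    0 ≤ growthConst b B G C γ τ₁ K₁ := by
  have h1 := c.bounds.b_pos
  have h2 := c.bounds.B_pos
  have h3 := c.bounds.C_pos
  have h4 := c.tension_deriv_nonneg
  have h5 := c.K₁_nonneg
  have h6 := c.gamma_pos
  unfold growthConst; positivity

theorem cutoffErrConst_nonneg (c : ControlledSolution V β b B G C γ τ τ' T τm τ₁ K₁ M n f) :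
    0 ≤ cutoffErrConst b G C γ τm n := by
  have h1 := c.bounds.b_pos
  have h2 := c.bounds.G_nonneg
  have h3 := c.bounds.C_pos
  have h4 := c.bounds.cutoffConst_nonneg (n := n) c.gamma_pos c.tension_nonneg
  unfold cutoffErrConst; positivity

theorem integrable_one_add (c : ControlledSolution V β b B G C γ τ τ' T τm τ₁ K₁ M n f) {u : ℝ}
    (hu : u ∈ Icc 0 T) :
    Integrable (fun x => (1 + totalEnergy V x) * f u x) (gibbs V β n) ∧
    ∫ x, (1 + totalEnergy V x) * f u x ∂(gibbs V β n) =
      1 + ∫ x, totalEnergy V x * f u x ∂(gibbs V β n) := by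
  simp only [add_mul, one_mul]
  refine ⟨(c.sol.integrable hu.1).add (c.energy u hu).1, ?_⟩
  rw [integral_add (c.sol.integrable hu.1) (c.energy u hu).1, c.sol.integral_eq_one hu.1]

theorem integrable_truncErr (c : ControlledSolution V β b B G C γ τ τ' T τm τ₁ K₁ M n f)
    {N : ℝ} (hN : 1 ≤ N) {a : ℝ} (ha : 0 ≤ a) {u : ℝ} (hu : u ∈ Ioc 0 T) :
    Integrable (truncErr V B b γ τm N a (f u)) (gibbs V β n) ∧
    ∫ x, truncErr V B b γ τm N a (f u) x ∂(gibbs V β n) ≤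
      truncConst B b γ τm K₁ n * (1 + M) := by
  have hu' : u ∈ Icc 0 T := ⟨hu.1.le, hu.2⟩
  obtain ⟨i1, e1⟩ := c.integrable_one_add hu'
  have hle := fun x => c.bounds.truncErr_le c.gamma_pos c.tension_nonneg c.K₁_nonneg c.pot_bound hN
    (a := a) (F := f u) x (c.sol.nonneg u hu.1.le x)
  have h0 := fun x => c.bounds.truncErr_nonneg c.gamma_pos c.tension_nonneg hN ha
    (F := f u) x (c.sol.nonneg u hu.1.le x)
  have hc := continuous_slice (F := fun v => truncErr V B b γ τm N a (f v))
    (c.sol.continuousOn_truncErr c.bounds hN τm a) (mem_Ioi.2 hu.1)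
  have hi : Integrable (truncErr V B b γ τm N a (f u)) (gibbs V β n) := by
    refine (i1.const_mul (truncConst B b γ τm K₁ n)).mono' hc.aestronglyMeasurable
      (Eventually.of_forall fun x => ?_)
    rw [Real.norm_eq_abs, abs_of_nonneg (h0 x)]
    exact hle x
  refine ⟨hi, (integral_mono hi (i1.const_mul _) hle).trans ?_⟩
  rw [integral_const_mul, e1]
  have hT0 : 0 ≤ truncConst B b γ τm K₁ n := by
    have h1 := c.bounds.B_pos
    have h2 := c.tension_nonneg
    have h3 := c.K₁_nonneg
    have h4 := c.bounds.cutoffConst_nonneg (n := n) c.gamma_pos h2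
    unfold truncConst; positivity
  have := (c.energy u hu').2
  gcongr

theorem integrable_rateBound (c : ControlledSolution V β b B G C γ τ τ' T τm τ₁ K₁ M n f)
    {N : ℝ} (hN : 1 ≤ N) {a : ℝ} (ha : 0 ≤ a) {u : ℝ} (hu : u ∈ Ioc 0 T) :
    Integrable (rateBound V b B G C γ τm τ₁ K₁ N a (f u)) (gibbs V β n) ∧
    ∫ x, rateBound V b B G C γ τm τ₁ K₁ N a (f u) x ∂(gibbs V β n) =
      cutoffErrConst b G C γ τm n * a * N * (1 + ∫ x, totalEnergy V x * f u x ∂(gibbs V β n)) +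
      growthConst b B G C γ τ₁ K₁ * (n + ∫ x, totalEnergy V x * f u x ∂(gibbs V β n)) +
      ∫ x, truncErr V B b γ τm N a (f u) x ∂(gibbs V β n) := by
  have hu' : u ∈ Icc 0 T := ⟨hu.1.le, hu.2⟩
  have i1 := c.sol.integrable hu'.1
  have i2 := (c.energy u hu').1
  have i3 := (c.integrable_truncErr hN ha hu).1
  set k1 := cutoffErrConst b G C γ τm n * a * N with hk1
  set k2 := growthConst b B G C γ τ₁ K₁ with hk2
  have e : rateBound V b B G C γ τm τ₁ K₁ N a (f u) = fun x =>
      (k1 + k2 * n) * f u x + (k1 + k2) * (totalEnergy V x * f u x) +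
        truncErr V B b γ τm N a (f u) x := by
    ext x; rw [rateBound, ← hk1, ← hk2]; ring
  have i4 : Integrable (fun x => (k1 + k2 * n) * f u x + (k1 + k2) * (totalEnergy V x * f u x))
    (gibbs V β n) := (i1.const_mul _).add (i2.const_mul _)
  rw [e]
  refine ⟨i4.add i3, ?_⟩
  rw [integral_add i4 i3, integral_add (i1.const_mul _) (i2.const_mul _), integral_const_mul,
    integral_const_mul, c.sol.integral_eq_one hu'.1]
  ring

theorem rateBound_nonneg (c : ControlledSolution V β b B G C γ τ τ' T τm τ₁ K₁ M n f)
    {N : ℝ} (hN : 1 ≤ N) {a : ℝ} (ha : 0 ≤ a) {u : ℝ} (hu : 0 ≤ u) (x : Phase n) :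
    0 ≤ rateBound V b B G C γ τm τ₁ K₁ N a (f u) x := by
  have h0 := c.sol.nonneg u hu x
  have h1 := c.bounds.truncErr_nonneg c.gamma_pos c.tension_nonneg hN ha (F := f u) x h0
  have h2 := c.growthConst_nonneg
  have h3 := c.cutoffErrConst_nonneg
  have h4 := c.bounds.totalEnergy_nonneg x
  unfold rateBound; positivity

theorem continuousOn_energy_mul (c : ControlledSolution V β b B G C γ τ τ' T τm τ₁ K₁ M n f)
    {φ : ℝ → ℝ} (hφ : Continuous φ) :
    ContinuousOn (fun z : ℝ × Phase n => φ (totalEnergy V z.2) * f z.1 z.2) (Ioi 0 ×ˢ univ) :=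
  ((hφ.comp (c.bounds.continuous_totalEnergy.comp continuous_snd)).continuousOn).mul
    c.sol.continuousOn

theorem integrable_prod_truncErr (c : ControlledSolution V β b B G C γ τ τ' T τm τ₁ K₁ M n f)
    {N : ℝ} (hN : 1 ≤ N) {a : ℝ} (ha : 0 ≤ a) {t : ℝ} (ht : t ≤ T) :
    Integrable (Function.uncurry fun u => truncErr V B b γ τm N a (f u))
      ((volume.restrict (Ioc 0 t)).prod (gibbs V β n)) :=
  integrable_prod_of_integral_le c.bounds (c.sol.continuousOn_truncErr c.bounds hN τm a)
    (fun u hu x => c.bounds.truncErr_nonneg c.gamma_pos c.tension_nonneg hN ha x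
      (c.sol.nonneg u hu.1.le x))
    (fun _ hu => c.integrable_truncErr hN ha ⟨hu.1, hu.2.trans ht⟩)

theorem integrable_prod_energy (c : ControlledSolution V β b B G C γ τ τ' T τm τ₁ K₁ M n f)
    {t : ℝ} (ht : t ≤ T) :
    Integrable (Function.uncurry fun u x => (1 + totalEnergy V x) * f u x)
      ((volume.restrict (Ioc 0 t)).prod (gibbs V β n)) :=
  integrable_prod_of_integral_le c.bounds (c.continuousOn_energy_mul (φ := fun s => 1 + s)
    (by fun_prop))
    (fun u hu x => mul_nonneg (by have := c.bounds.totalEnergy_nonneg x; linarith)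
      (c.sol.nonneg u hu.1.le x))
    (fun u hu => by
      have hu' : u ∈ Icc 0 T := ⟨hu.1.le, hu.2.trans ht⟩
      obtain ⟨i1, e1⟩ := c.integrable_one_add hu'
      exact ⟨i1, by rw [e1]; exact add_le_add le_rfl (c.energy u hu').2⟩)

theorem integrable_prod_rateBound (c : ControlledSolution V β b B G C γ τ τ' T τm τ₁ K₁ M n f)
    {N : ℝ} (hN : 1 ≤ N) {a : ℝ} (ha : 0 ≤ a) {t : ℝ} (ht : t ≤ T) :
    Integrable (Function.uncurry fun u => rateBound V b B G C γ τm τ₁ K₁ N a (f u))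
      ((volume.restrict (Ioc 0 t)).prod (gibbs V β n)) := by
  refine integrable_prod_of_integral_le (M := cutoffErrConst b G C γ τm n * a * N * (1 + M) +
      growthConst b B G C γ τ₁ K₁ * (n + M) + truncConst B b γ τm K₁ n * (1 + M)) c.bounds ?_
    (fun u hu x => c.rateBound_nonneg hN ha hu.1.le x) (fun u hu => ?_)
  · exact (c.continuousOn_energy_mul (φ := fun s => cutoffErrConst b G C γ τm n * a * N * (1 + s) +
      growthConst b B G C γ τ₁ K₁ * (n + s)) (by fun_prop)).add
      (c.sol.continuousOn_truncErr c.bounds hN τm a)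
  · have hu' : u ∈ Ioc 0 T := ⟨hu.1, hu.2.trans ht⟩
    obtain ⟨i1, e1⟩ := c.integrable_rateBound hN ha hu'
    refine ⟨i1, ?_⟩
    rw [e1]
    have h1 := (c.energy u ⟨hu.1.le, hu'.2⟩).2
    have h2 := (c.integrable_truncErr hN ha hu').2
    have h3 := c.growthConst_nonneg
    have h4 := c.cutoffErrConst_nonneg
    gcongr

/-- The truncated entropy inequality between two positive times. -/
theorem entBalance_sub_le (c : ControlledSolution V β b B G C γ τ τ' T τm τ₁ K₁ M n f)
    {N : ℝ} (hN : 1 ≤ N) {a : ℝ} (ha : 0 < a) (ha1 : a ≤ 1) {s t : ℝ} (hs : 0 < s) (hst : s ≤ t)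
    (ht : t ≤ T) :
    entBalance V β τ N a f t - entBalance V β τ N a f s + (n : ℝ) ^ 2 * γ / 2 *
      ∫ u in s..t, ∫ x, fisherCut V β N a (f u) x ∂(gibbs V β n) ≤
    ∫ u in s..t, ∫ x, rateBound V b B G C γ τm τ₁ K₁ N a (f u) x ∂(gibbs V β n) := by
  have hprob := c.bounds.isProbabilityMeasure (n := n)
  have h := c.bounds
  have hsub : Icc s t ×ˢ (univ : Set (Phase n)) ⊆ Ioi 0 ×ˢ univ :=
    prod_mono (fun u hu => hs.trans_le hu.1) le_rfl
  have hK := h.isCompact_sublevel (n := n) (1 / a)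
  have j1 := (h.integrable_prod_of_compact (F := fun u => entRate V β γ (τ u) N a (f u)) hK
    ((c.sol.continuousOn_entRate h c.tension.continuousOn hN a).mono hsub) fun u _ x hx => by
      rw [entRate, ChainBounds.cutoff_eq_zero ha hx, h.gen_cutoff_eq_zero ha hx]
      ring).integral_prod_left
  have j2 := (h.integrable_prod_of_compact (F := fun u => lenRate V β γ (τ u) (τ' u) a (f u)) hK
    ((c.sol.continuousOn_lenRate h c.tension.continuousOn c.tension.continuousOn_deriv a).mono hsub)
    fun u _ x hx => by
      rw [lenRate, ChainBounds.cutoff_eq_zero ha hx, h.gen_cutoff_eq_zero ha hx]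
      ring).integral_prod_left
  have j3 := (h.integrable_prod_of_compact (F := fun u => fisherCut V β N a (f u)) hK
    ((c.sol.continuousOn_fisherCut h hN a).mono hsub)
    fun u _ x hx => by
      rw [fisherCut, ChainBounds.cutoff_eq_zero ha hx]
      ring).integral_prod_left
  have j4 := (c.integrable_prod_rateBound hN ha.le ht).integral_prod_left
  simp only [Function.uncurry] at j1 j2 j3 j4
  have k1 := (intervalIntegrable_iff_integrableOn_Ioc_of_le hst).2 j1
  have k2 := (intervalIntegrable_iff_integrableOn_Ioc_of_le hst).2 j2
  have k3 := (intervalIntegrable_iff_integrableOn_Ioc_of_le hst).2 j3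
  have k4 := (intervalIntegrable_iff_integrableOn_Ioc_of_le hst).2
    (IntegrableOn.mono_set (s := Ioc s t) j4 (Ioc_subset_Ioc_left hs.le))
  have e1 := c.sol.integral_cutoff_ent_sub h c.tension.continuousOn hN ha hs hst
  have e2 := c.sol.integral_len_sub h c.tension ha hs hst
  have e3 : entBalance V β τ N a f t - entBalance V β τ N a f s =
      (∫ u in s..t, ∫ x, entRate V β γ (τ u) N a (f u) x ∂(gibbs V β n)) -
      β 1 * ∫ u in s..t, ∫ x, lenRate V β γ (τ u) (τ' u) a (f u) x ∂(gibbs V β n) := by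
    rw [← e1, ← e2, entBalance, entBalance]; ring
  rw [e3, ← intervalIntegral.integral_const_mul, ← intervalIntegral.integral_const_mul,
    ← intervalIntegral.integral_sub k1 (k2.const_mul _),
    ← intervalIntegral.integral_add (k1.sub (k2.const_mul _)) (k3.const_mul _)]
  refine intervalIntegral.integral_mono_on hst ((k1.sub (k2.const_mul _)).add (k3.const_mul _)) k4
    fun u hu => ?_
  have hu0 : 0 < u := hs.trans_le hu.1
  have huT : u ≤ T := hu.2.trans ht
  exact c.sol.entropy_production h c.one_le c.gamma_pos c.tension.continuousOn
    c.tension.continuousOn_deriv hu0 (c.tension.abs_le u ⟨hu0.le, huT⟩)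
    (c.tension.abs_deriv_le u ⟨hu0.le, huT⟩) c.K₁_nonneg c.pot_bound hN ha ha1
    (c.integrable_rateBound hN ha.le ⟨hu0, huT⟩).1

theorem fisherCut_nonneg (c : ControlledSolution V β b B G C γ τ τ' T τm τ₁ K₁ M n f)
    {N : ℝ} (hN : 1 ≤ N) (a : ℝ) {u : ℝ} (hu : 0 ≤ u) (x : Phase n) :
    0 ≤ fisherCut V β N a (f u) x :=
  mul_nonneg (cutoff_nonneg a x) (mul_nonneg (entCurv_nonneg hN (c.sol.nonneg u hu x))
    (Finset.sum_nonneg fun k _ => mul_nonneg (c.bounds.beta_inv_nonneg k) (sq_nonneg _)))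

/-- The starting time of the balance goes to zero while the dissipation is kept only on `[s, t]`.
The integrability of the dissipation down to time zero is a conclusion and cannot be presupposed
here. -/
theorem entBalance_sub_zero_le (c : ControlledSolution V β b B G C γ τ τ' T τm τ₁ K₁ M n f)
    {N : ℝ} (hN : 1 ≤ N) {a : ℝ} (ha : 0 < a) (ha1 : a ≤ 1) {s t : ℝ} (hs : 0 < s) (hst : s ≤ t)
    (ht : t ≤ T) :
    entBalance V β τ N a f t - entBalance V β τ N a f 0 + (n : ℝ) ^ 2 * γ / 2 *
      ∫ u in s..t, ∫ x, fisherCut V β N a (f u) x ∂(gibbs V β n) ≤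
    ∫ u in Ioc 0 t, ∫ x, rateBound V b B G C γ τm τ₁ K₁ N a (f u) x ∂(gibbs V β n) := by
  have hprob := c.bounds.isProbabilityMeasure (n := n)
  have hlim := c.sol.tendsto_entBalance c.bounds c.tension hN ha
  have hγ := c.gamma_pos
  refine le_of_tendsto (f := fun s' => entBalance V β τ N a f t - entBalance V β τ N a f s' +
    (n : ℝ) ^ 2 * γ / 2 * ∫ u in s..t, ∫ x, fisherCut V β N a (f u) x ∂(gibbs V β n))
    ((hlim.const_sub _).add_const _) ?_
  filter_upwards [Ioc_mem_nhdsGT hs] with s' hs'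
  have hst' : s' ≤ t := hs'.2.trans hst
  have h1 := c.entBalance_sub_le hN ha ha1 hs'.1 hst' ht
  have j4 := (c.integrable_prod_rateBound hN ha.le ht).integral_prod_left
  have j3 := (c.bounds.integrable_prod_of_compact (F := fun u => fisherCut V β N a (f u))
    (c.bounds.isCompact_sublevel (n := n) (1 / a)) (s := s') (t := t)
    ((c.sol.continuousOn_fisherCut c.bounds hN a).mono
      (prod_mono (fun u hu => hs'.1.trans_le hu.1) le_rfl))
    fun u _ x hx => by
      rw [fisherCut, ChainBounds.cutoff_eq_zero ha hx]
      ring).integral_prod_left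
  simp only [Function.uncurry] at j3 j4
  have h2 : ∫ u in s..t, ∫ x, fisherCut V β N a (f u) x ∂(gibbs V β n) ≤
      ∫ u in s'..t, ∫ x, fisherCut V β N a (f u) x ∂(gibbs V β n) := by
    rw [intervalIntegral.integral_of_le hst, intervalIntegral.integral_of_le hst']
    refine setIntegral_mono_set j3 ?_ (Ioc_subset_Ioc_left hs'.2).eventuallyLE
    filter_upwards [ae_restrict_mem measurableSet_Ioc] with u hu
    exact integral_nonneg fun x => c.fisherCut_nonneg hN a (hs'.1.trans hu.1).le x
  have h3 : ∫ u in s'..t, ∫ x, rateBound V b B G C γ τm τ₁ K₁ N a (f u) x ∂(gibbs V β n) ≤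
      ∫ u in Ioc 0 t, ∫ x, rateBound V b B G C γ τm τ₁ K₁ N a (f u) x ∂(gibbs V β n) := by
    rw [intervalIntegral.integral_of_le hst']
    refine setIntegral_mono_set j4 ?_ (Ioc_subset_Ioc_left hs'.1.le).eventuallyLE
    filter_upwards [ae_restrict_mem measurableSet_Ioc] with u hu
    exact integral_nonneg fun x => c.rateBound_nonneg hN ha.le hu.1.le x
  have h4 := mul_le_mul_of_nonneg_left h2 (by positivity : 0 ≤ (n : ℝ) ^ 2 * γ / 2)
  linarith

end ControlledSolution
end

/-! ### Removal of the truncations -/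

theorem lintegral_ofReal_le_of_tendsto {α : Type*} [MeasurableSpace α] {μ : Measure α}
    {g : ℕ → α → ℝ} {G : α → ℝ} {e : ℕ → ℝ} {A : ℝ} (hi : ∀ m, Integrable (g m) μ)
    (h0 : ∀ m, 0 ≤ᵐ[μ] g m) (hle : ∀ m, ∫ x, g m x ∂μ ≤ e m) (he : Tendsto e atTop (𝓝 A))
    (hlim : ∀ᵐ x ∂μ, Tendsto (fun m => g m x) atTop (𝓝 (G x))) :
    ∫⁻ x, ENNReal.ofReal (G x) ∂μ ≤ ENNReal.ofReal A := by
  have e1 : ∫⁻ x, ENNReal.ofReal (G x) ∂μ =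
      ∫⁻ x, liminf (fun m => ENNReal.ofReal (g m x)) atTop ∂μ := by
    refine lintegral_congr_ae ?_
    filter_upwards [hlim] with x hx
    exact ((ENNReal.continuous_ofReal.tendsto _).comp hx).liminf_eq.symm
  rw [e1]
  refine (lintegral_liminf_le' fun m => (hi m).aestronglyMeasurable.aemeasurable.ennreal_ofReal).trans
    ?_
  rw [← ((ENNReal.continuous_ofReal.tendsto A).comp he).liminf_eq]
  refine liminf_le_liminf (Eventually.of_forall fun m => ?_)
  rw [← ofReal_integral_eq_lintegral_ofReal (hi m) (h0 m)]
  exact ENNReal.ofReal_le_ofReal (hle m)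

/-- Monotone exhaustion of the interval from the left, with no measurability of the integrand
required. -/
theorem setLIntegral_Ioc_zero_le {g : ℝ → ℝ≥0∞} {t : ℝ} {A : ℝ≥0∞}
    (h : ∀ s, 0 < s → s ≤ t → ∫⁻ u in Ioc s t, g u ≤ A) : ∫⁻ u in Ioc 0 t, g u ≤ A := by
  rcases le_or_gt t 0 with ht | ht
  · simp [Ioc_eq_empty_of_le ht]
  have e : Ioc 0 t = ⋃ m : ℕ, Ioc (t / (m + 1)) t := by
    ext u
    simp only [mem_Ioc, mem_iUnion]
    constructor
    · rintro ⟨h1, h2⟩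
      obtain ⟨m, hm⟩ := exists_nat_gt (t / u)
      refine ⟨m, ?_, h2⟩
      rw [div_lt_iff₀ (by positivity)]
      rw [div_lt_iff₀ h1] at hm
      nlinarith
    · rintro ⟨m, h1, h2⟩
      exact ⟨lt_of_lt_of_le (by positivity) h1.le, h2⟩
  have hdir : Monotone fun m : ℕ => Ioc (t / ((m : ℝ) + 1)) t := fun m k hmk =>
    Ioc_subset_Ioc_left (by gcongr)
  rw [e, setLIntegral_iUnion_of_directed _ hdir.directed_le]
  exact iSup_le fun m => h _ (by positivity)
    (div_le_self ht.le (by linarith [(Nat.cast_nonneg m : (0 : ℝ) ≤ m)]))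

/-- The levels of truncation of the entropy. -/
def lvl (m : ℕ) : ℝ := m + 1

theorem one_le_lvl (m : ℕ) : 1 ≤ lvl m := by
  unfold lvl; linarith [(Nat.cast_nonneg m : (0 : ℝ) ≤ m)]

theorem tendsto_lvl : Tendsto lvl atTop atTop :=
  tendsto_atTop_add_const_right _ _ tendsto_natCast_atTop_atTop

/-- The levels of truncation of the energy. -/
def lvlE (m : ℕ) : ℝ := (lvl m ^ 2)⁻¹

theorem lvlE_pos (m : ℕ) : 0 < lvlE m := by
  have := one_le_lvl m
  unfold lvlE; positivity

theorem lvlE_le_one (m : ℕ) : lvlE m ≤ 1 :=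
  inv_le_one_of_one_le₀ (one_le_pow₀ (one_le_lvl m))

theorem tendsto_lvlE : Tendsto lvlE atTop (𝓝 0) :=
  tendsto_inv_atTop_zero.comp ((tendsto_pow_atTop two_ne_zero).comp tendsto_lvl)

/-- The cutoff error carries the product `a N`. Choosing `a = N⁻²` makes that product tend to zero.
-/
theorem lvlE_mul (m : ℕ) : lvlE m * lvl m = (lvl m)⁻¹ := by
  have := one_le_lvl m
  unfold lvlE; field_simp

section
variable {n : ℕ} {V β τ τ' : ℝ → ℝ} {b B G C γ T τm τ₁ K₁ M : ℝ} {f : ℝ → Phase n → ℝ}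

theorem tendsto_cutoff (x : Phase n) : Tendsto (fun m => cutoff V (lvlE m) x) atTop (𝓝 1) := by
  have h : Continuous fun a : ℝ => cutoff V a x := by unfold cutoff; fun_prop
  have := (h.tendsto 0).comp tendsto_lvlE
  simpa [cutoff, Function.comp_def] using this

/-- Where `f` vanishes so does its gradient, and both sides are zero; elsewhere the curvature
converges to `1/f`. -/
theorem IsForwardSolution.tendsto_fisherCut (hf : IsForwardSolution V β γ τ n f)
    {u : ℝ} (hu : 0 < u) (x : Phase n) :
    Tendsto (fun m => fisherCut V β (lvl m) (lvlE m) (f u) x) atTop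
      (𝓝 ((∑ k, (betaAt β n k)⁻¹ * dp k (f u) x ^ 2) / f u x)) := by
  rcases (hf.nonneg u hu.le x).eq_or_lt with h0 | h0
  · have : ∀ k, dp k (f u) x = 0 := fun k => by
      rw [dp, hf.fderiv_eq_zero_of_eq_zero hu h0.symm]; rfl
    simp [fisherCut, this]
  · have h1 := (tendsto_entCurv h0).comp tendsto_lvl
    have h2 := (tendsto_cutoff (V := V) x).mul (h1.mul_const
      (∑ k, (betaAt β n k)⁻¹ * dp k (f u) x ^ 2))
    rw [one_mul, inv_mul_eq_div] at h2
    exact h2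

namespace ControlledSolution

/-- Dominated convergence with majorant proportional to `(1 + E) f`. The Legendre deficit tends to
zero, and so does the second entry of the minimum. -/
theorem tendsto_integral_truncErr (c : ControlledSolution V β b B G C γ τ τ' T τm τ₁ K₁ M n f)
    {t : ℝ} (ht : t ≤ T) :
    Tendsto (fun m => ∫ z : ℝ × Phase n, truncErr V B b γ τm (lvl m) (lvlE m) (f z.1) z.2
      ∂((volume.restrict (Ioc 0 t)).prod (gibbs V β n))) atTop (𝓝 0) := by
  have hprob := c.bounds.isProbabilityMeasure (n := n)
  have hae : ∀ᵐ z ∂((volume.restrict (Ioc 0 t)).prod (gibbs V β n)), 0 < z.1 := by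
    have : ∀ᵐ u ∂(volume.restrict (Ioc 0 t)), (0 : ℝ) < u := by
      filter_upwards [ae_restrict_mem measurableSet_Ioc] with u hu using hu.1
    exact Measure.quasiMeasurePreserving_fst.ae this
  have := tendsto_integral_of_dominated_convergence
    (μ := (volume.restrict (Ioc 0 t)).prod (gibbs V β n))
    (F := fun m z => truncErr V B b γ τm (lvl m) (lvlE m) (f z.1) z.2) (f := fun _ => 0)
    (fun z => truncConst B b γ τm K₁ n * ((1 + totalEnergy V z.2) * f z.1 z.2))
    (fun m => (c.integrable_prod_truncErr (one_le_lvl m) (lvlE_pos m).le ht).aestronglyMeasurable)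
    ((c.integrable_prod_energy ht).const_mul _) (fun m => ?_) ?_
  · simpa using this
  · filter_upwards [hae] with z hz
    have h0 := c.sol.nonneg z.1 hz.le z.2
    rw [Real.norm_eq_abs, abs_of_nonneg (c.bounds.truncErr_nonneg c.gamma_pos c.tension_nonneg
      (one_le_lvl m) (lvlE_pos m).le _ h0)]
    exact c.bounds.truncErr_le c.gamma_pos c.tension_nonneg c.K₁_nonneg c.pot_bound (one_le_lvl m) _ h0
  · filter_upwards [hae] with z hz
    have h0 := c.sol.nonneg z.1 hz.le z.2
    have hcc := c.bounds.cutoffConst_nonneg (n := n) c.gamma_pos c.tension_nonneg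
    have h1 := ((tendsto_entDual h0).comp tendsto_lvl).const_sub (f z.1 z.2)
    have h2 := (tendsto_lvlE.const_mul (ChainBounds.cutoffConst b γ τm n)).mul_const
      (1 + totalEnergy V z.2)
    have h3 := (tendsto_const_nhds (x := 2 * ChainBounds.cutoffConst b γ τm n)).min h2
    have h4 := (h1.const_mul ((n : ℝ) ^ 2 * B * τm * |pLast z.2.2|)).add
      ((h3.const_mul (B * τm * |len z.2|)).mul_const (f z.1 z.2))
    rw [sub_self, mul_zero, mul_zero, zero_mul, min_eq_right (by positivity), mul_zero,
      zero_mul, add_zero] at h4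
    exact h4

/-- The bound on the entropy in terms of a bound on the energy. -/
def entropyBound (b B G C γ T τm τ₁ K₁ κ Kκ H₀ : ℝ) (n : ℕ) (Y : ℝ → ℝ) (t : ℝ) : ℝ :=
  H₀ + 2 + B * τm * (κ * (Y t + Y 0) + 2 * (n * Kκ)) +
    growthConst b B G C γ τ₁ K₁ * (T * n + ∫ u in (0)..t, Y u)

theorem abs_integral_len_le (c : ControlledSolution V β b B G C γ τ τ' T τm τ₁ K₁ M n f)
    {κ Kκ : ℝ} (hκ : 0 ≤ κ) (hKκ : ∀ r, |r| ≤ κ * V r + Kκ) {a : ℝ} (ha : 0 ≤ a) {y u : ℝ}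
    (hu : u ∈ Icc 0 T) (hY : ∫ x, totalEnergy V x * f u x ∂(gibbs V β n) ≤ y) :
    |β 1 * (τ u * ∫ x, len x * cutoff V a x * f u x ∂(gibbs V β n))| ≤
      B * τm * (κ * y + n * Kκ) := by
  have i1 := c.sol.integrable hu.1
  have i2 := (c.energy u hu).1
  have h1 : |∫ x, len x * cutoff V a x * f u x ∂(gibbs V β n)| ≤ κ * y + n * Kκ := by
    have i3 : Integrable (fun x => κ * (totalEnergy V x * f u x) + n * Kκ * f u x) (gibbs V β n) :=
      (i2.const_mul _).add (i1.const_mul _)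
    rw [← Real.norm_eq_abs]
    refine (norm_integral_le_of_norm_le i3 (Eventually.of_forall fun x => ?_)).trans ?_
    · have h0 := c.sol.nonneg u hu.1 x
      have hl := abs_len_le hκ hKκ x
      rw [Real.norm_eq_abs, abs_mul, abs_mul, abs_of_nonneg h0, abs_of_nonneg (cutoff_nonneg a x)]
      calc |len x| * cutoff V a x * f u x ≤ |len x| * 1 * f u x := by
            gcongr; exact c.bounds.cutoff_le_one ha x
        _ ≤ (κ * totalEnergy V x + n * Kκ) * f u x := by rw [mul_one]; gcongr
        _ = _ := by ring
    · rw [integral_add (i2.const_mul _) (i1.const_mul _), integral_const_mul, integral_const_mul,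
        c.sol.integral_eq_one hu.1, mul_one]
      gcongr
  have h2 := c.bounds.beta_one_pos
  have h3 := c.bounds.beta_one_le
  have h4 := c.tension.abs_le u hu
  have h5 := c.bounds.B_pos
  have h6 := c.tension_nonneg
  rw [abs_mul, abs_mul, abs_of_pos h2, mul_assoc]
  gcongr

theorem integrable_cutoff_ent (c : ControlledSolution V β b B G C γ τ τ' T τm τ₁ K₁ M n f)
    {N : ℝ} (hN : 1 ≤ N) {a : ℝ} (ha : 0 ≤ a) {u : ℝ} (hu : 0 ≤ u) :
    Integrable (fun x => cutoff V a x * ent N (f u x)) (gibbs V β n) := by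
  refine c.bounds.integrable_cutoff_mul ha (((c.sol.integrable hu).const_mul N).mono' ?_ ?_)
  · have := c.sol.aestronglyMeasurable hu (gibbs V β n)
    have hm : Measurable (ent N) := by unfold ent; fun_prop
    exact (hm.comp_aemeasurable this.aemeasurable).aestronglyMeasurable
  · exact Eventually.of_forall fun x => abs_ent_le hN (c.sol.nonneg u hu x)

/-- The balance is expressed through an arbitrary continuous bound `Y` of the energy. The Gronwall
argument below improves `Y` by feeding the conclusion back in. -/
theorem truncated_entropy_le (c : ControlledSolution V β b B G C γ τ τ' T τm τ₁ K₁ M n f)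
    {κ Kκ H₀ : ℝ} (hκ : 0 ≤ κ) (hKκ : ∀ r, |r| ≤ κ * V r + Kκ) {Y : ℝ → ℝ} (hYc : Continuous Y)
    (hY : ∀ u ∈ Icc 0 T, ∫ x, totalEnergy V x * f u x ∂(gibbs V β n) ≤ Y u)
    (h0 : EntropyLE V β (f 0) H₀) {s t : ℝ} (hs : 0 < s) (hst : s ≤ t) (ht : t ≤ T) (m : ℕ) :
    ∫ x, cutoff V (lvlE m) x * (ent (lvl m) (f t x) + 1) ∂(gibbs V β n) + (n : ℝ) ^ 2 * γ / 2 *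
      ∫ u in s..t, ∫ x, fisherCut V β (lvl m) (lvlE m) (f u) x ∂(gibbs V β n) ≤
    entropyBound b B G C γ T τm τ₁ K₁ κ Kκ H₀ n Y t +
      (T * (cutoffErrConst b G C γ τm n * (1 + M)) * (lvl m)⁻¹ +
      ∫ z : ℝ × Phase n, truncErr V B b γ τm (lvl m) (lvlE m) (f z.1) z.2
      ∂((volume.restrict (Ioc 0 t)).prod (gibbs V β n))) := by
  have hprob := c.bounds.isProbabilityMeasure (n := n)
  have hN := one_le_lvl m
  have ha := lvlE_pos m
  have ht0 : 0 < t := hs.trans_le hst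
  have htI : t ∈ Icc 0 T := ⟨ht0.le, ht⟩
  have h0I : (0 : ℝ) ∈ Icc 0 T := ⟨le_rfl, c.time_pos.le⟩
  have hbal := c.entBalance_sub_zero_le hN ha (lvlE_le_one m) hs hst ht
  have w1 := (abs_le.1 (c.abs_integral_len_le hκ hKκ ha.le htI (hY t htI))).2
  have w2 := (abs_le.1 (c.abs_integral_len_le hκ hKκ ha.le h0I (hY 0 h0I))).1
  have ic : Integrable (cutoff V (lvlE m) : Phase n → ℝ) (gibbs V β n) := by
    simpa using c.bounds.integrable_cutoff_mul ha.le (integrable_const (1 : ℝ))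
  have ie : ∀ u, 0 ≤ u → ∫ x, cutoff V (lvlE m) x * (ent (lvl m) (f u x) + 1) ∂(gibbs V β n) =
      ∫ x, cutoff V (lvlE m) x * ent (lvl m) (f u x) ∂(gibbs V β n) +
        ∫ x, cutoff V (lvlE m) x ∂(gibbs V β n) := fun u hu => by
    simp only [mul_add, mul_one]
    exact integral_add (c.integrable_cutoff_ent hN ha.le hu) ic
  -- Adding `1` makes the truncated entropy nonnegative, so the cutoff can be dropped. One unit of
  -- the `2` is this shift, the other bounds `(lvl m)⁻¹`.
  have hin : ∫ x, cutoff V (lvlE m) x * (ent (lvl m) (f 0 x) + 1) ∂(gibbs V β n) ≤ H₀ + 2 := by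
    have i3 : Integrable (fun x => f 0 x * Real.log (f 0 x) + 2) (gibbs V β n) :=
      h0.1.add (integrable_const _)
    calc _ ≤ ∫ x, (f 0 x * Real.log (f 0 x) + 2) ∂(gibbs V β n) := by
          refine integral_mono ?_ i3 fun x => ?_
          · simp only [mul_add, mul_one]
            exact (c.integrable_cutoff_ent hN ha.le le_rfl).add ic
          · have f0 := c.sol.nonneg 0 le_rfl x
            have e1 := neg_one_le_ent hN f0
            have e2 := ent_le hN f0
            have e3 : (lvl m)⁻¹ ≤ 1 := inv_le_one_of_one_le₀ hN
            have e4 := c.bounds.cutoff_le_one ha.le x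
            dsimp only
            nlinarith [cutoff_nonneg (V := V) (lvlE m) x]
      _ ≤ H₀ + 2 := by
          rw [integral_add h0.1 (integrable_const _)]
          simpa using h0.2
  have hrate : ∫ u in Ioc 0 t, ∫ x, rateBound V b B G C γ τm τ₁ K₁ (lvl m) (lvlE m) (f u) x
      ∂(gibbs V β n) ≤ growthConst b B G C γ τ₁ K₁ * (T * n + ∫ u in (0)..t, Y u) +
      (T * (cutoffErrConst b G C γ τm n * (1 + M)) * (lvl m)⁻¹ +
      ∫ z : ℝ × Phase n, truncErr V B b γ τm (lvl m) (lvlE m) (f z.1) z.2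
      ∂((volume.restrict (Ioc 0 t)).prod (gibbs V β n))) := by
    have j1 := c.integrable_prod_truncErr hN ha.le ht
    have j2 := j1.integral_prod_left
    have j3 := (c.integrable_prod_rateBound hN ha.le ht).integral_prod_left
    simp only [Function.uncurry] at j1 j2 j3
    rw [integral_prod (fun z : ℝ × Phase n => truncErr V B b γ τm (lvl m) (lvlE m) (f z.1) z.2) j1]
    set k1 := cutoffErrConst b G C γ τm n * (1 + M) * (lvl m)⁻¹ with hk1
    have g0 := c.growthConst_nonneg
    set g := growthConst b B G C γ τ₁ K₁ with hg
    have j4 : IntegrableOn (fun u => k1 + g * (n + Y u)) (Ioc 0 t) :=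
      (Continuous.integrableOn_Icc (by fun_prop)).mono_set Ioc_subset_Icc_self
    have j5 : IntegrableOn Y (Ioc 0 t) :=
      (Continuous.integrableOn_Icc (by fun_prop)).mono_set Ioc_subset_Icc_self
    have hk1' : 0 ≤ k1 := by
      have := c.cutoffErrConst_nonneg
      have := c.M_nonneg
      positivity
    calc _ ≤ ∫ u in Ioc 0 t, ((k1 + g * (n + Y u)) +
          ∫ x, truncErr V B b γ τm (lvl m) (lvlE m) (f u) x ∂(gibbs V β n)) := by
          refine setIntegral_mono_on j3 (j4.add j2) measurableSet_Ioc fun u hu => ?_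
          have huT : u ∈ Ioc 0 T := ⟨hu.1, hu.2.trans ht⟩
          have huI : u ∈ Icc 0 T := ⟨hu.1.le, huT.2⟩
          rw [(c.integrable_rateBound hN ha.le huT).2, mul_assoc _ (lvlE m), lvlE_mul]
          have q1 := hY u huI
          have q2 := (c.energy u huI).2
          have q3 := c.cutoffErrConst_nonneg
          have q4 : cutoffErrConst b G C γ τm n * (lvl m)⁻¹ *
              (1 + ∫ x, totalEnergy V x * f u x ∂(gibbs V β n)) ≤ k1 := by
            rw [hk1, mul_right_comm]; gcongr
          gcongr
      _ = k1 * t + g * (n * t + ∫ u in (0)..t, Y u) + _ := by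
          rw [integral_add j4 j2]
          congr 1
          have j6 : IntegrableOn (fun u => g * (n + Y u)) (Ioc 0 t) :=
            (Continuous.integrableOn_Icc (by fun_prop)).mono_set Ioc_subset_Icc_self
          have e1 : ∫ u in Ioc 0 t, g * (n + Y u) = g * (n * t + ∫ u in (0)..t, Y u) := by
            rw [integral_const_mul, integral_add (integrable_const _) j5,
              intervalIntegral.integral_of_le ht0.le]
            simp [ht0.le, mul_comm]
          have e2 : ∫ _ in Ioc 0 t, k1 = k1 * t := by simp [ht0.le, mul_comm]
          rw [integral_add (integrable_const _) j6, e1, e2]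
      _ ≤ k1 * T + g * (n * T + ∫ u in (0)..t, Y u) + _ := by gcongr
      _ = _ := by rw [hk1]; ring
  rw [entBalance, entBalance] at hbal
  rw [ie t ht0.le]
  rw [ie 0 le_rfl] at hin
  rw [entropyBound]
  linarith

end ControlledSolution
end

section
variable {n : ℕ} {V β τ τ' : ℝ → ℝ} {b B G C γ T τm τ₁ K₁ M : ℝ} {f : ℝ → Phase n → ℝ}

theorem ae_lt_fst (s t : ℝ) :
    ∀ᵐ z ∂((volume.restrict (Ioc s t)).prod (gibbs V β n)), s < z.1 := by
  have : ∀ᵐ u ∂(volume.restrict (Ioc s t)), s < u := by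
    filter_upwards [ae_restrict_mem measurableSet_Ioc] with u hu using hu.1
  exact Measure.quasiMeasurePreserving_fst.ae this

/-- The function `s log s - s + 1` is nonnegative and suits Fatou's lemma. Both `f` and the constant
`1` have mass one, so its integral is the entropy. -/
theorem IsForwardSolution.entropyLE_of_lintegral (hf : IsForwardSolution V β γ τ n f)
    (h : ChainBounds V β b B G C) {t A : ℝ} (ht : 0 ≤ t) (hA : 0 ≤ A)
    (hle : ∫⁻ x, ENNReal.ofReal (f t x * Real.log (f t x) - f t x + 1) ∂(gibbs V β n) ≤
      ENNReal.ofReal A) : EntropyLE V β (f t) A := by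
  have hprob := h.isProbabilityMeasure (n := n)
  have hm := (hf.aestronglyMeasurable ht (gibbs V β n)).aemeasurable
  have hm2 : AEMeasurable (fun x => f t x * Real.log (f t x) - f t x + 1) (gibbs V β n) :=
    ((hm.mul (Real.measurable_log.comp_aemeasurable hm)).sub hm).add_const 1
  have h0 : ∀ x, 0 ≤ f t x * Real.log (f t x) - f t x + 1 := fun x => by
    have := mul_le_mul_log_add_exp (hf.nonneg t ht x) 0
    simp at this; linarith
  have hi : Integrable (fun x => f t x * Real.log (f t x) - f t x + 1) (gibbs V β n) := by
    refine ⟨hm2.aestronglyMeasurable, ?_⟩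
    rw [hasFiniteIntegral_iff_ofReal (Eventually.of_forall h0)]
    exact hle.trans_lt ENNReal.ofReal_lt_top
  have hi2 : Integrable (fun x => f t x * Real.log (f t x)) (gibbs V β n) := by
    refine ((hi.add (hf.integrable ht)).sub (integrable_const 1)).congr
      (Eventually.of_forall fun x => ?_)
    simp only [Pi.add_apply, Pi.sub_apply]; ring
  refine ⟨hi2, ?_⟩
  have e : ∫ x, (f t x * Real.log (f t x) - f t x + 1) ∂(gibbs V β n) =
      ∫ x, f t x * Real.log (f t x) ∂(gibbs V β n) := by
    rw [integral_add (by exact hi2.sub (hf.integrable ht)) (integrable_const _),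
      integral_sub hi2 (hf.integrable ht), hf.integral_eq_one ht]
    simp
  rw [← e, integral_eq_lintegral_of_nonneg_ae (Eventually.of_forall h0) hi.aestronglyMeasurable]
  exact ENNReal.toReal_le_of_le_ofReal hA hle

theorem IsForwardSolution.aemeasurable_fisherP_integrand (hf : IsForwardSolution V β γ τ n f)
    (h : ChainBounds V β b B G C) {s t : ℝ} (hs : 0 ≤ s) :
    AEMeasurable (fun z : ℝ × Phase n => ENNReal.ofReal
      ((∑ k, (betaAt β n k)⁻¹ * dp k (f z.1) z.2 ^ 2) / f z.1 z.2))
      ((volume.restrict (Ioc s t)).prod (gibbs V β n)) := by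
  have hprob := h.isProbabilityMeasure (n := n)
  have hsub : Ioc s t ×ˢ (univ : Set (Phase n)) ⊆ Ioi 0 ×ˢ univ :=
    prod_mono (fun u hu => hs.trans_lt hu.1) le_rfl
  have hms : MeasurableSet (Ioc s t ×ˢ (univ : Set (Phase n))) :=
    measurableSet_Ioc.prod MeasurableSet.univ
  have h4 : ContinuousOn (fun z : ℝ × Phase n =>
      ∑ k, (betaAt β n k)⁻¹ * dp k (f z.1) z.2 ^ 2) (Ioi 0 ×ˢ univ) :=
    continuousOn_finsetSum _ fun k _ =>
      continuousOn_const.mul ((hf.continuousOn_dp k).pow 2)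
  rw [show (volume.restrict (Ioc s t)).prod (gibbs V β n) =
    ((volume : Measure ℝ).prod (gibbs V β n)).restrict (Ioc s t ×ˢ univ) by
      rw [← Measure.prod_restrict, Measure.restrict_univ]]
  exact (((h4.mono hsub).aemeasurable hms).div
    ((hf.continuousOn.mono hsub).aemeasurable hms)).ennreal_ofReal

namespace ControlledSolution

theorem integral_cutoff_ent_add_one_nonneg
    (c : ControlledSolution V β b B G C γ τ τ' T τm τ₁ K₁ M n f) {N : ℝ} (hN : 1 ≤ N) (a : ℝ)
    {t : ℝ} (ht : 0 ≤ t) : ∀ x, 0 ≤ cutoff V a x * (ent N (f t x) + 1) := fun x =>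
  mul_nonneg (cutoff_nonneg a x) (by linarith [neg_one_le_ent hN (c.sol.nonneg t ht x)])

theorem integrable_prod_fisherCut (c : ControlledSolution V β b B G C γ τ τ' T τm τ₁ K₁ M n f)
    {N : ℝ} (hN : 1 ≤ N) {a : ℝ} (ha : 0 < a) {s t : ℝ} (hs : 0 < s) :
    Integrable (Function.uncurry fun u => fisherCut V β N a (f u))
      ((volume.restrict (Ioc s t)).prod (gibbs V β n)) :=
  c.bounds.integrable_prod_of_compact (F := fun u => fisherCut V β N a (f u))
    (c.bounds.isCompact_sublevel (n := n) (1 / a))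
    ((c.sol.continuousOn_fisherCut c.bounds hN a).mono
      (prod_mono (fun _ hu => hs.trans_le hu.1) le_rfl))
    fun u _ x hx => by
      rw [fisherCut, ChainBounds.cutoff_eq_zero ha hx]
      ring

theorem lintegral_fisherP_eq (c : ControlledSolution V β b B G C γ τ τ' T τm τ₁ K₁ M n f)
    {s t : ℝ} (hs : 0 < s) :
    ∫⁻ u in Ioc s t, fisherP V β (f u) = ∫⁻ z : ℝ × Phase n, ENNReal.ofReal
      ((∑ k, (betaAt β n k)⁻¹ * dp k (f z.1) z.2 ^ 2) / f z.1 z.2)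
      ∂((volume.restrict (Ioc s t)).prod (gibbs V β n)) := by
  have hprob := c.bounds.isProbabilityMeasure (n := n)
  rw [lintegral_prod _ (c.sol.aemeasurable_fisherP_integrand c.bounds hs.le)]; rfl

/-- Both terms on the left of the truncated inequality are nonnegative, so Fatou's lemma applies to
each separately, with the same limiting bound. -/
theorem entropy_and_fisherP_le (c : ControlledSolution V β b B G C γ τ τ' T τm τ₁ K₁ M n f)
    {κ Kκ H₀ : ℝ} (hκ : 0 ≤ κ) (hKκ : ∀ r, |r| ≤ κ * V r + Kκ) {Y : ℝ → ℝ} (hYc : Continuous Y)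
    (hY : ∀ u ∈ Icc 0 T, ∫ x, totalEnergy V x * f u x ∂(gibbs V β n) ≤ Y u)
    (h0 : EntropyLE V β (f 0) H₀) {t A : ℝ} (ht0 : 0 < t) (ht : t ≤ T)
    (hA : entropyBound b B G C γ T τm τ₁ K₁ κ Kκ H₀ n Y t ≤ A) (hA0 : 0 ≤ A) :
    EntropyLE V β (f t) A ∧ ENNReal.ofReal ((n : ℝ) ^ 2 * γ / 2) *
      ∫⁻ s in Ioc 0 t, fisherP V β (f s) ≤ ENNReal.ofReal A := by
  have hprob := c.bounds.isProbabilityMeasure (n := n)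
  have hγ := c.gamma_pos
  have hc0 : 0 ≤ (n : ℝ) ^ 2 * γ / 2 := by positivity
  set e : ℕ → ℝ := fun m => A + (T * (cutoffErrConst b G C γ τm n * (1 + M)) * (lvl m)⁻¹ +
      ∫ z : ℝ × Phase n, truncErr V B b γ τm (lvl m) (lvlE m) (f z.1) z.2
      ∂((volume.restrict (Ioc 0 t)).prod (gibbs V β n))) with he
  have he' : Tendsto e atTop (𝓝 A) := by
    have h1 := ((tendsto_inv_atTop_zero.comp tendsto_lvl).const_mul
      (T * (cutoffErrConst b G C γ τm n * (1 + M)))).add (c.tendsto_integral_truncErr ht)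
    have h2 := h1.const_add A
    simpa using h2
  have key : ∀ s, 0 < s → s ≤ t → ∀ m,
      ∫ x, cutoff V (lvlE m) x * (ent (lvl m) (f t x) + 1) ∂(gibbs V β n) + (n : ℝ) ^ 2 * γ / 2 *
      ∫ u in s..t, ∫ x, fisherCut V β (lvl m) (lvlE m) (f u) x ∂(gibbs V β n) ≤ e m :=
    fun s hs hst m => (c.truncated_entropy_le hκ hKκ hYc hY h0 hs hst ht m).trans
      (add_le_add hA le_rfl)
  have hp : ∀ m, 0 ≤ ∫ x, cutoff V (lvlE m) x * (ent (lvl m) (f t x) + 1) ∂(gibbs V β n) :=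
    fun m => integral_nonneg (c.integral_cutoff_ent_add_one_nonneg (one_le_lvl m) _ ht0.le)
  constructor
  · refine c.sol.entropyLE_of_lintegral c.bounds ht0.le hA0 ?_
    refine lintegral_ofReal_le_of_tendsto (e := e)
      (g := fun m x => cutoff V (lvlE m) x * (ent (lvl m) (f t x) + 1)) (fun m => ?_)
      (fun m => Eventually.of_forall
        (c.integral_cutoff_ent_add_one_nonneg (one_le_lvl m) _ ht0.le))
      (fun m => ?_) he' (Eventually.of_forall fun x => ?_)
    · simp only [mul_add, mul_one]
      refine (c.integrable_cutoff_ent (one_le_lvl m) (lvlE_pos m).le ht0.le).add ?_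
      simpa using c.bounds.integrable_cutoff_mul (lvlE_pos m).le (integrable_const (1 : ℝ))
    · simpa using key t ht0 le_rfl m
    · have h1 := ((tendsto_ent (c.sol.nonneg t ht0.le x)).comp tendsto_lvl).add_const 1
      simpa using (tendsto_cutoff (V := V) x).mul h1
  · have hm : ∀ s, 0 < s → s ≤ t → ENNReal.ofReal ((n : ℝ) ^ 2 * γ / 2) *
        ∫⁻ u in Ioc s t, fisherP V β (f u) ≤ ENNReal.ofReal A := by
      intro s hs hst
      have hae := ae_lt_fst (n := n) (V := V) (β := β) s t
      rw [c.lintegral_fisherP_eq hs]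
      rw [← lintegral_const_mul' _ _ ENNReal.ofReal_ne_top]
      simp only [← ENNReal.ofReal_mul hc0]
      refine lintegral_ofReal_le_of_tendsto (e := e)
        (g := fun m (z : ℝ × Phase n) => (n : ℝ) ^ 2 * γ / 2 *
        fisherCut V β (lvl m) (lvlE m) (f z.1) z.2)
        (fun m => (c.integrable_prod_fisherCut (one_le_lvl m) (lvlE_pos m) hs).const_mul _)
        (fun m => ?_) (fun m => ?_) he' ?_
      · filter_upwards [hae] with z hz
        exact mul_nonneg hc0 (c.fisherCut_nonneg (one_le_lvl m) _ (hs.trans hz).le z.2)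
      · have j := c.integrable_prod_fisherCut (one_le_lvl m) (lvlE_pos m) hs (t := t)
        have h1 := key s hs hst m
        rw [integral_const_mul, integral_prod (fun z : ℝ × Phase n =>
          fisherCut V β (lvl m) (lvlE m) (f z.1) z.2) j]
        rw [intervalIntegral.integral_of_le hst] at h1
        have := hp m
        dsimp only
        linarith
      · filter_upwards [hae] with z hz
        exact (c.sol.tendsto_fisherCut (hs.trans hz) z.2).const_mul _
    rw [← lintegral_const_mul' _ _ ENNReal.ofReal_ne_top]
    refine setLIntegral_Ioc_zero_le fun s hs hst => ?_
    rw [lintegral_const_mul' _ _ ENNReal.ofReal_ne_top]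
    exact hm s hs hst

end ControlledSolution
end

/-! ### Gronwall argument for entropy and energy -/

theorem EntropyLE.mono {n : ℕ} {V β : ℝ → ℝ} {g : Phase n → ℝ} {a c : ℝ}
    (h : EntropyLE V β g a) (hac : a ≤ c) : EntropyLE V β g c := ⟨h.1, h.2.trans hac⟩

/-- The map `m ↦ Q + m/2` has fixed point `2 Q` and halves the distance to it, so the influence of
the starting value fades out. -/
theorem le_of_half_step {P : ℝ → Prop} {Q M : ℝ} (hM : P M)
    (hstep : ∀ m, P m → P (Q + m / 2)) (k : ℕ) : P (2 * Q + (M - 2 * Q) / 2 ^ k) := by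
  induction k with
  | zero => simpa using hM
  | succ k ih =>
    have := hstep _ ih
    convert this using 1
    rw [pow_succ]; field_simp; ring

theorem integral_mul_exp_le {m l t : ℝ} (hm : 0 ≤ m) (hl : 0 < l) :
    ∫ u in (0)..t, m * Real.exp (l * u) ≤ m * Real.exp (l * t) / l := by
  have h1 : ∀ u ∈ uIcc 0 t, HasDerivAt (fun u => m * Real.exp (l * u) / l)
      (m * Real.exp (l * u)) u := fun u _ => by
    have := (((hasDerivAt_id u).const_mul l).exp.const_mul m).div_const l
    refine this.congr_deriv ?_
    simp only [id]; field_simp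
  rw [intervalIntegral.integral_eq_sub_of_hasDerivAt h1
    (Continuous.intervalIntegrable (by fun_prop) _ _)]
  have : 0 ≤ m * Real.exp (l * 0) / l := by positivity
  linarith

section
variable {n : ℕ} {V β τ τ' : ℝ → ℝ} {b B G C γ T τm τ₁ K₁ M : ℝ} {f : ℝ → Phase n → ℝ}

namespace ControlledSolution

/-- The self-improving exponential bound of the energy. -/
theorem entropyBound_le (c : ControlledSolution V β b B G C γ τ τ' T τm τ₁ K₁ M n f)
    {κ Kκ D l : ℝ} (hκ : 0 ≤ κ) (hl : 0 < l) {m t : ℝ} (hm : 0 ≤ m)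
    (ht : t ∈ Icc 0 T) :
    entropyBound b B G C γ T τm τ₁ K₁ κ Kκ (D * n) n (fun u => m * Real.exp (l * u)) t ≤
      (D + 2 + 2 * B * τm * Kκ + growthConst b B G C γ τ₁ K₁ * T) * n +
        (2 * B * τm * κ + growthConst b B G C γ τ₁ K₁ / l) * (m * Real.exp (l * t)) := by
  have hn : (1 : ℝ) ≤ n := by exact_mod_cast c.one_le
  have h1 : m * Real.exp (l * 0) ≤ m * Real.exp (l * t) := by
    have := ht.1; gcongr
  have h2 := integral_mul_exp_le (t := t) hm hl
  have hB := c.bounds.B_pos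
  have hτ := c.tension_nonneg
  have hg := c.growthConst_nonneg
  have h3 := mul_le_mul_of_nonneg_left h1 (by positivity : 0 ≤ B * τm * κ)
  have h4 := mul_le_mul_of_nonneg_left h2 hg
  rw [entropyBound]
  have e : growthConst b B G C γ τ₁ K₁ / l * (m * Real.exp (l * t)) =
    growthConst b B G C γ τ₁ K₁ * (m * Real.exp (l * t) / l) := by ring
  rw [add_mul _ _ (m * Real.exp (l * t)), e]
  linarith

end ControlledSolution

set_option maxHeartbeats 1000000 in
/-- The entropy, energy and velocity Fisher information bounds, uniformly in the size. -/
theorem ChainBounds.exists_entropy_bound (h : ChainBounds V β b B G C) {τ : ℝ → ℝ}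
    (hγ : 0 < γ) (hτ : ContDiffOn ℝ 1 τ (Ici 0)) (C₀ : ℝ) (hT : 0 < T) :
    ∃ A, 0 ≤ A ∧ ∀ n : ℕ, 1 ≤ n → ∀ f : ℝ → Phase n → ℝ, IsForwardSolution V β γ τ n f →
      EntropyLE V β (f 0) (C₀ * n) → ∀ t ∈ Icc 0 T, EntropyLE V β (f t) (A * n) ∧
        ∫⁻ s in Ioc 0 t, fisherP V β (f s) ≤ ENNReal.ofReal (A / n) ∧
        Integrable (fun x => totalEnergy V x * f t x) (gibbs V β n) ∧
        ∫ x, totalEnergy V x * f t x ∂(gibbs V β n) ≤ A * n := by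
  obtain ⟨τ', τm, τ₁, hτb⟩ := exists_tensionBounds hτ T
  obtain ⟨K, hK0, hK⟩ := h.exists_exp_moment
  obtain ⟨K₁, hK₁0, hK₁⟩ := h.pot.abs_le one_pos
  simp only [one_mul] at hK₁
  have hb := h.b_pos
  have hB := h.B_pos
  have hC := h.C_pos
  have hτm : 0 ≤ τm := (abs_nonneg _).trans (hτb.abs_le 0 ⟨le_rfl, hT.le⟩)
  have hτ₁ : 0 ≤ τ₁ := (abs_nonneg _).trans (hτb.abs_deriv_le 0 ⟨le_rfl, hT.le⟩)
  set g := growthConst b B G C γ τ₁ K₁ with hg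
  have hg0 : 0 ≤ g := by rw [hg]; unfold growthConst; positivity
  -- Small enough that the length correction, after multiplication by the factor `2/b` of the
  -- entropy inequality, uses at most one quarter.
  set κ := (1 + 16 * B * τm / b)⁻¹ with hκ
  have hκ0 : 0 < κ := by positivity
  obtain ⟨Kκ, hKκ0, hKκ⟩ := h.pot.abs_le hκ0
  -- Against the weight `exp (l u)` the time integral of the energy gains `1/l`, so that it also
  -- uses at most one quarter.
  set l := 1 + 8 * g / b with hl
  have hl0 : 0 < l := by positivity
  set D := |C₀|
  have hD : 0 ≤ D := abs_nonneg _
  set Q₀ := D + 2 + 2 * B * τm * Kκ + g * T with hQ₀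
  have hQ₀0 : 0 ≤ Q₀ := by positivity
  set Q := 2 / b * (Q₀ + K) with hQ
  have hQ0 : 0 ≤ Q := by positivity
  set q := 2 * B * τm * κ + g / l with hq
  have hq0 : 0 ≤ q := by positivity
  have hqb : 2 / b * q ≤ 1 / 2 := by
    have e1 : 2 / b * (2 * B * τm * κ) ≤ 1 / 4 := by
      rw [hκ, show 2 / b * (2 * B * τm * (1 + 16 * B * τm / b)⁻¹) =
        (4 * B * τm / b) / (1 + 16 * B * τm / b) by field_simp; ring]
      rw [div_le_iff₀ (by positivity)]
      have : 16 * B * τm / b = 4 * (4 * B * τm / b) := by ring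
      rw [this]; linarith
    have e2 : 2 / b * (g / l) ≤ 1 / 4 := by
      rw [hl, show 2 / b * (g / (1 + 8 * g / b)) = (2 * g / b) / (1 + 8 * g / b) by field_simp]
      rw [div_le_iff₀ (by positivity)]
      have : 8 * g / b = 4 * (2 * g / b) := by ring
      rw [this]; linarith
    rw [hq, mul_add]; linarith
  set A₁ := Q₀ + q * (2 * Q * Real.exp (l * T)) with hA₁
  have hA₁0 : 0 ≤ A₁ := by positivity
  refine ⟨A₁ + 2 * Q * Real.exp (l * T) + 2 * A₁ / γ, by positivity, fun n hn f hf h0 => ?_⟩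
  have hn1 : (1 : ℝ) ≤ n := by exact_mod_cast hn
  have h0' : EntropyLE V β (f 0) (D * n) := h0.mono (by gcongr; exact le_abs_self _)
  obtain ⟨hE0, hE0'⟩ := integral_energy_le_entropy h (hK n) (hf.integrable le_rfl)
    (hf.nonneg 0 le_rfl) (hf.integral_eq_one le_rfl) h0'.1
  -- This bound depends on the solution and on `n`. It only starts the iteration.
  obtain ⟨M, hM0, hM⟩ := hf.exists_energy_bound h hγ hτb.continuousOn hτb.abs_le hE0
  have c : ControlledSolution V β b B G C γ τ τ' T τm τ₁ K₁ M n f :=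
    ⟨h, hf, hn, hγ, hT, hτb, hK₁0, hK₁, hM0, hM⟩
  have hbound : ∀ m, 0 ≤ m → (∀ u ∈ Icc 0 T, ∫ x, totalEnergy V x * f u x ∂(gibbs V β n) ≤
      m * Real.exp (l * u)) → ∀ t, 0 < t → t ≤ T →
      EntropyLE V β (f t) (Q₀ * n + q * (m * Real.exp (l * t))) ∧
      ENNReal.ofReal ((n : ℝ) ^ 2 * γ / 2) * ∫⁻ s in Ioc 0 t, fisherP V β (f s) ≤
        ENNReal.ofReal (Q₀ * n + q * (m * Real.exp (l * t))) := fun m hm hY t ht ht' =>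
    c.entropy_and_fisherP_le hκ0.le hKκ (Y := fun u => m * Real.exp (l * u)) (by fun_prop) hY h0'
      ht ht' (c.entropyBound_le hκ0.le hl0 hm ⟨ht.le, ht'⟩) (by positivity)
  -- From an energy bound to an entropy bound and back to the energy; the weights chosen above halve
  -- the constant.
  have hstep : ∀ m, (0 ≤ m ∧ ∀ u ∈ Icc 0 T, ∫ x, totalEnergy V x * f u x ∂(gibbs V β n) ≤
      m * Real.exp (l * u)) → (0 ≤ Q * n + m / 2 ∧ ∀ u ∈ Icc 0 T,
      ∫ x, totalEnergy V x * f u x ∂(gibbs V β n) ≤ (Q * n + m / 2) * Real.exp (l * u)) := by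
    rintro m ⟨hm, hY⟩
    refine ⟨by positivity, fun u hu => ?_⟩
    have hexp : 1 ≤ Real.exp (l * u) := Real.one_le_exp (mul_nonneg hl0.le hu.1)
    rcases hu.1.eq_or_lt with rfl | hu0
    · have e1 : ∫ x, totalEnergy V x * f 0 x ∂(gibbs V β n) ≤ 2 / b * (D * n + K * n) := by
        rw [div_mul_eq_mul_div, le_div_iff₀ hb]
        have := h0'.2; linarith
      have e2 : 2 / b * (D * n + K * n) ≤ Q * n := by
        rw [hQ, mul_assoc, add_mul]
        gcongr
        have : 0 ≤ 2 * B * τm * Kκ + g * T := by positivity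
        linarith
      exact (e1.trans e2).trans ((le_add_of_nonneg_right (by positivity)).trans
        (le_mul_of_one_le_right (by positivity) hexp))
    · have hent := (hbound m hm hY u hu0 hu.2).1
      have := (integral_energy_le_entropy h (hK n) (hf.integrable hu.1)
        (hf.nonneg u hu.1) (hf.integral_eq_one hu.1) hent.1).2
      have e1 : ∫ x, totalEnergy V x * f u x ∂(gibbs V β n) ≤
          2 / b * (Q₀ * n + q * (m * Real.exp (l * u)) + K * n) := by
        rw [div_mul_eq_mul_div, le_div_iff₀ hb]
        have := hent.2; linarith
      refine e1.trans ?_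
      have e2 : 2 / b * (Q₀ * n + q * (m * Real.exp (l * u)) + K * n) =
        Q * n + (2 / b * q) * (m * Real.exp (l * u)) := by rw [hQ]; ring
      rw [e2]
      have e3 := mul_le_mul_of_nonneg_right hqb (by positivity : 0 ≤ m * Real.exp (l * u))
      have e4 := le_mul_of_one_le_right (by positivity : 0 ≤ Q * n) hexp
      rw [add_mul (Q * n)]
      linarith
  have hstart : 0 ≤ M ∧ ∀ u ∈ Icc 0 T, ∫ x, totalEnergy V x * f u x ∂(gibbs V β n) ≤
      M * Real.exp (l * u) := ⟨hM0, fun u hu => (hM u hu).2.trans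
    (le_mul_of_one_le_right hM0 (Real.one_le_exp (mul_nonneg hl0.le hu.1)))⟩
  have hfin : ∀ u ∈ Icc 0 T, ∫ x, totalEnergy V x * f u x ∂(gibbs V β n) ≤
      2 * (Q * n) * Real.exp (l * u) := by
    intro u hu
    -- Infinitely many improvements remove `M` and leave a bound proportional to `n`.
    have hlim : Tendsto (fun k : ℕ => (2 * (Q * n) + (M - 2 * (Q * n)) / 2 ^ k) *
        Real.exp (l * u)) atTop (𝓝 (2 * (Q * n) * Real.exp (l * u))) := by
      have h1 : Tendsto (fun k : ℕ => (M - 2 * (Q * n)) / (2 : ℝ) ^ k) atTop (𝓝 0) :=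
        tendsto_const_nhds.div_atTop (tendsto_pow_atTop_atTop_of_one_lt (by norm_num))
      simpa using (h1.const_add (2 * (Q * n))).mul_const (Real.exp (l * u))
    refine ge_of_tendsto' hlim fun k => (le_of_half_step
      (P := fun m => 0 ≤ m ∧ ∀ u ∈ Icc 0 T, ∫ x, totalEnergy V x * f u x ∂(gibbs V β n) ≤
      m * Real.exp (l * u)) hstart hstep k).2 u hu
  intro t ht
  have hle2 : 2 * Q * Real.exp (l * T) ≤ A₁ + 2 * Q * Real.exp (l * T) + 2 * A₁ / γ := by
    have : 0 ≤ 2 * A₁ / γ := by positivity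
    linarith
  have hexp : Real.exp (l * t) ≤ Real.exp (l * T) := by have := ht.2; gcongr
  have hA : A₁ ≤ A₁ + 2 * Q * Real.exp (l * T) + 2 * A₁ / γ := by
    have : 0 ≤ 2 * A₁ / γ + 2 * Q * Real.exp (l * T) := by positivity
    linarith
  have hE2 : ∫ x, totalEnergy V x * f t x ∂(gibbs V β n) ≤
      (A₁ + 2 * Q * Real.exp (l * T) + 2 * A₁ / γ) * n := by
    refine (hfin t ht).trans ?_
    calc 2 * (Q * n) * Real.exp (l * t) ≤ 2 * (Q * n) * Real.exp (l * T) := by gcongr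
      _ = 2 * Q * Real.exp (l * T) * n := by ring
      _ ≤ _ := by gcongr
  rcases ht.1.eq_or_lt with rfl | ht0
  · refine ⟨h0'.mono ?_, by simp, (hM 0 ht).1, hE2⟩
    gcongr
    refine le_trans ?_ hA
    have : 0 ≤ 2 * B * τm * Kκ + g * T := by positivity
    have : 0 ≤ q * (2 * Q * Real.exp (l * T)) := by positivity
    rw [hA₁, hQ₀]; linarith
  · obtain ⟨r1, r2⟩ := hbound (2 * (Q * n)) (by positivity) hfin t ht0 ht.2
    have r3 : Q₀ * n + q * (2 * (Q * n) * Real.exp (l * t)) ≤ A₁ * n := by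
      calc Q₀ * n + q * (2 * (Q * n) * Real.exp (l * t)) ≤
          Q₀ * n + q * (2 * (Q * n) * Real.exp (l * T)) := by gcongr
        _ = _ := by rw [hA₁]; ring
    refine ⟨r1.mono (r3.trans (by gcongr)), ?_, (hM t ht).1, hE2⟩
    have hc : 0 < (n : ℝ) ^ 2 * γ / 2 := by positivity
    have r4 := r2.trans (ENNReal.ofReal_le_ofReal r3)
    rw [mul_comm, ← ENNReal.le_div_iff_mul_le (Or.inl (by simpa using hc))
      (Or.inl ENNReal.ofReal_ne_top), ← ENNReal.ofReal_div_of_pos hc] at r4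
    refine r4.trans (ENNReal.ofReal_le_ofReal ?_)
    have : A₁ * n / ((n : ℝ) ^ 2 * γ / 2) = (2 * A₁ / γ) / n := by field_simp
    rw [this]
    gcongr
    have : 0 ≤ 2 * Q * Real.exp (l * T) := by positivity
    linarith

end

/-! ### The convex difference functional -/

/-- The relative difference of two nonnegative numbers. -/
def relDiff (ε a c : ℝ) : ℝ := (a - c) / (a + c + ε)

/-- A convex function of two nonnegative numbers which measures their difference. -/
def sqDiff (ε a c : ℝ) : ℝ := (a - c) ^ 2 / (a + c + ε)

section Scalar
variable {ε a c : ℝ}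

theorem sqDiff_nonneg (hε : 0 < ε) (ha : 0 ≤ a) (hc : 0 ≤ c) : 0 ≤ sqDiff ε a c := by
  unfold sqDiff; positivity

theorem abs_relDiff_le (hε : 0 < ε) (ha : 0 ≤ a) (hc : 0 ≤ c) : |relDiff ε a c| ≤ 1 := by
  rw [relDiff, abs_div, abs_of_pos (by positivity : 0 < a + c + ε), div_le_one (by positivity),
    abs_le]
  constructor <;> linarith

theorem sqDiff_eq (hε : 0 < ε) (ha : 0 ≤ a) (hc : 0 ≤ c) :
    sqDiff ε a c = relDiff ε a c ^ 2 * (a + c + ε) := by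
  unfold sqDiff relDiff; field_simp

theorem sqDiff_le (hε : 0 < ε) (ha : 0 ≤ a) (hc : 0 ≤ c) : sqDiff ε a c ≤ a + c := by
  rw [sqDiff, div_le_iff₀ (by positivity)]
  nlinarith [mul_nonneg ha hc]

theorem hasDerivAt_relDiff {u v : ℝ → ℝ} {u' v' t : ℝ} (hu : HasDerivAt u u' t)
    (hv : HasDerivAt v v' t) (hm : u t + v t + ε ≠ 0) :
    HasDerivAt (fun t => relDiff ε (u t) (v t))
      (((u' - v') - relDiff ε (u t) (v t) * (u' + v')) / (u t + v t + ε)) t := by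
  refine ((hu.sub hv).div ((hu.add hv).add_const ε) hm).congr_deriv ?_
  unfold relDiff; simp only [Pi.sub_apply, Pi.add_apply]; field_simp

/-- In terms of the relative difference `s`, the partial derivatives are `2 s - s²` and `-(2 s +
s²)`. They are bounded because `|s| ≤ 1`. -/
theorem hasDerivAt_sqDiff {u v : ℝ → ℝ} {u' v' t : ℝ} (hu : HasDerivAt u u' t)
    (hv : HasDerivAt v v' t) (hm : u t + v t + ε ≠ 0) :
    HasDerivAt (fun t => sqDiff ε (u t) (v t))
      ((2 * relDiff ε (u t) (v t) - relDiff ε (u t) (v t) ^ 2) * u' -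
        (2 * relDiff ε (u t) (v t) + relDiff ε (u t) (v t) ^ 2) * v') t := by
  refine (((hu.sub hv).pow 2).div ((hu.add hv).add_const ε) hm).congr_deriv ?_
  unfold relDiff; simp only [Pi.sub_apply, Pi.add_apply]; field_simp; simp; ring

end Scalar

section TwoFunctions
variable {n : ℕ} {V β : ℝ → ℝ} {γ τ ε : ℝ} {u v : Phase n → ℝ}

theorem contDiff_relDiff {m : WithTop ℕ∞} (hε : 0 < ε) (hu : ContDiff ℝ m u) (hv : ContDiff ℝ m v)
    (hu0 : ∀ x, 0 ≤ u x) (hv0 : ∀ x, 0 ≤ v x) : ContDiff ℝ m fun x => relDiff ε (u x) (v x) :=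
  (hu.sub hv).div ((hu.add hv).add contDiff_const) fun x => by
    have := hu0 x; have := hv0 x; positivity

theorem contDiff_sqDiff {m : WithTop ℕ∞} (hε : 0 < ε) (hu : ContDiff ℝ m u) (hv : ContDiff ℝ m v)
    (hu0 : ∀ x, 0 ≤ u x) (hv0 : ∀ x, 0 ≤ v x) : ContDiff ℝ m fun x => sqDiff ε (u x) (v x) :=
  ((hu.sub hv).pow 2).div ((hu.add hv).add contDiff_const) fun x => by
    have := hu0 x; have := hv0 x; positivity

theorem fderiv_relDiff (hε : 0 < ε) (hu : ContDiff ℝ 1 u) (hv : ContDiff ℝ 1 v)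
    (hu0 : ∀ x, 0 ≤ u x) (hv0 : ∀ x, 0 ≤ v x) (x w : Phase n) :
    fderiv ℝ (fun x => relDiff ε (u x) (v x)) x w =
      ((fderiv ℝ u x w - fderiv ℝ v x w) -
        relDiff ε (u x) (v x) * (fderiv ℝ u x w + fderiv ℝ v x w)) / (u x + v x + ε) := by
  have h1 := ((contDiff_relDiff hε hu hv hu0 hv0).differentiable (by simp) x).hasFDerivAt.hasLineDerivAt w
  have h2 := (hu.differentiable (by simp) x).hasFDerivAt.hasLineDerivAt w
  have h3 := (hv.differentiable (by simp) x).hasFDerivAt.hasLineDerivAt w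
  have h4 := hasDerivAt_relDiff (ε := ε) h2 h3 (by
    have := hu0 x; have := hv0 x; simp only [zero_smul, add_zero]; positivity)
  simp only [zero_smul, add_zero] at h4
  exact HasDerivAt.unique h1 h4

theorem fderiv_sqDiff (hε : 0 < ε) (hu : ContDiff ℝ 1 u) (hv : ContDiff ℝ 1 v)
    (hu0 : ∀ x, 0 ≤ u x) (hv0 : ∀ x, 0 ≤ v x) (x w : Phase n) :
    fderiv ℝ (fun x => sqDiff ε (u x) (v x)) x w =
      (2 * relDiff ε (u x) (v x) - relDiff ε (u x) (v x) ^ 2) * fderiv ℝ u x w -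
        (2 * relDiff ε (u x) (v x) + relDiff ε (u x) (v x) ^ 2) * fderiv ℝ v x w := by
  have h1 := ((contDiff_sqDiff hε hu hv hu0 hv0).differentiable (by simp) x).hasFDerivAt.hasLineDerivAt w
  have h2 := (hu.differentiable (by simp) x).hasFDerivAt.hasLineDerivAt w
  have h3 := (hv.differentiable (by simp) x).hasFDerivAt.hasLineDerivAt w
  have h4 := hasDerivAt_sqDiff (ε := ε) h2 h3 (by
    have := hu0 x; have := hv0 x; simp only [zero_smul, add_zero]; positivity)
  simp only [zero_smul, add_zero] at h4
  exact HasDerivAt.unique h1 h4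

/-- The Hessian of the functional is a single square divided by the regularized sum. Convexity is
therefore explicit and the noise can only dissipate. -/
theorem dp_dp_sqDiff (hε : 0 < ε) (hu : ContDiff ℝ 2 u) (hv : ContDiff ℝ 2 v)
    (hu0 : ∀ x, 0 ≤ u x) (hv0 : ∀ x, 0 ≤ v x) (k : Fin n) (x : Phase n) :
    dp k (dp k fun x => sqDiff ε (u x) (v x)) x =
      (2 * relDiff ε (u x) (v x) - relDiff ε (u x) (v x) ^ 2) * dp k (dp k u) x -
        (2 * relDiff ε (u x) (v x) + relDiff ε (u x) (v x) ^ 2) * dp k (dp k v) x +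
      2 / (u x + v x + ε) *
        ((dp k u x - dp k v x) - relDiff ε (u x) (v x) * (dp k u x + dp k v x)) ^ 2 := by
  have hu1 : ContDiff ℝ 1 u := hu.of_le (by norm_num)
  have hv1 : ContDiff ℝ 1 v := hv.of_le (by norm_num)
  have e1 : (dp k fun x => sqDiff ε (u x) (v x)) = fun x =>
      (2 * relDiff ε (u x) (v x) - relDiff ε (u x) (v x) ^ 2) * dp k u x -
        (2 * relDiff ε (u x) (v x) + relDiff ε (u x) (v x) ^ 2) * dp k v x :=
    funext fun x => fderiv_sqDiff hε hu1 hv1 hu0 hv0 x (ep k)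
  have hs := (contDiff_relDiff hε hu1 hv1 hu0 hv0).differentiable (by simp)
  have hdu := (contDiff_dp k hu).differentiable (by simp)
  have hdv := (contDiff_dp k hv).differentiable (by simp)
  have hs' : dp k (fun x => relDiff ε (u x) (v x)) x = ((dp k u x - dp k v x) -
      relDiff ε (u x) (v x) * (dp k u x + dp k v x)) / (u x + v x + ε) :=
    fderiv_relDiff hε hu1 hv1 hu0 hv0 x (ep k)
  have hA : ∀ s : ℝ, HasDerivAt (fun s : ℝ => 2 * s - s ^ 2) (2 - 2 * s) s := fun s => by
    refine (((hasDerivAt_id s).const_mul 2).sub (hasDerivAt_pow 2 s)).congr_deriv (by simp)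
  have hB : ∀ s : ℝ, HasDerivAt (fun s : ℝ => 2 * s + s ^ 2) (2 + 2 * s) s := fun s => by
    refine (((hasDerivAt_id s).const_mul 2).add (hasDerivAt_pow 2 s)).congr_deriv (by simp)
  have h2 := dp_comp k (hA (relDiff ε (u x) (v x))) (hs x) (u := fun x => relDiff ε (u x) (v x))
  have h3 := dp_comp k (hB (relDiff ε (u x) (v x))) (hs x) (u := fun x => relDiff ε (u x) (v x))
  have dA : DifferentiableAt ℝ (fun x => 2 * relDiff ε (u x) (v x) - relDiff ε (u x) (v x) ^ 2) x :=
    ((hs x).const_mul 2).sub ((hs x).pow 2)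
  have dB : DifferentiableAt ℝ (fun x => 2 * relDiff ε (u x) (v x) + relDiff ε (u x) (v x) ^ 2) x :=
    ((hs x).const_mul 2).add ((hs x).pow 2)
  have mA : DifferentiableAt ℝ (fun x =>
      (2 * relDiff ε (u x) (v x) - relDiff ε (u x) (v x) ^ 2) * dp k u x) x := dA.mul (hdu x)
  have mB : DifferentiableAt ℝ (fun x =>
      (2 * relDiff ε (u x) (v x) + relDiff ε (u x) (v x) ^ 2) * dp k v x) x := dB.mul (hdv x)
  rw [e1, dp_sub k mA mB, dp_mul k dA (hdu x), dp_mul k dB (hdv x),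
    h2, h3, hs']
  ring

/-- The forward operator acting on `sqDiff ε u v`. -/
theorem forwardOp_sqDiff (hε : 0 < ε) (hu : ContDiff ℝ 2 u) (hv : ContDiff ℝ 2 v)
    (hu0 : ∀ x, 0 ≤ u x) (hv0 : ∀ x, 0 ≤ v x) (x : Phase n) :
    (2 * relDiff ε (u x) (v x) - relDiff ε (u x) (v x) ^ 2) * forwardOp V β γ τ u x -
      (2 * relDiff ε (u x) (v x) + relDiff ε (u x) (v x) ^ 2) * forwardOp V β γ τ v x -
      forwardOp V β γ τ (fun x => sqDiff ε (u x) (v x)) x =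
    sourceTerm V β τ x * (ε * relDiff ε (u x) (v x) ^ 2) - (n : ℝ) ^ 2 * γ *
      ∑ k, (betaAt β n k)⁻¹ * (2 / (u x + v x + ε) *
        ((dp k u x - dp k v x) - relDiff ε (u x) (v x) * (dp k u x + dp k v x)) ^ 2) := by
  have hu1 : ContDiff ℝ 1 u := hu.of_le (by norm_num)
  have hv1 : ContDiff ℝ 1 v := hv.of_le (by norm_num)
  have hdp : ∀ k, dp k (fun x => sqDiff ε (u x) (v x)) x =
      (2 * relDiff ε (u x) (v x) - relDiff ε (u x) (v x) ^ 2) * dp k u x -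
        (2 * relDiff ε (u x) (v x) + relDiff ε (u x) (v x) ^ 2) * dp k v x := fun k =>
    fderiv_sqDiff hε hu1 hv1 hu0 hv0 x (ep k)
  have hdr : ∀ k, dr k (fun x => sqDiff ε (u x) (v x)) x =
      (2 * relDiff ε (u x) (v x) - relDiff ε (u x) (v x) ^ 2) * dr k u x -
        (2 * relDiff ε (u x) (v x) + relDiff ε (u x) (v x) ^ 2) * dr k v x := fun k =>
    fderiv_sqDiff hε hu1 hv1 hu0 hv0 x (er k)
  -- Without `ε` the functional is homogeneous of degree one and the zero-order source would cancel.
  -- The defect in Euler's identity is `ε s²`.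
  have hΦ : (2 * relDiff ε (u x) (v x) - relDiff ε (u x) (v x) ^ 2) * u x -
      (2 * relDiff ε (u x) (v x) + relDiff ε (u x) (v x) ^ 2) * v x - sqDiff ε (u x) (v x) =
      ε * relDiff ε (u x) (v x) ^ 2 := by
    have := hu0 x; have := hv0 x
    have hm : u x + v x + ε ≠ 0 := by positivity
    unfold relDiff sqDiff; field_simp; ring
  rw [← hΦ]
  simp only [forwardOp, liouville, thermostat, hdp, hdr, dp_dp_sqDiff hε hu hv hu0 hv0]
  set s := relDiff ε (u x) (v x)
  have l1 : ∀ a w z : Fin n → ℝ, ∑ k, a k * ((2 * s - s ^ 2) * w k - (2 * s + s ^ 2) * z k) =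
      (2 * s - s ^ 2) * ∑ k, a k * w k - (2 * s + s ^ 2) * ∑ k, a k * z k := fun a w z => by
    rw [Finset.mul_sum, Finset.mul_sum, ← Finset.sum_sub_distrib]
    exact Finset.sum_congr rfl fun k _ => by ring
  rw [l1, l1]
  have l2 : ∀ (c p w z w' z' q : Fin n → ℝ),
      ∑ k, (c k * ((2 * s - s ^ 2) * w' k - (2 * s + s ^ 2) * z' k + q k) -
        p k * ((2 * s - s ^ 2) * w k - (2 * s + s ^ 2) * z k)) =
      (2 * s - s ^ 2) * ∑ k, (c k * w' k - p k * w k) -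
        (2 * s + s ^ 2) * ∑ k, (c k * z' k - p k * z k) + ∑ k, c k * q k := fun c p w z w' z' q => by
    rw [Finset.mul_sum, Finset.mul_sum, ← Finset.sum_sub_distrib, ← Finset.sum_add_distrib]
    exact Finset.sum_congr rfl fun k _ => by ring
  rw [l2]
  ring

end TwoFunctions

/-! ### Commutators with a shift along a bond -/

section Shift
variable {n : ℕ} {V β : ℝ → ℝ} {b B G C γ τ η : ℝ} {f : Phase n → ℝ}

/-- The direction of `∂_{p_i} + ∂_{q_i}`. -/
def bondDir (i : Fin n) : Phase n :=
  (Pi.single i 1 - if h : (i : ℕ) + 1 < n then Pi.single ⟨i + 1, h⟩ 1 else 0, Pi.single i 1)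

theorem fderiv_bondDir (i : Fin n) (f : Phase n → ℝ) (x : Phase n) :
    fderiv ℝ f x (bondDir i) = dp i f x + dq i f x := by
  have e : bondDir i = ep i + (er i - if h : (i : ℕ) + 1 < n then er ⟨i + 1, h⟩ else 0) := by
    unfold bondDir ep er
    split_ifs <;> simp
  rw [e, map_add, map_sub, dq, dp_eq, dr_eq]
  split_ifs
  · rfl
  · simp

/-- The particles at distance at most one. -/
def nbr (i : Fin n) : Finset (Fin n) :=
  Finset.univ.filter fun k => (k : ℕ) ≤ i + 1 ∧ (i : ℕ) ≤ k + 1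

theorem mem_nbr {i k : Fin n} : k ∈ nbr i ↔ (k : ℕ) ≤ i + 1 ∧ (i : ℕ) ≤ k + 1 := by simp [nbr]

theorem mem_nbr_comm {i k : Fin n} : k ∈ nbr i ↔ i ∈ nbr k := by
  rw [mem_nbr, mem_nbr]; tauto

theorem card_nbr_le (i : Fin n) : (nbr i).card ≤ 3 := by
  have h1 : ((nbr i).map Fin.valEmbedding) ⊆ Finset.Icc ((i : ℕ) - 1) (i + 1) := by
    intro k hk
    rw [Finset.mem_map] at hk
    obtain ⟨l, hl, rfl⟩ := hk
    rw [mem_nbr] at hl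
    simp only [Fin.valEmbedding_apply, Finset.mem_Icc]
    omega
  have h2 := Finset.card_le_card h1
  rw [Finset.card_map, Nat.card_Icc] at h2
  omega

theorem shift_snd (x : Phase n) (η : ℝ) (i k : Fin n) :
    (x + η • bondDir i).2 k = x.2 k + if k = i then η else 0 := by
  simp [bondDir, Pi.single_apply]

theorem abs_shift_fst_le (x : Phase n) (η : ℝ) (i k : Fin n) :
    |(x + η • bondDir i).1 k - x.1 k| ≤ |η| := by
  have e : (x + η • bondDir i).1 k - x.1 k = η * (bondDir i).1 k := by simp
  rw [e, abs_mul]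
  refine mul_le_of_le_one_right (abs_nonneg _) ?_
  unfold bondDir
  by_cases hki : k = i
  · subst hki
    split_ifs with h
    · have : (⟨(k : ℕ) + 1, h⟩ : Fin n) ≠ k := fun h => by simpa using congrArg Fin.val h
      simp [this.symm]
    · simp
  · split_ifs with h
    · have hji : (⟨(i : ℕ) + 1, h⟩ : Fin n) ≠ i := fun h => by simpa using congrArg Fin.val h
      by_cases hj : k = ⟨i + 1, h⟩ <;> simp [hki, hj, hji]
    · simp [hki]

theorem shift_fst_of_ne (x : Phase n) (η : ℝ) {i k : Fin n} (h1 : (k : ℕ) ≠ i)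
    (h2 : (k : ℕ) ≠ i + 1) : (x + η • bondDir i).1 k = x.1 k := by
  have e1 : k ≠ i := fun h => h1 (congrArg Fin.val h)
  unfold bondDir
  split_ifs with h
  · have e2 : k ≠ ⟨i + 1, h⟩ := fun h => h2 (congrArg Fin.val h)
    simp [e1, e2]
  · simp [e1]

/-- The coefficients of the commutator of the forward operator and a shift along a bond. -/
def shiftCoeff (V : ℝ → ℝ) (γ τ η : ℝ) (i : Fin n) (x : Phase n) (k : Fin n) : ℝ :=
  (if k = i then η * (1 - γ) else 0) -
    ((forceRight V τ (x + η • bondDir i).1 k - deriv V ((x + η • bondDir i).1 k)) -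
      (forceRight V τ x.1 k - deriv V (x.1 k)))

theorem ChainBounds.abs_shiftCoeff_le (h : ChainBounds V β b B G C) (hγ : 0 < γ) (i : Fin n)
    (x : Phase n) (k : Fin n) : |shiftCoeff V γ τ η i x k| ≤ (2 * C + 1 + γ) * |η| := by
  have hC := h.C_pos
  have h1 : |if k = i then η * (1 - γ) else 0| ≤ (1 + γ) * |η| := by
    split_ifs
    · rw [abs_mul, mul_comm]
      gcongr
      rw [abs_le]; constructor <;> linarith
    · rw [abs_zero]; positivity
  have hl : ∀ l, |deriv V ((x + η • bondDir i).1 l) - deriv V (x.1 l)| ≤ C * |η| := fun l =>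
    (h.deriv_lip _ _).trans (mul_le_mul_of_nonneg_left (abs_shift_fst_le x η i l) hC.le)
  have h2 : |forceRight V τ (x + η • bondDir i).1 k - forceRight V τ x.1 k| ≤ C * |η| := by
    unfold forceRight
    split_ifs
    · exact hl _
    · rw [sub_self, abs_zero]; positivity
  have h3 := hl k
  unfold shiftCoeff
  rw [abs_le] at h1 h2 h3 ⊢
  constructor <;> linarith [h1.1, h1.2, h2.1, h2.2, h3.1, h3.2]

theorem shiftCoeff_eq_zero (i : Fin n) (x : Phase n) {k : Fin n} (hk : k ∉ nbr i) :
    shiftCoeff V γ τ η i x k = 0 := by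
  rw [mem_nbr, not_and_or, not_le, not_le] at hk
  have h1 : k ≠ i := fun h => by subst h; omega
  have h2 : (x + η • bondDir i).1 k = x.1 k := shift_fst_of_ne x η (by omega) (by omega)
  unfold shiftCoeff forceRight
  rw [if_neg h1, h2]
  split_ifs with h
  · rw [shift_fst_of_ne x η (by simp; omega) (by simp; omega)]; ring
  · ring

/-- The commutator of the forward operator and a shift along a bond. -/
theorem forwardOp_shift (i : Fin n) (η : ℝ) (x : Phase n) :
    forwardOp V β γ τ f (x + η • bondDir i) +
        (n : ℝ) ^ 2 * η * fderiv ℝ f (x + η • bondDir i) (bondDir i) -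
      forwardOp V β γ τ (fun y => f (y + η • bondDir i)) x =
    (n : ℝ) ^ 2 * ∑ k, shiftCoeff V γ τ η i x k * dp k f (x + η • bondDir i) +
      (sourceTerm V β τ (x + η • bondDir i) - sourceTerm V β τ x) * f (x + η • bondDir i) := by
  have hdp : ∀ k, (dp k fun y => f (y + η • bondDir i)) = fun y => dp k f (y + η • bondDir i) :=
    fun k => funext fun y => by rw [dp, dp, fderiv_comp_add_right]
  have hdp2 : ∀ k y, (dp k fun y => dp k f (y + η • bondDir i)) y =
      dp k (dp k f) (y + η • bondDir i) := fun k y => by rw [dp, dp, fderiv_comp_add_right]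
  have hdr : ∀ k y, (dr k fun y => f (y + η • bondDir i)) y = dr k f (y + η • bondDir i) :=
    fun k y => by rw [dr, dr, fderiv_comp_add_right]
  rw [fderiv_bondDir]
  simp only [forwardOp, liouville, thermostat, hdp, hdp2, hdr]
  set y := x + η • bondDir i with hy
  have hy2 : ∀ k, y.2 k = x.2 k + if k = i then η else 0 := shift_snd x η i
  have hprev : ∀ k, pPrev y.2 k = pPrev x.2 k + pPrev (fun k => if k = i then η else 0) k :=
    fun k => by
      unfold pPrev; split_ifs <;> simp_all
  -- Raising `p_i` by `η` changes the stretching speed at `i` by `η` and at `i + 1` by `-η`, which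
  -- is `η` times the derivative along `q_i`.
  have e1 : ∑ k, (y.2 k - pPrev y.2 k) * dr k f y = ∑ k, (x.2 k - pPrev x.2 k) * dr k f y +
      η * dq i f y := by
    have e2 : ∑ k, (y.2 k - pPrev y.2 k) * dr k f y = ∑ k, (x.2 k - pPrev x.2 k) * dr k f y +
        (∑ k, (if k = i then η else 0) * dr k f y -
          ∑ k, pPrev (fun k => if k = i then η else 0) k * dr k f y) := by
      rw [← Finset.sum_sub_distrib, ← Finset.sum_add_distrib]
      exact Finset.sum_congr rfl fun k _ => by rw [hy2, hprev]; ring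
    rw [e2, sum_pPrev_mul]
    congr 1
    have e3 : ∀ k : Fin n, (if h : (k : ℕ) + 1 < n then
        (if k = i then η else 0) * dr ⟨k + 1, h⟩ f y else 0) = if k = i then
        η * (if h : (i : ℕ) + 1 < n then dr ⟨i + 1, h⟩ f y else 0) else 0 := fun k => by
      by_cases hk : k = i
      · subst hk; split_ifs <;> simp
      · simp [hk]
    rw [Finset.sum_congr rfl fun k _ => e3 k]
    simp only [ite_mul, zero_mul, Finset.sum_ite_eq', Finset.mem_univ, if_true, dq]
    ring
  have e4 : ∑ k, ((betaAt β n k)⁻¹ * dp k (dp k f) y - y.2 k * dp k f y) =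
      ∑ k, ((betaAt β n k)⁻¹ * dp k (dp k f) y - x.2 k * dp k f y) - η * dp i f y := by
    have : η * dp i f y = ∑ k, (if k = i then η else 0) * dp k f y := by simp
    rw [this, ← Finset.sum_sub_distrib]
    exact Finset.sum_congr rfl fun k _ => by rw [hy2]; ring
  -- The growth of the shift contributes `η (∂_{p_i} + ∂_{q_i})`. Its `q` part cancels the transport
  -- commutator, and friction reduces its `p` part to the coefficient `1 - γ`.
  have e5 : ∑ k, shiftCoeff V γ τ η i x k * dp k f y = η * (1 - γ) * dp i f y -
      (∑ k, (forceRight V τ y.1 k - deriv V (y.1 k)) * dp k f y -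
        ∑ k, (forceRight V τ x.1 k - deriv V (x.1 k)) * dp k f y) := by
    have : η * (1 - γ) * dp i f y = ∑ k, (if k = i then η * (1 - γ) else 0) * dp k f y := by simp
    rw [this, ← Finset.sum_sub_distrib, ← Finset.sum_sub_distrib]
    refine Finset.sum_congr rfl fun k _ => ?_
    rw [shiftCoeff, ← hy]
    ring
  rw [e1, e4, e5]
  ring

/-- The local energy near a bond. -/
def bondEnergy (V : ℝ → ℝ) (i : Fin n) (x : Phase n) : ℝ :=
  1 + x.2 i ^ 2 + pPrev x.2 i ^ 2 + nextForceSq V i x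

theorem bondEnergy_nonneg (i : Fin n) (x : Phase n) : 0 ≤ bondEnergy V i x := by
  have := nextForceSq_nonneg (V := V) i x
  unfold bondEnergy; positivity

/-- The shift moves only `r_i` and `r_{i+1}`, and the coefficient at `k` depends only on `r_{k+1}`.
It can thus change only for `k = i` and for `k + 1 = i`. -/
theorem ChainBounds.abs_bulkCoeff_sub_le (h : ChainBounds V β b B G C) (i k : Fin n)
    (x : Phase n) : |bulkCoeff V β k (x + η • bondDir i) - bulkCoeff V β k x| ≤
      n * G * C * |η| * ((if k = i then 1 else 0) +
        if h : (k : ℕ) + 1 < n then (Pi.single i 1 : Fin n → ℝ) ⟨k + 1, h⟩ else 0) := by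
  have hC := h.C_pos
  have hG := h.G_nonneg
  unfold bulkCoeff
  split_ifs with hk hki hki
  · rw [← mul_sub, abs_mul, abs_mul, abs_neg, Nat.abs_cast]
    have h1 := h.grad_le n k hk
    have h2 := (h.deriv_lip (x.1 ⟨k + 1, hk⟩) ((x + η • bondDir i).1 ⟨k + 1, hk⟩)).trans
      (mul_le_mul_of_nonneg_left (abs_shift_fst_le x η i ⟨k + 1, hk⟩) hC.le)
    have h3 : (Pi.single i 1 : Fin n → ℝ) ⟨k + 1, hk⟩ = 0 := by
      subst hki
      refine Pi.single_eq_of_ne (fun h => ?_) _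
      simpa using congrArg Fin.val h
    rw [h3, add_zero, mul_one]
    calc _ ≤ n * G * (C * |η|) := by gcongr
      _ = _ := by ring
  · by_cases hj : (⟨k + 1, hk⟩ : Fin n) = i
    · rw [hj, Pi.single_eq_same, zero_add, mul_one, ← mul_sub, abs_mul, abs_mul, abs_neg,
        Nat.abs_cast]
      have h1 := h.grad_le n k hk
      have h2 := (h.deriv_lip (x.1 i) ((x + η • bondDir i).1 i)).trans
        (mul_le_mul_of_nonneg_left (abs_shift_fst_le x η i i) hC.le)
      calc _ ≤ n * G * (C * |η|) := by gcongr
        _ = _ := by ring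
    · rw [shift_fst_of_ne x η (fun h => hj (Fin.ext h)) (fun h => hki (Fin.ext (by simpa using h)))]
      rw [sub_self, abs_zero, Pi.single_eq_of_ne hj]
      simp
  · simp; positivity
  · simp

/-- A bond has `i < n`, so `p_n` is not shifted and the boundary source of order `n²` cancels. The
remaining difference is of order `n η`, local, and independent of the tension. -/
theorem ChainBounds.sourceTerm_sub_sq_le (h : ChainBounds V β b B G C) (hη : |η| ≤ 1)
    {i : Fin n} (hi : i ∈ bulk n) (x : Phase n) :
    (sourceTerm V β τ (x + η • bondDir i) - sourceTerm V β τ x) ^ 2 ≤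
      4 * (n * G * C * η) ^ 2 * bondEnergy V i x := by
  have hC := h.one_le_C
  have hG := h.G_nonneg
  have hin : (i : ℕ) + 1 < n := by simpa [bulk] using hi
  set y := x + η • bondDir i with hy
  have hy2 : ∀ k, y.2 k = x.2 k + if k = i then η else 0 := shift_snd x η i
  have hlast : pLast y.2 = pLast x.2 := by
    unfold pLast
    refine Finset.sum_congr rfl fun k _ => ?_
    split_ifs with hk
    · rfl
    · rw [hy2, if_neg (fun h => hk (by rw [h]; exact hin)), add_zero]
  have e : sourceTerm V β τ y - sourceTerm V β τ x =
      ∑ k, (bulkCoeff V β k y - bulkCoeff V β k x) * x.2 k + bulkCoeff V β i y * η := by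
    rw [sourceTerm_split, sourceTerm_split, hlast]
    have : bulkCoeff V β i y * η = ∑ k, bulkCoeff V β k y * (if k = i then η else 0) := by simp
    rw [this, ← Finset.sum_add_distrib, add_sub_add_right_eq_sub, ← Finset.sum_sub_distrib]
    exact Finset.sum_congr rfl fun k _ => by rw [hy2]; ring
  have h1 : |∑ k, (bulkCoeff V β k y - bulkCoeff V β k x) * x.2 k| ≤
      n * G * C * |η| * (|x.2 i| + |pPrev x.2 i|) := by
    have hp : |pPrev x.2 i| = pPrev (fun k => |x.2 k|) i := by unfold pPrev; split_ifs <;> simp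
    have e3 := sum_pPrev_mul (fun k => |x.2 k|) (Pi.single i 1)
    simp only [Pi.single_apply, mul_ite, mul_one, mul_zero, Finset.sum_ite_eq', Finset.mem_univ,
      if_true] at e3
    rw [hp, e3]
    have e4 : |x.2 i| = ∑ k, (if k = i then |x.2 k| else 0) := by simp
    rw [e4, ← Finset.sum_add_distrib, Finset.mul_sum]
    refine (Finset.abs_sum_le_sum_abs _ _).trans (Finset.sum_le_sum fun k _ => ?_)
    rw [abs_mul]
    refine (mul_le_mul_of_nonneg_right (h.abs_bulkCoeff_sub_le i k x) (abs_nonneg _)).trans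
      (le_of_eq ?_)
    by_cases hk : (k : ℕ) + 1 < n
    · simp only [dif_pos hk, Pi.single_apply]
      split_ifs <;> ring
    · simp only [dif_neg hk]
      split_ifs <;> ring
  have h2 : |bulkCoeff V β i y * η| ≤
      n * G * C * |η| * (|deriv V (x.1 ⟨i + 1, hin⟩)| + 1) := by
    rw [abs_mul, bulkCoeff, dif_pos hin, abs_mul, abs_mul, abs_neg, Nat.abs_cast]
    have g1 := h.grad_le n i hin
    have g2 := (h.deriv_lip (x.1 ⟨i + 1, hin⟩) (y.1 ⟨i + 1, hin⟩)).trans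
      (mul_le_mul_of_nonneg_left (abs_shift_fst_le x η i ⟨i + 1, hin⟩) (by linarith))
    have g3 : |deriv V (y.1 ⟨i + 1, hin⟩)| ≤ C * (|deriv V (x.1 ⟨i + 1, hin⟩)| + 1) := by
      have g4 := abs_sub_abs_le_abs_sub (deriv V (y.1 ⟨i + 1, hin⟩)) (deriv V (x.1 ⟨i + 1, hin⟩))
      have g5 := abs_nonneg (deriv V (x.1 ⟨i + 1, hin⟩))
      nlinarith
    calc _ ≤ n * G * (C * (|deriv V (x.1 ⟨i + 1, hin⟩)| + 1)) * |η| := by gcongr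
      _ = _ := by ring
  have h3 : |sourceTerm V β τ y - sourceTerm V β τ x| ≤ n * G * C * |η| *
      (|x.2 i| + |pPrev x.2 i| + |deriv V (x.1 ⟨i + 1, hin⟩)| + 1) := by
    rw [e]
    refine (abs_add_le _ _).trans ((add_le_add h1 h2).trans (le_of_eq (by ring)))
  rw [← sq_abs]
  refine (pow_le_pow_left₀ (abs_nonneg _) h3 2).trans ?_
  have h4 : (|x.2 i| + |pPrev x.2 i| + |deriv V (x.1 ⟨i + 1, hin⟩)| + 1) ^ 2 ≤
      4 * bondEnergy V i x := by
    rw [bondEnergy, nextForceSq, dif_pos hin, ← sq_abs (x.2 i), ← sq_abs (pPrev x.2 i),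
      ← sq_abs (deriv V (x.1 ⟨i + 1, hin⟩))]
    set a1 := |x.2 i|
    set a2 := |pPrev x.2 i|
    set a3 := |deriv V (x.1 ⟨i + 1, hin⟩)|
    linarith [sq_nonneg (a1 - a2), sq_nonneg (a1 - a3), sq_nonneg (a1 - 1), sq_nonneg (a2 - a3),
      sq_nonneg (a2 - 1), sq_nonneg (a3 - 1)]
  calc _ = (n * G * C * |η|) ^ 2 *
        (|x.2 i| + |pPrev x.2 i| + |deriv V (x.1 ⟨i + 1, hin⟩)| + 1) ^ 2 := by ring
    _ ≤ (n * G * C * |η|) ^ 2 * (4 * bondEnergy V i x) := by gcongr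
    _ = _ := by rw [mul_pow _ |η|, sq_abs]; ring

/-- The local energy after a shift along the bond. -/
theorem ChainBounds.bondEnergy_le_shift (h : ChainBounds V β b B G C) (hη : |η| ≤ 1)
    (i : Fin n) (x : Phase n) :
    bondEnergy V i x ≤ 5 * C ^ 2 * bondEnergy V i (x + η • bondDir i) := by
  have hC := h.one_le_C
  set y := x + η • bondDir i with hy
  have hη2 : η ^ 2 ≤ 1 := by rw [← sq_abs]; exact pow_le_one₀ (abs_nonneg _) hη
  have h1 : x.2 i ^ 2 ≤ 2 * y.2 i ^ 2 + 2 := by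
    have : y.2 i = x.2 i + η := by rw [hy, shift_snd]; simp
    rw [this]; nlinarith [sq_nonneg (x.2 i + 2 * η)]
  have h2 : pPrev x.2 i = pPrev y.2 i := by
    unfold pPrev
    split_ifs with h0
    · rfl
    · rw [hy, shift_snd, if_neg, add_zero]
      intro hh
      have := congrArg Fin.val hh
      simp only at this; omega
  have h3 : nextForceSq V i x ≤ 2 * nextForceSq V i y + 2 * C ^ 2 := by
    unfold nextForceSq
    split_ifs with hi
    · have g2 := (h.deriv_lip (x.1 ⟨i + 1, hi⟩) (y.1 ⟨i + 1, hi⟩)).trans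
        (mul_le_mul_of_nonneg_left ((abs_shift_fst_le x η i ⟨i + 1, hi⟩).trans hη) (by linarith))
      rw [mul_one] at g2
      have g3 := pow_le_pow_left₀ (abs_nonneg _) g2 2
      rw [sq_abs] at g3
      nlinarith [sq_nonneg (2 * deriv V (y.1 ⟨i + 1, hi⟩) - deriv V (x.1 ⟨i + 1, hi⟩))]
    · positivity
  have h4 := nextForceSq_nonneg (V := V) i y
  have hC2 : 1 ≤ C ^ 2 := one_le_pow₀ hC
  unfold bondEnergy
  rw [h2]
  nlinarith [sq_nonneg (y.2 i), sq_nonneg (pPrev y.2 i)]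

theorem ChainBounds.sum_bondEnergy_le (h : ChainBounds V β b B G C) (x : Phase n) :
    ∑ i, bondEnergy V i x ≤ (C + 4) * (n + totalEnergy V x) := by
  have h1 := h.sum_sq_le x
  have h2 := h.sum_nextForceSq_le x
  have h3 : ∑ i, pPrev x.2 i ^ 2 ≤ ∑ i, x.2 i ^ 2 := by
    have e : ∀ i, pPrev x.2 i ^ 2 = pPrev (fun k => x.2 k ^ 2) i * 1 := fun i => by
      unfold pPrev; split_ifs <;> simp
    simp only [e]
    rw [sum_pPrev_mul (fun k => x.2 k ^ 2) fun _ => 1]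
    refine Finset.sum_le_sum fun k _ => ?_
    split_ifs
    · simp
    · positivity
  have hC := h.C_pos
  have hE := h.totalEnergy_nonneg x
  simp only [bondEnergy, Finset.sum_add_distrib, Finset.sum_const, Finset.card_univ,
    Fintype.card_fin, nsmul_eq_mul, mul_one]
  have : (0 : ℝ) ≤ n := n.cast_nonneg
  nlinarith

end Shift

/-! ### The shrinking cutoff and the Gibbs density under shifts -/

theorem hasDerivAt_max_pow_four (s : ℝ) :
    HasDerivAt (fun s : ℝ => max s 0 ^ 4) (4 * max s 0 ^ 3) s :=
  (hasDerivAt_max_pow 2 s).congr_deriv (by norm_num)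

theorem hasDerivAt_four_max_cube (s : ℝ) :
    HasDerivAt (fun s : ℝ => 4 * max s 0 ^ 3) (12 * max s 0 ^ 2) s :=
  ((hasDerivAt_max_cube s).const_mul 4).congr_deriv (by ring)

theorem contDiff_max_pow_four : ContDiff ℝ 2 fun s : ℝ => max s 0 ^ 4 := by
  have h1 : deriv (fun s : ℝ => max s 0 ^ 4) = fun s => 4 * max s 0 ^ 3 :=
    funext fun s => (hasDerivAt_max_pow_four s).deriv
  rw [show (2 : WithTop ℕ∞) = 1 + 1 by norm_num, contDiff_succ_iff_deriv]
  refine ⟨fun s => (hasDerivAt_max_pow_four s).differentiableAt, by simp, ?_⟩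
  rw [h1]
  exact contDiff_const.mul (contDiff_max_cube.of_le (by norm_num))

/-- The cutoff `(1 - a (1 + E))₊⁴` of the energy. -/
def bump (V : ℝ → ℝ) {n : ℕ} (a : ℝ) (x : Phase n) : ℝ := max (1 - a * (1 + totalEnergy V x)) 0 ^ 4

section Bump
variable {n : ℕ} {V β : ℝ → ℝ} {b B G C γ τ τm a h₀ : ℝ}

theorem bump_nonneg (a : ℝ) (x : Phase n) : 0 ≤ bump V a x := by unfold bump; positivity

namespace ChainBounds

theorem bump_le_one (h : ChainBounds V β b B G C) (ha : 0 ≤ a) (x : Phase n) : bump V a x ≤ 1 := by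
  have hE := h.totalEnergy_nonneg x
  refine pow_le_one₀ (le_max_right _ _) (max_le ?_ zero_le_one)
  have : 0 ≤ a * (1 + totalEnergy V x) := by positivity
  linarith

theorem contDiff_bump (h : ChainBounds V β b B G C) (a : ℝ) :
    ContDiff ℝ 2 (bump V a : Phase n → ℝ) := by
  have h1 : ContDiff ℝ 2 (totalEnergy V : Phase n → ℝ) := h.contDiff_totalEnergy.of_le (by norm_cast)
  exact contDiff_max_pow_four.comp (contDiff_const.sub (contDiff_const.mul (contDiff_const.add h1)))

theorem max_eq_zero_of_notMem (h : ChainBounds V β b B G C) (hh : 0 < h₀) (ha : h₀ ≤ a)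
    {x : Phase n} (hx : x ∉ {x : Phase n | totalEnergy V x ≤ 1 / h₀}) :
    max (1 - a * (1 + totalEnergy V x)) 0 = 0 := by
  have h1 : 1 / h₀ < totalEnergy V x := not_le.1 hx
  rw [div_lt_iff₀ hh] at h1
  have hE := h.totalEnergy_nonneg x
  refine max_eq_right ?_
  have : h₀ * totalEnergy V x ≤ a * totalEnergy V x := by gcongr
  nlinarith

theorem gen_bump (h : ChainBounds V β b B G C) (a : ℝ) (x : Phase n) :
    gen V β γ τ (bump V a) x =
      -(4 * a * max (1 - a * (1 + totalEnergy V x)) 0 ^ 3) * gen V β γ τ (totalEnergy V) x +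
      12 * a ^ 2 * max (1 - a * (1 + totalEnergy V x)) 0 ^ 2 *
        ((n : ℝ) ^ 2 * γ * ∑ k, (betaAt β n k)⁻¹ * x.2 k ^ 2) := by
  have d0 : ∀ s : ℝ, HasDerivAt (fun s : ℝ => 1 - a * (1 + s)) (-a) s := fun s => by
    have := (((hasDerivAt_id s).const_add 1).const_mul a).const_sub 1
    simpa using this
  have d1 : ∀ s : ℝ, HasDerivAt (fun s => max (1 - a * (1 + s)) 0 ^ 4)
      (4 * max (1 - a * (1 + s)) 0 ^ 3 * (-a)) s := fun s =>
    (hasDerivAt_max_pow_four (1 - a * (1 + s))).comp (h := fun s => 1 - a * (1 + s)) s (d0 s)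
  have d2 : ∀ s : ℝ, HasDerivAt (fun s => 4 * max (1 - a * (1 + s)) 0 ^ 3 * (-a))
      (12 * max (1 - a * (1 + s)) 0 ^ 2 * (-a) * (-a)) s := fun s =>
    ((hasDerivAt_four_max_cube (1 - a * (1 + s))).comp (h := fun s => 1 - a * (1 + s)) s
      (d0 s)).mul_const _
  have := gen_comp (V := V) (β := β) (γ := γ) (τ := τ) (x := x)
    ((h.contDiff_totalEnergy (n := n)).of_le (by norm_cast)) (fun y => d1 (totalEnergy V y))
    (d2 (totalEnergy V x))
  simp only [dp_totalEnergy h.differentiable] at this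
  unfold bump
  rw [this]; ring

/-- The constant in the bound of the generator applied to the energy. -/
def genConst (b γ τm : ℝ) (n : ℕ) : ℝ := (n : ℝ) ^ 2 * (2 * τm + 2 * γ + γ * (n * b⁻¹))

/-- The constant in the error made by the cutoff `bump`. -/
def bumpConst (b γ : ℝ) (n : ℕ) : ℝ := 24 * (n : ℝ) ^ 2 * γ * b⁻¹

/-- With the rate `genConst + bumpConst` of increase of `a`, the cutoff is almost a
supersolution. -/
theorem bump_rate_le (h : ChainBounds V β b B G C) (hγ : 0 < γ) (hτ : |τ| ≤ τm) (ha : 0 ≤ a)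
    (x : Phase n) :
    -(4 * ((genConst b γ τm n + bumpConst b γ n) * a) * (1 + totalEnergy V x) *
      max (1 - a * (1 + totalEnergy V x)) 0 ^ 3) + gen V β γ τ (bump V a) x ≤
      bumpConst b γ n * a ^ 3 := by
  rw [h.gen_bump]
  set E := totalEnergy V x with hE
  set θ := max (1 - a * (1 + E)) 0 with hθ
  set c₁ := genConst b γ τm n with hc₁
  set q := bumpConst b γ n with hq
  have hE0 : 0 ≤ E := h.totalEnergy_nonneg x
  have hθ0 : 0 ≤ θ := le_max_right _ _
  have hb := h.b_pos
  have hq0 : 0 ≤ q := by rw [hq, bumpConst]; positivity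
  have h1 : -(4 * a * θ ^ 3) * gen V β γ τ (totalEnergy V) x ≤ 4 * a * θ ^ 3 * (c₁ * (1 + E)) := by
    have := (abs_le.1 (h.abs_gen_totalEnergy_le hγ hτ x)).1
    have h2 : -gen V β γ τ (totalEnergy V) x ≤ c₁ * (1 + E) := by rw [hc₁, genConst]; linarith
    have := mul_le_mul_of_nonneg_left h2 (by positivity : 0 ≤ 4 * a * θ ^ 3)
    linarith
  have h2 : 12 * a ^ 2 * θ ^ 2 * ((n : ℝ) ^ 2 * γ * ∑ k, (betaAt β n k)⁻¹ * x.2 k ^ 2) ≤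
      q * a ^ 2 * E * θ ^ 2 := by
    calc _ ≤ 12 * a ^ 2 * θ ^ 2 * ((n : ℝ) ^ 2 * γ * (2 * b⁻¹ * E)) := by
          gcongr; exact h.sum_inv_sq_le x
      _ = _ := by rw [hq, bumpConst]; ring
  -- If `θ ≥ a` the damping from the moving cutoff dominates the second-order term. If `θ < a`, the
  -- factor `θ²` is at most `a²`, and `a E ≤ 1` where `θ` is positive.
  have h3 : q * a * θ ^ 2 * (a * E - 4 * (1 + E) * θ) ≤ q * a ^ 3 := by
    rcases le_or_gt a θ with hcase | hcase
    · have : a * E - 4 * (1 + E) * θ ≤ 0 := by nlinarith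
      have h4 : q * a * θ ^ 2 * (a * E - 4 * (1 + E) * θ) ≤ 0 :=
        mul_nonpos_of_nonneg_of_nonpos (by positivity) this
      exact h4.trans (by positivity)
    · rcases hθ0.eq_or_lt with h0 | h0
      · rw [← h0]; simp; positivity
      · have h4 : θ = 1 - a * (1 + E) := by
          rcases max_choice (1 - a * (1 + E)) 0 with h5 | h5
          · rw [hθ, h5]
          · rw [hθ, h5] at h0; exact absurd h0 (lt_irrefl _)
        have h5 : a * E - 4 * (1 + E) * θ ≤ 1 := by nlinarith
        calc q * a * θ ^ 2 * (a * E - 4 * (1 + E) * θ) ≤ q * a * θ ^ 2 * 1 := by gcongr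
          _ ≤ q * a * a ^ 2 * 1 := by gcongr
          _ = _ := by ring
  nlinarith

/-- The constant in the change of the density under a shift. -/
def shiftConst (B C : ℝ) (n : ℕ) : ℝ := B * (2 + C + (2 * C + 3) * n)

/-- A shift of size `ρ` raises the Gibbs exponent by at most a constant times `ρ (1 + E)`, because
velocities and forces are controlled quadratically by the energy. -/
theorem density_le_shift (h : ChainBounds V β b B G C) {x w : Phase n} {ρ : ℝ} (hρ : 0 ≤ ρ)
    (hρ1 : ρ ≤ 1) (hw1 : ∀ k, |w.1 k| ≤ ρ) (hw2 : ∀ k, |w.2 k| ≤ ρ)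
    (hsmall : shiftConst B C n * ρ * (1 + totalEnergy V x) ≤ Real.log 2) :
    density V β x ≤ 2 * density V β (x + w) := by
  have hB := h.B_pos
  have hC := h.C_pos
  have hE := h.totalEnergy_nonneg x
  have h1 : wEnergy V (betaAt β n) (x + w) - wEnergy V (betaAt β n) x ≤ Real.log 2 := by
    refine le_trans ?_ hsmall
    have hk : ∀ k, betaAt β n k * energy V ((x + w).1 k) ((x + w).2 k) -
        betaAt β n k * energy V (x.1 k) (x.2 k) ≤
        B * ρ * (x.2 k ^ 2 + deriv V (x.1 k) ^ 2 + (3 + C)) := fun k => by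
      have e1 : energy V ((x + w).1 k) ((x + w).2 k) - energy V (x.1 k) (x.2 k) =
          (x.2 k * w.2 k + w.2 k ^ 2 / 2) + (V (x.1 k + w.1 k) - V (x.1 k)) := by
        simp only [energy, Prod.fst_add, Prod.snd_add, Pi.add_apply]; ring
      have hsq : ∀ z : ℝ, |z| ≤ ρ → z ^ 2 ≤ ρ := fun z hz => by
        rw [← sq_abs]
        calc |z| ^ 2 ≤ ρ ^ 2 := by gcongr
          _ ≤ ρ := by nlinarith
      have hab : ∀ y : ℝ, |y| ≤ y ^ 2 + 1 := fun y => by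
        rw [← sq_abs]; nlinarith [sq_nonneg (|y| - 1)]
      have e2 : x.2 k * w.2 k ≤ (x.2 k ^ 2 + 1) * ρ := (le_abs_self _).trans (by
        rw [abs_mul]; exact mul_le_mul (hab _) (hw2 k) (abs_nonneg _) (by positivity))
      have e3 : |deriv V (x.1 k)| * |w.1 k| ≤ (deriv V (x.1 k) ^ 2 + 1) * ρ :=
        mul_le_mul (hab _) (hw1 k) (abs_nonneg _) (by positivity)
      have e4 := (le_abs_self _).trans (h.taylor (x.1 k) (w.1 k))
      have e5 := mul_le_mul_of_nonneg_left (hsq _ (hw1 k)) hC.le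
      have e6 := hsq _ (hw2 k)
      rw [← mul_sub, e1]
      have e7 : (x.2 k * w.2 k + w.2 k ^ 2 / 2) + (V (x.1 k + w.1 k) - V (x.1 k)) ≤
          ρ * (x.2 k ^ 2 + deriv V (x.1 k) ^ 2 + (3 + C)) := by linarith
      calc _ ≤ betaAt β n k * (ρ * (x.2 k ^ 2 + deriv V (x.1 k) ^ 2 + (3 + C))) :=
            mul_le_mul_of_nonneg_left e7 (h.betaAt_pos k).le
        _ ≤ B * (ρ * (x.2 k ^ 2 + deriv V (x.1 k) ^ 2 + (3 + C))) :=
            mul_le_mul_of_nonneg_right (h.le_B n k) (by positivity)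
        _ = _ := by ring
    rw [wEnergy, wEnergy, ← Finset.sum_sub_distrib]
    refine (Finset.sum_le_sum fun k _ => hk k).trans ?_
    rw [← Finset.mul_sum, Finset.sum_add_distrib, Finset.sum_add_distrib, Finset.sum_const,
      Finset.card_univ, Fintype.card_fin, nsmul_eq_mul, shiftConst]
    have s1 := h.sum_sq_le x
    have s2 := h.sum_deriv_sq_le x
    have hn : (0 : ℝ) ≤ n := n.cast_nonneg
    have s3 : ∑ k, x.2 k ^ 2 + ∑ k, deriv V (x.1 k) ^ 2 + n * (3 + C) ≤
        (2 + C + (2 * C + 3) * n) * (1 + totalEnergy V x) := by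
      have : 0 ≤ (2 * C + 3) * n * totalEnergy V x := by positivity
      nlinarith
    calc _ ≤ B * ρ * ((2 + C + (2 * C + 3) * n) * (1 + totalEnergy V x)) := by gcongr
      _ = _ := by ring
  rw [density_eq, density_eq]
  have hZ : 0 ≤ ∏ k, (partitionFn V (betaAt β n k))⁻¹ :=
    Finset.prod_nonneg fun k _ => inv_nonneg.2 (h.pot.partitionFn_pos (h.betaAt_pos k)).le
  have h2 : Real.exp (-wEnergy V (betaAt β n) x) ≤
      2 * Real.exp (-wEnergy V (betaAt β n) (x + w)) := by
    rw [← Real.exp_log (show (0 : ℝ) < 2 by norm_num), ← Real.exp_add]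
    refine Real.exp_le_exp.2 ?_
    linarith
  calc _ ≤ (∏ k, (partitionFn V (betaAt β n k))⁻¹) *
        (2 * Real.exp (-wEnergy V (betaAt β n) (x + w))) := by gcongr
    _ = _ := by ring

/-- Lebesgue measure is translation invariant, so the comparison of densities is the only cost of
undoing the shift. -/
theorem setLIntegral_shift_le (h : ChainBounds V β b B G C) {K : Set (Phase n)}
    (hK : MeasurableSet K) {w : Phase n} (hw : ∀ x ∈ K, density V β x ≤ 2 * density V β (x + w))
    (F : Phase n → ℝ≥0∞) :
    ∫⁻ x in K, F (x + w) ∂(gibbs V β n) ≤ 2 * ∫⁻ x, F x ∂(gibbs V β n) := by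
  rw [← lintegral_indicator hK, h.lintegral_gibbs, h.lintegral_gibbs,
    ← lintegral_const_mul' _ _ (by simp),
    ← lintegral_add_right_eq_self (fun x => 2 * (ENNReal.ofReal (density V β x) * F x)) w]
  refine lintegral_mono fun x => ?_
  by_cases hx : x ∈ K
  · rw [indicator_of_mem hx, ← mul_assoc]
    gcongr
    rw [← ENNReal.ofReal_ofNat, ← ENNReal.ofReal_mul (by norm_num)]
    exact ENNReal.ofReal_le_ofReal (hw x hx)
  · rw [indicator_of_notMem hx]; simp

end ChainBounds
end Bump

/-! ### Pointwise growth of the difference functional -/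

/-- The weight `1/6` is chosen because a bond has at most three neighbouring velocities: together
they use half of the growth rate `n²`. -/
theorem young_relDiff {s m c c₀ η D : ℝ} (hs : |s| ≤ 1) (hm : 0 < m) (hc : |c| ≤ c₀ * |η|) :
    -((2 * s + s ^ 2) * (c * D)) ≤ 1 / 6 * (s ^ 2 * m) + 27 / 2 * c₀ ^ 2 * η ^ 2 * (D ^ 2 / m) := by
  have h1 : |(2 * s + s ^ 2) * (c * D)| ≤ 3 * |s| * (c₀ * |η| * |D|) := by
    rw [abs_mul, abs_mul]
    have : |2 * s + s ^ 2| ≤ 3 * |s| := by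
      rw [show 2 * s + s ^ 2 = s * (2 + s) by ring, abs_mul, mul_comm]
      gcongr
      rw [abs_le] at hs ⊢
      constructor <;> linarith
    gcongr
  have h2 : 3 * |s| * (c₀ * |η| * |D|) ≤
      1 / 6 * (s ^ 2 * m) + 27 / 2 * c₀ ^ 2 * η ^ 2 * (D ^ 2 / m) := by
    have e : 1 / 6 * (s ^ 2 * m) + 27 / 2 * c₀ ^ 2 * η ^ 2 * (D ^ 2 / m) -
        3 * |s| * (c₀ * |η| * |D|) = (|s| * m - 9 * (c₀ * |η| * |D|)) ^ 2 / (6 * m) := by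
      rw [← sq_abs s, ← sq_abs η, ← sq_abs D]; field_simp; ring
    have : 0 ≤ (|s| * m - 9 * (c₀ * |η| * |D|)) ^ 2 / (6 * m) := by positivity
    linarith
  exact (neg_le_abs _).trans (h1.trans h2)

/-- Applied with `N = n²`, this uses the other half of the growth rate, for the difference of the
source terms. -/
theorem young_relDiff_mul {s m v N A Q : ℝ} (hs : |s| ≤ 1) (hv : 0 ≤ v) (hvm : v ≤ m)
    (hN : 0 < N) (hA : A ^ 2 ≤ N * Q) :
    -((2 * s + s ^ 2) * (A * v)) ≤ N / 2 * (s ^ 2 * m) + 9 / 2 * Q * v := by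
  have h1 : |(2 * s + s ^ 2) * (A * v)| ≤ 3 * |s| * (|A| * v) := by
    rw [abs_mul, abs_mul, abs_of_nonneg hv]
    have : |2 * s + s ^ 2| ≤ 3 * |s| := by
      rw [show 2 * s + s ^ 2 = s * (2 + s) by ring, abs_mul, mul_comm]
      gcongr
      rw [abs_le] at hs ⊢
      constructor <;> linarith
    gcongr
  have h2 : 3 * |s| * (|A| * v) ≤ N / 2 * (s ^ 2 * v) + 9 / 2 * (A ^ 2 / N) * v := by
    have e : N / 2 * (s ^ 2 * v) + 9 / 2 * (A ^ 2 / N) * v - 3 * |s| * (|A| * v) =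
        (N * |s| - 3 * |A|) ^ 2 / (2 * N) * v := by
      rw [← sq_abs s, ← sq_abs A]; field_simp; ring
    have : 0 ≤ (N * |s| - 3 * |A|) ^ 2 / (2 * N) * v := by positivity
    linarith
  have h3 : A ^ 2 / N ≤ Q := by rw [div_le_iff₀ hN]; linarith
  have h4 : N / 2 * (s ^ 2 * v) ≤ N / 2 * (s ^ 2 * m) := by gcongr
  have h5 : 9 / 2 * (A ^ 2 / N) * v ≤ 9 / 2 * Q * v := by gcongr
  linarith [neg_le_abs ((2 * s + s ^ 2) * (A * v))]

/-- This allows upper bounds with values in `[0, ∞]` without any integrability proof, since a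
non-integrable function has integral zero. -/
theorem ofReal_integral_le_lintegral {α : Type*} [MeasurableSpace α] {μ : Measure α} (g : α → ℝ) :
    ENNReal.ofReal (∫ x, g x ∂μ) ≤ ∫⁻ x, ENNReal.ofReal (g x) ∂μ := by
  by_cases hg : Integrable g μ
  · rw [integral_eq_lintegral_pos_part_sub_lintegral_neg_part hg]
    exact (ENNReal.ofReal_le_ofReal (sub_le_self _ ENNReal.toReal_nonneg)).trans
      ENNReal.ofReal_toReal_le
  · rw [integral_undef hg]; simp

section
variable {n : ℕ} {V β τ : ℝ → ℝ} {b B G C γ T τm : ℝ} {f : ℝ → Phase n → ℝ}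

/-- The density of the source in the evolution of the bond Fisher information, with a
regularized denominator. -/
def bondSource (V : ℝ → ℝ) (G C γ ε : ℝ) (i : Fin n) (F : Phase n → ℝ) (x : Phase n) : ℝ :=
  27 / 2 * (2 * C + 1 + γ) ^ 2 * (n : ℝ) ^ 2 * ∑ k ∈ nbr i, dp k F x ^ 2 / (F x + ε) +
    90 * G ^ 2 * C ^ 4 * (bondEnergy V i x * F x)

theorem bondSource_nonneg {ε : ℝ} (hε : 0 ≤ ε) (i : Fin n) {F : Phase n → ℝ} {x : Phase n}
    (hF : 0 ≤ F x) : 0 ≤ bondSource V G C γ ε i F x := by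
  have h1 : 0 ≤ ∑ k ∈ nbr i, dp k F x ^ 2 / (F x + ε) :=
    Finset.sum_nonneg fun k _ => by positivity
  have h2 := bondEnergy_nonneg (V := V) i x
  unfold bondSource; positivity

namespace ChainBounds

/-- The evolution of the difference quotient along a bond, pointwise. -/
theorem sqDiff_rate_le (h : ChainBounds V β b B G C) (hn : 1 ≤ n) (hγ : 0 < γ) {τ ε η : ℝ}
    (hε : 0 < ε) (hη : |η| ≤ 1) {i : Fin n} (hi : i ∈ bulk n) {F : Phase n → ℝ}
    (hF : ContDiff ℝ 2 F) (hF0 : ∀ x, 0 ≤ F x) (x : Phase n) :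
    (2 * relDiff ε (F x) (F (x + η • bondDir i)) - relDiff ε (F x) (F (x + η • bondDir i)) ^ 2) *
        forwardOp V β γ τ F x -
      (2 * relDiff ε (F x) (F (x + η • bondDir i)) + relDiff ε (F x) (F (x + η • bondDir i)) ^ 2) *
        (forwardOp V β γ τ F (x + η • bondDir i) +
          (n : ℝ) ^ 2 * η * fderiv ℝ F (x + η • bondDir i) (bondDir i)) -
      forwardOp V β γ τ (fun x => sqDiff ε (F x) (F (x + η • bondDir i))) x ≤
    (n : ℝ) ^ 2 * sqDiff ε (F x) (F (x + η • bondDir i)) +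
      η ^ 2 * bondSource V G C γ ε i F (x + η • bondDir i) + ε * |sourceTerm V β τ x| := by
  have hn0 : (0 : ℝ) < (n : ℝ) ^ 2 := by
    have : (0 : ℝ) < n := by exact_mod_cast hn
    positivity
  have hv : ContDiff ℝ 2 fun y => F (y + η • bondDir i) := hF.comp (contDiff_id.add contDiff_const)
  have hv0 : ∀ y, 0 ≤ F (y + η • bondDir i) := fun y => hF0 _
  have e1 := forwardOp_sqDiff (V := V) (β := β) (γ := γ) (τ := τ) hε hF hv hF0 hv0 x
  have e2 := forwardOp_shift (V := V) (β := β) (γ := γ) (τ := τ) (f := F) i η x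
  have hs := abs_relDiff_le hε (hF0 x) (hv0 x)
  have hΦ := sqDiff_eq hε (hF0 x) (hv0 x)
  have hσ := h.sourceTerm_sub_sq_le (τ := τ) hη hi x
  have hbe := h.bondEnergy_le_shift hη i x
  have hcc := fun k => h.abs_shiftCoeff_le hγ (τ := τ) (η := η) i x k
  have hFx := hF0 x
  have hFy := hF0 (x + η • bondDir i)
  rw [hΦ]
  set y := x + η • bondDir i with hy
  set s := relDiff ε (F x) (F y) with hsdef
  set m := F x + F y + ε with hm
  have hm0 : 0 < m := by positivity
  -- The dissipation of the convex functional has a sign and is discarded; the decay comes from the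
  -- growth of the shift, not from here.
  have hdiss : 0 ≤ (n : ℝ) ^ 2 * γ * ∑ k, (betaAt β n k)⁻¹ * (2 / m *
        ((dp k F x - dp k (fun y => F (y + η • bondDir i)) x) -
          s * (dp k F x + dp k (fun y => F (y + η • bondDir i)) x)) ^ 2) := by
    refine mul_nonneg (by positivity) (Finset.sum_nonneg fun k _ =>
      mul_nonneg (h.beta_inv_nonneg k) (by positivity))
  have hsrc : sourceTerm V β τ x * (ε * s ^ 2) ≤ ε * |sourceTerm V β τ x| := by
    have : s ^ 2 ≤ 1 := by rw [← sq_abs]; exact pow_le_one₀ (abs_nonneg _) hs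
    calc _ ≤ |sourceTerm V β τ x| * (ε * s ^ 2) := by gcongr; exact le_abs_self _
      _ ≤ |sourceTerm V β τ x| * (ε * 1) := by gcongr
      _ = _ := by ring
  have hR : -((2 * s + s ^ 2) * ((n : ℝ) ^ 2 * ∑ k, shiftCoeff V γ τ η i x k * dp k F y)) ≤
      (n : ℝ) ^ 2 / 2 * (s ^ 2 * m) + η ^ 2 * (27 / 2 * (2 * C + 1 + γ) ^ 2 * (n : ℝ) ^ 2 *
        ∑ k ∈ nbr i, dp k F y ^ 2 / (F y + ε)) := by
    have e3 : ∑ k, shiftCoeff V γ τ η i x k * dp k F y =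
        ∑ k ∈ nbr i, shiftCoeff V γ τ η i x k * dp k F y :=
      (Finset.sum_subset (Finset.subset_univ _) fun k _ hk => by
        rw [shiftCoeff_eq_zero i x hk, zero_mul]).symm
    have e4 : -((2 * s + s ^ 2) * ∑ k ∈ nbr i, shiftCoeff V γ τ η i x k * dp k F y) ≤
        ∑ k ∈ nbr i, (1 / 6 * (s ^ 2 * m) +
          27 / 2 * (2 * C + 1 + γ) ^ 2 * η ^ 2 * (dp k F y ^ 2 / (F y + ε))) := by
      rw [Finset.mul_sum, ← Finset.sum_neg_distrib]
      refine Finset.sum_le_sum fun k _ => (young_relDiff hs hm0 (hcc k)).trans ?_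
      gcongr
      rw [hm]; linarith
    have e5 : ∑ k ∈ nbr i, (1 / 6 * (s ^ 2 * m) +
          27 / 2 * (2 * C + 1 + γ) ^ 2 * η ^ 2 * (dp k F y ^ 2 / (F y + ε))) ≤
        1 / 2 * (s ^ 2 * m) + 27 / 2 * (2 * C + 1 + γ) ^ 2 * η ^ 2 *
          ∑ k ∈ nbr i, dp k F y ^ 2 / (F y + ε) := by
      rw [Finset.sum_add_distrib, Finset.sum_const, nsmul_eq_mul, Finset.mul_sum]
      have h0 : 0 ≤ 1 / 6 * (s ^ 2 * m) := by positivity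
      have := mul_le_mul_of_nonneg_right
        (show ((nbr i).card : ℝ) ≤ 3 by exact_mod_cast card_nbr_le i) h0
      linarith
    rw [e3]
    calc _ = (n : ℝ) ^ 2 * -((2 * s + s ^ 2) *
          ∑ k ∈ nbr i, shiftCoeff V γ τ η i x k * dp k F y) := by ring
      _ ≤ (n : ℝ) ^ 2 * (1 / 2 * (s ^ 2 * m) + 27 / 2 * (2 * C + 1 + γ) ^ 2 * η ^ 2 *
          ∑ k ∈ nbr i, dp k F y ^ 2 / (F y + ε)) :=
        mul_le_mul_of_nonneg_left (e4.trans e5) hn0.le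
      _ = _ := by ring
  -- The local energy is moved to the shifted point, where `F y` sits, so that the product can later
  -- be translated back as a whole.
  have hA : -((2 * s + s ^ 2) * ((sourceTerm V β τ y - sourceTerm V β τ x) * F y)) ≤
      (n : ℝ) ^ 2 / 2 * (s ^ 2 * m) + η ^ 2 * (90 * G ^ 2 * C ^ 4 * (bondEnergy V i y * F y)) := by
    have hA2 : (sourceTerm V β τ y - sourceTerm V β τ x) ^ 2 ≤
        (n : ℝ) ^ 2 * (20 * G ^ 2 * C ^ 4 * η ^ 2 * bondEnergy V i y) := by
      refine hσ.trans ?_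
      calc _ ≤ 4 * (n * G * C * η) ^ 2 * (5 * C ^ 2 * bondEnergy V i y) := by gcongr
        _ = _ := by ring
    refine (young_relDiff_mul hs hFy (show F y ≤ m by rw [hm]; linarith) hn0 hA2).trans (le_of_eq ?_)
    ring
  rw [bondSource]
  have key : (2 * s - s ^ 2) * forwardOp V β γ τ F x -
      (2 * s + s ^ 2) * (forwardOp V β γ τ F y + (n : ℝ) ^ 2 * η * fderiv ℝ F y (bondDir i)) -
      forwardOp V β γ τ (fun x => sqDiff ε (F x) (F (x + η • bondDir i))) x =
      sourceTerm V β τ x * (ε * s ^ 2) - (n : ℝ) ^ 2 * γ *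
      ∑ k, (betaAt β n k)⁻¹ * (2 / m *
        ((dp k F x - dp k (fun y => F (y + η • bondDir i)) x) -
          s * (dp k F x + dp k (fun y => F (y + η • bondDir i)) x)) ^ 2) -
      (2 * s + s ^ 2) * ((n : ℝ) ^ 2 * ∑ k, shiftCoeff V γ τ η i x k * dp k F y) -
      (2 * s + s ^ 2) * ((sourceTerm V β τ y - sourceTerm V β τ x) * F y) := by
    rw [← e1]
    have e6 : forwardOp V β γ τ F y + (n : ℝ) ^ 2 * η * fderiv ℝ F y (bondDir i) =
      forwardOp V β γ τ (fun y => F (y + η • bondDir i)) x +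
      ((n : ℝ) ^ 2 * ∑ k, shiftCoeff V γ τ η i x k * dp k F y +
        (sourceTerm V β τ y - sourceTerm V β τ x) * F y) := by linarith
    rw [e6]
    ring
  rw [key]
  linarith

/-- The constant in the bound of the source term by the energy. -/
def sourceConst (B G C τm : ℝ) (n : ℕ) : ℝ :=
  (n : ℝ) ^ 2 * G ^ 2 * C * (n + 1) + 2 + 2 * (n : ℝ) ^ 2 * B * τm

theorem abs_sourceTerm_le (h : ChainBounds V β b B G C) {τ : ℝ} (hτ : |τ| ≤ τm) (x : Phase n) :
    |sourceTerm V β τ x| ≤ sourceConst B G C τm n * (1 + totalEnergy V x) := by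
  have hE := h.totalEnergy_nonneg x
  have hC := h.C_pos
  have hB := h.B_pos
  have h1 : |∑ k, bulkCoeff V β k x * x.2 k| ≤
      ((n : ℝ) ^ 2 * G ^ 2 * C * (n + 1) + 2) * (1 + totalEnergy V x) := by
    calc _ ≤ ∑ k, ((n : ℝ) ^ 2 * G ^ 2 * nextForceSq V k x + x.2 k ^ 2) := by
          refine (Finset.abs_sum_le_sum_abs _ _).trans (Finset.sum_le_sum fun k _ => ?_)
          have h2 := h.bulkCoeff_sq_le k x
          rw [abs_mul]
          nlinarith [sq_nonneg (|bulkCoeff V β k x| - |x.2 k|), sq_abs (bulkCoeff V β k x),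
            sq_abs (x.2 k), sq_nonneg (x.2 k), sq_nonneg (bulkCoeff V β k x)]
      _ = (n : ℝ) ^ 2 * G ^ 2 * ∑ k, nextForceSq V k x + ∑ k, x.2 k ^ 2 := by
          rw [Finset.sum_add_distrib, Finset.mul_sum]
      _ ≤ (n : ℝ) ^ 2 * G ^ 2 * (C * (n + totalEnergy V x)) + 2 * totalEnergy V x := by
          gcongr
          · exact h.sum_nextForceSq_le x
          · exact h.sum_sq_le x
      _ ≤ (n : ℝ) ^ 2 * G ^ 2 * (C * ((n + 1) * (1 + totalEnergy V x))) +
          2 * (1 + totalEnergy V x) := by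
          have hn : (0 : ℝ) ≤ n := n.cast_nonneg
          gcongr
          · nlinarith
          · linarith
      _ = _ := by ring
  have h2 : |(n : ℝ) ^ 2 * β 1 * τ * pLast x.2| ≤
      2 * (n : ℝ) ^ 2 * B * τm * (1 + totalEnergy V x) := by
    rw [abs_mul, abs_mul, abs_mul, abs_of_nonneg (by positivity : 0 ≤ (n : ℝ) ^ 2),
      abs_of_pos h.beta_one_pos]
    have h3 := h.beta_one_le
    have h4 := h.abs_pLast_le x
    have h5 := (abs_nonneg _).trans hτ
    calc _ ≤ (n : ℝ) ^ 2 * B * τm * (2 * (1 + totalEnergy V x)) := by gcongr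
      _ = _ := by ring
  rw [sourceTerm_split]
  refine (abs_add_le _ _).trans ((add_le_add h1 h2).trans (le_of_eq ?_))
  rw [sourceConst]; ring

end ChainBounds
end

/-! ### Evolution of the weighted difference along a bond -/

/-- Admissible sizes of the shift along a bond and of the cutoff. -/
structure IsShiftSize (B C T κ δ : ℝ) (n : ℕ) : Prop where
  amp_pos : 0 < κ
  pos : 0 < δ
  le_one : δ ≤ 1
  amp_le_one : κ * Real.exp ((n : ℝ) ^ 2 * T) ≤ 1
  amp_le : ChainBounds.shiftConst B C n * (κ * Real.exp ((n : ℝ) ^ 2 * T)) * 2 ≤ Real.log 2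

/-- The size of the shift at time `u`. -/
def shiftSize (n : ℕ) (κ δ u : ℝ) : ℝ := κ * δ * Real.exp ((n : ℝ) ^ 2 * u)

/-- The weight against which the difference along a bond is integrated. -/
def bondWeight (V : ℝ → ℝ) {n : ℕ} (c δ u : ℝ) (x : Phase n) : ℝ :=
  Real.exp (-((n : ℝ) ^ 2 * u)) * bump V (δ * Real.exp (c * u)) x

/-- The time derivative of `bondWeight`. -/
def bondWeightDeriv (V : ℝ → ℝ) {n : ℕ} (c δ u : ℝ) (x : Phase n) : ℝ :=
  -(n : ℝ) ^ 2 * bondWeight V c δ u x + Real.exp (-((n : ℝ) ^ 2 * u)) *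
    -(4 * (c * (δ * Real.exp (c * u))) * (1 + totalEnergy V x) *
      max (1 - δ * Real.exp (c * u) * (1 + totalEnergy V x)) 0 ^ 3)

/-- The squared difference of `f` along a bond. -/
def bondDiff {n : ℕ} (κ δ : ℝ) (i : Fin n) (f : ℝ → Phase n → ℝ) (u : ℝ) (x : Phase n) : ℝ :=
  sqDiff (δ ^ 4) (f u x) (f u (x + shiftSize n κ δ u • bondDir i))

/-- The time derivative of `bondDiff` for a solution of the forward equation. -/
def bondDiffDeriv (V β τ : ℝ → ℝ) (γ : ℝ) {n : ℕ} (κ δ : ℝ) (i : Fin n) (f : ℝ → Phase n → ℝ)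
    (u : ℝ) (x : Phase n) : ℝ :=
  (2 * relDiff (δ ^ 4) (f u x) (f u (x + shiftSize n κ δ u • bondDir i)) -
      relDiff (δ ^ 4) (f u x) (f u (x + shiftSize n κ δ u • bondDir i)) ^ 2) *
      forwardOp V β γ (τ u) (f u) x -
    (2 * relDiff (δ ^ 4) (f u x) (f u (x + shiftSize n κ δ u • bondDir i)) +
      relDiff (δ ^ 4) (f u x) (f u (x + shiftSize n κ δ u • bondDir i)) ^ 2) *
      (forwardOp V β γ (τ u) (f u) (x + shiftSize n κ δ u • bondDir i) +
        (n : ℝ) ^ 2 * shiftSize n κ δ u *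
          fderiv ℝ (f u) (x + shiftSize n κ δ u • bondDir i) (bondDir i))

section
variable {n : ℕ} {V β τ : ℝ → ℝ} {b B G C γ T τm κ δ c : ℝ} {f : ℝ → Phase n → ℝ}

theorem continuous_shiftSize : Continuous (shiftSize n κ δ) := by unfold shiftSize; fun_prop

theorem hasDerivAt_shiftSize (u : ℝ) :
    HasDerivAt (shiftSize n κ δ) ((n : ℝ) ^ 2 * shiftSize n κ δ u) u := by
  have := ((((hasDerivAt_id u).const_mul ((n : ℝ) ^ 2))).exp).const_mul (κ * δ)
  refine this.congr_deriv ?_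
  simp [shiftSize]; ring

theorem bondWeight_nonneg (u : ℝ) (x : Phase n) : 0 ≤ bondWeight V c δ u x :=
  mul_nonneg (Real.exp_pos _).le (bump_nonneg _ _)

theorem hasDerivAt_bondWeight (u : ℝ) (x : Phase n) :
    HasDerivAt (fun u => bondWeight V c δ u x) (bondWeightDeriv V c δ u x) u := by
  have h1 : HasDerivAt (fun u : ℝ => Real.exp (-((n : ℝ) ^ 2 * u)))
      (Real.exp (-((n : ℝ) ^ 2 * u)) * -((n : ℝ) ^ 2 * 1)) u :=
    (((hasDerivAt_id u).const_mul ((n : ℝ) ^ 2)).neg).exp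
  have h2 : HasDerivAt (fun u : ℝ => 1 - δ * Real.exp (c * u) * (1 + totalEnergy V x))
      (-(δ * (Real.exp (c * u) * (c * 1)) * (1 + totalEnergy V x))) u :=
    ((((((hasDerivAt_id u).const_mul c).exp).const_mul δ).mul_const _).const_sub 1)
  have h3 := (hasDerivAt_max_pow_four (1 - δ * Real.exp (c * u) * (1 + totalEnergy V x))).comp
    (h := fun u : ℝ => 1 - δ * Real.exp (c * u) * (1 + totalEnergy V x)) u h2
  refine (h1.mul h3).congr_deriv ?_
  simp only [bondWeightDeriv, bondWeight, bump, Function.comp_apply]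
  ring

theorem le_mul_exp (hδ : 0 ≤ δ) (hc : 0 ≤ c) {u : ℝ} (hu : 0 ≤ u) : δ ≤ δ * Real.exp (c * u) :=
  le_mul_of_one_le_right hδ (Real.one_le_exp (by positivity))

namespace ChainBounds

theorem bondWeight_le (h : ChainBounds V β b B G C) (hδ : 0 ≤ δ) {u : ℝ} (x : Phase n) :
    bondWeight V c δ u x ≤ Real.exp (-((n : ℝ) ^ 2 * u)) :=
  mul_le_of_le_one_right (Real.exp_pos _).le (h.bump_le_one (by positivity) x)

theorem bondWeight_eq_zero (h : ChainBounds V β b B G C) (hδ : 0 < δ) (hc : 0 ≤ c) {u : ℝ}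
    (hu : 0 ≤ u) {x : Phase n} (hx : x ∉ {x : Phase n | totalEnergy V x ≤ 1 / δ}) :
    bondWeight V c δ u x = 0 := by
  rw [bondWeight, bump, h.max_eq_zero_of_notMem hδ (le_mul_exp hδ.le hc hu) hx]; simp

theorem bondWeightDeriv_eq_zero (h : ChainBounds V β b B G C) (hδ : 0 < δ) (hc : 0 ≤ c) {u : ℝ}
    (hu : 0 ≤ u) {x : Phase n} (hx : x ∉ {x : Phase n | totalEnergy V x ≤ 1 / δ}) :
    bondWeightDeriv V c δ u x = 0 := by
  rw [bondWeightDeriv, h.bondWeight_eq_zero hδ hc hu hx,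
    h.max_eq_zero_of_notMem hδ (le_mul_exp hδ.le hc hu) hx]; simp

theorem gen_bondWeight_eq_zero (h : ChainBounds V β b B G C) (hδ : 0 < δ) (hc : 0 ≤ c) {u : ℝ}
    (hu : 0 ≤ u) {x : Phase n} (hx : x ∉ {x : Phase n | totalEnergy V x ≤ 1 / δ}) {τ : ℝ} :
    gen V β γ τ (bondWeight V c δ u) x = 0 := by
  unfold bondWeight
  rw [gen_const_mul _ _ (h.contDiff_bump _), h.gen_bump,
    h.max_eq_zero_of_notMem hδ (le_mul_exp hδ.le hc hu) hx]; simp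

theorem continuous_bondWeight (h : ChainBounds V β b B G C) :
    Continuous fun z : ℝ × Phase n => bondWeight V c δ z.1 z.2 := by
  have := h.continuous_totalEnergy (n := n)
  unfold bondWeight bump; fun_prop

theorem continuous_bondWeightDeriv (h : ChainBounds V β b B G C) :
    Continuous fun z : ℝ × Phase n => bondWeightDeriv V c δ z.1 z.2 := by
  have := h.continuous_totalEnergy (n := n)
  have := h.continuous_bondWeight (n := n) (c := c) (δ := δ)
  unfold bondWeightDeriv; fun_prop

theorem contDiff_bondWeight (h : ChainBounds V β b B G C) (u : ℝ) :
    ContDiff ℝ 2 (bondWeight V c δ u : Phase n → ℝ) :=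
  contDiff_const.mul (h.contDiff_bump _)

/-- The factor `exp (-n² u)` supplies the term `-n²` that cancels the growth allowed for the
difference functional. The cutoff contributes only a cubic error. -/
theorem bondWeight_rate_le (h : ChainBounds V β b B G C) (hγ : 0 < γ) {τ : ℝ} (hτ : |τ| ≤ τm)
    (hδ : 0 ≤ δ) (hc : c = ChainBounds.genConst b γ τm n + ChainBounds.bumpConst b γ n) {u : ℝ} (x : Phase n) :
    bondWeightDeriv V c δ u x + gen V β γ τ (bondWeight V c δ u) x ≤
      -(n : ℝ) ^ 2 * bondWeight V c δ u x + Real.exp (-((n : ℝ) ^ 2 * u)) *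
        (ChainBounds.bumpConst b γ n * (δ * Real.exp (c * u)) ^ 3) := by
  have h1 := h.bump_rate_le hγ hτ (a := δ * Real.exp (c * u)) (by positivity) x
  have e : gen V β γ τ (bondWeight V c δ u) x =
      Real.exp (-((n : ℝ) ^ 2 * u)) * gen V β γ τ (bump V (δ * Real.exp (c * u))) x :=
    gen_const_mul _ _ (h.contDiff_bump _) x
  rw [e, bondWeightDeriv, add_assoc, ← mul_add]
  rw [← hc] at h1
  gcongr

end ChainBounds

theorem ChainBounds.shiftConst_nonneg (h : ChainBounds V β b B G C) : 0 ≤ ChainBounds.shiftConst B C n := by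
  have := h.B_pos; have := h.C_pos; unfold ChainBounds.shiftConst; positivity

namespace IsShiftSize

theorem shiftSize_pos (hs : IsShiftSize B C T κ δ n) (u : ℝ) : 0 < shiftSize n κ δ u :=
  mul_pos (mul_pos hs.amp_pos hs.pos) (Real.exp_pos _)

theorem shiftSize_le (hs : IsShiftSize B C T κ δ n) {u : ℝ} (hu : u ≤ T) :
    shiftSize n κ δ u ≤ κ * Real.exp ((n : ℝ) ^ 2 * T) * δ := by
  have h1 := hs.amp_pos
  have h2 := hs.pos
  calc shiftSize n κ δ u ≤ κ * δ * Real.exp ((n : ℝ) ^ 2 * T) := by unfold shiftSize; gcongr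
    _ = _ := by ring

theorem shiftSize_le_one (hs : IsShiftSize B C T κ δ n) {u : ℝ} (hu : u ≤ T) :
    shiftSize n κ δ u ≤ 1 :=
  (hs.shiftSize_le hu).trans (mul_le_one₀ hs.amp_le_one hs.pos.le hs.le_one)

theorem one_add_le (hs : IsShiftSize B C T κ δ n) {x : Phase n}
    (hx : x ∈ {x : Phase n | totalEnergy V x ≤ 1 / δ}) : δ * (1 + totalEnergy V x) ≤ 2 := by
  have h1 : totalEnergy V x ≤ 1 / δ := hx
  rw [le_div_iff₀ hs.pos] at h1
  have := hs.le_one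
  linarith

/-- On the support `1 + E ≤ 2/δ` while the shift is at most a constant times `δ`; the product is
bounded independently of `δ`. -/
theorem density_le_shift (hs : IsShiftSize B C T κ δ n) (h : ChainBounds V β b B G C) {ρ : ℝ}
    (hρ : 0 ≤ ρ) {u : ℝ} (hρu : ρ ≤ shiftSize n κ δ u) (hu : u ≤ T) (i : Fin n)
    {x : Phase n} (hx : x ∈ {x : Phase n | totalEnergy V x ≤ 1 / δ}) :
    density V β x ≤ 2 * density V β (x + ρ • bondDir i) := by
  have h1 := hs.shiftSize_le hu
  have h2 := hs.shiftSize_le_one hu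
  have hE := h.totalEnergy_nonneg x
  have hS := h.shiftConst_nonneg (n := n)
  refine h.density_le_shift hρ (hρu.trans h2) (fun k => ?_) (fun k => ?_) ?_
  · simpa [abs_of_nonneg hρ] using abs_shift_fst_le (0 : Phase n) ρ i k
  · have := shift_snd (0 : Phase n) ρ i k
    simp only [zero_add] at this
    rw [this]
    split_ifs
    · simp [abs_of_nonneg hρ]
    · simpa using hρ
  · calc _ ≤ ChainBounds.shiftConst B C n * (κ * Real.exp ((n : ℝ) ^ 2 * T) * δ) * (1 + totalEnergy V x) := by
          gcongr; exact hρu.trans h1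
      _ = ChainBounds.shiftConst B C n * (κ * Real.exp ((n : ℝ) ^ 2 * T)) * (δ * (1 + totalEnergy V x)) := by
          ring
      _ ≤ ChainBounds.shiftConst B C n * (κ * Real.exp ((n : ℝ) ^ 2 * T)) * 2 := by
          have := hs.amp_pos
          gcongr
          exact hs.one_add_le hx
      _ ≤ _ := hs.amp_le

end IsShiftSize

namespace IsForwardSolution

theorem continuousOn_shift {F : ℝ × Phase n → ℝ} {S : Set ℝ} (hF : ContinuousOn F (S ×ˢ univ))
    (i : Fin n) : ContinuousOn
      (fun z : ℝ × Phase n => F (z.1, z.2 + shiftSize n κ δ z.1 • bondDir i)) (S ×ˢ univ) := by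
  have := continuous_shiftSize (n := n) (κ := κ) (δ := δ)
  exact hF.comp (f := fun z : ℝ × Phase n => (z.1, z.2 + shiftSize n κ δ z.1 • bondDir i))
    (by fun_prop) fun z hz => ⟨hz.1, mem_univ _⟩

theorem continuousOn_bondDiff (hf : IsForwardSolution V β γ τ n f) (hδ : 0 < δ) {S : Set ℝ}
    (hS : S ⊆ Ici 0) (hc : ContinuousOn (fun z : ℝ × Phase n => f z.1 z.2) (S ×ˢ univ))
    (i : Fin n) :
    ContinuousOn (fun z : ℝ × Phase n => bondDiff κ δ i f z.1 z.2) (S ×ˢ univ) := by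
  have h2 := continuousOn_shift (κ := κ) (δ := δ) hc i
  refine ((hc.sub h2).pow 2).div ((hc.add h2).add continuousOn_const) ?_
  rintro ⟨u, x⟩ ⟨hu, -⟩
  have h3 := hf.nonneg u (hS hu) x
  have h4 := hf.nonneg u (hS hu) (x + shiftSize n κ δ u • bondDir i)
  dsimp only
  positivity

theorem continuousOn_bondDiffDeriv (hf : IsForwardSolution V β γ τ n f)
    (h : ChainBounds V β b B G C) (hτ : ContinuousOn τ (Ioi 0)) (hδ : 0 < δ) (i : Fin n) :
    ContinuousOn (fun z : ℝ × Phase n => bondDiffDeriv V β τ γ κ δ i f z.1 z.2)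
      (Ioi 0 ×ˢ univ) := by
  have h1 := hf.continuousOn
  have h2 := continuousOn_shift (κ := κ) (δ := δ) h1 i
  have h3 := hf.continuousOn_forwardOp h hτ
  have h4 := continuousOn_shift (κ := κ) (δ := δ) h3 i
  have h5 := continuousOn_shift (κ := κ) (δ := δ) (hf.continuousOn_fderiv_apply (bondDir i)) i
  have h6 : ContinuousOn (fun z : ℝ × Phase n =>
      relDiff (δ ^ 4) (f z.1 z.2) (f z.1 (z.2 + shiftSize n κ δ z.1 • bondDir i)))
      (Ioi 0 ×ˢ univ) := by
    refine (h1.sub h2).div ((h1.add h2).add continuousOn_const) ?_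
    rintro ⟨u, x⟩ ⟨hu, -⟩
    have h3 := hf.nonneg u (mem_Ioi.1 hu).le x
    have h4 := hf.nonneg u (mem_Ioi.1 hu).le (x + shiftSize n κ δ u • bondDir i)
    dsimp only
    positivity
  have h7 : ContinuousOn (fun z : ℝ × Phase n => (n : ℝ) ^ 2 * shiftSize n κ δ z.1)
      (Ioi 0 ×ˢ univ) :=
    (continuous_const.mul (continuous_shiftSize.comp continuous_fst)).continuousOn
  exact (((continuousOn_const.mul h6).sub (h6.pow 2)).mul h3).sub
    (((continuousOn_const.mul h6).add (h6.pow 2)).mul (h4.add (h7.mul h5)))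

theorem contDiff_bondDiff (hf : IsForwardSolution V β γ τ n f) (hδ : 0 < δ) (i : Fin n) {u : ℝ}
    (hu : 0 < u) : ContDiff ℝ 2 (bondDiff κ δ i f u) := by
  have h1 : ContDiff ℝ 2 (f u) := (hf.contDiff u hu).of_le (by norm_cast)
  exact contDiff_sqDiff (by positivity) h1 (h1.comp (contDiff_id.add contDiff_const))
    (hf.nonneg u hu.le) fun x => hf.nonneg u hu.le _

theorem hasDerivAt_bondDiff (hf : IsForwardSolution V β γ τ n f) (h : ChainBounds V β b B G C)
    (hτ : ContinuousOn τ (Ioi 0)) (hδ : 0 < δ) (i : Fin n) {u : ℝ} (hu : 0 < u) (x : Phase n) :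
    HasDerivAt (fun u => bondDiff κ δ i f u x) (bondDiffDeriv V β τ γ κ δ i f u x) u := by
  have h1 := hf.forward u hu x
  have h2 := hf.hasDerivAt_shift h hτ hu x (bondDir i) (hasDerivAt_shiftSize (n := n) (κ := κ) (δ := δ) u)
  have h3 := hf.nonneg u hu.le x
  have h4 := hf.nonneg u hu.le (x + shiftSize n κ δ u • bondDir i)
  exact hasDerivAt_sqDiff (ε := δ ^ 4) h1 h2 (by positivity)

theorem bondDiff_nonneg (hf : IsForwardSolution V β γ τ n f) (hδ : 0 < δ) (i : Fin n) {u : ℝ}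
    (hu : 0 ≤ u) (x : Phase n) : 0 ≤ bondDiff κ δ i f u x :=
  sqDiff_nonneg (by positivity) (hf.nonneg u hu x) (hf.nonneg u hu _)

theorem bondSource_le (hf : IsForwardSolution V β γ τ n f) {ε : ℝ} (hε : 0 ≤ ε) (i : Fin n)
    {u : ℝ} (hu : 0 < u) (x : Phase n) :
    bondSource V G C γ ε i (f u) x ≤ bondSource V G C γ 0 i (f u) x := by
  have h1 : ∀ k, dp k (f u) x ^ 2 / (f u x + ε) ≤ dp k (f u) x ^ 2 / (f u x + 0) := fun k => by
    rw [add_zero]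
    rcases (hf.nonneg u hu.le x).eq_or_lt with h0 | h0
    · have : dp k (f u) x = 0 := by unfold dp; rw [hf.fderiv_eq_zero_of_eq_zero hu h0.symm]; rfl
      simp [this]
    · exact div_le_div_of_nonneg_left (sq_nonneg _) h0 (by linarith)
  unfold bondSource
  have h2 := Finset.sum_le_sum fun k (_ : k ∈ nbr i) => h1 k
  gcongr

/-- The integrand in the evolution of the weighted difference, pointwise. -/
theorem bond_integrand_le (hf : IsForwardSolution V β γ τ n f) (h : ChainBounds V β b B G C)
    (hn : 1 ≤ n) (hγ : 0 < γ) (hs : IsShiftSize B C T κ δ n) {u : ℝ} (hu : 0 < u) (huT : u ≤ T)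
    (hτ : |τ u| ≤ τm) (hc : c = ChainBounds.genConst b γ τm n + ChainBounds.bumpConst b γ n) (hc0 : 0 ≤ c)
    {i : Fin n} (hi : i ∈ bulk n) (x : Phase n) :
    (bondWeightDeriv V c δ u x + gen V β γ (τ u) (bondWeight V c δ u) x) * bondDiff κ δ i f u x +
      bondWeight V c δ u x * (bondDiffDeriv V β τ γ κ δ i f u x -
        forwardOp V β γ (τ u) (bondDiff κ δ i f u) x) ≤
    {x : Phase n | totalEnergy V x ≤ 1 / δ}.indicator (fun x =>
      ChainBounds.bumpConst b γ n * Real.exp (3 * c * T) * δ ^ 3 *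
        (f u x + f u (x + shiftSize n κ δ u • bondDir i)) +
      (κ * δ) ^ 2 * Real.exp ((n : ℝ) ^ 2 * u) *
        bondSource V G C γ 0 i (f u) (x + shiftSize n κ δ u • bondDir i) +
      2 * ChainBounds.sourceConst B G C τm n * δ ^ 3) x := by
  have hδ := hs.pos
  have hΦ := hf.bondDiff_nonneg (κ := κ) hδ i hu.le x
  by_cases hx : x ∈ {x : Phase n | totalEnergy V x ≤ 1 / δ}
  swap
  · rw [indicator_of_notMem hx, h.bondWeightDeriv_eq_zero hδ hc0 hu.le hx,
      h.gen_bondWeight_eq_zero hδ hc0 hu.le hx, h.bondWeight_eq_zero hδ hc0 hu.le hx]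
    simp
  rw [indicator_of_mem hx]
  set η := shiftSize n κ δ u with hη
  have hη0 : 0 < η := hs.shiftSize_pos u
  have hη1 : |η| ≤ 1 := by rw [abs_of_pos hη0]; exact hs.shiftSize_le_one huT
  have hE := h.totalEnergy_nonneg x
  have hb := h.b_pos
  have h1 := h.bondWeight_rate_le hγ hτ hδ.le hc (u := u) x
  have h2 := h.sqDiff_rate_le hn hγ (τ := τ u) (ε := δ ^ 4) (by positivity) hη1 hi
    ((hf.contDiff u hu).of_le (by norm_cast)) (hf.nonneg u hu.le) x
  have h3 := hf.bondSource_le (G := G) (C := C) (ε := δ ^ 4) (by positivity) i hu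
    (x + η • bondDir i)
  have h4 := bondSource_nonneg (V := V) (G := G) (C := C) (γ := γ) (ε := 0) le_rfl i
    (hf.nonneg u hu.le (x + η • bondDir i))
  have h4' := bondSource_nonneg (V := V) (G := G) (C := C) (γ := γ) (ε := δ ^ 4) (by positivity) i
    (hf.nonneg u hu.le (x + η • bondDir i))
  have h5 := h.abs_sourceTerm_le hτ x
  have h6 : bondDiff κ δ i f u x ≤ f u x + f u (x + η • bondDir i) :=
    sqDiff_le (by positivity) (hf.nonneg u hu.le x) (hf.nonneg u hu.le _)
  have hW := bondWeight_nonneg (V := V) (c := c) (δ := δ) u x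
  have hW1 := h.bondWeight_le (c := c) hδ.le (u := u) x
  have hexp : Real.exp (-((n : ℝ) ^ 2 * u)) ≤ 1 :=
    Real.exp_le_one_iff.2 (by have : 0 ≤ (n : ℝ) ^ 2 * u := by positivity
                              linarith)
  have hq : 0 ≤ ChainBounds.bumpConst b γ n := by unfold ChainBounds.bumpConst; positivity
  have hsc : 0 ≤ ChainBounds.sourceConst B G C τm n := by
    have := h.C_pos; have := h.B_pos; have := (abs_nonneg _).trans hτ
    unfold ChainBounds.sourceConst; positivity
  have p1 : Real.exp (-((n : ℝ) ^ 2 * u)) * (ChainBounds.bumpConst b γ n * (δ * Real.exp (c * u)) ^ 3) ≤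
      ChainBounds.bumpConst b γ n * Real.exp (3 * c * T) * δ ^ 3 := by
    have e3 : (δ * Real.exp (c * u)) ^ 3 = Real.exp (3 * c * u) * δ ^ 3 := by
      rw [mul_pow, ← Real.exp_nat_mul]; push_cast; ring_nf
    rw [e3]
    calc _ ≤ 1 * (ChainBounds.bumpConst b γ n * (Real.exp (3 * c * T) * δ ^ 3)) := by gcongr
      _ = _ := by ring
  -- The weight decays like `exp (-n² u)` and the squared shift grows like `exp (2 n² u)`, so the
  -- source is weighted by `exp (n² u)`.
  have p2 : bondWeight V c δ u x * (η ^ 2 * bondSource V G C γ (δ ^ 4) i (f u) (x + η • bondDir i)) ≤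
      (κ * δ) ^ 2 * Real.exp ((n : ℝ) ^ 2 * u) * bondSource V G C γ 0 i (f u) (x + η • bondDir i) := by
    have e4 : Real.exp (-((n : ℝ) ^ 2 * u)) * η ^ 2 = (κ * δ) ^ 2 * Real.exp ((n : ℝ) ^ 2 * u) := by
      rw [hη, shiftSize, mul_pow, ← Real.exp_nat_mul, mul_left_comm, ← Real.exp_add]
      push_cast; ring_nf
    calc _ ≤ Real.exp (-((n : ℝ) ^ 2 * u)) *
          (η ^ 2 * bondSource V G C γ 0 i (f u) (x + η • bondDir i)) := by gcongr
      _ = _ := by rw [← mul_assoc, e4]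
  -- The regularization `δ⁴` meets a source of order `1 + E`, and `δ (1 + E) ≤ 2` on the support;
  -- the error is of order `δ³`.
  have p3 : bondWeight V c δ u x * (δ ^ 4 * |sourceTerm V β (τ u) x|) ≤
      2 * ChainBounds.sourceConst B G C τm n * δ ^ 3 := by
    calc _ ≤ 1 * (δ ^ 4 * (ChainBounds.sourceConst B G C τm n * (1 + totalEnergy V x))) := by
          gcongr; exact hW1.trans hexp
      _ = ChainBounds.sourceConst B G C τm n * δ ^ 3 * (δ * (1 + totalEnergy V x)) := by ring
      _ ≤ ChainBounds.sourceConst B G C τm n * δ ^ 3 * 2 := by gcongr; exact hs.one_add_le hx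
      _ = _ := by ring
  have q1 := mul_le_mul_of_nonneg_right h1 hΦ
  have q2 := mul_le_mul_of_nonneg_left h2 hW
  have q3 := mul_le_mul_of_nonneg_left h6
    (by positivity : 0 ≤ ChainBounds.bumpConst b γ n * Real.exp (3 * c * T) * δ ^ 3)
  have q4 := mul_le_mul_of_nonneg_right p1 hΦ
  change bondWeight V c δ u x * (bondDiffDeriv V β τ γ κ δ i f u x -
        forwardOp V β γ (τ u) (bondDiff κ δ i f u) x) ≤ bondWeight V c δ u x *
      ((n : ℝ) ^ 2 * bondDiff κ δ i f u x + η ^ 2 * bondSource V G C γ (δ ^ 4) i (f u)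
        (x + η • bondDir i) + δ ^ 4 * |sourceTerm V β (τ u) x|) at q2
  linarith

end IsForwardSolution
end

/-- The integrated source in the evolution of the bond Fisher information. -/
def bondRate (V β : ℝ → ℝ) (G C γ : ℝ) {n : ℕ} (i : Fin n) (F : Phase n → ℝ) : ℝ≥0∞ :=
  ∫⁻ x, ENNReal.ofReal (bondSource V G C γ 0 i F x) ∂(gibbs V β n)

/-- The constant in the error made by the cutoff and by the regularization. -/
def bondErrConst (b B G C γ T τm c : ℝ) (n : ℕ) : ℝ :=
  3 * (ChainBounds.bumpConst b γ n * Real.exp (3 * c * T)) + 2 * ChainBounds.sourceConst B G C τm n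

section
variable {n : ℕ} {V β τ : ℝ → ℝ} {b B G C γ T τm κ δ c : ℝ} {f : ℝ → Phase n → ℝ}

namespace IsForwardSolution

theorem continuous (hf : IsForwardSolution V β γ τ n f) {u : ℝ} (hu : 0 < u) : Continuous (f u) :=
  (hf.contDiff u hu).continuous

/-- Shifted terms are translated back at the price of a factor two. The mass of `f` plus twice the
mass for its translate gives the `3` in `bondErrConst`. -/
theorem lintegral_bond_integrand_le (hf : IsForwardSolution V β γ τ n f)
    (h : ChainBounds V β b B G C) (hn : 1 ≤ n) (hγ : 0 < γ) (hs : IsShiftSize B C T κ δ n) {u : ℝ}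
    (hu : 0 < u) (huT : u ≤ T) (hτ : |τ u| ≤ τm)
    (hc : c = ChainBounds.genConst b γ τm n + ChainBounds.bumpConst b γ n) (hc0 : 0 ≤ c)
    {i : Fin n} (hi : i ∈ bulk n) :
    ∫⁻ x, ENNReal.ofReal ((bondWeightDeriv V c δ u x +
        gen V β γ (τ u) (bondWeight V c δ u) x) * bondDiff κ δ i f u x +
      bondWeight V c δ u x * (bondDiffDeriv V β τ γ κ δ i f u x -
        forwardOp V β γ (τ u) (bondDiff κ δ i f u) x)) ∂(gibbs V β n) ≤
    ENNReal.ofReal (bondErrConst b B G C γ T τm c n * δ ^ 3) +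
      2 * (ENNReal.ofReal ((κ * δ) ^ 2 * Real.exp ((n : ℝ) ^ 2 * u)) *
        bondRate V β G C γ i (f u)) := by
  have hprob := h.isProbabilityMeasure (n := n)
  have hδ := hs.pos
  have hb := h.b_pos
  have hcont := hf.continuous hu
  set w : Phase n := shiftSize n κ δ u • bondDir i with hw
  set K : Set (Phase n) := {x | totalEnergy V x ≤ 1 / δ} with hKdef
  have hK : MeasurableSet K := (h.isCompact_sublevel _).isClosed.measurableSet
  set q := ChainBounds.bumpConst b γ n * Real.exp (3 * c * T) * δ ^ 3 with hq
  set k := (κ * δ) ^ 2 * Real.exp ((n : ℝ) ^ 2 * u) with hk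
  set e := 2 * ChainBounds.sourceConst B G C τm n * δ ^ 3 with he
  have hq0 : 0 ≤ q := by rw [hq, ChainBounds.bumpConst]; positivity
  have hk0 : 0 ≤ k := by positivity
  have he0 : 0 ≤ e := by
    have := h.C_pos; have := h.B_pos; have := (abs_nonneg _).trans hτ
    rw [he, ChainBounds.sourceConst]; positivity
  have hdens : ∀ x ∈ K, density V β x ≤ 2 * density V β (x + w) := fun x hx =>
    hs.density_le_shift h (hs.shiftSize_pos u).le le_rfl huT i hx
  have hm : Measurable fun x => f u x := hcont.measurable
  have hms : Measurable fun x => f u (x + w) := hm.comp (measurable_id.add_const w)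
  have m1 : ∫⁻ x in K, ENNReal.ofReal (f u x) ∂(gibbs V β n) ≤ 1 :=
    (setLIntegral_le_lintegral _ _).trans (hf.mass u hu.le).le
  have m2 : ∫⁻ x in K, ENNReal.ofReal (f u (x + w)) ∂(gibbs V β n) ≤ 2 := by
    refine (h.setLIntegral_shift_le hK hdens fun x => ENNReal.ofReal (f u x)).trans ?_
    rw [hf.mass u hu.le, mul_one]
  have m3 : ∫⁻ x in K, ENNReal.ofReal (bondSource V G C γ 0 i (f u) (x + w)) ∂(gibbs V β n) ≤
      2 * bondRate V β G C γ i (f u) :=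
    h.setLIntegral_shift_le hK hdens fun x => ENNReal.ofReal (bondSource V G C γ 0 i (f u) x)
  calc _ ≤ ∫⁻ x, K.indicator (fun x => ENNReal.ofReal q * ENNReal.ofReal (f u x) +
        ENNReal.ofReal q * ENNReal.ofReal (f u (x + w)) +
        ENNReal.ofReal k * ENNReal.ofReal (bondSource V G C γ 0 i (f u) (x + w)) +
        ENNReal.ofReal e) x ∂(gibbs V β n) := by
        refine lintegral_mono fun x => ?_
        refine (ENNReal.ofReal_le_ofReal
          (hf.bond_integrand_le h hn hγ hs hu huT hτ hc hc0 hi x)).trans ?_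
        by_cases hx : x ∈ K
        · rw [indicator_of_mem hx, indicator_of_mem hx]
          have h1 := hf.nonneg u hu.le x
          have h2 := hf.nonneg u hu.le (x + w)
          have h3 := bondSource_nonneg (V := V) (G := G) (C := C) (γ := γ) (ε := 0) le_rfl i h2
          rw [← ENNReal.ofReal_mul hq0, ← ENNReal.ofReal_mul hq0, ← ENNReal.ofReal_mul hk0,
            ← ENNReal.ofReal_add (by positivity) (by positivity),
            ← ENNReal.ofReal_add (by positivity) (by positivity),
            ← ENNReal.ofReal_add (by positivity) he0, ← mul_add]
        · rw [indicator_of_notMem hx, indicator_of_notMem hx]; simp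
    _ = ENNReal.ofReal q * ∫⁻ x in K, ENNReal.ofReal (f u x) ∂(gibbs V β n) +
        ENNReal.ofReal q * ∫⁻ x in K, ENNReal.ofReal (f u (x + w)) ∂(gibbs V β n) +
        ENNReal.ofReal k * ∫⁻ x in K, ENNReal.ofReal (bondSource V G C γ 0 i (f u) (x + w))
          ∂(gibbs V β n) + ENNReal.ofReal e * gibbs V β n K := by
        rw [lintegral_indicator hK, lintegral_add_right _ measurable_const,
          lintegral_add_left (by fun_prop), lintegral_add_left (by fun_prop),
          lintegral_const_mul' _ _ ENNReal.ofReal_ne_top,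
          lintegral_const_mul' _ _ ENNReal.ofReal_ne_top,
          lintegral_const_mul' _ _ ENNReal.ofReal_ne_top, setLIntegral_const]
    _ ≤ ENNReal.ofReal q * 1 + ENNReal.ofReal q * 2 +
        ENNReal.ofReal k * (2 * bondRate V β G C γ i (f u)) + ENNReal.ofReal e * 1 := by
        gcongr; exact prob_le_one
    _ = ENNReal.ofReal (q * 3 + e) + 2 * (ENNReal.ofReal k * bondRate V β G C γ i (f u)) := by
        rw [ENNReal.ofReal_add (by positivity) he0, ENNReal.ofReal_mul hq0, ENNReal.ofReal_ofNat]
        ring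
    _ = _ := by
        congr 3
        rw [hq, he, bondErrConst]; ring

theorem ofReal_integral_bond_le (hf : IsForwardSolution V β γ τ n f) (h : ChainBounds V β b B G C)
    (hn : 1 ≤ n) (hγ : 0 < γ) (hτc : ContinuousOn τ (Ioi 0)) (hτ : ∀ u ∈ Icc 0 T, |τ u| ≤ τm)
    (hs : IsShiftSize B C T κ δ n)
    (hc : c = ChainBounds.genConst b γ τm n + ChainBounds.bumpConst b γ n) (hc0 : 0 ≤ c)
    {i : Fin n} (hi : i ∈ bulk n) {s t : ℝ} (hs0 : 0 < s) (hst : s ≤ t) (ht : t ≤ T) :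
    ENNReal.ofReal (∫ x, bondWeight V c δ t x * bondDiff κ δ i f t x ∂(gibbs V β n)) ≤
      ENNReal.ofReal (∫ x, bondWeight V c δ s x * bondDiff κ δ i f s x ∂(gibbs V β n)) +
      ∫⁻ u in Ioc s t, (ENNReal.ofReal (bondErrConst b B G C γ T τm c n * δ ^ 3) +
        2 * (ENNReal.ofReal ((κ * δ) ^ 2 * Real.exp ((n : ℝ) ^ 2 * u)) *
          bondRate V β G C γ i (f u))) := by
  have hδ := hs.pos
  have hpos : ∀ u ∈ Icc s t, 0 < u := fun u hu => hs0.trans_le hu.1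
  have hsub : Icc s t ×ˢ (univ : Set (Phase n)) ⊆ Ioi 0 ×ˢ univ :=
    prod_mono hpos le_rfl
  have key := h.evolution γ τ (h.isCompact_sublevel (n := n) (1 / δ)) hst
    (fun u _ => h.contDiff_bondWeight (c := c) (δ := δ) u)
    (fun u hu x hx => h.bondWeight_eq_zero hδ hc0 (hpos u hu).le hx)
    (fun u hu x hx => h.bondWeightDeriv_eq_zero hδ hc0 (hpos u hu).le hx)
    (fun u _ x => hasDerivAt_bondWeight u x) h.continuous_bondWeight.continuousOn
    h.continuous_bondWeightDeriv.continuousOn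
    (fun u hu => hf.contDiff_bondDiff (κ := κ) hδ i (hpos u hu))
    (fun u hu x => hf.hasDerivAt_bondDiff h hτc hδ i (hpos u hu) x)
    ((hf.continuousOn_bondDiff hδ Ioi_subset_Ici_self hf.continuousOn i).mono hsub)
    ((hf.continuousOn_bondDiffDeriv h hτc hδ i).mono hsub)
  rw [sub_eq_iff_eq_add'] at key
  rw [key]
  refine ENNReal.ofReal_add_le.trans ?_
  gcongr
  rw [intervalIntegral.integral_of_le hst]
  refine (ofReal_integral_le_lintegral _).trans (setLIntegral_mono' measurableSet_Ioc fun u hu => ?_)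
  have hu0 : 0 < u := hs0.trans hu.1
  have huT : u ≤ T := hu.2.trans ht
  exact (ofReal_integral_le_lintegral _).trans
    (hf.lintegral_bond_integrand_le h hn hγ hs hu0 huT (hτ u ⟨hu0.le, huT⟩) hc hc0 hi)

/-- Continuity of `f` up to time zero, together with a support common to all times, lets the
starting time tend to zero. The source integral is only enlarged. -/
theorem ofReal_integral_bond_le_zero (hf : IsForwardSolution V β γ τ n f) (hf0 : IsC1UpToZero f)
    (h : ChainBounds V β b B G C)
    (hn : 1 ≤ n) (hγ : 0 < γ) (hτc : ContinuousOn τ (Ioi 0)) (hτ : ∀ u ∈ Icc 0 T, |τ u| ≤ τm)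
    (hs : IsShiftSize B C T κ δ n)
    (hc : c = ChainBounds.genConst b γ τm n + ChainBounds.bumpConst b γ n) (hc0 : 0 ≤ c)
    {i : Fin n} (hi : i ∈ bulk n) {t : ℝ} (ht0 : 0 < t) (ht : t ≤ T) :
    ENNReal.ofReal (∫ x, bondWeight V c δ t x * bondDiff κ δ i f t x ∂(gibbs V β n)) ≤
      ENNReal.ofReal (∫ x, bondWeight V c δ 0 x * bondDiff κ δ i f 0 x ∂(gibbs V β n)) +
      ∫⁻ u in Ioc 0 t, (ENNReal.ofReal (bondErrConst b B G C γ T τm c n * δ ^ 3) +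
        2 * (ENNReal.ofReal ((κ * δ) ^ 2 * Real.exp ((n : ℝ) ^ 2 * u)) *
          bondRate V β G C γ i (f u))) := by
  have hprob := h.isProbabilityMeasure (n := n)
  have hδ := hs.pos
  have hlim : ContinuousOn
      (fun u => ∫ x, bondWeight V c δ u x * bondDiff κ δ i f u x ∂(gibbs V β n)) (Ici 0) := by
    refine continuousOn_integral_of_compact_support (h.isCompact_sublevel (n := n) (1 / δ)) ?_
      fun u x hu hx => by rw [h.bondWeight_eq_zero hδ hc0 hu hx, zero_mul]
    exact h.continuous_bondWeight.continuousOn.mul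
      (hf.continuousOn_bondDiff hδ le_rfl hf0.continuousOn i)
  have h1 := ((ENNReal.continuous_ofReal.tendsto _).comp
    ((hlim 0 self_mem_Ici).mono_left (nhdsWithin_mono 0 Ioi_subset_Ici_self))).add_const
      (∫⁻ u in Ioc 0 t, (ENNReal.ofReal (bondErrConst b B G C γ T τm c n * δ ^ 3) +
        2 * (ENNReal.ofReal ((κ * δ) ^ 2 * Real.exp ((n : ℝ) ^ 2 * u)) *
          bondRate V β G C γ i (f u))))
  refine ge_of_tendsto h1 ?_
  filter_upwards [Ioc_mem_nhdsGT ht0] with s hs'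
  refine (hf.ofReal_integral_bond_le h hn hγ hτc hτ hs hc hc0 hi hs'.1 hs'.2 ht).trans ?_
  exact add_le_add le_rfl (lintegral_mono_set (Ioc_subset_Ioc_left hs'.1.le))

end IsForwardSolution
end

/-! ### The limit of vanishing shift -/

theorem sq_intervalIntegral_le {g : ℝ → ℝ} (hg : Continuous g) :
    (∫ s in (0 : ℝ)..1, g s) ^ 2 ≤ ∫ s in (0 : ℝ)..1, g s ^ 2 := by
  set m := ∫ s in (0 : ℝ)..1, g s with hm
  have h0 : 0 ≤ ∫ s in (0 : ℝ)..1, (g s - m) ^ 2 :=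
    intervalIntegral.integral_nonneg zero_le_one fun s _ => sq_nonneg _
  have h1 : ∫ s in (0 : ℝ)..1, (g s - m) ^ 2 = (∫ s in (0 : ℝ)..1, g s ^ 2) - m ^ 2 := by
    have e : ∀ s, (g s - m) ^ 2 = g s ^ 2 - 2 * m * g s + m ^ 2 := fun s => by ring
    simp only [e]
    rw [intervalIntegral.integral_add, intervalIntegral.integral_sub,
      intervalIntegral.integral_const_mul, ← hm, intervalIntegral.integral_const]
    · simp; ring
    all_goals exact Continuous.intervalIntegrable (by fun_prop) _ _
  linarith

/-- After passing to the square roots of `v + ε/2`, the functional is at most twice the squared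
difference of the roots, since `(x + y)² ≤ 2 (x² + y²)`. Cauchy–Schwarz along the segment then gives
a Fisher integral. -/
theorem sqDiff_le_integral {v v' : ℝ → ℝ} {ε : ℝ} (hε : 0 < ε) (hv : ∀ s, HasDerivAt v (v' s) s)
    (hv' : Continuous v') (h0 : ∀ s, 0 ≤ v s) :
    sqDiff ε (v 0) (v 1) ≤ 1 / 2 * ∫ s in (0 : ℝ)..1, v' s ^ 2 / (v s + ε / 2) := by
  have hpos : ∀ s, 0 < v s + ε / 2 := fun s => by have := h0 s; positivity
  have hvc : Continuous v := continuous_iff_continuousAt.2 fun s => (hv s).continuousAt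
  have hg : ∀ s, HasDerivAt (fun s => √(v s + ε / 2)) (v' s / (2 * √(v s + ε / 2))) s := fun s =>
    ((hv s).add_const _).sqrt (hpos s).ne'
  have hgc : Continuous fun s => v' s / (2 * √(v s + ε / 2)) :=
    hv'.div (by fun_prop) fun s => by have := Real.sqrt_pos.2 (hpos s); positivity
  have h1 := sq_intervalIntegral_le hgc
  rw [intervalIntegral.integral_eq_sub_of_hasDerivAt (fun s _ => hg s)
    (hgc.intervalIntegrable _ _)] at h1
  have h2 : ∫ s in (0 : ℝ)..1, (v' s / (2 * √(v s + ε / 2))) ^ 2 =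
      1 / 4 * ∫ s in (0 : ℝ)..1, v' s ^ 2 / (v s + ε / 2) := by
    rw [← intervalIntegral.integral_const_mul]
    refine intervalIntegral.integral_congr fun s _ => ?_
    rw [div_pow, mul_pow, Real.sq_sqrt (hpos s).le]
    have := (hpos s).ne'
    field_simp; norm_num
  rw [h2] at h1
  have h3 : sqDiff ε (v 0) (v 1) ≤ 2 * (√(v 1 + ε / 2) - √(v 0 + ε / 2)) ^ 2 := by
    have a0 := Real.sq_sqrt (hpos 0).le
    have a1 := Real.sq_sqrt (hpos 1).le
    set x := √(v 0 + ε / 2)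
    set y := √(v 1 + ε / 2)
    have hx : v 0 = x ^ 2 - ε / 2 := by linarith
    have hy : v 1 = y ^ 2 - ε / 2 := by linarith
    rw [sqDiff, div_le_iff₀ (by have := h0 0; have := h0 1; positivity), hx, hy]
    nlinarith [mul_nonneg (sq_nonneg (y - x)) (sq_nonneg (y - x))]
  linarith

theorem lintegral_ofReal_le_of_tendsto' {α : Type*} [MeasurableSpace α] {μ : Measure α}
    {g : ℕ → α → ℝ} {G : α → ℝ} {e : ℕ → ℝ≥0∞} {A : ℝ≥0∞} (hi : ∀ m, AEMeasurable (g m) μ)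
    (hle : ∀ m, ∫⁻ x, ENNReal.ofReal (g m x) ∂μ ≤ e m) (he : Tendsto e atTop (𝓝 A))
    (hlim : ∀ x, Tendsto (fun m => g m x) atTop (𝓝 (G x))) :
    ∫⁻ x, ENNReal.ofReal (G x) ∂μ ≤ A := by
  have e1 : ∫⁻ x, ENNReal.ofReal (G x) ∂μ =
      ∫⁻ x, liminf (fun m => ENNReal.ofReal (g m x)) atTop ∂μ :=
    lintegral_congr fun x => ((ENNReal.continuous_ofReal.tendsto _).comp (hlim x)).liminf_eq.symm
  rw [e1, ← he.liminf_eq]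
  exact (lintegral_liminf_le' fun m => (hi m).ennreal_ofReal).trans
    (liminf_le_liminf (Eventually.of_forall hle))

/-- The Fisher information along the bond of the particle `i`. -/
def bondFisher (V β : ℝ → ℝ) {n : ℕ} (i : Fin n) (F : Phase n → ℝ) : ℝ≥0∞ :=
  ∫⁻ x, ENNReal.ofReal ((dp i F x + dq i F x) ^ 2 / F x) ∂(gibbs V β n)

section
variable {n : ℕ} {V β τ : ℝ → ℝ} {b B G C γ T τm κ δ c : ℝ} {f : ℝ → Phase n → ℝ}

theorem shiftSize_zero : shiftSize n κ δ 0 = κ * δ := by simp [shiftSize]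

/-- The initial value of the weighted difference. -/
theorem IsShiftSize.ofReal_integral_bond_zero_le (hs : IsShiftSize B C T κ δ n)
    (h : ChainBounds V β b B G C) (hT : 0 ≤ T) (hc0 : 0 ≤ c) (hF : ContDiff ℝ 1 (f 0))
    (hF0 : ∀ x, 0 ≤ f 0 x) (i : Fin n) :
    ENNReal.ofReal (∫ x, bondWeight V c δ 0 x * bondDiff κ δ i f 0 x ∂(gibbs V β n)) ≤
      ENNReal.ofReal ((κ * δ) ^ 2) * bondFisher V β i (f 0) := by
  have hprob := h.isProbabilityMeasure (n := n)
  have hδ := hs.pos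
  have hκ := hs.amp_pos
  set K : Set (Phase n) := {x | totalEnergy V x ≤ 1 / δ} with hKdef
  have hK : MeasurableSet K := (h.isCompact_sublevel _).isClosed.measurableSet
  set ε := δ ^ 4 with hε
  have hε0 : 0 < ε := by positivity
  set Q : Phase n → ℝ := fun y => fderiv ℝ (f 0) y (bondDir i) ^ 2 / (f 0 y + ε / 2) with hQ
  have hfc : Continuous (f 0) := hF.continuous
  have hfd : Continuous fun y => fderiv ℝ (f 0) y (bondDir i) :=
    (hF.continuous_fderiv (by simp)).clm_apply continuous_const
  have hQc : Continuous Q := (hfd.pow 2).div (hfc.add continuous_const) fun y => by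
    have := hF0 y; positivity
  have hQle : ∫⁻ y, ENNReal.ofReal (Q y) ∂(gibbs V β n) ≤ bondFisher V β i (f 0) := by
    refine lintegral_mono fun y => ENNReal.ofReal_le_ofReal ?_
    simp only [hQ]
    rw [fderiv_bondDir]
    rcases (hF0 y).eq_or_lt with h0 | h0
    · have h1 : fderiv ℝ (f 0) y = 0 :=
        IsLocalMin.fderiv_eq_zero (Eventually.of_forall fun z => h0 ▸ hF0 z)
      rw [← fderiv_bondDir, h1]; simp
    · exact div_le_div_of_nonneg_left (sq_nonneg _) h0 (by linarith)
  have hpt : ∀ x, bondDiff κ δ i f 0 x ≤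
      (κ * δ) ^ 2 / 2 * ∫ s in (0 : ℝ)..1, Q (x + (s * (κ * δ)) • bondDir i) := fun x => by
    have hv : ∀ s : ℝ, HasDerivAt (fun s : ℝ => f 0 (x + (s * (κ * δ)) • bondDir i))
        (κ * δ * fderiv ℝ (f 0) (x + (s * (κ * δ)) • bondDir i) (bondDir i)) s := fun s => by
      have h1 : HasDerivAt (fun s : ℝ => x + (s * (κ * δ)) • bondDir i)
          ((1 * (κ * δ)) • bondDir i) s :=
        (((hasDerivAt_id s).mul_const (κ * δ)).smul_const _).const_add x
      have h2 := ((hF.differentiable (by simp)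
        (x + (s * (κ * δ)) • bondDir i)).hasFDerivAt).comp_hasDerivAt s h1
      refine h2.congr_deriv ?_
      rw [map_smul, one_mul, smul_eq_mul]
    have h2 := sqDiff_le_integral (ε := ε) hε0 hv (by
      exact continuous_const.mul (hfd.comp (by fun_prop))) fun s => hF0 _
    have e1 : sqDiff ε (f 0 (x + ((0 : ℝ) * (κ * δ)) • bondDir i))
        (f 0 (x + ((1 : ℝ) * (κ * δ)) • bondDir i)) = bondDiff κ δ i f 0 x := by
      rw [bondDiff, shiftSize_zero]; simp [hε]
    rw [e1] at h2
    refine h2.trans (le_of_eq ?_)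
    have e2 : ∀ s : ℝ, (κ * δ * fderiv ℝ (f 0) (x + (s * (κ * δ)) • bondDir i) (bondDir i)) ^ 2 /
        (f 0 (x + (s * (κ * δ)) • bondDir i) + ε / 2) =
        (κ * δ) ^ 2 * Q (x + (s * (κ * δ)) • bondDir i) := fun s => by
      simp only [hQ]; ring
    simp only [e2]
    rw [intervalIntegral.integral_const_mul]; ring
  have hmeas : Measurable (Function.uncurry fun (x : Phase n) (s : ℝ) =>
      ENNReal.ofReal (Q (x + (s * (κ * δ)) • bondDir i))) := by
    refine Measurable.ennreal_ofReal (Continuous.measurable ?_)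
    exact hQc.comp (by fun_prop)
  have hk : 0 ≤ (κ * δ) ^ 2 / 2 := by positivity
  have hpt' : ∀ x, ENNReal.ofReal (bondWeight V c δ 0 x * bondDiff κ δ i f 0 x) ≤
      K.indicator (fun x => ENNReal.ofReal ((κ * δ) ^ 2 / 2) *
        ∫⁻ s in Ioc (0 : ℝ) 1, ENNReal.ofReal (Q (x + (s * (κ * δ)) • bondDir i))) x := fun x => by
    by_cases hx : x ∈ K
    · rw [indicator_of_mem hx]
      have hΦ : 0 ≤ bondDiff κ δ i f 0 x := sqDiff_nonneg hε0 (hF0 _) (hF0 _)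
      have hW := h.bondWeight_le (c := c) hδ.le (u := 0) x
      simp only [mul_zero, neg_zero, Real.exp_zero] at hW
      refine (ENNReal.ofReal_le_ofReal ((mul_le_of_le_one_left hΦ hW).trans (hpt x))).trans ?_
      rw [ENNReal.ofReal_mul hk, intervalIntegral.integral_of_le zero_le_one]
      gcongr
      exact ofReal_integral_le_lintegral _
    · rw [h.bondWeight_eq_zero hδ hc0 le_rfl hx]; simp
  calc _ ≤ ∫⁻ x, ENNReal.ofReal (bondWeight V c δ 0 x * bondDiff κ δ i f 0 x) ∂(gibbs V β n) :=
        ofReal_integral_le_lintegral _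
    _ ≤ _ := lintegral_mono hpt'
    _ = ENNReal.ofReal ((κ * δ) ^ 2 / 2) * ∫⁻ x in K, (∫⁻ s in Ioc (0 : ℝ) 1,
        ENNReal.ofReal (Q (x + (s * (κ * δ)) • bondDir i))) ∂(gibbs V β n) := by
        rw [lintegral_indicator hK, lintegral_const_mul' _ _ ENNReal.ofReal_ne_top]
    _ = ENNReal.ofReal ((κ * δ) ^ 2 / 2) * ∫⁻ s in Ioc (0 : ℝ) 1, ∫⁻ x in K,
        ENNReal.ofReal (Q (x + (s * (κ * δ)) • bondDir i)) ∂(gibbs V β n) := by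
        rw [lintegral_lintegral_swap hmeas.aemeasurable]
    -- Each intermediate translate is shorter than the full shift, so the density comparison applies
    -- to it. The factor two cancels the one half.
    _ ≤ ENNReal.ofReal ((κ * δ) ^ 2 / 2) * ∫⁻ s in Ioc (0 : ℝ) 1, 2 * bondFisher V β i (f 0) := by
        refine mul_le_mul' le_rfl ?_
        refine setLIntegral_mono' measurableSet_Ioc fun s hs' => ?_
        refine (h.setLIntegral_shift_le hK (fun x hx => hs.density_le_shift h
          (ρ := s * (κ * δ)) (mul_nonneg hs'.1.le (by positivity)) (u := 0) ?_ hT i hx)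
          fun y => ENNReal.ofReal (Q y)).trans (by gcongr)
        rw [shiftSize_zero]
        exact mul_le_of_le_one_left (by positivity) hs'.2
    _ = _ := by
        rw [setLIntegral_const, Real.volume_Ioc, sub_zero, ENNReal.ofReal_one, mul_one, ← mul_assoc]
        congr 1
        rw [← ENNReal.ofReal_ofNat, ← ENNReal.ofReal_mul hk]
        congr 1; ring

end

section
variable {n : ℕ} {V β τ : ℝ → ℝ} {b B G C γ T τm κ c : ℝ} {f : ℝ → Phase n → ℝ}

/-- The amplitude depends on `n` and `T` but not on `δ`. It may be exponentially small because it is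
divided out in the limit. -/
theorem ChainBounds.exists_isShiftSize (h : ChainBounds V β b B G C) (n : ℕ) (T : ℝ) :
    ∃ κ, ∀ δ, 0 < δ → δ ≤ 1 → IsShiftSize B C T κ δ n := by
  have hS := h.shiftConst_nonneg (n := n)
  have hl : 0 < Real.log 2 := Real.log_pos one_lt_two
  set ρ := min 1 (Real.log 2 / (2 * (ChainBounds.shiftConst B C n + 1))) with hρ
  have hρ0 : 0 < ρ := lt_min one_pos (by positivity)
  have e : ρ * Real.exp (-((n : ℝ) ^ 2 * T)) * Real.exp ((n : ℝ) ^ 2 * T) = ρ := by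
    rw [mul_assoc, ← Real.exp_add]; simp
  refine ⟨ρ * Real.exp (-((n : ℝ) ^ 2 * T)), fun δ h0 h1 =>
    ⟨by positivity, h0, h1, e.le.trans (min_le_left _ _), ?_⟩⟩
  rw [e]
  have h2 : ρ ≤ Real.log 2 / (2 * (ChainBounds.shiftConst B C n + 1)) := min_le_right _ _
  rw [le_div_iff₀ (by positivity)] at h2
  nlinarith

theorem tendsto_bondWeight (u : ℝ) (x : Phase n) :
    Tendsto (fun δ => bondWeight V c δ u x) (𝓝 0) (𝓝 (Real.exp (-((n : ℝ) ^ 2 * u)))) := by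
  have : Continuous fun δ => bondWeight V c δ u x := by unfold bondWeight bump; fun_prop
  simpa [bondWeight, bump] using this.tendsto 0

/-- The numerator is the square of a difference quotient along the bond and the denominator tends to
`2 f`. Points where `f` vanishes are excluded, as the regularization alone would decide the limit
there. -/
theorem tendsto_bondDiff (hκ : 0 < κ) (i : Fin n) {t : ℝ} (hF : ContDiff ℝ 1 (f t)) {x : Phase n}
    (hx : f t x ≠ 0) :
    Tendsto (fun δ => bondDiff κ δ i f t x / (κ * δ) ^ 2) (𝓝[>] 0)
      (𝓝 ((Real.exp ((n : ℝ) ^ 2 * t) * fderiv ℝ (f t) x (bondDir i)) ^ 2 / (2 * f t x))) := by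
  have h1 : HasDerivAt (fun δ => f t (x + shiftSize n κ δ t • bondDir i))
      (κ * Real.exp ((n : ℝ) ^ 2 * t) * fderiv ℝ (f t) x (bondDir i)) 0 := by
    have h2 : HasDerivAt (fun δ => x + shiftSize n κ δ t • bondDir i)
        ((κ * 1 * Real.exp ((n : ℝ) ^ 2 * t)) • bondDir i) 0 :=
      ((((hasDerivAt_id (0 : ℝ)).const_mul κ).mul_const _).smul_const _).const_add x
    have h3 : HasFDerivAt (f t) (fderiv ℝ (f t) x) (x + shiftSize n κ 0 t • bondDir i) := by
      simpa [shiftSize] using (hF.differentiable (by simp) x).hasFDerivAt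
    refine (h3.comp_hasDerivAt (0 : ℝ) h2).congr_deriv ?_
    rw [map_smul, smul_eq_mul]; ring
  have hcont : Tendsto (fun δ => f t (x + shiftSize n κ δ t • bondDir i)) (𝓝[>] 0)
      (𝓝 (f t x)) := by
    have := h1.continuousAt.tendsto.mono_left (nhdsWithin_le_nhds (s := Ioi 0))
    simpa [shiftSize] using this
  have h4 := (hasDerivAt_iff_tendsto_slope_zero.1 h1).mono_left
    (nhdsWithin_mono (0 : ℝ) (s := Ioi 0) fun δ hδ => (mem_Ioi.1 hδ).ne')
  have h5 : Tendsto (fun δ : ℝ => f t x + f t (x + shiftSize n κ δ t • bondDir i) + δ ^ 4)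
      (𝓝[>] 0) (𝓝 (f t x + f t x + 0 ^ 4)) :=
    (hcont.const_add _).add ((tendsto_id.mono_left nhdsWithin_le_nhds).pow 4)
  have h6 := ((h4.div_const κ).pow 2).div h5 (by simpa [← two_mul] using hx)
  refine (h6.congr' ?_).trans (le_of_eq ?_)
  · filter_upwards [self_mem_nhdsWithin] with δ hδ
    have hδ' : δ ≠ 0 := (mem_Ioi.1 hδ).ne'
    have e : x + shiftSize n κ 0 t • bondDir i = x := by simp [shiftSize]
    rw [Pi.div_apply]
    simp only [zero_add, e, bondDiff, sqDiff, smul_eq_mul]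
    rw [div_right_comm]
    congr 1
    field_simp
    ring
  · congr 1
    field_simp
    ring

namespace IsForwardSolution

/-- The evolution of the Fisher information along a bond. -/
theorem bondFisher_le (hf : IsForwardSolution V β γ τ n f) (hf0 : IsC1UpToZero f)
    (h : ChainBounds V β b B G C) (hn : 1 ≤ n) (hγ : 0 < γ) (hτc : ContinuousOn τ (Ioi 0))
    (hτ : ∀ u ∈ Icc 0 T, |τ u| ≤ τm) {i : Fin n} (hi : i ∈ bulk n) {t : ℝ} (ht0 : 0 < t)
    (ht : t ≤ T) :
    ENNReal.ofReal (Real.exp ((n : ℝ) ^ 2 * t) / 2) * bondFisher V β i (f t) ≤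
      bondFisher V β i (f 0) + ∫⁻ u in Ioc 0 t,
        2 * (ENNReal.ofReal (Real.exp ((n : ℝ) ^ 2 * u)) * bondRate V β G C γ i (f u)) := by
  have hprob := h.isProbabilityMeasure (n := n)
  obtain ⟨κ, hsh⟩ := h.exists_isShiftSize n T
  have hκ := (hsh 1 one_pos le_rfl).amp_pos
  obtain ⟨c, hc⟩ : ∃ c, c = ChainBounds.genConst b γ τm n + ChainBounds.bumpConst b γ n := ⟨_, rfl⟩
  have hc0 : 0 ≤ c := by
    have := h.b_pos
    have := (abs_nonneg _).trans (hτ t ⟨ht0.le, ht⟩)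
    rw [hc, ChainBounds.genConst, ChainBounds.bumpConst]; positivity
  set A := bondErrConst b B G C γ T τm c n with hA
  set R : ℝ≥0∞ := ∫⁻ u in Ioc 0 t,
    2 * (ENNReal.ofReal (Real.exp ((n : ℝ) ^ 2 * u)) * bondRate V β G C γ i (f u)) with hR
  set J := bondFisher V β i (f 0) with hJ
  have hbound : ∀ δ, 0 < δ → δ ≤ 1 → ∫⁻ x, ENNReal.ofReal
      (bondWeight V c δ t x * (bondDiff κ δ i f t x / (κ * δ) ^ 2)) ∂(gibbs V β n) ≤
      J + (ENNReal.ofReal (A * δ / κ ^ 2) * ENNReal.ofReal t + R) := fun δ hδ hδ1 => by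
    have hs := hsh δ hδ hδ1
    have hk : 0 < (κ * δ) ^ 2 := by positivity
    have h1 := hf.ofReal_integral_bond_le_zero hf0 h hn hγ hτc hτ hs hc hc0 hi ht0 ht
    have h2 := hs.ofReal_integral_bond_zero_le h (ht0.le.trans ht) hc0 hf0.contDiff_zero
      (hf.nonneg 0 le_rfl) i
    have hpos : ∀ x, 0 ≤ bondWeight V c δ t x * bondDiff κ δ i f t x := fun x =>
      mul_nonneg (bondWeight_nonneg t x) (hf.bondDiff_nonneg hδ i ht0.le x)
    have hint : Integrable (fun x => bondWeight V c δ t x * bondDiff κ δ i f t x) (gibbs V β n) :=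
      h.integrable_gibbs_of_compact ((h.contDiff_bondWeight t).continuous.mul
        (hf.contDiff_bondDiff hδ i ht0).continuous)
        (HasCompactSupport.intro (h.isCompact_sublevel (n := n) (1 / δ)) fun x hx => by
          rw [h.bondWeight_eq_zero hδ hc0 ht0.le hx, zero_mul])
    rw [ofReal_integral_eq_lintegral_ofReal hint (Eventually.of_forall hpos)] at h1
    have e1 : ∫⁻ x, ENNReal.ofReal (bondWeight V c δ t x * bondDiff κ δ i f t x) ∂(gibbs V β n) =
        ENNReal.ofReal ((κ * δ) ^ 2) * ∫⁻ x, ENNReal.ofReal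
          (bondWeight V c δ t x * (bondDiff κ δ i f t x / (κ * δ) ^ 2)) ∂(gibbs V β n) := by
      rw [← lintegral_const_mul' _ _ ENNReal.ofReal_ne_top]
      refine lintegral_congr fun x => ?_
      rw [← ENNReal.ofReal_mul hk.le]
      congr 1; field_simp
    -- After division by `(κ δ)²` the cubic errors are of order `δ` and the source term no longer
    -- depends on `δ`.
    have e2 : ∫⁻ u in Ioc 0 t, (ENNReal.ofReal (A * δ ^ 3) +
        2 * (ENNReal.ofReal ((κ * δ) ^ 2 * Real.exp ((n : ℝ) ^ 2 * u)) *
          bondRate V β G C γ i (f u))) =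
        ENNReal.ofReal ((κ * δ) ^ 2) * (ENNReal.ofReal (A * δ / κ ^ 2) * ENNReal.ofReal t + R) := by
      rw [lintegral_add_left measurable_const, setLIntegral_const, Real.volume_Ioc, sub_zero, hR,
        mul_add, ← lintegral_const_mul' _ _ ENNReal.ofReal_ne_top, ← mul_assoc,
        ← ENNReal.ofReal_mul hk.le]
      congr 1
      · congr 2; field_simp
      · refine lintegral_congr fun u => ?_
        rw [ENNReal.ofReal_mul hk.le]; ring
    rw [e1, e2] at h1
    have h3 := h1.trans (add_le_add_left h2 _)
    rw [← mul_add] at h3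
    exact (ENNReal.mul_le_mul_iff_right (ENNReal.ofReal_pos.2 hk).ne' ENNReal.ofReal_ne_top).1 h3
  set d : ℕ → ℝ := fun m => 1 / ((m : ℝ) + 1) with hd
  have hd0 : ∀ m, 0 < d m := fun m => by simp only [hd]; positivity
  have hd1 : ∀ m, d m ≤ 1 := fun m => by
    simp only [hd]; rw [div_le_one (by positivity)]
    have : (0 : ℝ) ≤ m := m.cast_nonneg
    linarith
  have hdlim : Tendsto d atTop (𝓝[>] 0) :=
    tendsto_nhdsWithin_iff.2 ⟨tendsto_one_div_add_atTop_nhds_zero_nat, Eventually.of_forall hd0⟩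
  have hft := hf.continuous ht0
  have hS : MeasurableSet {x | f t x ≠ 0} := (isOpen_ne_fun hft continuous_const).measurableSet
  have hrhs : Tendsto (fun m => J + (ENNReal.ofReal (A * d m / κ ^ 2) * ENNReal.ofReal t + R)) atTop
      (𝓝 (J + R)) := by
    have h1 : Tendsto (fun m => ENNReal.ofReal (A * d m / κ ^ 2)) atTop (𝓝 0) := by
      have := ((tendsto_one_div_add_atTop_nhds_zero_nat (𝕜 := ℝ)).const_mul A).div_const (κ ^ 2)
      simpa [hd, Function.comp_def] using (ENNReal.continuous_ofReal.tendsto _).comp this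
    have h2 := (((ENNReal.Tendsto.mul_const h1 (b := ENNReal.ofReal t)
      (Or.inr ENNReal.ofReal_ne_top)).add_const R).const_add J)
    simpa using h2
  -- The indicator removes the zero set of `f`, where the limiting quotient is read as zero and
  -- pointwise convergence is not needed.
  have hfin := lintegral_ofReal_le_of_tendsto' (μ := gibbs V β n)
    (g := fun m => {x | f t x ≠ 0}.indicator
      fun x => bondWeight V c (d m) t x * (bondDiff κ (d m) i f t x / (κ * d m) ^ 2))
    (G := fun x => Real.exp ((n : ℝ) ^ 2 * t) / 2 * ((dp i (f t) x + dq i (f t) x) ^ 2 / f t x))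
    (fun m => ((((h.contDiff_bondWeight t).continuous.mul
      ((hf.contDiff_bondDiff (hd0 m) i ht0).continuous.div_const _)).measurable).indicator
        hS).aemeasurable)
    (fun m => (lintegral_mono fun x => ?_).trans (hbound (d m) (hd0 m) (hd1 m))) hrhs fun x => ?_
  · refine le_trans (le_of_eq ?_) hfin
    rw [bondFisher, ← lintegral_const_mul' _ _ ENNReal.ofReal_ne_top]
    refine lintegral_congr fun x => ?_
    rw [← ENNReal.ofReal_mul (by positivity)]
  · refine ENNReal.ofReal_le_ofReal (indicator_le_self' (fun x _ => ?_) x)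
    exact mul_nonneg (bondWeight_nonneg t x)
      (div_nonneg (hf.bondDiff_nonneg (hd0 m) i ht0.le x) (sq_nonneg _))
  · by_cases hx : f t x = 0
    · have e : ∀ m, {x | f t x ≠ 0}.indicator (fun x => bondWeight V c (d m) t x *
          (bondDiff κ (d m) i f t x / (κ * d m) ^ 2)) x = 0 := fun m =>
        indicator_of_notMem (by simpa using hx) _
      simp only [e, hx, div_zero, mul_zero]
      exact tendsto_const_nhds
    · have e : ∀ m, {x | f t x ≠ 0}.indicator (fun x => bondWeight V c (d m) t x *
          (bondDiff κ (d m) i f t x / (κ * d m) ^ 2)) x = bondWeight V c (d m) t x *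
          (bondDiff κ (d m) i f t x / (κ * d m) ^ 2) := fun m =>
        indicator_of_mem (by simpa using hx) _
      simp only [e]
      have h1 := ((tendsto_bondWeight (V := V) (c := c) t x).mono_left
        (nhdsWithin_le_nhds (s := Ioi 0))).comp hdlim
      have h2 := (tendsto_bondDiff hκ i ((hf.contDiff t ht0).of_le (by norm_cast)) hx).comp hdlim
      refine (h1.mul h2).trans (le_of_eq ?_)
      rw [fderiv_bondDir, mul_pow, ← Real.exp_nat_mul]
      congr 1
      -- The squared shift brings `exp (2 n² t)` and the weight `exp (-n² t)`. The surviving factor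
      -- `exp (n² t)` is the relaxation.
      rw [show ((2 : ℕ) : ℝ) * ((n : ℝ) ^ 2 * t) = (n : ℝ) ^ 2 * t + (n : ℝ) ^ 2 * t by
        push_cast; ring, Real.exp_add, Real.exp_neg]
      field_simp

end IsForwardSolution
end

/-! ### Summation over the bonds and integration in time -/

theorem lintegral_exp_neg_Ioi {a : ℝ} (ha : 0 < a) (s : ℝ) :
    ∫⁻ v in Ioi s, ENNReal.ofReal (Real.exp (-(a * v))) =
      ENNReal.ofReal (Real.exp (-(a * s)) / a) := by
  have h1 := integrableOn_exp_mul_Ioi (neg_lt_zero.2 ha) s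
  have h2 := integral_exp_mul_Ioi (neg_lt_zero.2 ha) s
  simp only [neg_mul] at h1 h2
  rw [← ofReal_integral_eq_lintegral_ofReal h1 (Eventually.of_forall fun v => (Real.exp_pos _).le),
    h2, neg_div_neg_eq]

/-- Tonelli, and the total mass `1/a` of the one-sided exponential kernel. -/
theorem lintegral_convolution_exp_le {a : ℝ} (ha : 0 < a) {g : ℝ → ℝ≥0∞} {t : ℝ}
    (hg : AEMeasurable g (volume.restrict (Ioc 0 t))) :
    ∫⁻ v in Ioc 0 t, ∫⁻ u in Ioc 0 v, ENNReal.ofReal (Real.exp (-(a * (v - u)))) * g u ≤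
      ENNReal.ofReal (1 / a) * ∫⁻ u in Ioc 0 t, g u := by
  set k : ℝ → ℝ → ℝ≥0∞ := fun v u => (Ici u).indicator
    (fun v => ENNReal.ofReal (Real.exp (-(a * (v - u))))) v with hk
  have hkm : Measurable (Function.uncurry k) := by
    have e : Function.uncurry k = {z : ℝ × ℝ | z.2 ≤ z.1}.indicator
        (fun z => ENNReal.ofReal (Real.exp (-(a * (z.1 - z.2))))) := by
      funext z
      rfl
    rw [e]
    exact Measurable.indicator (by fun_prop) (measurableSet_le measurable_snd measurable_fst)
  have h1 : ∀ v ∈ Ioc 0 t, ∫⁻ u in Ioc 0 v, ENNReal.ofReal (Real.exp (-(a * (v - u)))) * g u ≤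
      ∫⁻ u in Ioc 0 t, k v u * g u := fun v hv => by
    calc _ ≤ ∫⁻ u in Ioc 0 v, k v u * g u := by
          refine setLIntegral_mono' measurableSet_Ioc fun u hu => ?_
          simp only [hk]
          rw [indicator_of_mem (mem_Ici.2 hu.2)]
      _ ≤ _ := lintegral_mono_set (Ioc_subset_Ioc_right hv.2)
  refine (setLIntegral_mono' measurableSet_Ioc h1).trans ?_
  rw [lintegral_lintegral_swap (hkm.aemeasurable.mul hg.comp_snd), ← lintegral_const_mul'' _ hg]
  refine lintegral_mono fun u => ?_
  have hku : Measurable fun v => k v u := hkm.comp (measurable_id.prodMk measurable_const)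
  rw [lintegral_mul_const _ hku]
  gcongr
  calc _ ≤ ∫⁻ v, k v u := lintegral_mono' Measure.restrict_le_self le_rfl
    _ = ∫⁻ v in Ici u, ENNReal.ofReal (Real.exp (-(a * (v - u)))) :=
        lintegral_indicator measurableSet_Ici _
    _ = ∫⁻ v in Ioi u, ENNReal.ofReal (Real.exp (a * u)) *
          ENNReal.ofReal (Real.exp (-(a * v))) := by
        rw [setLIntegral_congr Ioi_ae_eq_Ici.symm]
        refine lintegral_congr fun v => ?_
        rw [← ENNReal.ofReal_mul (Real.exp_pos _).le, ← Real.exp_add]; ring_nf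
    _ = _ := by
        rw [lintegral_const_mul' _ _ ENNReal.ofReal_ne_top, lintegral_exp_neg_Ioi ha,
          ← ENNReal.ofReal_mul (Real.exp_pos _).le, mul_div_assoc', ← Real.exp_add]
        simp

/-- Only superadditivity of the integral is used, so no measurability in time of the bond rates is
needed. -/
theorem sum_lintegral_le {ι α : Type*} [MeasurableSpace α] {μ : Measure α} (s : Finset ι)
    (F : ι → α → ℝ≥0∞) : ∑ i ∈ s, ∫⁻ x, F i x ∂μ ≤ ∫⁻ x, ∑ i ∈ s, F i x ∂μ := by
  classical
  induction s using Finset.induction_on with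
  | empty => simp
  | insert i s hi ih =>
    simp only [Finset.sum_insert hi]
    exact (add_le_add le_rfl ih).trans (le_lintegral_add _ _)

section
variable {n : ℕ} {V β τ : ℝ → ℝ} {b B G C γ T τm A : ℝ} {f : ℝ → Phase n → ℝ}

/-- The constant multiplying the velocity Fisher information. -/
def velocityConst (b B C γ : ℝ) : ℝ := b⁻¹ * (27 / 2 * (2 * C + 1 + γ) ^ 2 * (3 * B))

/-- The constant multiplying the number of particles. -/
def sizeConst (b G C A : ℝ) : ℝ := b⁻¹ * (90 * G ^ 2 * C ^ 4 * ((C + 4) * (1 + A)))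

namespace ChainBounds

theorem velocityConst_nonneg (h : ChainBounds V β b B G C) : 0 ≤ velocityConst b B C γ := by
  have := h.b_pos; have := h.B_pos; unfold velocityConst; positivity

theorem sizeConst_nonneg (h : ChainBounds V β b B G C) (hA : 0 ≤ A) : 0 ≤ sizeConst b G C A := by
  have := h.b_pos; have := h.C_pos; unfold sizeConst; positivity

/-- Double counting: each velocity derivative occurs in the source of at most three bonds, and `B
β_k⁻¹ ≥ 1` restores the weights of the velocity Fisher information. -/
theorem sum_bondSource_le (h : ChainBounds V β b B G C) {F : Phase n → ℝ} (hF : ∀ x, 0 ≤ F x)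
    (x : Phase n) :
    ∑ i ∈ bulk n, (betaAt β n i)⁻¹ * bondSource V G C γ 0 i F x ≤
      velocityConst b B C γ * (n : ℝ) ^ 2 * ((∑ k, (betaAt β n k)⁻¹ * dp k F x ^ 2) / F x) +
        b⁻¹ * (90 * G ^ 2 * C ^ 4 * ((C + 4) * (n * F x + totalEnergy V x * F x))) := by
  have hb := h.b_pos
  have hB := h.B_pos
  have hC := h.C_pos
  have hFx := hF x
  have h1 : ∑ i : Fin n, ∑ k ∈ nbr i, dp k F x ^ 2 / (F x + 0) ≤
      3 * B * ((∑ k, (betaAt β n k)⁻¹ * dp k F x ^ 2) / F x) := by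
    have e1 : ∑ i : Fin n, ∑ k ∈ nbr i, dp k F x ^ 2 / (F x + 0) =
        ∑ k : Fin n, ((nbr k).card : ℝ) * (dp k F x ^ 2 / F x) := by
      rw [Finset.sum_comm' (t' := Finset.univ) (s' := fun k => nbr k) (by
        intro i k; simp [mem_nbr_comm])]
      simp
    rw [e1, Finset.sum_div, Finset.mul_sum]
    refine Finset.sum_le_sum fun k _ => ?_
    have hk : 1 ≤ B * (betaAt β n k)⁻¹ := by
      rw [← div_eq_mul_inv, one_le_div (h.betaAt_pos k)]; exact h.le_B n k
    have hq : 0 ≤ dp k F x ^ 2 / F x := by positivity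
    calc _ ≤ (3 : ℝ) * (dp k F x ^ 2 / F x) := by
          gcongr; exact_mod_cast card_nbr_le k
      _ ≤ 3 * ((B * (betaAt β n k)⁻¹) * (dp k F x ^ 2 / F x)) := by
          gcongr; exact le_mul_of_one_le_left hq hk
      _ = _ := by ring
  have h2 : (∑ i, bondEnergy V i x) * F x ≤
      (C + 4) * (n * F x + totalEnergy V x * F x) := by
    calc _ ≤ (C + 4) * (n + totalEnergy V x) * F x := by gcongr; exact h.sum_bondEnergy_le x
      _ = _ := by ring
  calc _ ≤ ∑ i ∈ bulk n, b⁻¹ * bondSource V G C γ 0 i F x :=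
        Finset.sum_le_sum fun i _ =>
          mul_le_mul_of_nonneg_right (h.inv_le i) (bondSource_nonneg le_rfl i hFx)
    _ ≤ ∑ i, b⁻¹ * bondSource V G C γ 0 i F x :=
        Finset.sum_le_sum_of_subset_of_nonneg (Finset.subset_univ _) fun i _ _ =>
          mul_nonneg (by positivity) (bondSource_nonneg le_rfl i hFx)
    _ = b⁻¹ * (27 / 2 * (2 * C + 1 + γ) ^ 2 * (n : ℝ) ^ 2 *
          ∑ i : Fin n, ∑ k ∈ nbr i, dp k F x ^ 2 / (F x + 0)) +
        b⁻¹ * (90 * G ^ 2 * C ^ 4 * ((∑ i, bondEnergy V i x) * F x)) := by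
        simp only [bondSource]
        rw [← Finset.mul_sum, Finset.sum_add_distrib, ← Finset.mul_sum, ← Finset.mul_sum,
          ← Finset.sum_mul]
        ring
    _ ≤ b⁻¹ * (27 / 2 * (2 * C + 1 + γ) ^ 2 * (n : ℝ) ^ 2 *
          (3 * B * ((∑ k, (betaAt β n k)⁻¹ * dp k F x ^ 2) / F x))) +
        b⁻¹ * (90 * G ^ 2 * C ^ 4 * ((C + 4) * (n * F x + totalEnergy V x * F x))) := by
        gcongr
    _ = _ := by rw [velocityConst]; ring

theorem sum_bondRate_le (h : ChainBounds V β b B G C) {F : Phase n → ℝ} (hF : ∀ x, 0 ≤ F x)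
    (hF1 : ∫⁻ x, ENNReal.ofReal (F x) ∂(gibbs V β n) = 1) (hFi : Integrable F (gibbs V β n))
    (hE : Integrable (fun x => totalEnergy V x * F x) (gibbs V β n))
    (hEA : ∫ x, totalEnergy V x * F x ∂(gibbs V β n) ≤ A * n) :
    ∑ i ∈ bulk n, ENNReal.ofReal (betaAt β n i)⁻¹ * bondRate V β G C γ i F ≤
      ENNReal.ofReal (velocityConst b B C γ * (n : ℝ) ^ 2) * fisherP V β F +
        ENNReal.ofReal (sizeConst b G C A * n) := by
  have hb := h.b_pos
  have hC := h.C_pos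
  have hv := h.velocityConst_nonneg (γ := γ)
  set D := b⁻¹ * (90 * G ^ 2 * C ^ 4 * (C + 4)) with hD
  have hD0 : 0 ≤ D := by positivity
  have hY0 : ∀ x, 0 ≤ n * F x + totalEnergy V x * F x := fun x => by
    have := hF x; have := h.totalEnergy_nonneg x; positivity
  have hYi : Integrable (fun x => D * (n * F x + totalEnergy V x * F x)) (gibbs V β n) :=
    ((hFi.const_mul _).add hE).const_mul D
  have hF1' : ∫ x, F x ∂(gibbs V β n) = 1 := by
    rw [integral_eq_lintegral_of_nonneg_ae (Eventually.of_forall hF) hFi.aestronglyMeasurable, hF1]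
    simp
  have hY : ∫⁻ x, ENNReal.ofReal (D * (n * F x + totalEnergy V x * F x)) ∂(gibbs V β n) ≤
      ENNReal.ofReal (sizeConst b G C A * n) := by
    rw [← ofReal_integral_eq_lintegral_ofReal hYi
      (Eventually.of_forall fun x => mul_nonneg hD0 (hY0 x))]
    refine ENNReal.ofReal_le_ofReal ?_
    rw [integral_const_mul, integral_add (hFi.const_mul _) hE, integral_const_mul, hF1', mul_one]
    calc _ ≤ D * (n + A * n) := by gcongr
      _ = _ := by rw [hD, sizeConst]; ring
  calc _ = ∑ i ∈ bulk n, ∫⁻ x, ENNReal.ofReal ((betaAt β n i)⁻¹ * bondSource V G C γ 0 i F x)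
          ∂(gibbs V β n) := by
        refine Finset.sum_congr rfl fun i _ => ?_
        rw [bondRate, ← lintegral_const_mul' _ _ ENNReal.ofReal_ne_top]
        simp only [ENNReal.ofReal_mul (h.beta_inv_nonneg i)]
    _ ≤ ∫⁻ x, ∑ i ∈ bulk n, ENNReal.ofReal ((betaAt β n i)⁻¹ * bondSource V G C γ 0 i F x)
          ∂(gibbs V β n) := sum_lintegral_le _ _
    _ ≤ ∫⁻ x, (ENNReal.ofReal (velocityConst b B C γ * (n : ℝ) ^ 2) *
          ENNReal.ofReal ((∑ k, (betaAt β n k)⁻¹ * dp k F x ^ 2) / F x) +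
          ENNReal.ofReal (D * (n * F x + totalEnergy V x * F x))) ∂(gibbs V β n) := by
        refine lintegral_mono fun x => ?_
        have hp : 0 ≤ (∑ k, (betaAt β n k)⁻¹ * dp k F x ^ 2) / F x :=
          div_nonneg (Finset.sum_nonneg fun k _ =>
            mul_nonneg (h.beta_inv_nonneg k) (sq_nonneg _)) (hF x)
        rw [← ENNReal.ofReal_sum_of_nonneg fun i _ =>
          mul_nonneg (h.beta_inv_nonneg i) (bondSource_nonneg le_rfl i (hF x)),
          ← ENNReal.ofReal_mul (by positivity),
          ← ENNReal.ofReal_add (by positivity) (mul_nonneg hD0 (hY0 x))]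
        refine ENNReal.ofReal_le_ofReal ((h.sum_bondSource_le hF x).trans (le_of_eq ?_))
        rw [hD]; ring
    _ ≤ _ := by
        rw [lintegral_add_right' _ hYi.aestronglyMeasurable.aemeasurable.ennreal_ofReal,
          lintegral_const_mul' _ _ ENNReal.ofReal_ne_top]
        exact add_le_add le_rfl hY

theorem fisherI_eq_sum (h : ChainBounds V β b B G C) {F : Phase n → ℝ} (hF : ∀ x, 0 ≤ F x)
    (hF1 : ContDiff ℝ 1 F) :
    fisherI V β F = ∑ i ∈ bulk n, ENNReal.ofReal (betaAt β n i)⁻¹ * bondFisher V β i F := by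
  have hm : ∀ i : Fin n, Measurable fun x => ENNReal.ofReal ((betaAt β n i)⁻¹) *
      ENNReal.ofReal ((dp i F x + dq i F x) ^ 2 / F x) := fun i => by
    simp only [← fderiv_bondDir]
    have hc : Continuous fun x => fderiv ℝ F x (bondDir i) :=
      (hF1.continuous_fderiv (by simp)).clm_apply continuous_const
    exact (((hc.measurable.pow_const 2).div hF1.continuous.measurable).ennreal_ofReal).const_mul _
  simp only [bondFisher, ← lintegral_const_mul' _ _ ENNReal.ofReal_ne_top]
  rw [← lintegral_finsetSum _ fun i _ => hm i, fisherI]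
  refine lintegral_congr fun x => ?_
  have hx := hF x
  simp only [← ENNReal.ofReal_mul (h.beta_inv_nonneg _)]
  rw [← ENNReal.ofReal_sum_of_nonneg fun i _ => mul_nonneg (h.beta_inv_nonneg i) (by positivity),
    Finset.sum_div]
  simp only [mul_div_assoc]

end ChainBounds

end

section
variable {n : ℕ} {V β τ : ℝ → ℝ} {b B G C γ T τm A : ℝ} {f : ℝ → Phase n → ℝ}

namespace IsForwardSolution

/-- Exponential relaxation of the Fisher information along the bonds. -/
theorem fisherI_le (hf : IsForwardSolution V β γ τ n f) (hf0 : IsC1UpToZero f)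
    (h : ChainBounds V β b B G C) (hn : 1 ≤ n) (hγ : 0 < γ) (hτc : ContinuousOn τ (Ioi 0))
    (hτ : ∀ u ∈ Icc 0 T, |τ u| ≤ τm)
    (hE : ∀ u ∈ Icc 0 T, Integrable (fun x => totalEnergy V x * f u x) (gibbs V β n) ∧
      ∫ x, totalEnergy V x * f u x ∂(gibbs V β n) ≤ A * n) {t : ℝ} (ht0 : 0 < t) (ht : t ≤ T) :
    fisherI V β (f t) ≤ ENNReal.ofReal (2 * Real.exp (-((n : ℝ) ^ 2 * t))) * fisherI V β (f 0) +
      ∫⁻ u in Ioc 0 t, ENNReal.ofReal (Real.exp (-((n : ℝ) ^ 2 * (t - u)))) *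
        (4 * (ENNReal.ofReal (velocityConst b B C γ * (n : ℝ) ^ 2) * fisherP V β (f u) +
          ENNReal.ofReal (sizeConst b G C A * n))) := by
  have hexp : (0 : ℝ) < 2 * Real.exp (-((n : ℝ) ^ 2 * t)) := by positivity
  have hone : ENNReal.ofReal (2 * Real.exp (-((n : ℝ) ^ 2 * t))) *
      ENNReal.ofReal (Real.exp ((n : ℝ) ^ 2 * t) / 2) = 1 := by
    rw [← ENNReal.ofReal_mul hexp.le, Real.exp_neg]
    rw [← ENNReal.ofReal_one]
    congr 1; field_simp
  have hbond : ∀ i ∈ bulk n, bondFisher V β i (f t) ≤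
      ENNReal.ofReal (2 * Real.exp (-((n : ℝ) ^ 2 * t))) * bondFisher V β i (f 0) +
      ∫⁻ u in Ioc 0 t, ENNReal.ofReal (Real.exp (-((n : ℝ) ^ 2 * (t - u)))) *
        (4 * bondRate V β G C γ i (f u)) := fun i hi => by
    have h1 := mul_le_mul_right (hf.bondFisher_le hf0 h hn hγ hτc hτ hi ht0 ht)
      (ENNReal.ofReal (2 * Real.exp (-((n : ℝ) ^ 2 * t))))
    rw [← mul_assoc, hone, one_mul, mul_add,
      ← lintegral_const_mul' _ _ ENNReal.ofReal_ne_top] at h1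
    refine h1.trans (le_of_eq ?_)
    congr 1
    refine lintegral_congr fun u => ?_
    have e : ENNReal.ofReal (2 * Real.exp (-((n : ℝ) ^ 2 * t))) *
        ENNReal.ofReal (Real.exp ((n : ℝ) ^ 2 * u)) =
        2 * ENNReal.ofReal (Real.exp (-((n : ℝ) ^ 2 * (t - u)))) := by
      rw [← ENNReal.ofReal_mul hexp.le, mul_assoc, ← Real.exp_add, ENNReal.ofReal_mul (by norm_num),
        ENNReal.ofReal_ofNat]
      congr 3; ring
    calc _ = 2 * (ENNReal.ofReal (2 * Real.exp (-((n : ℝ) ^ 2 * t))) *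
          ENNReal.ofReal (Real.exp ((n : ℝ) ^ 2 * u))) * bondRate V β G C γ i (f u) := by ring
      _ = _ := by rw [e]; ring
  rw [h.fisherI_eq_sum (hf.nonneg t ht0.le) ((hf.contDiff t ht0).of_le (by norm_cast)),
    h.fisherI_eq_sum (hf.nonneg 0 le_rfl) hf0.contDiff_zero, Finset.mul_sum]
  calc _ ≤ ∑ i ∈ bulk n, (ENNReal.ofReal (2 * Real.exp (-((n : ℝ) ^ 2 * t))) *
        (ENNReal.ofReal (betaAt β n i)⁻¹ * bondFisher V β i (f 0)) +
        ∫⁻ u in Ioc 0 t, ENNReal.ofReal (betaAt β n i)⁻¹ *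
          (ENNReal.ofReal (Real.exp (-((n : ℝ) ^ 2 * (t - u)))) *
            (4 * bondRate V β G C γ i (f u)))) := by
        refine Finset.sum_le_sum fun i hi => ?_
        rw [lintegral_const_mul' _ _ ENNReal.ofReal_ne_top, mul_left_comm, ← mul_add]
        exact mul_le_mul' le_rfl (hbond i hi)
    _ ≤ _ := by
        rw [Finset.sum_add_distrib]
        refine add_le_add le_rfl ((sum_lintegral_le _ _).trans
          (setLIntegral_mono' measurableSet_Ioc fun u hu => ?_))
        have huT : u ∈ Icc 0 T := ⟨hu.1.le, hu.2.trans ht⟩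
        have h1 := h.sum_bondRate_le (γ := γ) (A := A) (hf.nonneg u hu.1.le) (hf.mass u hu.1.le)
          (hf.integrable hu.1.le) (hE u huT).1 (hE u huT).2
        calc _ = ENNReal.ofReal (Real.exp (-((n : ℝ) ^ 2 * (t - u)))) *
              (4 * ∑ i ∈ bulk n, ENNReal.ofReal (betaAt β n i)⁻¹ *
                bondRate V β G C γ i (f u)) := by
              simp only [Finset.mul_sum]
              exact Finset.sum_congr rfl fun i _ => by ring
          _ ≤ _ := by gcongr

theorem aemeasurable_fisherP (hf : IsForwardSolution V β γ τ n f) (h : ChainBounds V β b B G C)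
    {s t : ℝ} (hs : 0 ≤ s) :
    AEMeasurable (fun u => fisherP V β (f u)) (volume.restrict (Ioc s t)) := by
  have hprob := h.isProbabilityMeasure (n := n)
  exact (hf.aemeasurable_fisherP_integrand h hs).lintegral_prod_right'

/-- The convolution gains `n⁻²`. It turns `n²` times the integrated velocity Fisher information, of
order `1/n`, and the local energy, of order `n`, both into order `1/n`. -/
theorem lintegral_fisherI_le (hf : IsForwardSolution V β γ τ n f) (hf0 : IsC1UpToZero f)
    (h : ChainBounds V β b B G C) (hn : 1 ≤ n) (hγ : 0 < γ) (hτc : ContinuousOn τ (Ioi 0))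
    (hτ : ∀ u ∈ Icc 0 T, |τ u| ≤ τm) (hA : 0 ≤ A)
    (hE : ∀ u ∈ Icc 0 T, Integrable (fun x => totalEnergy V x * f u x) (gibbs V β n) ∧
      ∫ x, totalEnergy V x * f u x ∂(gibbs V β n) ≤ A * n) {s t : ℝ} (hs : 0 ≤ s)
    (ht : t ∈ Icc 0 T) (hP : ∫⁻ u in Ioc 0 t, fisherP V β (f u) ≤ ENNReal.ofReal (A / n)) :
    ∫⁻ u in Ioc s t, fisherI V β (f u) ≤
      ENNReal.ofReal (2 * Real.exp (-((n : ℝ) ^ 2 * s)) / (n : ℝ) ^ 2) * fisherI V β (f 0) +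
      ENNReal.ofReal (4 * (velocityConst b B C γ * A + sizeConst b G C A * T) / n) := by
  have hn0 : (0 : ℝ) < n := by exact_mod_cast hn
  have hn2 : (0 : ℝ) < (n : ℝ) ^ 2 := by positivity
  have hv := h.velocityConst_nonneg (γ := γ)
  have hz := h.sizeConst_nonneg (A := A) hA
  have hT : 0 ≤ T := ht.1.trans ht.2
  set g : ℝ → ℝ≥0∞ := fun u =>
    4 * (ENNReal.ofReal (velocityConst b B C γ * (n : ℝ) ^ 2) * fisherP V β (f u) +
      ENNReal.ofReal (sizeConst b G C A * n)) with hg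
  have hPm := hf.aemeasurable_fisherP h (s := 0) (t := t) le_rfl
  have hgm : AEMeasurable g (volume.restrict (Ioc 0 t)) :=
    ((hPm.const_mul _).add_const _).const_mul _
  have hgi : ∫⁻ u in Ioc 0 t, g u ≤
      ENNReal.ofReal (4 * (velocityConst b B C γ * A + sizeConst b G C A * T) * n) := by
    simp only [hg]
    rw [lintegral_const_mul' _ _ (by simp), lintegral_add_right _ measurable_const,
      lintegral_const_mul' _ _ ENNReal.ofReal_ne_top, setLIntegral_const, Real.volume_Ioc, sub_zero]
    calc _ ≤ 4 * (ENNReal.ofReal (velocityConst b B C γ * (n : ℝ) ^ 2) * ENNReal.ofReal (A / n) +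
          ENNReal.ofReal (sizeConst b G C A * n) * ENNReal.ofReal T) := by
          gcongr; exact ht.2
      _ = _ := by
          rw [← ENNReal.ofReal_mul (by positivity), ← ENNReal.ofReal_mul (by positivity),
            ← ENNReal.ofReal_add (by positivity) (by positivity), ← ENNReal.ofReal_ofNat,
            ← ENNReal.ofReal_mul (by norm_num)]
          congr 1; field_simp
  calc _ ≤ ∫⁻ v in Ioc s t, (ENNReal.ofReal (2 * Real.exp (-((n : ℝ) ^ 2 * v))) *
          fisherI V β (f 0) + ∫⁻ u in Ioc 0 v,
            ENNReal.ofReal (Real.exp (-((n : ℝ) ^ 2 * (v - u)))) * g u) :=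
        setLIntegral_mono' measurableSet_Ioc fun v hv' =>
          hf.fisherI_le hf0 h hn hγ hτc hτ hE (hs.trans_lt hv'.1) (hv'.2.trans ht.2)
    _ = (∫⁻ v in Ioc s t, ENNReal.ofReal (2 * Real.exp (-((n : ℝ) ^ 2 * v)))) *
          fisherI V β (f 0) + ∫⁻ v in Ioc s t, ∫⁻ u in Ioc 0 v,
            ENNReal.ofReal (Real.exp (-((n : ℝ) ^ 2 * (v - u)))) * g u := by
        rw [lintegral_add_left (by fun_prop), lintegral_mul_const _ (by fun_prop)]
    _ ≤ _ := by
        refine add_le_add (mul_le_mul' ?_ le_rfl) ?_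
        · refine (lintegral_mono_set Ioc_subset_Ioi_self).trans (le_of_eq ?_)
          simp only [ENNReal.ofReal_mul (zero_le_two (α := ℝ))]
          rw [lintegral_const_mul' _ _ ENNReal.ofReal_ne_top, lintegral_exp_neg_Ioi hn2,
            ← ENNReal.ofReal_mul zero_le_two, mul_div_assoc]
        · refine (lintegral_mono_set (Ioc_subset_Ioc_left hs)).trans
            ((lintegral_convolution_exp_le hn2 hgm).trans ?_)
          refine (mul_le_mul' le_rfl hgi).trans (le_of_eq ?_)
          rw [← ENNReal.ofReal_mul (by positivity)]
          congr 1; field_simp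

/-- The derivative along `q_k` is the difference of the bond derivative and the velocity derivative.
-/
theorem fisherR_le (hf : IsForwardSolution V β γ τ n f) (h : ChainBounds V β b B G C) {u : ℝ}
    (hu : 0 < u) : fisherR V β (f u) ≤ 2 * (fisherI V β (f u) + fisherP V β (f u)) := by
  have hm : Measurable fun x => ENNReal.ofReal
      ((∑ k, (betaAt β n k)⁻¹ * dp k (f u) x ^ 2) / f u x) := by
    have h1 : ∀ k, Continuous (dp k (f u)) := fun k =>
      continuous_slice (F := fun u => dp k (f u)) (hf.continuousOn_dp k) hu
    have h2 : Continuous fun x => ∑ k, (betaAt β n k)⁻¹ * dp k (f u) x ^ 2 := by fun_prop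
    exact (h2.measurable.div (hf.continuous hu).measurable).ennreal_ofReal
  rw [fisherI, fisherP, ← lintegral_add_right _ hm, ← lintegral_const_mul' _ _ (by simp)]
  refine lintegral_mono fun x => ?_
  have hx := hf.nonneg u hu.le x
  have hb := fun k => h.beta_inv_nonneg (n := n) k
  have hI : 0 ≤ ∑ k ∈ bulk n, (betaAt β n k)⁻¹ * (dp k (f u) x + dq k (f u) x) ^ 2 :=
    Finset.sum_nonneg fun k _ => mul_nonneg (hb k) (sq_nonneg _)
  have hP : 0 ≤ ∑ k, (betaAt β n k)⁻¹ * dp k (f u) x ^ 2 :=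
    Finset.sum_nonneg fun k _ => mul_nonneg (hb k) (sq_nonneg _)
  rw [← ENNReal.ofReal_add (by positivity) (by positivity), ← ENNReal.ofReal_ofNat,
    ← ENNReal.ofReal_mul (by norm_num), ← add_div, mul_div_assoc']
  refine ENNReal.ofReal_le_ofReal (div_le_div_of_nonneg_right ?_ hx)
  calc _ ≤ ∑ k ∈ bulk n, 2 * ((betaAt β n k)⁻¹ * (dp k (f u) x + dq k (f u) x) ^ 2 +
          (betaAt β n k)⁻¹ * dp k (f u) x ^ 2) := by
        refine Finset.sum_le_sum fun k _ => ?_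
        rw [← mul_add, mul_left_comm]
        refine mul_le_mul_of_nonneg_left ?_ (hb k)
        nlinarith [sq_nonneg (2 * dp k (f u) x + dq k (f u) x)]
    _ = 2 * (∑ k ∈ bulk n, (betaAt β n k)⁻¹ * (dp k (f u) x + dq k (f u) x) ^ 2 +
          ∑ k ∈ bulk n, (betaAt β n k)⁻¹ * dp k (f u) x ^ 2) := by
        rw [← Finset.mul_sum, Finset.sum_add_distrib]
    _ ≤ _ := by
        gcongr
        · exact fun k _ _ => mul_nonneg (hb k) (sq_nonneg _)
        · exact Finset.subset_univ _

theorem lintegral_fisherR_le (hf : IsForwardSolution V β γ τ n f) (h : ChainBounds V β b B G C)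
    {s t : ℝ} (hs : 0 ≤ s) : ∫⁻ u in Ioc s t, fisherR V β (f u) ≤
      2 * ((∫⁻ u in Ioc s t, fisherI V β (f u)) + ∫⁻ u in Ioc 0 t, fisherP V β (f u)) := by
  refine (setLIntegral_mono' measurableSet_Ioc fun u hu =>
    hf.fisherR_le h (hs.trans_lt hu.1)).trans ?_
  rw [lintegral_const_mul' _ _ (by simp), lintegral_add_right' _ (hf.aemeasurable_fisherP h hs)]
  refine mul_le_mul' le_rfl (add_le_add le_rfl ?_)
  exact lintegral_mono_set (Ioc_subset_Ioc_left hs)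

end IsForwardSolution

namespace ChainBounds

/-- The Fisher informations of positions and of bonds, integrated over time. -/
theorem exists_fisher_bound (h : ChainBounds V β b B G C) (hγ : 0 < γ)
    (hτ : ContDiffOn ℝ 1 τ (Ici 0)) (C₀ : ℝ) (hT : 0 < T) : ∃ D, 0 ≤ D ∧ ∀ n : ℕ, 1 ≤ n →
    ∀ f : ℝ → Phase n → ℝ, IsForwardSolution V β γ τ n f → IsC1UpToZero f →
    EntropyLE V β (f 0) (C₀ * n) → ∀ a s M : ℝ, 0 ≤ s → 0 ≤ a → 0 ≤ M →
    fisherI V β (f 0) ≤ ENNReal.ofReal a →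
    Real.exp (-((n : ℝ) ^ 2 * s)) * a ≤ M * n → ∀ t ∈ Icc 0 T,
      ∫⁻ u in Ioc s t, fisherR V β (f u) ≤ ENNReal.ofReal ((4 * M + D) / n) ∧
      ∫⁻ u in Ioc s t, fisherI V β (f u) ≤ ENNReal.ofReal ((4 * M + D) / n) := by
  obtain ⟨A, hA, hent⟩ := h.exists_entropy_bound hγ hτ C₀ hT
  obtain ⟨τ', τm, τ₁, hτb⟩ := exists_tensionBounds hτ T
  have hv := h.velocityConst_nonneg (γ := γ)
  have hz := h.sizeConst_nonneg (A := A) hA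
  set D := 4 * (velocityConst b B C γ * A + sizeConst b G C A * T) with hD
  have hD0 : 0 ≤ D := by positivity
  refine ⟨2 * D + 2 * A, by positivity,
    fun n hn f hf hf0 h0 a s M hs ha hM hI0 hsM t ht => ?_⟩
  have hn0 : (0 : ℝ) < n := by exact_mod_cast hn
  have hall := hent n hn f hf h0
  have hP := (hall t ht).2.1
  have hI := hf.lintegral_fisherI_le hf0 h hn hγ hτb.continuousOn hτb.abs_le hA
    (fun u hu => (hall u hu).2.2) hs ht hP
  have hI' : ∫⁻ u in Ioc s t, fisherI V β (f u) ≤ ENNReal.ofReal ((2 * M + D) / n) := by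
    refine hI.trans ((add_le_add (mul_le_mul' le_rfl hI0) le_rfl).trans ?_)
    rw [← ENNReal.ofReal_mul (by positivity), ← ENNReal.ofReal_add (by positivity) (by positivity)]
    refine ENNReal.ofReal_le_ofReal ?_
    rw [add_div]
    gcongr
    -- The initial information, already damped to order `n`, is divided by `n²` by the time
    -- integration.
    calc _ = 2 * (Real.exp (-((n : ℝ) ^ 2 * s)) * a) / (n : ℝ) ^ 2 := by ring
      _ ≤ 2 * (M * n) / (n : ℝ) ^ 2 := by gcongr
      _ = _ := by field_simp
  refine ⟨(hf.lintegral_fisherR_le h hs).trans ((mul_le_mul' le_rfl (add_le_add hI' hP)).trans ?_),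
    hI'.trans (ENNReal.ofReal_le_ofReal (by gcongr <;> linarith))⟩
  rw [← ENNReal.ofReal_add (by positivity) (by positivity), ← ENNReal.ofReal_ofNat,
    ← ENNReal.ofReal_mul (by norm_num)]
  refine ENNReal.ofReal_le_ofReal (le_of_eq ?_)
  ring

end ChainBounds

end

end OscChain

end

/-! ### The three estimates -/

open OscChain
theorem mainTheorem3 (V β τ : ℝ → ℝ) (γ : ℝ) (hV : IsPotential V) (hβ : IsProfile β)
    (hγ : 0 < γ) (hτ : ContDiffOn ℝ 1 τ (Set.Ici 0)) (C₀ T : ℝ) (hT : 0 < T) :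
    (∃ C : ℝ, ∀ n : ℕ, 1 ≤ n → ∀ f : ℝ → Phase n → ℝ, IsForwardSolution V β γ τ n f →
      EntropyLE V β (f 0) (C₀ * n) → ∀ t ∈ Set.Icc 0 T,
        EntropyLE V β (f t) (C * n) ∧
        ∫⁻ s in Set.Ioc 0 t, fisherP V β (f s) ≤ ENNReal.ofReal (C / n)) ∧
    (∀ K₀ : ℝ, ∃ C : ℝ, ∀ n : ℕ, 1 ≤ n → ∀ f : ℝ → Phase n → ℝ,
      IsForwardSolution V β γ τ n f → IsC1UpToZero f → EntropyLE V β (f 0) (C₀ * n) →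
      fisherI V β (f 0) ≤ ENNReal.ofReal (K₀ * n) → ∀ t ∈ Set.Icc 0 T,
        ∫⁻ s in Set.Ioc 0 t, fisherR V β (f s) ≤ ENNReal.ofReal (C / n) ∧
        ∫⁻ s in Set.Ioc 0 t, fisherI V β (f s) ≤ ENNReal.ofReal (C / n)) ∧
    (∀ K : ℕ → ℝ, Subexponential K → ∀ δ > 0, ∃ C : ℝ, ∀ n : ℕ, 1 ≤ n →
      ∀ f : ℝ → Phase n → ℝ, IsForwardSolution V β γ τ n f → IsC1UpToZero f →
      EntropyLE V β (f 0) (C₀ * n) → fisherI V β (f 0) ≤ ENNReal.ofReal (K n) → ∀ t ∈ Set.Icc 0 T,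
        ∫⁻ s in Set.Ioc δ t, fisherR V β (f s) ≤ ENNReal.ofReal (C / n) ∧
        ∫⁻ s in Set.Ioc δ t, fisherI V β (f s) ≤ ENNReal.ofReal (C / n)) := by
  obtain ⟨b, B, G, C, h⟩ := exists_chainBounds hV hβ
  obtain ⟨A, -, hent⟩ := h.exists_entropy_bound hγ hτ C₀ hT
  obtain ⟨D, -, hfish⟩ := h.exists_fisher_bound hγ hτ C₀ hT
  refine ⟨⟨A, fun n hn f hf h0 t ht => ?_⟩, fun K₀ => ⟨4 * |K₀| + D, fun n hn f hf hf0 h0 hI => ?_⟩,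
    fun K hK δ hδ => ?_⟩
  · exact ⟨(hent n hn f hf h0 t ht).1, (hent n hn f hf h0 t ht).2.1⟩
  -- With starting time zero no damping is available, so an initial information of order `n` is what
  -- is required.
  · refine hfish n hn f hf hf0 h0 (|K₀| * n) 0 |K₀| le_rfl (by positivity) (abs_nonneg _)
      (hI.trans (ENNReal.ofReal_le_ofReal ?_)) (by simp)
    gcongr
    exact le_abs_self _
  -- Subexponential growth is used only at the rate `ε = δ`, and only through boundedness of the
  -- resulting sequence.
  · obtain ⟨M, hM⟩ := (hK δ hδ).bddAbove_range
    have hM' : ∀ n : ℕ, K n * Real.exp (-δ * n) ≤ M := fun n => hM (Set.mem_range_self n)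
    refine ⟨4 * |M| + D, fun n hn f hf hf0 h0 hI => ?_⟩
    have hn1 : (1 : ℝ) ≤ n := by exact_mod_cast hn
    -- The relaxation rate `n²` exceeds `n`, so the damping accumulated by time `δ` already
    -- compensates `K n`.
    have hexp : Real.exp (-((n : ℝ) ^ 2 * δ)) ≤ Real.exp (-δ * n) := by
      refine Real.exp_le_exp.2 ?_
      nlinarith [mul_nonneg hδ.le (sub_nonneg.2 hn1)]
    refine hfish n hn f hf hf0 h0 (max (K n) 0) δ |M| hδ.le (le_max_right _ _) (abs_nonneg _)
      (hI.trans (ENNReal.ofReal_le_ofReal (le_max_left _ _))) ?_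
    calc _ ≤ Real.exp (-δ * n) * max (K n) 0 := by gcongr
      _ ≤ |M| := by
          rw [mul_max_of_nonneg _ _ (Real.exp_pos _).le, mul_zero, mul_comm]
          exact max_le ((hM' n).trans (le_abs_self _)) (abs_nonneg _)
      _ ≤ |M| * n := le_mul_of_one_le_right (abs_nonneg _) hn1
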